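/- **Oscillatory integrals.** Let $m\ge 1$, let $\zeta$ be a primitive $m$-th root of unity in $\mathbb C$, $\lambda\in\mathbb C^*$, $\lambda_i=\zeta^i\lambda$ for $0\le i<m$, and $q=e^\tau\ne 0$ with $m^mq\neq 1$. Let $L$ satisfy $L^m(1-m^mq)=1$ (for example $L=(1-m^mq)^{-1/m}$) and put $L_\alpha=\zeta^\alpha\lambda L$. Consider the potential $$W=\sum_{i=0}^{m-1}(x_i+\lambda_i\ln x_i)-\Big(q^{-1}\prod_{i=0}^{m-1}x_i\Big)^{1/m}$$ on the universal cover of $(\mathbb C^*)^m$ (coordinates $t_i=\ln x_i$, with $(q^{-1}\prod x_i)^{1/m}=e^{(\sum t_i-\tau)/m}$). Let $\gamma_\alpha$ be a Lefschetz thimble of $W$ for $z\to0^-$ through a critical point with $(q^{-1}\prod x_i)^{1/m}=mL_\alpha$ and critical value $u_\alpha$. That is, $\gamma_\alpha$ is a smoothly embedded $m$-disc $\varphi\colon\mathbb R^m\to\mathbb C^m$ with $\varphi(0)$ this critical point and $W(\varphi(x))=u_\alpha+\|x\|^2$, such that for some $z_0<0$ the integral $\mathcal I_\alpha(q',z_0)$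 over $\gamma_\alpha$ converges absolutely for all $q'$ near $q$. Here $$\mathcal I_\alpha(q',z)=\int_{\gamma_\alpha}e^{W/z}\,\frac{dx_0\wedge\cdots\wedge dx_{m-1}}{x_0\cdots x_{m-1}},$$ the cycle $\gamma_\alpha$ being kept fixed for $q'$ near $q$. **Formal quintic.** Let $m=5$, $h_\alpha=\zeta^\alpha\lambda$, $L=(1-5^5q)^{-1/5}\in\mathbb Q[[q]]$. Let $I_0,I_1$ be defined by $$z\sum_{d\ge0} q^d\,\frac{\prod_{k=1}^{5d}(5H+kz)}{\prod_{k=1}^d(H+kz)^5}=zI_0+I_1H+O(H^2),$$ and put $I_{1,1}=I_{3,3}=1+q\frac{d}{dq}\frac{I_1}{I_0}$, $I_{2,2}=L^5I_0^{-2}I_{1,1}^{-2}$, $I_{4,4}=I_{5,5}=I_0$. On the span of $1,H,\dots,H^4$ let $(H^a,H^b)=5$ if $a+b=3$, $5\lambda^5$ if $a+b=8$, and $0$ otherwise. Let $\bar\phi_k=I_0I_{1,1}\cdots I_{k,k}L^{-k-1}H^k$, let $\bar\phi^j$ be the dual basis of $\bar\phi_j$, and let $\bar e_\alpha=\frac15\sum_i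 h_\alpha^{3/2-i}\bar\phi_i$ be the normalized idempotents. Let $R^*(z)$ be the endomorphism over $\mathbb C[[q,z]]$ whose entries $R_{i\bar\alpha}(z)=(\bar e_\alpha,R^*(z)H^i)$ satisfy $$\Big(zq\frac{d}{dq}+h_\alpha L\Big)R_{i\bar\alpha}=I_{i+1,i+1}R_{i+1,\bar\alpha}\ \ (0\le i\le3),\qquad \Big(zq\frac{d}{dq}+h_\alpha L\Big)R_{4\bar\alpha}=\lambda^5I_{5,5}R_{0\bar\alpha},$$ with the normalization $R_{i\bar\alpha}|_{q=0}=(\bar e_\alpha,H^i)|_{q=0}\,C_\alpha(z)^{-1}$, where $$C_\alpha(z)=\exp\sum_{k>0}\frac{B_{2k}\,z^{2k-1}}{2k(2k-1)}\Big(\sum_{\beta\ne\alpha}\frac1{(h_\alpha-h_\beta)^{2k-1}}+\frac1{(-5h_\alpha)^{2k-1}}\Big).$$ Write $\bar R_0{}^j(z)=(\bar\phi^j,R^*(z)\bar\phi_0)$. **Statement.** There are polynomials $P_k(m,X)\in\mathbb Q[m][X]$, $k\ge0$, of degree exactly $k$ in $X$ over $\mathbb Q[m]$, such that the following hold. 1.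 For all $m,\zeta,\lambda,q,L,\alpha,\gamma_\alpha$ as above, for $z<0$ close to $0$ the integral $\mathcal I_\alpha(q,z)$ converges absolutely and $\mathcal I_\alpha(\cdot,z)$ is differentiable at $q$. For one of the two square roots $(-\lambda^m)^{-1/2}$ (depending on the orientation of $\gamma_\alpha$), there is an asymptotic expansion $$zq\frac{d}{dq}\mathcal I_\alpha(q,z)\asymp e^{u_\alpha/z}\,(-2\pi z)^{m/2}\,(-\lambda^m)^{-1/2}\,L_\alpha\Big(1+\sum_{k>0}(R_k)_{0\bar\alpha}(-z)^k\Big),\qquad z\to0^-,$$ with $(mL_\alpha)^k(R_k)_{0\bar\alpha}=P_k(m,L^m)$. 2. For all $m\ge1$ and $k\ge 0$, $X^k$ divides $P_k(m,X^m)$ in $\mathbb Q[X]$. Hence $(mL_\alpha)^k(R_k)_{0\bar\alpha}\in L^k\mathbb Q[L]\cap\mathbb Q[L^m]$. 3. For $m=5$, the endomorphism $R^*(z)$ exists and is unique. The coefficient of $z^k$ in $h_\alpha^{3/2}(\bar e_\alpha,R^*(z)\bar\phi_0)$ is $(-1)^kP_k(5,L^5)/(5h_\alpha L)^k$, that is,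 $(-1)^k(R_k)_{0\bar\alpha}$. For all $k\ge0$ and $0\le j\le4$, $$\lambda^{k+j}\,[z^k]\bar R_0{}^j(z)\in\mathbb Q[L]\cap L^{-k}\mathbb Q[L^5],\qquad [z^k]\bar R_0{}^j(z)=0\ \text{ unless } k+j\in5\mathbb Z.$$ -/

import Mathlib

open Filter Topology MeasureTheory Asymptotics

namespace ZagierZinger

noncomputable section

/-! ### The Landau--Ginzburg model, in logarithmic coordinates `x i = exp (t i)`, `q = exp τ` -/

/-- The specialised equivariant parameters `λ_i = ζ ^ i * λ`. -/
def eqParam (m : ℕ) (ζ lam : ℂ) (i : Fin m) : ℂ := ζ ^ (i : ℕ) * lam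

/-- The multivalued function `y = (q⁻¹ * ∏ x_i) ^ (1 / m)`, on the universal cover. -/
def yFun (m : ℕ) (τ : ℂ) (t : Fin m → ℂ) : ℂ :=
  Complex.exp (((∑ i, t i) - τ) / m)

/-- The Landau--Ginzburg potential
`W = ∑ (x_i + λ_i * log x_i) - (q⁻¹ * ∏ x_i) ^ (1 / m)`, on the universal cover. -/
def potential (m : ℕ) (ζ lam τ : ℂ) (t : Fin m → ℂ) : ℂ :=
  (∑ i, (Complex.exp (t i) + eqParam m ζ lam i * t i)) - yFun m τ t

/-- The coefficient of the pullback of the holomorphic volume form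
`dx_0 ∧ ⋯ ∧ dx_{m-1} / (x_0 ⋯ x_{m-1}) = dt_0 ∧ ⋯ ∧ dt_{m-1}` along a parametrised `m`-chain. -/
def volForm (m : ℕ) (φ : EuclideanSpace ℝ (Fin m) → (Fin m → ℂ))
    (x : EuclideanSpace ℝ (Fin m)) : ℂ :=
  Matrix.det (Matrix.of fun i j : Fin m => fderiv ℝ φ x (EuclideanSpace.single j 1) i)

/-- The integrand `exp (W / z) * dx / x` of the oscillatory integral along `φ`. -/
def integrand (m : ℕ) (ζ lam τ : ℂ) (φ : EuclideanSpace ℝ (Fin m) → (Fin m → ℂ))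
    (z : ℝ) (x : EuclideanSpace ℝ (Fin m)) : ℂ :=
  Complex.exp (potential m ζ lam τ (φ x) / z) * volForm m φ x

/-- The oscillatory integral along the cycle parametrised by `φ`, as a function of `τ = log q`
and `z`. -/
def oscIntegral (m : ℕ) (ζ lam : ℂ) (φ : EuclideanSpace ℝ (Fin m) → (Fin m → ℂ))
    (τ : ℂ) (z : ℝ) : ℂ :=
  ∫ x, integrand m ζ lam τ φ z x

/-- `φ` parametrises a Lefschetz thimble of the potential (at the parameter `τ`) for the critical
points with `y = m * Lα`, for the direction `z → 0⁻`: a smoothly embedded `m`-disc through such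
a critical point which the potential maps to the ray `u + ℝ_{≥ 0}` starting at the critical
value `u`, the parametrisation being normalised by `W = u + ‖x‖ ^ 2`. Its fibres over the ray are
the vanishing spheres. The last field says that the oscillatory integral over this cycle
converges absolutely for some `z₀ < 0` at all parameters near `τ`. -/
structure IsThimble (m : ℕ) (ζ lam τ Lα : ℂ)
    (φ : EuclideanSpace ℝ (Fin m) → (Fin m → ℂ)) : Prop where
  smooth : ContDiff ℝ (⊤ : ℕ∞) φ
  injective : Function.Injective φ
  immersion : ∀ x, Function.Injective (fderiv ℝ φ x)
  critical : fderiv ℂ (potential m ζ lam τ) (φ 0) = 0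
  branch : yFun m τ (φ 0) = m * Lα
  ray : ∀ x, potential m ζ lam τ (φ x) = potential m ζ lam τ (φ 0) + ((‖x‖ ^ 2 : ℝ) : ℂ)
  convergent : ∃ z₀ < (0 : ℝ), ∀ᶠ τ' in 𝓝 τ, Integrable (integrand m ζ lam τ' φ z₀)

/-- `f z ≍ pre z * ∑ R_k * (-z) ^ k` as `z → 0⁻`. -/
def HasExpansion (f pre : ℝ → ℂ) (R : ℕ → ℂ) : Prop :=
  ∀ N : ℕ,
    (fun z : ℝ => f z / pre z - ∑ k ∈ Finset.range (N + 1), R k * (-(z : ℂ)) ^ k)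
      =O[𝓝[<] (0 : ℝ)] fun z : ℝ => z ^ (N + 1)

/-- For `P` in `ℚ[m][X]`, the polynomial in `ℚ[X]` obtained by giving `m` an integer value. -/
def specialize (m : ℕ) (P : Polynomial (Polynomial ℚ)) : Polynomial ℚ :=
  P.map (Polynomial.evalRingHom (m : ℚ))

/-! ### The formal quintic

Power series in `q` are elements of `PowerSeries ℂ`; power series in `z` whose coefficients are
power series in `q` are elements of `PowerSeries (PowerSeries ℂ)`, the outer variable being `z`.
The state space has the basis `1, H, H ^ 2, H ^ 3, H ^ 4`; vectors are functions on `Fin 5`. -/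

/-- The operator `q d/dq` on power series in `q`. -/
def qD (f : PowerSeries ℂ) : PowerSeries ℂ :=
  PowerSeries.mk fun d => (d : ℂ) * PowerSeries.coeff d f

/-- The operator `q d/dq` on power series in `z` and `q`. -/
def qDz (F : PowerSeries (PowerSeries ℂ)) : PowerSeries (PowerSeries ℂ) :=
  PowerSeries.mk fun k => qD (PowerSeries.coeff k F)

/-- The series `L = (1 - 5 ^ 5 * q) ^ (- 1 / 5)`. -/
def Lser : PowerSeries ℂ :=
  PowerSeries.mk fun d =>
    (∏ k ∈ Finset.range d, ((1 : ℂ) / 5 + k)) / (d.factorial : ℂ) * (5 ^ 5) ^ d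

/-- The series `I_j (q)` in the expansion `I (q, z) = ∑ I_j (q) * H ^ j * z ^ (1 - j)` of
`I (q, z) = z * ∑ q ^ d * ∏_{k ≤ 5d} (5 H + k z) / ∏_{k ≤ d} (H + k z) ^ 5`. -/
def Iser (j : ℕ) : PowerSeries ℂ :=
  PowerSeries.mk fun d =>
    PowerSeries.coeff j
      ((∏ k ∈ Finset.Icc 1 (5 * d), (5 * PowerSeries.X + PowerSeries.C (k : ℂ))) *
        (∏ k ∈ Finset.Icc 1 d, (PowerSeries.X + PowerSeries.C (k : ℂ)) ^ 5)⁻¹)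

/-- `I_{1,1} = 1 + q d/dq (I_1 / I_0)`. -/
def I11 : PowerSeries ℂ := 1 + qD (Iser 1 * (Iser 0)⁻¹)

/-- `I_{2,2} = L ^ 5 / (I_0 ^ 2 * I_{1,1} ^ 2)`. -/
def I22 : PowerSeries ℂ := Lser ^ 5 * (Iser 0 ^ 2 * I11 ^ 2)⁻¹

/-- The series `I_{i+1,i+1}` for `i = 0, …, 4`; `I_{3,3} = I_{1,1}` and
`I_{4,4} = I_{5,5} = I_0`. -/
def Idiag : Fin 5 → PowerSeries ℂ := ![I11, I22, I11, Iser 0, Iser 0]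

/-- The entry `A_i^j` of the quantum multiplication by `H + q d/dq (I_1 / I_0) H`:
`H ^ i ↦ I_{i+1,i+1} * H ^ (i+1)` for `i < 4`, and `H ^ 4 ↦ λ ^ 5 * I_{5,5}`. -/
def quantumMul (lam : ℂ) (i j : Fin 5) : PowerSeries ℂ :=
  if j = i + 1 then (if i = 4 then PowerSeries.C (lam ^ 5) * Idiag i else Idiag i) else 0

/-- The pairing of `H ^ a` and `H ^ b`. -/
def gram (lam : ℂ) (a b : Fin 5) : ℂ :=
  if (a : ℕ) + b = 3 then 5 else if (a : ℕ) + b = 8 then 5 * lam ^ 5 else 0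

/-- The pairing, extended linearly to power series in `z` and `q`. -/
def pairing (lam : ℂ) (v w : Fin 5 → PowerSeries (PowerSeries ℂ)) :
    PowerSeries (PowerSeries ℂ) :=
  ∑ a, ∑ b, PowerSeries.C (PowerSeries.C (gram lam a b)) * v a * w b

/-- The flat basis vector `H ^ i`. -/
def flat (i : Fin 5) : Fin 5 → PowerSeries (PowerSeries ℂ) := Pi.single i 1

/-- The factor `I_0 * I_{1,1} ⋯ I_{i,i} / L ^ (i+1)` with `phiBar_i = factor * H ^ i`. -/
def phiFactor (i : Fin 5) : PowerSeries ℂ :=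
  Iser 0 * (∏ k ∈ Finset.univ.filter (fun k : Fin 5 => k < i), Idiag k) *
    (Lser ^ ((i : ℕ) + 1))⁻¹

/-- The normalised flat basis vector `phiBar_i`. -/
def phiBar (i : Fin 5) : Fin 5 → PowerSeries (PowerSeries ℂ) :=
  Pi.single i (PowerSeries.C (phiFactor i))

/-- The dual basis: `phiBar^j = phiBar_{3-j} / 5`, where
`phiBar_{-1} = phiBar_4 / λ ^ 5`. -/
def phiDual (lam : ℂ) (j : Fin 5) : Fin 5 → PowerSeries (PowerSeries ℂ) :=
  if j = 4 then fun a => PowerSeries.C (PowerSeries.C (1 / (5 * lam ^ 5))) * phiBar 4 a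
  else fun a => PowerSeries.C (PowerSeries.C (1 / 5)) * phiBar (3 - j) a

/-- `h_α = ζ ^ α * λ`. -/
def hpt (ζ lam : ℂ) (α : Fin 5) : ℂ := ζ ^ (α : ℕ) * lam

/-- A square root of `h_α`. -/
def sqrtH (ζ lam : ℂ) (α : Fin 5) : ℂ := hpt ζ lam α ^ (1 / 2 : ℂ)

/-- The normalised idempotent `(1 / 5) * ∑ h_α ^ (3 / 2 - i) * phiBar_i`. -/
def idem (ζ lam : ℂ) (α : Fin 5) : Fin 5 → PowerSeries (PowerSeries ℂ) :=
  fun a => ∑ i : Fin 5,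
    PowerSeries.C (PowerSeries.C ((1 / 5) * sqrtH ζ lam α ^ (3 - 2 * (i : ℤ)))) * phiBar i a

/-- The exponent of `C_α (z)`: the coefficient of `z ^ (2 k - 1)` is
`B_{2k} / (2 k (2 k - 1))` times
`∑_{β ≠ α} (h_α - h_β) ^ (- (2 k - 1)) + (- 5 h_α) ^ (- (2 k - 1))`. -/
def logC (ζ lam : ℂ) (α : Fin 5) : PowerSeries ℂ :=
  PowerSeries.mk fun n =>
    if Odd n then
      (bernoulli (n + 1) : ℂ) / ((n + 1) * n) *
        ((∑ β ∈ Finset.univ.erase α, ((hpt ζ lam α - hpt ζ lam β) ^ n)⁻¹) +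
          ((-5 * hpt ζ lam α) ^ n)⁻¹)
    else 0

/-- The series `C_α (z)`. -/
def Cser (ζ lam : ℂ) (α : Fin 5) : PowerSeries ℂ :=
  PowerSeries.subst (logC ζ lam α) (PowerSeries.exp ℂ)

/-- The entry `R_{i,α} = (e_α, R^* H ^ i)`, with `e_α` the normalised idempotent. The `(a, i)`
entry of the matrix `Rs` is the coefficient of `H ^ a` in `R^* H ^ i`. -/
def entry (ζ lam : ℂ) (Rs : Matrix (Fin 5) (Fin 5) (PowerSeries (PowerSeries ℂ)))
    (i α : Fin 5) : PowerSeries (PowerSeries ℂ) :=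
  pairing lam (idem ζ lam α) (Rs.mulVec (flat i))

/-- `Rs` is the matrix of `R^* (z)` for the formal quintic: the `R_{i,α}` form the
power series solution of the quantum differential equation
`(z q d/dq + L_α) R_{i,α} = ∑_j A_i^j R_{j,α}`, `L_α = h_α L`,
normalised by the Birkhoff factorisation `S_{i,α} C_α⁻¹ = exp (u_α / z) R_{i,α}` with the
`S`-matrix, where `S = 1` and `u_α = 0` at `q = 0`. -/
structure IsRMatrix (ζ lam : ℂ)
    (Rs : Matrix (Fin 5) (Fin 5) (PowerSeries (PowerSeries ℂ))) : Prop where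
  qde : ∀ i α : Fin 5,
    PowerSeries.X * qDz (entry ζ lam Rs i α) +
        PowerSeries.C (PowerSeries.C (hpt ζ lam α) * Lser) * entry ζ lam Rs i α =
      ∑ j, PowerSeries.C (quantumMul lam i j) * entry ζ lam Rs j α
  initial : ∀ i α : Fin 5,
    PowerSeries.map PowerSeries.constantCoeff (entry ζ lam Rs i α) * Cser ζ lam α =
      PowerSeries.map PowerSeries.constantCoeff (pairing lam (idem ζ lam α) (flat i))

/-- `Rbar_0^j (z) = (phiBar^j, R^* (z) phiBar_0)`. -/
def firstColumn (lam : ℂ) (Rs : Matrix (Fin 5) (Fin 5) (PowerSeries (PowerSeries ℂ)))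
    (j : Fin 5) : PowerSeries (PowerSeries ℂ) :=
  pairing lam (phiDual lam j) (Rs.mulVec (phiBar 0))

end

end ZagierZinger

/-!
Both halves of the theorem are governed by one formal object. At a critical point with `y = m ℓ`
one has `x_i = ℓ - λ_i`, and in displacement coordinates `s` the potential minus its critical
value is the action `S = ∑ x_i ψ (s_i) - m ℓ ψ (mean s)`, with `ψ (s) = exp s - 1 - s`. Its Hessian
has the determinant `- λ ^ m`, which does not depend on `ℓ` (`det_hessian`), so that the inverse
Hessian is polynomial in `ℓ`, and so are the coefficients `F_k (a)` of the formal Gaussian integral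
of `exp (- S / ħ + a · s)`, `ħ = -z` (`formalCoeff`). The number `(R_k)_{0 α}` is the value of `F_k`
at `a = (1 / m, …, 1 / m)`, which accounts for the factor `y` produced by `q d/dq`.

**Universal polynomials.** Put `j_k (κ) = (m ℓ) ^ k F_k (κ / m, …, κ / m)` and `X = (ℓ / λ) ^ m`.
Integration by parts in all `m` directions gives a difference equation in `κ` of step `m`
(`jval_recurrence`), and differentiation in `ℓ` gives a flow of Fuchsian type in `ℓ`
(`derivative_linePoly_eval`). The difference equation determines `j_k` up to its value at `κ = 0`,
with a dependence on `m` and `κ` that is polynomial; the flow gives `j_k (0) = ∑ g_i X ^ i` with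
`(m i - k) g_i` polynomial in `m`, the homogeneous solution `ℓ ^ k` being excluded by comparing the
points `ℓ = λ_α`. At these points all directions but one decouple, integration by parts becomes the
difference equation of Stirling's series, and `∑ g_i` is given by Bernoulli numbers and the power
sums of `(1 - ζ ^ β)⁻¹` (`isGammaSeq_fval`, `exists_rootValue`). Since the poles `m = k / i` are
distinct and the sum has none, each `g_i` is a polynomial in `m` (`dvd_of_sum_div`,
`exists_jval_expansion`). The degree is `k` because for `m = 1` the polynomial is a coefficient of
Stirling's series times `X ^ k`, and that coefficient is not zero for 2-adic reasons
(`stirling_ne_zero`). Divisibility by `X ^ k` after `X ↦ X ^ m` holds because `j_k` is divisible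
by `ℓ ^ k` by definition (`exists_universal_polynomials`).

**Oscillatory integrals.** On a thimble the potential is `u + ‖x‖ ^ 2`, so that Laplace's method
(`laplace_expansion`) expresses the coefficients of the expansion by powers of the Laplacian at the
origin. By the divergence-free property of the adjugate of a Jacobian matrix, these coefficients
satisfy the same integration by parts and Euler relations as `F_k`, and these relations have a
unique solution up to scaling (`IsMorseChart.gaussCoeff_eq`). Hence the expansion is the formal one,
whatever the choice of the thimble. Convergence for nearby `q` at a single `z₀` dominates
`exp (c ‖y‖)`, which gives convergence, differentiation under the integral sign and the discarding
of the tail for all `z` near zero (`IsThimble.exists_domination`, `IsThimble.expansion`).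

**The formal quintic.** The difference equation and the flow for `m = 5` say that
`Y_n = ∑ ℓ ^ n F_k (n / 5, …, n / 5) (-z) ^ k` solves the Picard--Fuchs equation of the quintic with
its equivariant term (`theta_pow_five_solSer`, `solSer_five`). The Picard--Fuchs operator is the
product of the first order operators with the factors `I_{i,i}`: both sides are formally self-adjoint
with the same leading coefficient and have two solutions in common (`pfCoeff_lower`). Therefore
`I₀⁻¹ Y_1` is, up to a constant, the entry `R_{0 α}`; its initial value is the inverse of `C_α (z)`
because both satisfy the recursion of the coefficients of products of Gamma functions
(`initSer_mul_Cser`), and solutions of the system are determined by their values at `q = 0`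
(`eq_zero_of_system`). The coefficients of the first column are averages over `α` of
`h_α ^ (- (k + j))`, which vanish unless `5 ∣ k + j` (`IsRMatrix.coeff_firstColumn`).
-/

namespace ZagierZinger

/-! ### Shift operators on polynomials -/

section Shift

open MvPolynomial

variable {σ : Type*}

/-- The substitution `a ↦ a + v` on polynomials in `a`. Polynomials in `a` stand for functionals
`f ↦ Λ (exp (a · s)) `, so that this is the operator dual to multiplication by `exp (v · s)`. -/
noncomputable def shift (v : σ → ℂ) : MvPolynomial σ ℂ →ₐ[ℂ] MvPolynomial σ ℂ :=
  aeval fun i => X i + C (v i)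

/-- The derivative in the direction `v`. -/
noncomputable def dirDeriv (v : σ → ℂ) : Derivation ℂ (MvPolynomial σ ℂ) (MvPolynomial σ ℂ) :=
  mkDerivation ℂ fun i => C (v i)

@[simp] lemma shift_X (v : σ → ℂ) (i : σ) : shift v (X i) = X i + C (v i) := by simp [shift]

@[simp] lemma dirDeriv_X (v : σ → ℂ) (i : σ) : dirDeriv v (X i) = C (v i) := by
  simp [dirDeriv, mkDerivation_X]

@[simp] lemma dirDeriv_C (v : σ → ℂ) (c : ℂ) : dirDeriv v (C c) = 0 := by
  simp [dirDeriv]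

lemma eval_shift (v a : σ → ℂ) (p : MvPolynomial σ ℂ) :
    eval a (shift v p) = eval (a + v) p := by
  induction p using MvPolynomial.induction_on with
  | C c => simp
  | add p q hp hq => simp [hp, hq]
  | mul_X p i hp => simp [hp]

lemma shift_shift (v w : σ → ℂ) (p : MvPolynomial σ ℂ) :
    shift v (shift w p) = shift (v + w) p := by
  induction p using MvPolynomial.induction_on with
  | C c => simp
  | add p q hp hq => simp [hp, hq]
  | mul_X p i hp => simp [hp, add_assoc]

lemma dirDeriv_shift (v w : σ → ℂ) (p : MvPolynomial σ ℂ) :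
    dirDeriv v (shift w p) = shift w (dirDeriv v p) := by
  induction p using MvPolynomial.induction_on with
  | C c => simp
  | add p q hp hq => simp [hp, hq]
  | mul_X p i hp => simp [hp]

lemma dirDeriv_comm (v w : σ → ℂ) (p : MvPolynomial σ ℂ) :
    dirDeriv v (dirDeriv w p) = dirDeriv w (dirDeriv v p) := by
  induction p using MvPolynomial.induction_on with
  | C c => simp
  | add p q hp hq => simp [hp, hq]
  | mul_X p i hp => simp [hp]; ring

/-- The operators dual to multiplication by `exp s`, `exp s - 1`, `exp s - 1 - s` and
`exp s - 1 - s - s ^ 2 / 2`, where `s` is the linear form with coefficient vector `v`. -/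
noncomputable def psi (v : σ → ℂ) : ℕ → Module.End ℂ (MvPolynomial σ ℂ)
  | 0 => (shift v).toLinearMap
  | 1 => (shift v).toLinearMap - 1
  | 2 => (shift v).toLinearMap - 1 - (dirDeriv v).toLinearMap
  | _ => (shift v).toLinearMap - 1 - (dirDeriv v).toLinearMap -
      (1 / 2 : ℂ) • ((dirDeriv v).toLinearMap * (dirDeriv v).toLinearMap)

lemma psi_zero (v : σ → ℂ) (p : MvPolynomial σ ℂ) : psi v 0 p = shift v p := rfl

lemma psi_one (v : σ → ℂ) (p : MvPolynomial σ ℂ) : psi v 1 p = shift v p - p := rfl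

lemma psi_two (v : σ → ℂ) (p : MvPolynomial σ ℂ) :
    psi v 2 p = shift v p - p - dirDeriv v p := rfl

lemma psi_three (v : σ → ℂ) (p : MvPolynomial σ ℂ) :
    psi v 3 p = shift v p - p - dirDeriv v p - (1 / 2 : ℂ) • dirDeriv v (dirDeriv v p) := rfl

lemma psi_X_mul (v : σ → ℂ) (i : σ) (r : ℕ) (hr : r < 3) (p : MvPolynomial σ ℂ) :
    psi v (r + 1) (X i * p) = X i * psi v (r + 1) p + C (v i) * psi v r p := by
  have h2 : (C (1 / 2 : ℂ) : MvPolynomial σ ℂ) * C 2 = 1 := by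
    rw [← C_mul]; norm_num
  obtain rfl | rfl | rfl : r = 0 ∨ r = 1 ∨ r = 2 := by omega
  · simp only [zero_add, psi_zero, psi_one, map_mul, shift_X]; ring
  · simp only [Nat.reduceAdd, psi_one, psi_two, map_mul, shift_X, Derivation.leibniz, dirDeriv_X, smul_eq_mul]
    ring
  · simp only [Nat.reduceAdd, psi_two, psi_three, map_mul, shift_X, Derivation.leibniz, dirDeriv_X, smul_eq_mul,
      map_add, dirDeriv_C, mul_zero, smul_eq_C_mul]
    simp only [show (C 2 : MvPolynomial σ ℂ) = 2 from rfl] at h2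
    linear_combination (-C (v i) * dirDeriv v p) * h2

/-- Polynomials whose monomials have weighted degree less than `n`. -/
def lowDeg (w : σ → ℕ) (n : ℕ) : Submodule ℂ (MvPolynomial σ ℂ) where
  carrier := {p | ∀ s, coeff s p ≠ 0 → Finsupp.weight w s < n}
  add_mem' {p q} hp hq s hs := by
    rw [coeff_add] at hs
    by_cases h : coeff s p = 0
    · exact hq s fun h' => hs (by rw [h, h', add_zero])
    · exact hp s h
  zero_mem' s hs := by simp at hs
  smul_mem' c p hp s hs := hp s fun h => hs (by simp [h])

lemma lowDeg_mono {w : σ → ℕ} {n k : ℕ} (h : n ≤ k) : lowDeg w n ≤ lowDeg w k :=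
  fun _ hp s hs => (hp s hs).trans_le h

lemma eq_zero_of_mem_lowDeg_zero {w : σ → ℕ} {p : MvPolynomial σ ℂ} (hp : p ∈ lowDeg w 0) :
    p = 0 := by
  ext s
  by_contra h
  exact absurd (hp s h) (Nat.not_lt_zero _)

lemma monomial_mem_lowDeg {w : σ → ℕ} {n : ℕ} (s : σ →₀ ℕ) (c : ℂ)
    (h : Finsupp.weight w s < n) : monomial s c ∈ lowDeg w n := by
  classical
  intro s' hs'
  rw [coeff_monomial] at hs'
  split_ifs at hs' with hh
  · exact hh ▸ h
  · exact absurd rfl hs'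

lemma C_mem_lowDeg {w : σ → ℕ} {n : ℕ} (c : ℂ) (hn : 0 < n) :
    (C c : MvPolynomial σ ℂ) ∈ lowDeg w n :=
  monomial_mem_lowDeg 0 c (by simpa using hn)

lemma mul_mem_lowDeg {w : σ → ℕ} {n k : ℕ} {p q : MvPolynomial σ ℂ}
    (hp : p ∈ lowDeg w (n + 1)) (hq : q ∈ lowDeg w k) : p * q ∈ lowDeg w (n + k) := by
  classical
  intro s hs
  rw [coeff_mul] at hs
  obtain ⟨x, hx, hx'⟩ := Finset.exists_ne_zero_of_sum_ne_zero hs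
  have h1 := hp x.1 (left_ne_zero_of_mul hx')
  have h2 := hq x.2 (right_ne_zero_of_mul hx')
  rw [← Finset.HasAntidiagonal.mem_antidiagonal.1 hx, map_add]
  omega

lemma X_mem_lowDeg {w : σ → ℕ} {n : ℕ} (i : σ) (hi : w i < n) :
    (X i : MvPolynomial σ ℂ) ∈ lowDeg w n :=
  monomial_mem_lowDeg _ _ (by simpa [Finsupp.weight_single] using hi)

/-- A polynomial of degree less than `n` is a sum of monomials of degree less than `n`. -/
lemma map_mem_of_monomial {w : σ → ℕ} {n k : ℕ} (f : Module.End ℂ (MvPolynomial σ ℂ))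
    (h : ∀ s c, Finsupp.weight w s < n → f (monomial s c) ∈ lowDeg w k) {p : MvPolynomial σ ℂ}
    (hp : p ∈ lowDeg w n) : f p ∈ lowDeg w k := by
  rw [p.as_sum, map_sum]
  exact Submodule.sum_mem _ fun s hs => h s _ (hp s (mem_support_iff.1 hs))

/-- The operators `psi v r` lower the degree by `r`. -/
lemma psi_mem_lowDeg {w : σ → ℕ} (hw : ∀ i, w i ≤ 1) {v : σ → ℂ} (hv : ∀ i, w i = 0 → v i = 0)
    {r : ℕ} (hr : r ≤ 3) {n : ℕ} {p : MvPolynomial σ ℂ} (hp : p ∈ lowDeg w n) :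
    psi v r p ∈ lowDeg w (n - r) := by
  have key : ∀ d : ℕ, ∀ s : σ →₀ ℕ, s.degree = d → ∀ r ≤ 3, ∀ c : ℂ,
      psi v r (monomial s c) ∈ lowDeg w (Finsupp.weight w s + 1 - r) := by
    intro d
    induction d with
    | zero =>
      intro s hs r hr c
      have hs0 : s = 0 := (Finsupp.degree_eq_zero_iff s).1 hs
      subst hs0
      rw [show (monomial 0 c : MvPolynomial σ ℂ) = C c from rfl]
      interval_cases r
      · simpa [psi_zero] using C_mem_lowDeg c one_pos
      all_goals simp [psi_one, psi_two, psi_three]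
    | succ d ih =>
      intro s hs r hr c
      obtain ⟨i, hi⟩ : ∃ i, s i ≠ 0 := by
        by_contra hcon
        push Not at hcon
        have : s = 0 := Finsupp.ext hcon
        simp [this] at hs
      obtain ⟨t, rfl⟩ : ∃ t, s = Finsupp.single i 1 + t := by
        refine ⟨s - Finsupp.single i 1, ?_⟩
        ext j
        classical
        by_cases hj : i = j
        · subst hj; simp; omega
        · simp [hj]
      have ht : t.degree = d := by
        rw [map_add, Finsupp.degree_single] at hs; omega
      have hmon : (monomial (Finsupp.single i 1 + t) c : MvPolynomial σ ℂ)
          = X i * monomial t c := by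
        rw [X, monomial_mul, one_mul]
      have hwt : Finsupp.weight w (Finsupp.single i 1 + t) = w i + Finsupp.weight w t := by
        simp [Finsupp.weight_single]
      rw [hmon, hwt]
      rcases Nat.eq_zero_or_pos r with rfl | hr0
      · rw [psi_zero, map_mul, shift_X, ← psi_zero]
        refine mul_mem_lowDeg (n := w i) ?_ (ih t ht 0 (by omega) c)
        exact Submodule.add_mem _ (X_mem_lowDeg _ (by omega)) (C_mem_lowDeg _ (by omega))
      · obtain ⟨r, rfl⟩ : ∃ r', r = r' + 1 := ⟨r - 1, by omega⟩
        rw [psi_X_mul v i r (by omega)]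
        have h1 := ih t ht (r + 1) hr c
        have h0 := ih t ht r (by omega) c
        refine Submodule.add_mem _ ?_ ?_
        · by_cases hlt : Finsupp.weight w t + 1 ≤ r + 1
          · rw [show Finsupp.weight w t + 1 - (r + 1) = 0 by omega] at h1
            rw [eq_zero_of_mem_lowDeg_zero h1, mul_zero]
            exact Submodule.zero_mem _
          · have := mul_mem_lowDeg (n := w i) (X_mem_lowDeg (w := w) i (by omega)) h1
            exact lowDeg_mono (by omega) this
        · by_cases hwi : w i = 0
          · rw [hv i hwi]; simp
          · have := mul_mem_lowDeg (w := w) (n := 0) (C_mem_lowDeg (v i) (by omega)) h0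
            exact lowDeg_mono (by have := hw i; omega) this
  exact map_mem_of_monomial _ (fun s c hs => lowDeg_mono (by omega) (key _ s rfl r hr c)) hp

end Shift

/-! ### Operators dual to multiplication by exponentials -/

noncomputable section Formal

open MvPolynomial

/-- Polynomials in `a_1, …, a_m` and in the parameter `ℓ`, which is the variable `none`. -/
abbrev Pol (m : ℕ) : Type := MvPolynomial (Option (Fin m)) ℂ

variable {m : ℕ}

/-- The `i`-th standard basis vector in the `a`-directions. -/
def basisVec (i : Fin m) : Option (Fin m) → ℂ := Pi.single (some i) 1

/-- The vector `(1 / m, …, 1 / m)`, which is dual to the mean. -/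
def meanVec (m : ℕ) : Option (Fin m) → ℂ := fun o => o.elim 0 fun _ => 1 / m

/-- A polynomial in `ℓ` alone. -/
def polyEll : Polynomial ℂ →ₐ[ℂ] Pol m := Polynomial.aeval (X none)

lemma shift_polyEll {v : Option (Fin m) → ℂ} (hv : v none = 0) (p : Polynomial ℂ) :
    shift v (polyEll p) = polyEll p := by
  have : ((shift v).comp polyEll : Polynomial ℂ →ₐ[ℂ] Pol m) = polyEll := by
    ext; simp [polyEll, hv]
  exact DFunLike.congr_fun this p

lemma dirDeriv_polyEll (v : Option (Fin m) → ℂ) (p : Polynomial ℂ) :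
    dirDeriv v (polyEll p) = C (v none) * polyEll (Polynomial.derivative p) := by
  induction p using Polynomial.induction_on with
  | C c => simp [polyEll]
  | add p q hp hq => simp [hp, hq, mul_add]
  | monomial n c hp =>
    simp [polyEll, Derivation.leibniz_pow, MvPolynomial.algebraMap_eq, nsmul_eq_mul]
    ring

/-- Multiplication operators by polynomials in `ℓ`, shifts and derivatives in the `a`-directions. -/
def opGens (m : ℕ) : Set (Module.End ℂ (Pol m)) :=
  {f | (∃ p, f = LinearMap.mulLeft ℂ (polyEll p)) ∨
    (∃ v : Option (Fin m) → ℂ, v none = 0 ∧ f = (shift v).toLinearMap) ∨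
    ∃ v : Option (Fin m) → ℂ, v none = 0 ∧ f = (dirDeriv v).toLinearMap}

/-- The commutative algebra of operators generated by `opGens`. -/
def opAlg (m : ℕ) : Subalgebra ℂ (Module.End ℂ (Pol m)) := Algebra.adjoin ℂ (opGens m)

lemma opGens_comm {f g : Module.End ℂ (Pol m)} (hf : f ∈ opGens m) (hg : g ∈ opGens m) :
    f * g = g * f := by
  refine LinearMap.ext fun x => ?_
  rcases hf with ⟨p, rfl⟩ | ⟨v, hv, rfl⟩ | ⟨v, hv, rfl⟩ <;>
  rcases hg with ⟨q, rfl⟩ | ⟨w, hw, rfl⟩ | ⟨w, hw, rfl⟩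
  · simp [mul_left_comm]
  · simp [shift_polyEll hw]
  · simp [dirDeriv_polyEll, hw]
  · simp [shift_polyEll hv]
  · simp [shift_shift, add_comm]
  · simp [dirDeriv_shift]
  · simp [dirDeriv_polyEll, hv]
  · simp [dirDeriv_shift]
  · simp [dirDeriv_comm v w]

lemma opAlg_comm {f g : Module.End ℂ (Pol m)} (hf : f ∈ opAlg m) (hg : g ∈ opAlg m) :
    f * g = g * f := by
  have h1 : ∀ f ∈ opGens m, ∀ g ∈ opAlg m, f * g = g * f := by
    intro f hf g hg
    induction hg using Algebra.adjoin_induction with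
    | mem x hx => exact opGens_comm hf hx
    | algebraMap r => exact (Algebra.commutes r f).symm
    | add x y _ _ hx hy => rw [mul_add, add_mul, hx, hy]
    | mul x y _ _ hx hy => rw [← mul_assoc, hx, mul_assoc, hy, mul_assoc]
  induction hf using Algebra.adjoin_induction with
  | mem x hx => exact h1 x hx g hg
  | algebraMap r => exact Algebra.commutes r g
  | add x y _ _ hx hy => rw [mul_add, add_mul, hx, hy]
  | mul x y _ _ hx hy => rw [mul_assoc, hy, ← mul_assoc, hx, mul_assoc]

lemma opAlg_comm_apply {f g : Module.End ℂ (Pol m)} (hf : f ∈ opAlg m) (hg : g ∈ opAlg m)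
    (x : Pol m) : f (g x) = g (f x) :=
  DFunLike.congr_fun (opAlg_comm hf hg) x

lemma mulLeft_mem_opAlg (p : Polynomial ℂ) :
    LinearMap.mulLeft ℂ (polyEll p : Pol m) ∈ opAlg m :=
  Algebra.subset_adjoin (Or.inl ⟨p, rfl⟩)

lemma shift_mem_opAlg {v : Option (Fin m) → ℂ} (hv : v none = 0) :
    (shift v).toLinearMap ∈ opAlg m := Algebra.subset_adjoin (Or.inr (Or.inl ⟨v, hv, rfl⟩))

lemma dirDeriv_mem_opAlg {v : Option (Fin m) → ℂ} (hv : v none = 0) :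
    (dirDeriv v).toLinearMap ∈ opAlg m := Algebra.subset_adjoin (Or.inr (Or.inr ⟨v, hv, rfl⟩))

lemma psi_mem_opAlg {v : Option (Fin m) → ℂ} (hv : v none = 0) (r : ℕ) : psi v r ∈ opAlg m := by
  have h1 := shift_mem_opAlg hv
  have h2 := dirDeriv_mem_opAlg hv
  match r with
  | 0 => exact h1
  | 1 => exact sub_mem h1 (one_mem _)
  | 2 => exact sub_mem (sub_mem h1 (one_mem _)) h2
  | r + 3 =>
    exact sub_mem (sub_mem (sub_mem h1 (one_mem _)) h2) (Subalgebra.smul_mem _ (mul_mem h2 h2) _)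

@[simp] lemma basisVec_none (i : Fin m) : basisVec i none = 0 := by simp [basisVec]
@[simp] lemma meanVec_none : meanVec m none = 0 := rfl
@[simp] lemma meanVec_some (i : Fin m) : meanVec m (some i) = 1 / m := rfl
lemma basisVec_some (i j : Fin m) : basisVec i (some j) = if j = i then 1 else 0 := by
  simp [basisVec, Pi.single_apply]

lemma sum_dirDeriv_basisVec (hm : m ≠ 0) (p : Pol m) :
    ∑ i, dirDeriv (basisVec i) p = m * dirDeriv (meanVec m) p := by
  have hm' : (m : Pol m) * C (1 / (m : ℂ)) = 1 := by
    rw [show (m : Pol m) = C (m : ℂ) by simp, ← C_mul]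
    rw [mul_one_div_cancel (by exact_mod_cast hm), C_1]
  induction p using MvPolynomial.induction_on with
  | C c => simp
  | add p q hp hq => simp [Finset.sum_add_distrib, hp, hq, mul_add]
  | mul_X p o hp =>
    simp only [Derivation.leibniz, Finset.sum_add_distrib, smul_eq_mul, dirDeriv_X,
      ← Finset.mul_sum, hp]
    cases o with
    | none => simp; ring
    | some j =>
      have : ∑ i : Fin m, (C (basisVec i (some j)) : Pol m) = 1 := by
        simp [basisVec_some, apply_ite (C : ℂ → Pol m)]
      rw [this, meanVec_some]
      linear_combination (-p) * hm'

variable (lamb : Fin m → ℂ)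

/-- The coefficient `x_i = ℓ - λ_i`. -/
def xPol (i : Fin m) : Polynomial ℂ := Polynomial.X - Polynomial.C (lamb i)

/-- The operator dual to multiplication by
`∑ x_i ψ_r (s_i) - m ℓ ψ_r (mean s)`, where `ψ_r (s)` is `exp s` without its Taylor
polynomial of degree `r - 1`. -/
def actionOp (r : ℕ) : Module.End ℂ (Pol m) :=
  ∑ i, LinearMap.mulLeft ℂ (polyEll (xPol lamb i)) * psi (basisVec i) r -
    LinearMap.mulLeft ℂ (polyEll ((m : Polynomial ℂ) * Polynomial.X)) * psi (meanVec m) r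

/-- The operator dual to multiplication by the `i`-th derivative of the function in `actionOp`. -/
def gradOp (r : ℕ) (i : Fin m) : Module.End ℂ (Pol m) :=
  LinearMap.mulLeft ℂ (polyEll (xPol lamb i)) * psi (basisVec i) r -
    LinearMap.mulLeft ℂ (polyEll Polynomial.X) * psi (meanVec m) r

/-- The operator dual to multiplication by the `i`-th derivative of the Hessian quadratic form. -/
def hessOp (i : Fin m) : Module.End ℂ (Pol m) :=
  LinearMap.mulLeft ℂ (polyEll (xPol lamb i)) * (dirDeriv (basisVec i)).toLinearMap -
    LinearMap.mulLeft ℂ (polyEll Polynomial.X) * (dirDeriv (meanVec m)).toLinearMap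

/-- The derivative of `actionOp` with respect to `ℓ`. -/
def actionOpDeriv (m r : ℕ) : Module.End ℂ (Pol m) :=
  ∑ i : Fin m, psi (basisVec i) r - (m : ℂ) • psi (meanVec m) r

lemma actionOp_apply (r : ℕ) (p : Pol m) : actionOp lamb r p =
    ∑ i, polyEll (xPol lamb i) * psi (basisVec i) r p -
      polyEll ((m : Polynomial ℂ) * Polynomial.X) * psi (meanVec m) r p := by
  simp [actionOp, LinearMap.sum_apply, mul_assoc]

lemma gradOp_apply (r : ℕ) (i : Fin m) (p : Pol m) : gradOp lamb r i p =
    polyEll (xPol lamb i) * psi (basisVec i) r p -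
      polyEll Polynomial.X * psi (meanVec m) r p := rfl

lemma hessOp_apply (i : Fin m) (p : Pol m) : hessOp lamb i p =
    polyEll (xPol lamb i) * dirDeriv (basisVec i) p -
      polyEll Polynomial.X * dirDeriv (meanVec m) p := rfl

lemma actionOpDeriv_apply (r : ℕ) (p : Pol m) : actionOpDeriv m r p =
    ∑ i : Fin m, psi (basisVec i) r p - (m : ℂ) • psi (meanVec m) r p := by
  simp [actionOpDeriv, LinearMap.sum_apply]

lemma actionOp_mem (r : ℕ) : actionOp lamb r ∈ opAlg m :=
  sub_mem (sum_mem fun i _ => mul_mem (mulLeft_mem_opAlg _) (psi_mem_opAlg (basisVec_none i) r))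
    (mul_mem (mulLeft_mem_opAlg _) (psi_mem_opAlg meanVec_none r))

lemma gradOp_mem (r : ℕ) (i : Fin m) : gradOp lamb r i ∈ opAlg m :=
  sub_mem (mul_mem (mulLeft_mem_opAlg _) (psi_mem_opAlg (basisVec_none i) r))
    (mul_mem (mulLeft_mem_opAlg _) (psi_mem_opAlg meanVec_none r))

lemma hessOp_mem (i : Fin m) : hessOp lamb i ∈ opAlg m :=
  sub_mem (mul_mem (mulLeft_mem_opAlg _) (dirDeriv_mem_opAlg (basisVec_none i)))
    (mul_mem (mulLeft_mem_opAlg _) (dirDeriv_mem_opAlg meanVec_none))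

lemma actionOpDeriv_mem (r : ℕ) : actionOpDeriv m r ∈ opAlg m :=
  sub_mem (sum_mem fun i _ => psi_mem_opAlg (basisVec_none i) r)
    (Subalgebra.smul_mem _ (psi_mem_opAlg meanVec_none r) _)

lemma natCast_mul_C_one_div (hm : m ≠ 0) :
    (m : Pol m) * C (1 / (m : ℂ)) = 1 := by
  rw [show (m : Pol m) = C (m : ℂ) by simp, ← C_mul]
  rw [mul_one_div_cancel (by exact_mod_cast hm), C_1]

lemma actionOp_three_X_mul (hm : m ≠ 0) (i : Fin m) (p : Pol m) :
    actionOp lamb 3 (X (some i) * p) =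
      X (some i) * actionOp lamb 3 p + gradOp lamb 2 i p := by
  have h1 := natCast_mul_C_one_div hm
  simp only [actionOp_apply, gradOp_apply, psi_X_mul _ _ 2 (by norm_num), mul_add,
    Finset.sum_add_distrib, meanVec_some]
  have h2 : ∑ j, polyEll (xPol lamb j) * (C (basisVec j (some i)) * psi (basisVec j) 2 p) =
      polyEll (xPol lamb i) * psi (basisVec i) 2 p := by
    rw [Finset.sum_eq_single i]
    · simp [basisVec_some]
    · intro j _ hj
      simp [basisVec_some, hj.symm]
    · simp
  rw [h2, mul_sub, Finset.mul_sum]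
  simp only [map_mul, map_natCast, mul_left_comm (X (some i) : Pol m)]
  linear_combination (-(polyEll Polynomial.X * psi (meanVec m) 2 p : Pol m)) * h1

lemma actionOp_three_pow_X_mul (hm : m ≠ 0) (i : Fin m) (n : ℕ) (p : Pol m) :
    (actionOp lamb 3 ^ (n + 1)) (X (some i) * p) = X (some i) * (actionOp lamb 3 ^ (n + 1)) p +
      ((n : ℂ) + 1) • gradOp lamb 2 i ((actionOp lamb 3 ^ n) p) := by
  induction n generalizing p with
  | zero => simp [actionOp_three_X_mul lamb hm]
  | succ n ih =>
    have h1 : ∀ k (q : Pol m), (actionOp lamb 3 ^ (k + 1)) q =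
        (actionOp lamb 3 ^ k) (actionOp lamb 3 q) := fun k q => by
      rw [pow_succ, Module.End.mul_apply]
    rw [h1 (n + 1) (_ * _), actionOp_three_X_mul lamb hm, map_add, ih, ← h1, ← h1,
      opAlg_comm_apply (pow_mem (actionOp_mem lamb 3) _) (gradOp_mem lamb 2 i)]
    push_cast
    module

/-- The weight in which `ℓ` has degree zero and each `a_i` has degree one. -/
def aWeight : Option (Fin m) → ℕ := fun o => o.elim 0 fun _ => 1

lemma polyEll_mem_lowDeg (p : Polynomial ℂ) : (polyEll p : Pol m) ∈ lowDeg aWeight 1 := by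
  induction p using Polynomial.induction_on with
  | C c => simpa [polyEll] using C_mem_lowDeg (w := aWeight) c one_pos
  | add p q hp hq => rw [map_add]; exact add_mem hp hq
  | monomial n c hp =>
    rw [pow_succ, ← mul_assoc, map_mul, mul_comm]
    have hX : (polyEll Polynomial.X : Pol m) ∈ lowDeg aWeight 1 := by
      simpa [polyEll] using X_mem_lowDeg (w := aWeight) (none : Option (Fin m)) (n := 1)
        (by simp [aWeight])
    simpa using mul_mem_lowDeg (n := 0) hX hp

lemma polyEll_mul_mem_lowDeg (q : Polynomial ℂ) {n : ℕ} {p : Pol m} (hp : p ∈ lowDeg aWeight n) :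
    polyEll q * p ∈ lowDeg aWeight n := by
  have := mul_mem_lowDeg (n := 0) (polyEll_mem_lowDeg q) hp
  rwa [zero_add] at this

lemma actionOp_mem_lowDeg {n : ℕ} {p : Pol m} (hp : p ∈ lowDeg aWeight n) :
    actionOp lamb 3 p ∈ lowDeg aWeight (n - 3) := by
  have hw : ∀ o : Option (Fin m), aWeight o ≤ 1 := by rintro (_ | _) <;> simp [aWeight]
  have hn : ∀ v : Option (Fin m) → ℂ, v none = 0 → ∀ o, aWeight o = 0 → v o = 0 := by
    rintro v hv (_ | i) h
    · exact hv
    · simp [aWeight] at h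
  rw [actionOp_apply]
  refine Submodule.sub_mem _ (Submodule.sum_mem _ fun i _ => ?_) ?_
  · exact polyEll_mul_mem_lowDeg _ (psi_mem_lowDeg hw (hn _ (basisVec_none i)) le_rfl hp)
  · exact polyEll_mul_mem_lowDeg _ (psi_mem_lowDeg hw (hn _ meanVec_none) le_rfl hp)

lemma actionOp_pow_mem_lowDeg {n : ℕ} (r : ℕ) {p : Pol m} (hp : p ∈ lowDeg aWeight n) :
    (actionOp lamb 3 ^ r) p ∈ lowDeg aWeight (n - 3 * r) := by
  induction r with
  | zero => simpa using hp
  | succ r ih =>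
    rw [pow_succ', Module.End.mul_apply]
    exact lowDeg_mono (by omega) (actionOp_mem_lowDeg lamb ih)

end Formal

/-! ### The formal Gaussian functional -/

noncomputable section Formal

open MvPolynomial

variable {m : ℕ} (lamb : Fin m → ℂ)

/-- `G` is the inverse of the Hessian `diag (x_i) - ℓ / m` of the action at its critical point,
as a matrix of polynomials in `ℓ`. -/
structure IsInvHessian (G : Matrix (Fin m) (Fin m) (Polynomial ℂ)) : Prop where
  symm : ∀ i j, G i j = G j i
  inv : ∀ i j, xPol lamb i * G i j - Polynomial.C (1 / (m : ℂ)) * Polynomial.X * ∑ k, G k j =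
    if i = j then 1 else 0

variable {lamb} {G : Matrix (Fin m) (Fin m) (Polynomial ℂ)}

/-- The linear form `∑ G i j * a_j`. -/
def covForm (G : Matrix (Fin m) (Fin m) (Polynomial ℂ)) (i : Fin m) : Pol m :=
  ∑ j, polyEll (G i j) * X (some j)

/-- The quadratic form `(1 / 2) * ∑ G i j * a_i * a_j`. -/
def covQuad (G : Matrix (Fin m) (Fin m) (Polynomial ℂ)) : Pol m :=
  C (1 / 2) * ∑ i, X (some i) * covForm G i

lemma two_mul_C_half : (2 : Pol m) * C (1 / 2) = 1 := by
  rw [show (2 : Pol m) = C 2 from rfl, ← C_mul]; norm_num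

lemma two_mul_covQuad : 2 * covQuad G = ∑ i, X (some i) * covForm G i := by
  rw [covQuad, ← mul_assoc, two_mul_C_half, one_mul]

lemma dirDeriv_covForm (i j : Fin m) :
    dirDeriv (basisVec i) (covForm G j) = polyEll (G j i) := by
  simp only [covForm, map_sum, Derivation.leibniz, dirDeriv_X, dirDeriv_polyEll, basisVec_none,
    smul_eq_mul, C_0, zero_mul, mul_zero, add_zero, basisVec_some]
  rw [Finset.sum_eq_single i] <;> simp +contextual

lemma dirDeriv_covQuad (hG : IsInvHessian lamb G) (i : Fin m) :
    dirDeriv (basisVec i) (covQuad G) = covForm G i := by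
  have h : dirDeriv (basisVec i) (2 * covQuad G) = 2 * covForm G i := by
    rw [two_mul_covQuad, map_sum]
    simp only [Derivation.leibniz, dirDeriv_covForm, smul_eq_mul, dirDeriv_X, basisVec_some,
      Finset.sum_add_distrib]
    rw [two_mul]
    congr 1
    · rw [covForm]
      exact Finset.sum_congr rfl fun j _ => by rw [hG.symm i j, mul_comm]
    · rw [Finset.sum_eq_single i] <;> simp +contextual [eq_comm]
  have h2 := two_mul_C_half (m := m)
  rw [Derivation.leibniz, show (2 : Pol m) = C 2 from rfl, dirDeriv_C, smul_zero, add_zero,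
    smul_eq_mul, show (C 2 : Pol m) = 2 from rfl] at h
  linear_combination C (1 / 2) * h - (dirDeriv (basisVec i) (covQuad G) - covForm G i) * h2

lemma dirDeriv_meanVec_covQuad (hm : m ≠ 0) (hG : IsInvHessian lamb G) :
    dirDeriv (meanVec m) (covQuad G) = C (1 / (m : ℂ)) * ∑ i, covForm G i := by
  have h := sum_dirDeriv_basisVec hm (covQuad G)
  simp only [dirDeriv_covQuad hG] at h
  rw [h, ← mul_assoc, mul_comm (C _), natCast_mul_C_one_div hm, one_mul]

lemma covForm_eq (hG : IsInvHessian lamb G) (i : Fin m) :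
    polyEll (xPol lamb i) * covForm G i -
      polyEll Polynomial.X * (C (1 / (m : ℂ)) * ∑ j, covForm G j) = X (some i) := by
  have h : ∀ k, polyEll (xPol lamb i) * (polyEll (G i k) * X (some k)) -
      polyEll Polynomial.X * (C (1 / (m : ℂ)) * ∑ j, polyEll (G j k) * X (some k)) =
      (if i = k then 1 else 0) * X (some k) := by
    intro k
    have := congrArg (polyEll : Polynomial ℂ → Pol m) (hG.inv i k)
    simp only [map_sub, map_mul, map_sum] at this
    rw [show polyEll (Polynomial.C (1 / (m : ℂ))) = (C (1 / (m : ℂ)) : Pol m) by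
      simp [polyEll, MvPolynomial.algebraMap_eq]] at this
    rw [← Finset.sum_mul, show (if i = k then 1 else 0 : Pol m) =
      polyEll (if i = k then 1 else 0) by split_ifs <;> simp, ← this]
    ring
  have h2 := Finset.sum_congr rfl (fun k (_ : k ∈ Finset.univ) => h k)
  rw [Finset.sum_sub_distrib, ← Finset.mul_sum, ← Finset.mul_sum, ← Finset.mul_sum,
    Finset.sum_comm] at h2
  simp only [ite_mul, one_mul, zero_mul, Finset.sum_ite_eq, Finset.mem_univ, if_true] at h2
  exact h2

lemma hessOp_covQuad (hm : m ≠ 0) (hG : IsInvHessian lamb G) (i : Fin m) :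
    hessOp lamb i (covQuad G) = X (some i) := by
  rw [hessOp_apply, dirDeriv_covQuad hG, dirDeriv_meanVec_covQuad hm hG, covForm_eq hG]

/-- The divided powers of the covariance form. -/
def covPow (G : Matrix (Fin m) (Fin m) (Polynomial ℂ)) (n : ℕ) : Pol m :=
  C (1 / (n.factorial : ℂ)) * covQuad G ^ n

lemma covPow_zero : covPow G 0 = 1 := by simp [covPow]

lemma covPow_one : covPow G 1 = covQuad G := by simp [covPow]

lemma covPow_succ (n : ℕ) : ((n : Pol m) + 1) * covPow G (n + 1) = covQuad G * covPow G n := by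
  have : ((n : Pol m) + 1) * C (1 / ((n + 1).factorial : ℂ)) = C (1 / (n.factorial : ℂ)) := by
    rw [show ((n : Pol m) + 1) = C ((n : ℂ) + 1) by simp, ← C_mul, Nat.factorial_succ]
    congr 1
    push_cast
    have := Nat.cast_add_one_ne_zero (R := ℂ) n
    have h2 : (n.factorial : ℂ) ≠ 0 := by exact_mod_cast n.factorial_ne_zero
    field_simp
  rw [covPow, covPow, pow_succ, ← mul_assoc, this]
  ring

lemma derivation_covPow (D : Derivation ℂ (Pol m) (Pol m)) (n : ℕ) :
    D (covPow G (n + 1)) = D (covQuad G) * covPow G n := by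
  have : ((n : Pol m) + 1) * C (1 / ((n + 1).factorial : ℂ)) = C (1 / (n.factorial : ℂ)) := by
    rw [show ((n : Pol m) + 1) = C ((n : ℂ) + 1) by simp, ← C_mul, Nat.factorial_succ]
    congr 1
    push_cast
    have := Nat.cast_add_one_ne_zero (R := ℂ) n
    have h2 : (n.factorial : ℂ) ≠ 0 := by exact_mod_cast n.factorial_ne_zero
    field_simp
  rw [covPow, covPow, ← smul_eq_C_mul, D.map_smul, Derivation.leibniz_pow, smul_eq_C_mul,
    ← this]
  simp only [add_tsub_cancel_right, nsmul_eq_mul, smul_eq_mul]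
  push_cast
  ring

lemma hessOp_covPow (hm : m ≠ 0) (hG : IsInvHessian lamb G) (i : Fin m) (n : ℕ) :
    hessOp lamb i (covPow G (n + 1)) = X (some i) * covPow G n := by
  have := hessOp_covQuad hm hG i
  rw [hessOp_apply] at this
  rw [hessOp_apply, derivation_covPow, derivation_covPow, ← this]
  ring

lemma covForm_mem_lowDeg (i : Fin m) : covForm G i ∈ lowDeg aWeight 2 := by
  refine Submodule.sum_mem _ fun j _ => polyEll_mul_mem_lowDeg _ (X_mem_lowDeg _ ?_)
  simp [aWeight]

lemma covQuad_mem_lowDeg : covQuad G ∈ lowDeg aWeight 3 := by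
  have h := mul_mem_lowDeg (w := aWeight) (n := 0) (k := 3) (C_mem_lowDeg (1 / 2 : ℂ) one_pos)
    (Submodule.sum_mem (t := Finset.univ) (f := fun i => X (some i) * covForm G i) _ fun i _ =>
      mul_mem_lowDeg (n := 1) (X_mem_lowDeg _ (by simp [aWeight])) (covForm_mem_lowDeg i))
  rw [zero_add] at h
  exact h

lemma covPow_mem_lowDeg (n : ℕ) : covPow G n ∈ lowDeg aWeight (2 * n + 1) := by
  have : covQuad G ^ n ∈ lowDeg aWeight (2 * n + 1) := by
    induction n with
    | zero => simpa using C_mem_lowDeg (w := aWeight) (1 : ℂ) one_pos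
    | succ n ih =>
      rw [pow_succ']
      exact lowDeg_mono (by omega) (mul_mem_lowDeg (n := 2) (covQuad_mem_lowDeg (G := G)) ih)
  have h2 := mul_mem_lowDeg (w := aWeight) (n := 0)
    (C_mem_lowDeg (1 / (n.factorial : ℂ)) one_pos) this
  rwa [zero_add] at h2

variable (lamb G)

/-- The `n`-th term, of degree `n` in the non-quadratic part of the action, of the `k`-th
coefficient of the formal Gaussian functional. -/
def formalTerm (k n : ℕ) : Pol m :=
  ((-1) ^ n / (n.factorial : ℂ)) • (actionOp lamb 3 ^ n) (covPow G (k + n))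

/-- The `k`-th coefficient, in powers of `ħ`, of the formal expansion of
`∫ exp (- S (s) / ħ + a · s) ds`, normalised to be `1 + O(ħ)`, for the action
`S = ∑ x_i ψ (s_i) - m ℓ ψ (mean s)` with `ψ (s) = exp s - 1 - s`. It is a polynomial in
`a` and `ℓ`. -/
def formalCoeff (k : ℕ) : Pol m := ∑ n ∈ Finset.range (2 * k + 1), formalTerm lamb G k n

variable {lamb G}

lemma formalTerm_eq_zero {k n : ℕ} (h : 2 * k < n) : formalTerm lamb G k n = 0 := by
  have := actionOp_pow_mem_lowDeg lamb n (covPow_mem_lowDeg (G := G) (k + n))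
  rw [show 2 * (k + n) + 1 - 3 * n = 0 by omega] at this
  rw [formalTerm, eq_zero_of_mem_lowDeg_zero this, smul_zero]

lemma formalCoeff_eq_sum {k N : ℕ} (hN : 2 * k < N) :
    formalCoeff lamb G k = ∑ n ∈ Finset.range N, formalTerm lamb G k n := by
  refine Finset.sum_subset (Finset.range_mono hN) fun n _ hn => formalTerm_eq_zero ?_
  simpa [Nat.lt_succ_iff] using hn

lemma formalCoeff_zero : formalCoeff lamb G 0 = 1 := by
  simp [formalCoeff, formalTerm, covPow_zero]

lemma coef_succ (n : ℕ) : ((-1) ^ (n + 1) / ((n + 1).factorial : ℂ)) * (n + 1) =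
    -((-1) ^ n / (n.factorial : ℂ)) := by
  have := Nat.cast_add_one_ne_zero (R := ℂ) n
  have h2 : (n.factorial : ℂ) ≠ 0 := by exact_mod_cast n.factorial_ne_zero
  rw [Nat.factorial_succ]
  push_cast
  field_simp
  ring

lemma hessOp_add_gradOp (i : Fin m) (p : Pol m) :
    hessOp lamb i p + gradOp lamb 2 i p = gradOp lamb 1 i p := by
  simp only [hessOp_apply, gradOp_apply, psi_one, psi_two]
  ring

/-- Integration by parts in the direction `s_i`. -/
lemma gradOp_formalCoeff (hm : m ≠ 0) (hG : IsInvHessian lamb G) (i : Fin m) (k : ℕ) :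
    gradOp lamb 1 i (formalCoeff lamb G (k + 1)) = X (some i) * formalCoeff lamb G k := by
  have h0 : hessOp lamb i (formalTerm lamb G (k + 1) 0) = X (some i) * formalTerm lamb G k 0 := by
    simp [formalTerm, hessOp_covPow hm hG]
  have h1 : ∀ n, hessOp lamb i (formalTerm lamb G (k + 1) (n + 1)) =
      X (some i) * formalTerm lamb G k (n + 1) -
        gradOp lamb 2 i (formalTerm lamb G (k + 1) n) := by
    intro n
    rw [formalTerm, formalTerm, formalTerm, map_smul,
      opAlg_comm_apply (hessOp_mem lamb i) (pow_mem (actionOp_mem lamb 3) _),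
      show k + 1 + (n + 1) = k + (n + 1) + 1 by omega, hessOp_covPow hm hG,
      actionOp_three_pow_X_mul lamb hm, smul_add, smul_smul, coef_succ, map_smul,
      show k + (n + 1) = k + 1 + n by omega, mul_smul_comm, neg_smul, sub_eq_add_neg]
  rw [← hessOp_add_gradOp]
  nth_rewrite 1 [formalCoeff_eq_sum (N := 2 * (k + 1) + 2) (by omega)]
  rw [formalCoeff_eq_sum (k := k + 1) (N := 2 * (k + 1) + 1) (by omega),
    formalCoeff_eq_sum (k := k) (N := 2 * (k + 1) + 2) (by omega)]
  simp only [map_sum]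
  rw [Finset.sum_range_succ', Finset.mul_sum, Finset.sum_range_succ' _ (2 * (k + 1) + 1), h0]
  simp only [h1, Finset.sum_sub_distrib]
  ring

/-- The second-order operator dual to multiplication by the Hessian quadratic form. -/
lemma half_sum_dirDeriv_hessOp (hm : m ≠ 0) (p : Pol m) :
    (1 / 2 : ℂ) • ∑ i, dirDeriv (basisVec i) (hessOp lamb i p) + actionOp lamb 3 p =
      actionOp lamb 2 p := by
  have h := sum_dirDeriv_basisVec hm (dirDeriv (meanVec m) p)
  have h2 := two_mul_C_half (m := m)
  have h3 : ∑ i, dirDeriv (basisVec i) (hessOp lamb i p) =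
      ∑ i, polyEll (xPol lamb i) * dirDeriv (basisVec i) (dirDeriv (basisVec i) p) -
        polyEll Polynomial.X * ((m : Pol m) * dirDeriv (meanVec m) (dirDeriv (meanVec m) p)) := by
    rw [← h, Finset.mul_sum, ← Finset.sum_sub_distrib]
    refine Finset.sum_congr rfl fun i _ => ?_
    simp [hessOp_apply, dirDeriv_polyEll]
  rw [h3, actionOp_apply, actionOp_apply]
  simp only [psi_two, psi_three, smul_eq_C_mul, mul_sub, Finset.sum_sub_distrib, Finset.mul_sum,
    map_mul, map_natCast, mul_left_comm (C (1 / 2 : ℂ) : Pol m)]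
  ring

lemma hess_covPow (hm : m ≠ 0) (hG : IsInvHessian lamb G) (n : ℕ) :
    (1 / 2 : ℂ) • ∑ i, dirDeriv (basisVec i) (hessOp lamb i (covPow G (n + 1))) =
      ((m : ℂ) / 2 + n) • covPow G n := by
  simp only [hessOp_covPow hm hG, Derivation.leibniz, dirDeriv_X, basisVec_some, if_true, C_1,
    smul_eq_mul, mul_one, Finset.sum_add_distrib, Finset.sum_const, Finset.card_univ,
    Fintype.card_fin, nsmul_eq_mul]
  cases n with
  | zero =>
    simp [covPow_zero, smul_eq_C_mul, div_eq_mul_inv, mul_comm]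
  | succ n =>
    simp only [derivation_covPow, dirDeriv_covQuad hG, ← mul_assoc]
    rw [← Finset.sum_mul, ← two_mul_covQuad, mul_assoc 2, ← covPow_succ]
    simp only [smul_eq_C_mul]
    have h2 := two_mul_C_half (m := m)
    have e : (C ((m : ℂ) / 2 + ((n + 1 : ℕ) : ℂ)) : Pol m) = (m : Pol m) * C (1 / 2) + ((n : Pol m) + 1) := by
      rw [C_add, div_eq_mul_one_div, C_mul]; simp
    rw [e]
    linear_combination (((n : Pol m) + 1) * covPow G (n + 1)) * h2

/-- The Euler relation: multiplication by the action is `ħ ^ 2 d/dħ`. -/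
lemma actionOp_formalCoeff (hm : m ≠ 0) (hG : IsInvHessian lamb G) (k : ℕ) :
    actionOp lamb 2 (formalCoeff lamb G (k + 1)) =
      ((m : ℂ) / 2 + k) • formalCoeff lamb G k := by
  have hq : ∀ n, (1 / 2 : ℂ) • ∑ i, dirDeriv (basisVec i)
      (hessOp lamb i (formalTerm lamb G (k + 1) n)) =
      ((m : ℂ) / 2 + k + n) • formalTerm lamb G k n := by
    intro n
    have := hess_covPow hm hG (k + n)
    have hc : ∀ i, dirDeriv (basisVec i) (hessOp lamb i (formalTerm lamb G (k + 1) n)) =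
        ((-1) ^ n / (n.factorial : ℂ)) • (actionOp lamb 3 ^ n)
          (dirDeriv (basisVec i) (hessOp lamb i (covPow G (k + n + 1)))) := by
      intro i
      rw [formalTerm, map_smul, opAlg_comm_apply (hessOp_mem lamb i)
        (pow_mem (actionOp_mem lamb 3) _), Derivation.map_smul]
      congr 1
      rw [show k + 1 + n = k + n + 1 by omega]
      exact opAlg_comm_apply (dirDeriv_mem_opAlg (basisVec_none i))
        (pow_mem (actionOp_mem lamb 3) _) _
    simp only [hc]
    rw [← Finset.smul_sum, ← map_sum, smul_comm, ← map_smul, this, map_smul, formalTerm,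
      smul_comm]
    push_cast
    rw [add_assoc]
  have hs : ∀ n, actionOp lamb 3 (formalTerm lamb G (k + 1) n) =
      -((n : ℂ) + 1) • formalTerm lamb G k (n + 1) := by
    intro n
    rw [formalTerm, map_smul, ← Module.End.mul_apply, ← pow_succ', formalTerm, smul_smul,
      show k + 1 + n = k + (n + 1) by omega, neg_mul, mul_comm, coef_succ, neg_neg]
  rw [← half_sum_dirDeriv_hessOp hm]
  nth_rewrite 1 [formalCoeff_eq_sum (N := 2 * (k + 1) + 2) (by omega)]
  rw [formalCoeff_eq_sum (k := k + 1) (N := 2 * (k + 1) + 1) (by omega),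
    formalCoeff_eq_sum (k := k) (N := 2 * (k + 1) + 2) (by omega)]
  simp only [map_sum]
  rw [Finset.sum_comm, Finset.smul_sum]
  simp only [hq, hs]
  rw [Finset.sum_range_succ', Finset.sum_range_succ' _ (2 * (k + 1) + 1), add_right_comm,
    ← Finset.sum_add_distrib, smul_add, Finset.smul_sum]
  congr 1
  · refine Finset.sum_congr rfl fun n _ => ?_
    push_cast
    module
  · simp

/-- The derivative with respect to `ℓ`. -/
def ellDeriv (m : ℕ) : Derivation ℂ (Pol m) (Pol m) := dirDeriv (Pi.single none 1)

lemma ellDeriv_polyEll (p : Polynomial ℂ) :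
    ellDeriv m (polyEll p) = polyEll (Polynomial.derivative p) := by
  simp [ellDeriv, dirDeriv_polyEll]

lemma ellDeriv_X_some (i : Fin m) : ellDeriv m (X (some i)) = 0 := by
  simp [ellDeriv]

lemma ellDeriv_psi (v : Option (Fin m) → ℂ) (r : ℕ) (p : Pol m) :
    ellDeriv m (psi v r p) = psi v r (ellDeriv m p) := by
  match r with
  | 0 => simp [psi_zero, ellDeriv, dirDeriv_shift]
  | 1 => simp [psi_one, ellDeriv, dirDeriv_shift]
  | 2 => simp [psi_two, ellDeriv, dirDeriv_shift, dirDeriv_comm v]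
  | r + 3 =>
    change ellDeriv m (psi v 3 p) = psi v 3 (ellDeriv m p)
    simp [psi_three, ellDeriv, dirDeriv_shift, dirDeriv_comm v]

lemma ellDeriv_actionOp (p : Pol m) : ellDeriv m (actionOp lamb 3 p) =
    actionOp lamb 3 (ellDeriv m p) + actionOpDeriv m 3 p := by
  simp only [actionOp_apply, actionOpDeriv_apply, map_sub, map_sum, Derivation.leibniz,
    ellDeriv_psi, ellDeriv_polyEll, smul_eq_mul, Finset.sum_add_distrib, xPol,
    Polynomial.derivative_X, Polynomial.derivative_C, sub_zero, map_one, mul_one,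
    Polynomial.derivative_mul, Polynomial.derivative_natCast, zero_mul, zero_add, map_natCast,
    smul_eq_C_mul, map_zero, show (C (m : ℂ) : Pol m) = m by simp]
  ring_nf

lemma ellDeriv_actionOp_pow (n : ℕ) (p : Pol m) : ellDeriv m ((actionOp lamb 3 ^ (n + 1)) p) =
    (actionOp lamb 3 ^ (n + 1)) (ellDeriv m p) +
      ((n : ℂ) + 1) • actionOpDeriv m 3 ((actionOp lamb 3 ^ n) p) := by
  induction n generalizing p with
  | zero => simp [ellDeriv_actionOp]
  | succ n ih =>
    have h1 : ∀ k (q : Pol m), (actionOp lamb 3 ^ (k + 1)) q =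
        (actionOp lamb 3 ^ k) (actionOp lamb 3 q) := fun k q => by
      rw [pow_succ, Module.End.mul_apply]
    rw [h1 (n + 1) p, ih, ellDeriv_actionOp, map_add, ← h1, ← h1,
      opAlg_comm_apply (pow_mem (actionOp_mem lamb 3) _) (actionOpDeriv_mem 3)]
    push_cast
    module

lemma ellDeriv_covQuad (hm : m ≠ 0) (hG : IsInvHessian lamb G) :
    2 * ellDeriv m (covQuad G) = m * dirDeriv (meanVec m) (covQuad G) ^ 2 -
      ∑ i, covForm G i ^ 2 := by
  have hm' := natCast_mul_C_one_div hm
  set f := covForm G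
  set f' := fun i => ellDeriv m (f i)
  have h1 : ∀ i, f i + polyEll (xPol lamb i) * f' i - C (1 / (m : ℂ)) * ∑ j, f j -
      polyEll Polynomial.X * (C (1 / (m : ℂ)) * ∑ j, f' j) = 0 := by
    intro i
    have := congrArg (ellDeriv m) (covForm_eq hG i)
    simp only [map_sub, Derivation.leibniz, ellDeriv_polyEll, smul_eq_mul, ellDeriv_X_some,
      map_sum, xPol, Polynomial.derivative_X, Polynomial.derivative_C, map_zero, sub_zero, map_one] at this
    have hC : ellDeriv m (C (1 / (m : ℂ))) = 0 := by simp [ellDeriv]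
    rw [hC] at this
    simp only [xPol, map_sub, f', f] at this ⊢
    linear_combination this
  have h2 : 2 * ellDeriv m (covQuad G) = ∑ i, X (some i) * f' i := by
    have := congrArg (ellDeriv m) (two_mul_covQuad (G := G))
    simp only [Derivation.leibniz, map_sum, ellDeriv_X_some, smul_eq_mul, mul_zero,
      add_zero] at this
    rw [show (2 : Pol m) = C 2 from rfl, show ellDeriv m (C 2) = 0 by simp [ellDeriv]] at this
    rw [mul_zero, add_zero] at this
    exact this
  have h3 : ∑ i, X (some i) * f' i =
      ∑ i, polyEll (xPol lamb i) * f i * f' i -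
        polyEll Polynomial.X * C (1 / (m : ℂ)) * (∑ j, f j) * ∑ i, f' i := by
    rw [Finset.mul_sum, ← Finset.sum_sub_distrib]
    refine Finset.sum_congr rfl fun i _ => ?_
    rw [← covForm_eq hG i]; ring
  have h4 : ∑ i, f i * (f i + polyEll (xPol lamb i) * f' i - C (1 / (m : ℂ)) * ∑ j, f j -
      polyEll Polynomial.X * (C (1 / (m : ℂ)) * ∑ j, f' j)) = 0 :=
    Finset.sum_eq_zero fun i _ => by rw [h1, mul_zero]
  have h5 : ∑ i, f i * (f i + polyEll (xPol lamb i) * f' i - C (1 / (m : ℂ)) * ∑ j, f j -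
      polyEll Polynomial.X * (C (1 / (m : ℂ)) * ∑ j, f' j)) =
      ∑ i, f i ^ 2 + ∑ i, polyEll (xPol lamb i) * f i * f' i -
        (∑ i, f i) * (C (1 / (m : ℂ)) * ∑ j, f j) -
        (∑ i, f i) * (polyEll Polynomial.X * (C (1 / (m : ℂ)) * ∑ j, f' j)) := by
    rw [Finset.sum_mul, Finset.sum_mul, ← Finset.sum_add_distrib, ← Finset.sum_sub_distrib,
      ← Finset.sum_sub_distrib]
    exact Finset.sum_congr rfl fun i _ => by ring
  rw [h2, h3, dirDeriv_meanVec_covQuad hm hG]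
  linear_combination h4 - h5 - (∑ i, f i) ^ 2 * C (1 / (m : ℂ)) * hm'

/-- Half the trace of the inverse Hessian times the `ℓ`-derivative of the Hessian. -/
def traceTerm (G : Matrix (Fin m) (Fin m) (Polynomial ℂ)) : Polynomial ℂ :=
  Polynomial.C (1 / 2) * (∑ i, G i i - Polynomial.C (1 / (m : ℂ)) * ∑ i, ∑ j, G i j)

/-- The second-order operator dual to multiplication by the `ℓ`-derivative of the Hessian
quadratic form. -/
def hessDeriv (m : ℕ) : Module.End ℂ (Pol m) :=
  (1 / 2 : ℂ) • (∑ i : Fin m, (dirDeriv (basisVec i)).toLinearMap *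
    (dirDeriv (basisVec i)).toLinearMap -
      (m : ℂ) • ((dirDeriv (meanVec m)).toLinearMap * (dirDeriv (meanVec m)).toLinearMap))

lemma hessDeriv_apply (p : Pol m) : hessDeriv m p =
    (1 / 2 : ℂ) • (∑ i : Fin m, dirDeriv (basisVec i) (dirDeriv (basisVec i) p) -
      (m : ℂ) • dirDeriv (meanVec m) (dirDeriv (meanVec m) p)) := by
  simp [hessDeriv, LinearMap.sum_apply]

lemma hessDeriv_mem : hessDeriv m ∈ opAlg m :=
  Subalgebra.smul_mem _ (sub_mem (sum_mem fun i _ => mul_mem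
    (dirDeriv_mem_opAlg (basisVec_none i)) (dirDeriv_mem_opAlg (basisVec_none i)))
    (Subalgebra.smul_mem _ (mul_mem (dirDeriv_mem_opAlg meanVec_none)
      (dirDeriv_mem_opAlg meanVec_none)) _)) _

lemma hessDeriv_covQuad (hm : m ≠ 0) (hG : IsInvHessian lamb G) :
    hessDeriv m (covQuad G) = polyEll (traceTerm G) := by
  have hm' := natCast_mul_C_one_div hm
  have hu : dirDeriv (meanVec m) (dirDeriv (meanVec m) (covQuad G)) =
      C (1 / (m : ℂ)) * (C (1 / (m : ℂ)) * ∑ i, ∑ j, polyEll (G i j)) := by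
    have h := sum_dirDeriv_basisVec hm (dirDeriv (meanVec m) (covQuad G))
    have h2 : ∀ i, dirDeriv (basisVec i) (dirDeriv (meanVec m) (covQuad G)) =
        C (1 / (m : ℂ)) * ∑ j, polyEll (G j i) := by
      intro i
      rw [dirDeriv_meanVec_covQuad hm hG]
      simp [dirDeriv_covForm]
    simp only [h2] at h
    rw [← Finset.mul_sum, Finset.sum_comm] at h
    rw [h]
    linear_combination (-dirDeriv (meanVec m) (dirDeriv (meanVec m) (covQuad G))) * hm'
  rw [hessDeriv_apply, hu]
  simp only [dirDeriv_covQuad hG, dirDeriv_covForm, traceTerm, map_mul, map_sub, map_sum,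
    smul_eq_C_mul]
  rw [show polyEll (Polynomial.C (1 / (m : ℂ))) = (C (1 / (m : ℂ)) : Pol m) by
      simp [polyEll, MvPolynomial.algebraMap_eq],
    show polyEll (Polynomial.C (1 / 2 : ℂ)) = (C (1 / 2) : Pol m) by
      simp [polyEll, MvPolynomial.algebraMap_eq], show (C (m : ℂ) : Pol m) = m by simp]
  linear_combination (-C (1 / 2) * C (1 / (m : ℂ)) * ∑ i, ∑ j, (polyEll (G i j) : Pol m)) * hm'

lemma hessDeriv_covPow (hm : m ≠ 0) (hG : IsInvHessian lamb G) (n : ℕ) :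
    hessDeriv m (covPow G (n + 1)) =
      polyEll (traceTerm G) * covPow G n - ellDeriv m (covPow G n) := by
  cases n with
  | zero =>
    rw [zero_add, covPow_one, hessDeriv_covQuad hm hG, covPow_zero]
    simp
  | succ n =>
    have h := hessDeriv_covQuad hm hG
    have h2 := ellDeriv_covQuad hm hG
    have h3 := two_mul_C_half (m := m)
    rw [← h, derivation_covPow (ellDeriv m), hessDeriv_apply, hessDeriv_apply]
    simp only [derivation_covPow, Derivation.leibniz, smul_eq_mul, Finset.sum_add_distrib]
    simp only [dirDeriv_covQuad hG] at h2 ⊢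
    have h4 : ∑ i, covForm G i * (covForm G i * covPow G n) =
        (∑ i, covForm G i ^ 2) * covPow G n := by
      rw [Finset.sum_mul]; exact Finset.sum_congr rfl fun i _ => by ring
    have h5 : ∑ i, covPow G (n + 1) * dirDeriv (basisVec i) (covForm G i) =
        covPow G (n + 1) * ∑ i, dirDeriv (basisVec i) (covForm G i) := by rw [Finset.mul_sum]
    rw [h4, h5]
    simp only [smul_eq_C_mul, show (C (m : ℂ) : Pol m) = m by simp]
    linear_combination (C (1 / 2) * covPow G n) * h2 -
      (ellDeriv m (covQuad G) * covPow G n) * h3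

lemma hessDeriv_add_actionOpDeriv (hm : m ≠ 0) (p : Pol m) :
    hessDeriv m p + actionOpDeriv m 3 p =
      ∑ i : Fin m, shift (basisVec i) p - (m : ℂ) • shift (meanVec m) p := by
  have h := sum_dirDeriv_basisVec hm p
  rw [hessDeriv_apply, actionOpDeriv_apply]
  simp only [psi_three, Finset.sum_sub_distrib, h, Finset.sum_const, Finset.card_univ,
    Fintype.card_fin, nsmul_eq_mul, smul_eq_C_mul, show (C (m : ℂ) : Pol m) = m by simp,
    ← Finset.mul_sum]
  ring

/-- Differentiation of the formal expansion under the integral sign. -/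
lemma ellDeriv_formalCoeff (hm : m ≠ 0) (hG : IsInvHessian lamb G) (k : ℕ) :
    ellDeriv m (formalCoeff lamb G k) = polyEll (traceTerm G) * formalCoeff lamb G k -
      (∑ i, shift (basisVec i) (formalCoeff lamb G (k + 1)) -
        (m : ℂ) • shift (meanVec m) (formalCoeff lamb G (k + 1))) := by
  have hpow : ∀ n, (actionOp lamb 3 ^ n) (ellDeriv m (covPow G (k + n))) =
      polyEll (traceTerm G) * (actionOp lamb 3 ^ n) (covPow G (k + n)) -
        hessDeriv m ((actionOp lamb 3 ^ n) (covPow G (k + 1 + n))) := by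
    intro n
    have := hessDeriv_covPow hm hG (k + n)
    rw [eq_sub_iff_add_eq, ← eq_sub_iff_add_eq'] at this
    rw [this, map_sub, ← opAlg_comm_apply hessDeriv_mem (pow_mem (actionOp_mem lamb 3) _),
      show k + 1 + n = k + n + 1 by omega]
    congr 1
    exact (opAlg_comm_apply (mulLeft_mem_opAlg (traceTerm G))
      (pow_mem (actionOp_mem lamb 3) n) _).symm
  have h0 : ellDeriv m (formalTerm lamb G k 0) = polyEll (traceTerm G) * formalTerm lamb G k 0 -
      hessDeriv m (formalTerm lamb G (k + 1) 0) := by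
    have := hpow 0
    simp only [formalTerm, pow_zero, Module.End.one_apply, Nat.factorial_zero, Nat.cast_one,
      div_one, one_smul, add_zero] at this ⊢
    exact this
  have h1 : ∀ n, ellDeriv m (formalTerm lamb G k (n + 1)) =
      polyEll (traceTerm G) * formalTerm lamb G k (n + 1) -
      hessDeriv m (formalTerm lamb G (k + 1) (n + 1)) -
      actionOpDeriv m 3 (formalTerm lamb G (k + 1) n) := by
    intro n
    rw [formalTerm, formalTerm, formalTerm, Derivation.map_smul, ellDeriv_actionOp_pow, hpow,
      smul_add, smul_smul, coef_succ, map_smul, map_smul, smul_sub, mul_smul_comm,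
      show k + (n + 1) = k + 1 + n by omega, neg_smul, ← sub_eq_add_neg]
  rw [← hessDeriv_add_actionOpDeriv hm]
  nth_rewrite 1 [formalCoeff_eq_sum (k := k + 1) (N := 2 * (k + 1) + 2) (by omega)]
  rw [formalCoeff_eq_sum (k := k + 1) (N := 2 * (k + 1) + 1) (by omega),
    formalCoeff_eq_sum (k := k) (N := 2 * (k + 1) + 2) (by omega)]
  simp only [map_sum]
  rw [Finset.sum_range_succ', Finset.mul_sum, Finset.sum_range_succ' _ (2 * (k + 1) + 1),
    Finset.sum_range_succ' _ (2 * (k + 1) + 1), h0]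
  simp only [h1, Finset.sum_sub_distrib]
  ring

end Formal

/-! ### The Hessian at the critical point -/

noncomputable section Hessian

variable {m : ℕ} {ζ lam : ℂ}

lemma prod_sub_eqParam (hm : m ≠ 0) (hζ : IsPrimitiveRoot ζ m) (lam : ℂ) :
    ∏ i : Fin m, xPol (eqParam m ζ lam) i =
      Polynomial.X ^ m - Polynomial.C (lam ^ m) := by
  rw [X_pow_sub_C_eq_prod hζ (Nat.pos_of_ne_zero hm) (α := lam) rfl, Finset.prod_range]
  rfl

lemma prod_eval_sub_eqParam (hm : m ≠ 0) (hζ : IsPrimitiveRoot ζ m) (lam ell : ℂ) :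
    ∏ i : Fin m, (ell - eqParam m ζ lam i) = ell ^ m - lam ^ m := by
  have := congrArg (Polynomial.eval ell) (prod_sub_eqParam hm hζ lam)
  simpa [xPol, Polynomial.eval_prod] using this

lemma sum_prod_erase_eqParam (hm : m ≠ 0) (hζ : IsPrimitiveRoot ζ m) (lam ell : ℂ) :
    ∑ i : Fin m, ∏ j ∈ Finset.univ.erase i, (ell - eqParam m ζ lam j) = m * ell ^ (m - 1) := by
  have := congrArg (fun p => Polynomial.eval ell (Polynomial.derivative p))
    (prod_sub_eqParam hm hζ lam)
  simpa only [xPol, Polynomial.eval_prod, Polynomial.derivative_prod_finset,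
    Polynomial.eval_finsetSum, Polynomial.derivative_sub, Polynomial.derivative_X,
    Polynomial.derivative_C, sub_zero, mul_one, Polynomial.eval_sub, Polynomial.eval_X,
    Polynomial.eval_C, Polynomial.derivative_X_pow, Polynomial.eval_mul, Polynomial.eval_pow,
    Polynomial.eval_natCast, Polynomial.map_natCast, map_natCast] using this

lemma det_diagonal_sub_const (x : Fin m → ℂ) (hx : ∀ i, x i ≠ 0) (c : ℂ) :
    (Matrix.of fun i j : Fin m => (if i = j then x i else 0) - c).det =
      ∏ i, x i - c * ∑ i, ∏ j ∈ Finset.univ.erase i, x j := by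
  have h1 : (Matrix.of fun i j : Fin m => (if i = j then x i else 0) - c) =
      Matrix.diagonal x * (1 + Matrix.replicateCol Unit (fun i : Fin m => -c / x i) *
        Matrix.replicateRow Unit fun _ : Fin m => (1 : ℂ)) := by
    ext i j
    rw [Matrix.diagonal_mul]
    simp only [Matrix.of_apply, Matrix.add_apply, Matrix.one_apply, Matrix.mul_apply,
      Matrix.replicateCol_apply, Matrix.replicateRow_apply]
    have := hx i
    split_ifs <;> simp <;> field_simp; ring
  rw [h1, Matrix.det_mul, Matrix.det_diagonal, Matrix.det_one_add_replicateCol_mul_replicateRow,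
    mul_add, mul_one, sub_eq_add_neg]
  congr 1
  rw [dotProduct, Finset.mul_sum, ← mul_neg, ← Finset.sum_neg_distrib, Finset.mul_sum]
  refine Finset.sum_congr rfl fun i _ => ?_
  rw [← Finset.mul_prod_erase _ _ (Finset.mem_univ i)]
  have := hx i
  field_simp

/-- The Hessian of the action at its critical point has the constant determinant `-lam ^ m`. -/
lemma det_hessian (hm : m ≠ 0) (hζ : IsPrimitiveRoot ζ m) (ell : ℂ)
    (hx : ∀ i, ell - eqParam m ζ lam i ≠ 0) :
    (Matrix.of fun i j : Fin m => (if i = j then ell - eqParam m ζ lam i else 0) - ell / m).det =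
      -lam ^ m := by
  rw [det_diagonal_sub_const _ hx, prod_eval_sub_eqParam hm hζ, sum_prod_erase_eqParam hm hζ]
  have hm' : (m : ℂ) ≠ 0 := by exact_mod_cast hm
  have : ell ^ m = ell * ell ^ (m - 1) := by rw [← pow_succ', Nat.sub_add_cancel (by omega)]
  rw [this]
  field_simp
  ring

/-- The Hessian of the action at its critical point, with polynomial entries in `ℓ`. -/
def hessMat (m : ℕ) (ζ lam : ℂ) : Matrix (Fin m) (Fin m) (Polynomial ℂ) :=
  Matrix.of fun i j => (if i = j then xPol (eqParam m ζ lam) i else 0) -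
    Polynomial.C (1 / (m : ℂ)) * Polynomial.X

lemma det_hessMat (hm : m ≠ 0) (hζ : IsPrimitiveRoot ζ m) (lam : ℂ) :
    (hessMat m ζ lam).det = Polynomial.C (-lam ^ m) := by
  refine Polynomial.eq_of_infinite_eval_eq _ _ ?_
  refine Set.Infinite.mono (s := (Set.range (eqParam m ζ lam))ᶜ) ?_
    (Set.finite_range _).infinite_compl
  intro ell hell
  have hx : ∀ i, ell - eqParam m ζ lam i ≠ 0 := fun i h =>
    hell ⟨i, (sub_eq_zero.1 h).symm⟩
  rw [Set.mem_ofPred_eq, Polynomial.eval_C, ← det_hessian hm hζ ell hx,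
    ← Polynomial.coe_evalRingHom, RingHom.map_det]
  congr 1
  ext i j
  simp only [hessMat, xPol, RingHom.mapMatrix_apply, Matrix.map_apply, Matrix.of_apply,
    Polynomial.coe_evalRingHom, Polynomial.eval_sub, Polynomial.eval_mul, Polynomial.eval_C,
    Polynomial.eval_X]
  rw [one_div_mul_eq_div]
  split_ifs <;> simp

/-- The inverse of the Hessian. -/
def invHess (m : ℕ) (ζ lam : ℂ) : Matrix (Fin m) (Fin m) (Polynomial ℂ) :=
  Polynomial.C (-lam ^ m)⁻¹ • (hessMat m ζ lam).adjugate

lemma isInvHessian_invHess (hm : m ≠ 0) (hζ : IsPrimitiveRoot ζ m) (hlam : lam ≠ 0) :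
    IsInvHessian (eqParam m ζ lam) (invHess m ζ lam) := by
  constructor
  · intro i j
    have hs : (hessMat m ζ lam).transpose = hessMat m ζ lam := by
      ext1 i j
      simp only [hessMat, Matrix.transpose_apply, Matrix.of_apply]
      by_cases h : i = j
      · subst h; rfl
      · rw [if_neg h, if_neg (Ne.symm h)]
    have := congrFun (congrFun (Matrix.adjugate_transpose (hessMat m ζ lam)) j) i
    rw [hs, Matrix.transpose_apply] at this
    simp only [invHess, Matrix.smul_apply, this]
  · intro i j
    have h : hessMat m ζ lam * invHess m ζ lam = 1 := by
      rw [invHess, Matrix.mul_smul, Matrix.mul_adjugate, det_hessMat hm hζ, smul_smul,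
        ← Polynomial.C_mul, inv_mul_cancel₀ (by simp [hlam]), Polynomial.C_1, one_smul]
    have h2 := congrFun (congrFun h i) j
    rw [Matrix.mul_apply, Matrix.one_apply] at h2
    rw [← h2]
    simp only [hessMat, Matrix.of_apply, sub_mul, Finset.sum_sub_distrib, ite_mul, zero_mul,
      Finset.sum_ite_eq, Finset.mem_univ, if_true, Finset.mul_sum]

end Hessian

/-! ### The formal coefficients on the line through the origin and the mean -/

noncomputable section Line

open MvPolynomial

variable (m : ℕ) (ζ lam : ℂ)

/-- The formal coefficients of the Landau--Ginzburg potential, as functions of `ℓ` and `a`. -/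
def fval (k : ℕ) (ell : ℂ) (a : Fin m → ℂ) : ℂ :=
  eval (fun o : Option (Fin m) => o.elim ell a) (formalCoeff (eqParam m ζ lam) (invHess m ζ lam) k)

variable {m ζ lam}

lemma fval_zero (ell : ℂ) (a : Fin m → ℂ) : fval m ζ lam 0 ell a = 1 := by
  simp [fval, formalCoeff_zero]

lemma eval_polyEll (ell : ℂ) (a : Fin m → ℂ) (p : Polynomial ℂ) :
    eval (fun o : Option (Fin m) => o.elim ell a) (polyEll p) = p.eval ell := by
  rw [polyEll, ← Polynomial.coe_aeval_eq_eval]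
  change ((aeval (R := ℂ) fun o : Option (Fin m) => o.elim ell a).comp
    (Polynomial.aeval (X none))) p = _
  congr 1
  ext
  simp

lemma elim_add_basisVec (ell : ℂ) (a : Fin m → ℂ) (i : Fin m) :
    (fun o : Option (Fin m) => o.elim ell a) + basisVec i =
      fun o : Option (Fin m) => o.elim ell (a + Pi.single i 1) := by
  ext o
  cases o <;> simp [basisVec, Pi.single_apply]

lemma elim_add_meanVec (ell : ℂ) (a : Fin m → ℂ) :
    (fun o : Option (Fin m) => o.elim ell a) + meanVec m =
      fun o : Option (Fin m) => o.elim ell (a + fun _ => 1 / (m : ℂ)) := by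
  ext o
  cases o <;> simp

/-- Integration by parts. -/
lemma fval_ibp (hm : m ≠ 0) (hζ : IsPrimitiveRoot ζ m) (hlam : lam ≠ 0) (k : ℕ) (ell : ℂ)
    (a : Fin m → ℂ) (i : Fin m) :
    a i * fval m ζ lam k ell a =
      (ell - eqParam m ζ lam i) *
        (fval m ζ lam (k + 1) ell (a + Pi.single i 1) - fval m ζ lam (k + 1) ell a) -
      ell * (fval m ζ lam (k + 1) ell (a + fun _ => 1 / (m : ℂ)) -
        fval m ζ lam (k + 1) ell a) := by
  have h := congrArg (eval (fun o : Option (Fin m) => o.elim ell a))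
    (gradOp_formalCoeff hm (isInvHessian_invHess hm hζ hlam) i k)
  rw [gradOp_apply, psi_one, psi_one] at h
  simp only [map_sub, map_mul, eval_shift, eval_X, eval_polyEll, elim_add_basisVec,
    elim_add_meanVec, xPol, Polynomial.eval_X, Polynomial.eval_C,
    Option.elim_some] at h
  exact h.symm

/-- The `ℓ`-derivative of the formal coefficients. -/
lemma eval_ellDeriv_formalCoeff (hm : m ≠ 0) (hζ : IsPrimitiveRoot ζ m) (hlam : lam ≠ 0) (k : ℕ)
    (ell : ℂ) (a : Fin m → ℂ) :
    eval (fun o : Option (Fin m) => o.elim ell a)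
      (ellDeriv m (formalCoeff (eqParam m ζ lam) (invHess m ζ lam) k)) =
    (traceTerm (invHess m ζ lam)).eval ell * fval m ζ lam k ell a -
      (∑ i, fval m ζ lam (k + 1) ell (a + Pi.single i 1) -
        m * fval m ζ lam (k + 1) ell (a + fun _ => 1 / (m : ℂ))) := by
  rw [ellDeriv_formalCoeff hm (isInvHessian_invHess hm hζ hlam)]
  simp only [map_sub, map_mul, map_sum, eval_shift, eval_polyEll, elim_add_basisVec,
    elim_add_meanVec, smul_eq_C_mul, eval_C]
  rfl

/-- The point `(κ / m, …, κ / m)`. -/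
def linePt (m : ℕ) (κ : ℂ) : Fin m → ℂ := fun _ => κ / m

lemma linePt_add (κ : ℂ) : (linePt m κ + fun _ => 1 / (m : ℂ)) = linePt m (κ + 1) := by
  ext i; simp [linePt, add_div]

/-- The formal coefficients on the line `(κ / m, …, κ / m)`, as polynomials in `ℓ`. -/
def linePoly (m : ℕ) (ζ lam : ℂ) (k : ℕ) (κ : ℂ) : Polynomial ℂ :=
  aeval (fun o : Option (Fin m) => o.elim Polynomial.X fun _ => Polynomial.C (κ / m))
    (formalCoeff (eqParam m ζ lam) (invHess m ζ lam) k)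

lemma eval_aeval_elim (p : Pol m) (ell κ : ℂ) :
    (aeval (fun o : Option (Fin m) => o.elim Polynomial.X fun _ => Polynomial.C (κ / m)) p).eval ell =
      eval (fun o : Option (Fin m) => o.elim ell (linePt m κ)) p := by
  induction p using MvPolynomial.induction_on with
  | C c => simp
  | add p q hp hq => simp [hp, hq]
  | mul_X p o hp => cases o <;> simp [hp, linePt]

lemma eval_linePoly (k : ℕ) (κ ell : ℂ) :
    (linePoly m ζ lam k κ).eval ell = fval m ζ lam k ell (linePt m κ) :=
  eval_aeval_elim _ _ _

lemma derivative_linePoly (k : ℕ) (κ : ℂ) : Polynomial.derivative (linePoly m ζ lam k κ) =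
    aeval (fun o : Option (Fin m) => o.elim Polynomial.X fun _ => Polynomial.C (κ / m))
      (ellDeriv m (formalCoeff (eqParam m ζ lam) (invHess m ζ lam) k)) := by
  rw [linePoly]
  generalize formalCoeff (eqParam m ζ lam) (invHess m ζ lam) k = p
  induction p using MvPolynomial.induction_on with
  | C c => simp [ellDeriv]
  | add p q hp hq => simp [hp, hq]
  | mul_X p o hp =>
    cases o <;> simp [hp, ellDeriv, mul_comm]

/-- The coefficients `j_n (κ) = (m ℓ) ^ n F_n (κ / m, …, κ / m)`. -/
def jval (m : ℕ) (ζ lam ell : ℂ) (n : ℕ) (κ : ℂ) : ℂ :=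
  (m * ell) ^ n * fval m ζ lam n ell (linePt m κ)

lemma jval_zero (ell κ : ℂ) : jval m ζ lam ell 0 κ = 1 := by simp [jval, fval_zero]

/-- At fixed `ℓ` the coefficients are polynomials in `κ`. -/
lemma exists_poly_jval (ell : ℂ) (n : ℕ) :
    ∃ p : Polynomial ℂ, ∀ κ, jval m ζ lam ell n κ = p.eval κ := by
  refine ⟨Polynomial.C ((m * ell) ^ n) * aeval (fun o : Option (Fin m) => o.elim (Polynomial.C ell) fun _ =>
    Polynomial.C (1 / (m : ℂ)) * Polynomial.X)
    (formalCoeff (eqParam m ζ lam) (invHess m ζ lam) n), fun κ => ?_⟩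
  rw [jval, Polynomial.eval_mul, Polynomial.eval_C, fval]
  congr 1
  generalize formalCoeff (eqParam m ζ lam) (invHess m ζ lam) n = p
  induction p using MvPolynomial.induction_on with
  | C c => simp
  | add p q hp hq => simp [hp, hq]
  | mul_X p o hp => cases o <;> simp [hp, linePt, div_eq_inv_mul]

/-- The operator `T + w κ` on series in `w` whose coefficients are functions of `κ`, where `T`
is the shift `κ ↦ κ + 1`. -/
def shiftMul : Module.End ℂ (ℕ → ℂ → ℂ) where
  toFun g n κ := match n with
    | 0 => g 0 (κ + 1)
    | n + 1 => g (n + 1) (κ + 1) + κ * g n κ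
  map_add' g h := by
    ext n κ; cases n <;> simp; ring
  map_smul' c g := by
    ext n κ; cases n <;> simp; ring

lemma shiftMul_zero (g : ℕ → ℂ → ℂ) (κ : ℂ) : shiftMul g 0 κ = g 0 (κ + 1) := rfl

lemma shiftMul_succ (g : ℕ → ℂ → ℂ) (n : ℕ) (κ : ℂ) :
    shiftMul g (n + 1) κ = g (n + 1) (κ + 1) + κ * g n κ := rfl

/-- The coefficients in the normal ordering
`(T + w κ) ^ r = ∑ s, orderCoeff r s κ * w ^ s * T ^ (r - s)`. -/
def orderCoeff : ℕ → ℕ → ℂ → ℂ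
  | 0, 0, _ => 1
  | 0, _ + 1, _ => 0
  | _ + 1, 0, _ => 1
  | r + 1, s + 1, κ => orderCoeff r (s + 1) κ + (κ + r - s) * orderCoeff r s κ

lemma orderCoeff_zero_right (r : ℕ) (κ : ℂ) : orderCoeff r 0 κ = 1 := by
  cases r <;> rfl

lemma orderCoeff_succ (r s : ℕ) (κ : ℂ) : orderCoeff (r + 1) (s + 1) κ =
    orderCoeff r (s + 1) κ + (κ + r - s) * orderCoeff r s κ := rfl

lemma shiftMul_pow (r : ℕ) (g : ℕ → ℂ → ℂ) (n : ℕ) (κ : ℂ) : (shiftMul ^ r) g n κ =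
    ∑ s ∈ Finset.range (n + 1), orderCoeff r s κ * g (n - s) (κ + r - s) := by
  induction r generalizing g with
  | zero =>
    rw [Finset.sum_range_succ']
    simp [orderCoeff]
  | succ r ih =>
    rw [pow_succ, Module.End.mul_apply, ih]
    have h1 : ∀ s ∈ Finset.range n, orderCoeff r s κ * shiftMul g (n - s) (κ + r - s) =
        orderCoeff r s κ * g (n - s) (κ + (r + 1 : ℕ) - s) +
          (κ + r - s) * orderCoeff r s κ * g (n - (s + 1)) (κ + (r + 1 : ℕ) - (s + 1 : ℕ)) := by
      intro s hs
      obtain ⟨d, hd⟩ : ∃ d, n - s = d + 1 := ⟨n - s - 1, by have := Finset.mem_range.1 hs; omega⟩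
      rw [hd, shiftMul_succ, show n - (s + 1) = d by omega]
      push_cast
      rw [show κ + r - s + 1 = κ + (r + 1) - s by ring,
        show κ + ((r : ℂ) + 1) - (s + 1) = κ + r - s by ring]
      ring
    have h2 : orderCoeff r n κ * shiftMul g (n - n) (κ + r - n) =
        orderCoeff r n κ * g (n - n) (κ + (r + 1 : ℕ) - n) := by
      rw [Nat.sub_self, shiftMul_zero]
      push_cast
      rw [show κ + r - n + 1 = κ + (r + 1) - n by ring]
    rw [Finset.sum_range_succ, Finset.sum_congr rfl h1, h2, Finset.sum_add_distrib, add_right_comm,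
      ← Finset.sum_range_succ (fun s => orderCoeff r s κ * g (n - s) (κ + (r + 1 : ℕ) - s)),
      Finset.sum_range_succ', Finset.sum_range_succ' _ n, add_right_comm,
      ← Finset.sum_add_distrib]
    congr 1
    · refine Finset.sum_congr rfl fun s _ => ?_
      rw [orderCoeff_succ]; ring
    · simp [orderCoeff_zero_right]

/-- The formal coefficients at `(κ / m, …, κ / m) + ∑_{i ∈ S} e_i`. -/
def jset (m : ℕ) (ζ lam ell : ℂ) (S : Finset (Fin m)) (n : ℕ) (κ : ℂ) : ℂ :=
  (m * ell) ^ n * fval m ζ lam n ell (linePt m κ + fun i => if i ∈ S then 1 else 0)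

lemma jset_empty (ell : ℂ) : jset m ζ lam ell ∅ = jval m ζ lam ell := by
  ext n κ
  simp only [jset, jval, Finset.notMem_empty, if_false]
  congr 2
  ext; simp

lemma jset_univ (hm : m ≠ 0) (ell : ℂ) (n : ℕ) (κ : ℂ) :
    jset m ζ lam ell Finset.univ n κ = jval m ζ lam ell n (κ + m) := by
  have : (m : ℂ) ≠ 0 := by exact_mod_cast hm
  simp only [jset, jval, Finset.mem_univ, if_true]
  congr 2
  ext
  simp [linePt, add_div, this]

lemma mul_jset_insert (hm : m ≠ 0) (hζ : IsPrimitiveRoot ζ m) (hlam : lam ≠ 0) (ell : ℂ)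
    {S : Finset (Fin m)} {i : Fin m} (hi : i ∉ S) :
    (ell - eqParam m ζ lam i) • jset m ζ lam ell (insert i S) =
      (ell • shiftMul - algebraMap ℂ (Module.End ℂ (ℕ → ℂ → ℂ)) (eqParam m ζ lam i))
        (jset m ζ lam ell S) := by
  have hpt : ∀ κ, (linePt m κ + fun j => if j ∈ insert i S then (1 : ℂ) else 0) =
      (linePt m κ + fun j => if j ∈ S then (1 : ℂ) else 0) + Pi.single i 1 := by
    intro κ
    ext j
    by_cases hj : j = i
    · subst hj; simp [hi]
    · simp [hj]
  have hpt2 : ∀ κ, ((linePt m κ + fun j => if j ∈ S then (1 : ℂ) else 0) +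
      fun _ => 1 / (m : ℂ)) = linePt m (κ + 1) + fun j => if j ∈ S then (1 : ℂ) else 0 := by
    intro κ
    rw [← linePt_add, add_right_comm]
  ext n κ
  simp only [LinearMap.sub_apply, LinearMap.smul_apply, Pi.sub_apply, Pi.smul_apply, smul_eq_mul,
    Module.algebraMap_end_apply]
  cases n with
  | zero => simp [shiftMul_zero, jset, fval_zero]
  | succ n =>
    have h := fval_ibp hm hζ hlam n ell (linePt m κ + fun j => if j ∈ S then (1 : ℂ) else 0) i
    rw [← hpt, hpt2] at h
    rw [shiftMul_succ]
    simp only [jset]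
    have hm' : (m : ℂ) ≠ 0 := by exact_mod_cast hm
    have h3 : (linePt m κ + fun j => if j ∈ S then (1 : ℂ) else 0) i = κ / m := by
      simp [linePt, hi]
    rw [h3] at h
    have h4 : κ * fval m ζ lam n ell (linePt m κ + fun j => if j ∈ S then (1 : ℂ) else 0) =
        m * (κ / m * fval m ζ lam n ell
          (linePt m κ + fun j => if j ∈ S then (1 : ℂ) else 0)) := by
      field_simp
    rw [h] at h4
    linear_combination (-ell * (m * ell) ^ n) * h4

lemma prod_smul_jset (hm : m ≠ 0) (hζ : IsPrimitiveRoot ζ m) (hlam : lam ≠ 0) (ell : ℂ)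
    (S : Finset (Fin m)) :
    (∏ i ∈ S, (ell - eqParam m ζ lam i)) • jset m ζ lam ell S =
      Polynomial.aeval (ell • shiftMul : Module.End ℂ (ℕ → ℂ → ℂ))
        (∏ i ∈ S, xPol (eqParam m ζ lam) i) (jval m ζ lam ell) := by
  induction S using Finset.induction_on with
  | empty => simp [jset_empty]
  | insert i S hi ih =>
    rw [Finset.prod_insert hi, Finset.prod_insert hi, map_mul, Module.End.mul_apply, ← ih,
      mul_comm, mul_smul, mul_jset_insert hm hζ hlam ell hi, map_smul]
    simp [xPol]

/-- The recurrence of order `m` in `κ`. -/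
lemma jval_recurrence (hm : m ≠ 0) (hζ : IsPrimitiveRoot ζ m) (hlam : lam ≠ 0) (ell : ℂ) (n : ℕ)
    (κ : ℂ) :
    jval m ζ lam ell n (κ + m) - jval m ζ lam ell n κ =
      -(ell ^ m / lam ^ m) * ∑ s ∈ Finset.range n, orderCoeff m (s + 1) κ *
        jval m ζ lam ell (n - (s + 1)) (κ + m - (s + 1)) := by
  have h := congrFun (congrFun (prod_smul_jset hm hζ hlam ell Finset.univ) n) κ
  rw [prod_sub_eqParam hm hζ, prod_eval_sub_eqParam hm hζ] at h
  simp only [Pi.smul_apply, jset_univ hm, smul_eq_mul, map_sub, map_pow, Polynomial.aeval_X,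
    Polynomial.aeval_C, smul_pow, LinearMap.sub_apply, LinearMap.smul_apply, Pi.sub_apply,
    shiftMul_pow] at h
  rw [← map_pow, Module.algebraMap_end_apply, Pi.smul_apply, Pi.smul_apply, smul_eq_mul,
    Finset.sum_range_succ'] at h
  simp only [orderCoeff_zero_right, Nat.sub_zero, Nat.cast_zero, sub_zero, one_mul] at h
  have hl : lam ^ m ≠ 0 := pow_ne_zero _ hlam
  field_simp
  push_cast at h
  linear_combination (-1 : ℂ) * h

end Line

/-! ### A difference equation and Bernoulli numbers -/

noncomputable section Difference

open Polynomial

/-- A polynomial with a nonzero period is constant. -/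
lemma eval_eq_of_periodic {p : ℂ[X]} {s : ℂ} (hs : s ≠ 0) (h : ∀ x, p.eval (x + s) = p.eval x)
    (x y : ℂ) : p.eval x = p.eval y := by
  have h2 : ∀ n : ℕ, p.eval (n * s) = p.eval 0 := by
    intro n
    induction n with
    | zero => simp
    | succ n ih => rw [← ih, ← h (n * s)]; push_cast; ring_nf
  have h3 : p = C (p.eval 0) := by
    refine eq_of_infinite_eval_eq _ _ (Set.Infinite.mono (s := Set.range fun n : ℕ => (n : ℂ) * s)
      ?_ (Set.infinite_range_of_injective fun a b hab => ?_))
    · rintro _ ⟨n, rfl⟩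
      simp [h2]
    · exact_mod_cast mul_right_cancel₀ hs hab
  rw [h3]; simp

/-- A power series is determined by its logarithmic derivative and its constant term. -/
lemma eq_of_X_mul_derivative {A F K : PowerSeries ℂ} (hA : PowerSeries.constantCoeff A = 0)
    (hF : PowerSeries.X * PowerSeries.derivative ℂ F = A * F)
    (hK : PowerSeries.X * PowerSeries.derivative ℂ K = A * K)
    (h0 : PowerSeries.constantCoeff F = PowerSeries.constantCoeff K) : F = K := by
  ext n
  induction n using Nat.strong_induction_on with
  | _ n ih =>
    cases n with
    | zero => simpa using h0
    | succ n =>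
      have h1 := congrArg (PowerSeries.coeff (n + 1)) hF
      have h2 := congrArg (PowerSeries.coeff (n + 1)) hK
      rw [PowerSeries.coeff_succ_X_mul, PowerSeries.coeff_derivative, PowerSeries.coeff_mul,
        Finset.Nat.sum_antidiagonal_succ, PowerSeries.coeff_zero_eq_constantCoeff, hA, zero_mul,
        zero_add] at h1 h2
      have h3 : ∀ p ∈ Finset.HasAntidiagonal.antidiagonal n,
          PowerSeries.coeff (p.1 + 1) A * PowerSeries.coeff p.2 F =
          PowerSeries.coeff (p.1 + 1) A * PowerSeries.coeff p.2 K := by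
        intro p hp
        rw [ih p.2 (by have := Finset.HasAntidiagonal.mem_antidiagonal.1 hp; omega)]
      rw [Finset.sum_congr rfl h3, ← h2] at h1
      exact mul_right_cancel₀ (by exact_mod_cast Nat.succ_ne_zero n) h1

/-- The coefficients of the logarithmic derivative, in `w`, of the polynomial-coefficient
solution of `G (t + 1) = (1 + c w t) G (t)`. -/
def bernStep (c : ℂ) : ℕ → ℂ[X]
  | 0 => 0
  | s + 1 => C ((-1) ^ s * c ^ (s + 1) / (s + 2)) *
      ((Polynomial.bernoulli (s + 2)).map (algebraMap ℚ ℂ) - C (bernoulli (s + 2) : ℂ))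

lemma eval_add_one_bernoulli (n : ℕ) (x : ℂ) :
    ((Polynomial.bernoulli n).map (algebraMap ℚ ℂ)).eval (x + 1) =
      ((Polynomial.bernoulli n).map (algebraMap ℚ ℂ)).eval x + n * x ^ (n - 1) := by
  have h : (Polynomial.bernoulli n).comp (1 + X) =
      Polynomial.bernoulli n + (n : ℚ[X]) * X ^ (n - 1) := by
    refine Polynomial.funext fun y => ?_
    simp [Polynomial.bernoulli_eval_one_add]
  have h2 := congrArg (fun p => (p.map (algebraMap ℚ ℂ)).eval x) h
  simpa [Polynomial.map_comp, add_comm] using h2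

lemma eval_zero_bernoulli_map (n : ℕ) :
    ((Polynomial.bernoulli n).map (algebraMap ℚ ℂ)).eval 0 = (bernoulli n : ℂ) := by
  rw [← map_zero (algebraMap ℚ ℂ), Polynomial.eval_map_apply, Polynomial.bernoulli_eval_zero]
  rfl

lemma bernStep_eval_zero (c : ℂ) (n : ℕ) : (bernStep c n).eval 0 = 0 := by
  cases n with
  | zero => simp [bernStep]
  | succ s => simp only [bernStep, eval_mul, eval_sub, eval_C, eval_zero_bernoulli_map, sub_self,
      mul_zero]

lemma bernStep_derivative_eval_zero (c : ℂ) (s : ℕ) :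
    (derivative (bernStep c (s + 1))).eval 0 =
      (-1) ^ s * c ^ (s + 1) * (bernoulli (s + 1) : ℂ) := by
  have : ((s : ℂ) + 2) ≠ 0 := by exact_mod_cast Nat.succ_ne_zero (s + 1)
  simp only [bernStep, derivative_mul, derivative_sub, derivative_C, zero_mul, zero_add, sub_zero,
    Polynomial.derivative_map, Polynomial.derivative_bernoulli, Polynomial.map_mul,
    Polynomial.map_natCast, eval_mul, eval_C, eval_natCast, eval_zero_bernoulli_map]
  rw [show s + 2 - 1 = s + 1 by omega]
  push_cast
  field_simp

lemma bernStep_eval_add_one (c : ℂ) (s : ℕ) (t : ℂ) :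
    (bernStep c (s + 1)).eval (t + 1) =
      (bernStep c (s + 1)).eval t + (-1) ^ s * (c * t) ^ (s + 1) := by
  have : ((s : ℂ) + 2) ≠ 0 := by exact_mod_cast Nat.succ_ne_zero (s + 1)
  simp only [bernStep, eval_mul, eval_sub, eval_C, eval_add_one_bernoulli]
  rw [show s + 2 - 1 = s + 1 by omega]
  push_cast
  field_simp
  ring

/-- The solution of `G (t + 1) = (1 + c w t) G (t)`, `G (0) = 1`, as a series in `w` with
coefficients polynomial in `t`. -/
def bernSol (c : ℂ) : ℕ → ℂ[X]
  | 0 => 1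
  | n + 1 => C (1 / ((n : ℂ) + 1)) * ∑ s : Fin (n + 1), bernStep c (s + 1) * bernSol c (n - s)

lemma bernSol_zero (c : ℂ) : bernSol c 0 = 1 := by rw [bernSol]

lemma bernSol_succ (c : ℂ) (n : ℕ) : C ((n : ℂ) + 1) * bernSol c (n + 1) =
    ∑ s ∈ Finset.range (n + 1), bernStep c (s + 1) * bernSol c (n - s) := by
  have h : ((n : ℂ) + 1) ≠ 0 := by exact_mod_cast Nat.succ_ne_zero n
  rw [bernSol, ← mul_assoc, ← C_mul, mul_one_div_cancel h, C_1, one_mul, Finset.sum_range]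

lemma bernSol_eval_zero (c : ℂ) (n : ℕ) : (bernSol c n).eval 0 = if n = 0 then 1 else 0 := by
  cases n with
  | zero => simp [bernSol]
  | succ n => simp [bernSol, eval_finsetSum, bernStep_eval_zero]

lemma bernSol_derivative_eval_zero (c : ℂ) (n : ℕ) :
    (derivative (bernSol c (n + 1))).eval 0 =
      (-1) ^ n * c ^ (n + 1) * (bernoulli (n + 1) : ℂ) / (n + 1) := by
  have h : ((n : ℂ) + 1) ≠ 0 := by exact_mod_cast Nat.succ_ne_zero n
  have h1 := congrArg (fun p => (derivative p).eval 0) (bernSol_succ c n)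
  simp only [derivative_C, zero_mul, zero_add, eval_mul, eval_C, derivative_sum, derivative_mul, eval_finsetSum,
    eval_add, bernStep_eval_zero, zero_mul, add_zero, bernSol_eval_zero,
    bernStep_derivative_eval_zero] at h1
  rw [Finset.sum_eq_single_of_mem n (by simp)] at h1
  · rw [eq_div_iff h, mul_comm, h1]; simp
  · intro s hs hne
    rw [if_neg (by have := Finset.mem_range.1 hs; omega), mul_zero]

lemma bernSol_eval_add_one (c : ℂ) (n : ℕ) (t : ℂ) :
    (bernSol c (n + 1)).eval (t + 1) =
      (bernSol c (n + 1)).eval t + c * t * (bernSol c n).eval t := by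
  set A : ℂ → PowerSeries ℂ := fun t => PowerSeries.mk fun n => (bernStep c n).eval t with hA
  set K : ℂ → PowerSeries ℂ := fun t => PowerSeries.mk fun n => (bernSol c n).eval t with hK
  have hode : ∀ t, PowerSeries.X * PowerSeries.derivative ℂ (K t) = A t * K t := by
    intro t
    ext n
    cases n with
    | zero => simp [hA, hK, bernStep]
    | succ n =>
      rw [PowerSeries.coeff_succ_X_mul, PowerSeries.coeff_derivative, PowerSeries.coeff_mul,
        Finset.Nat.sum_antidiagonal_succ, hA, hK]
      simp only [PowerSeries.coeff_mk]
      have := congrArg (eval t) (bernSol_succ c n)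
      rw [eval_mul, eval_C, eval_finsetSum] at this
      rw [mul_comm, this, Finset.Nat.sum_antidiagonal_eq_sum_range_succ_mk]
      simp [bernStep]
  set E : PowerSeries ℂ := PowerSeries.mk fun n => if n = 0 then 0 else -(-(c * t)) ^ n with hE
  have hE1 : E * (1 + PowerSeries.C (c * t) * PowerSeries.X) =
      PowerSeries.C (c * t) * PowerSeries.X := by
    ext n
    cases n with
    | zero => simp [hE]
    | succ n =>
      rw [mul_add, mul_one, mul_left_comm, map_add, PowerSeries.coeff_C_mul,
        PowerSeries.coeff_succ_mul_X, PowerSeries.coeff_C_mul, PowerSeries.coeff_X, hE]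
      simp only [PowerSeries.coeff_mk]
      cases n with
      | zero => simp
      | succ n => simp; ring
  have hE2 : A (t + 1) = A t + E := by
    ext n
    cases n with
    | zero => simp [hA, hE, bernStep]
    | succ n =>
      simp only [hA, hE, map_add, PowerSeries.coeff_mk, bernStep_eval_add_one,
        if_neg (Nat.succ_ne_zero n)]
      rw [neg_pow (c * t)]; ring
  have hc : ∀ t, PowerSeries.constantCoeff (A t) = 0 := by
    intro t
    rw [← PowerSeries.coeff_zero_eq_constantCoeff_apply]
    simp [hA, bernStep]
  have key : K (t + 1) = (1 + PowerSeries.C (c * t) * PowerSeries.X) * K t := by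
    refine eq_of_X_mul_derivative (hc (t + 1)) (hode _) ?_ ?_
    · have hd : PowerSeries.derivative ℂ ((1 + PowerSeries.C (c * t) * PowerSeries.X) * K t) =
          PowerSeries.C (c * t) * K t + (1 + PowerSeries.C (c * t) * PowerSeries.X) *
            PowerSeries.derivative ℂ (K t) := by
        have hCX : PowerSeries.derivative ℂ (PowerSeries.C (c * t) * PowerSeries.X) =
            PowerSeries.C (c * t) := by
          rw [Derivation.leibniz, PowerSeries.derivative_X, PowerSeries.derivative_C]; simp
        rw [Derivation.leibniz, map_add, hCX]
        simp [mul_comm]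
        ring
      rw [hd, hE2]
      linear_combination (1 + PowerSeries.C (c * t) * PowerSeries.X) * hode t - (K t) * hE1
    · simp only [map_mul, map_add, map_one, PowerSeries.constantCoeff_X, mul_zero, add_zero,
        one_mul]
      rw [← PowerSeries.coeff_zero_eq_constantCoeff_apply,
        ← PowerSeries.coeff_zero_eq_constantCoeff_apply]
      simp [hK, bernSol]
  have := congrArg (PowerSeries.coeff (n + 1)) key
  rw [add_mul, one_mul, map_add, mul_assoc, PowerSeries.coeff_C_mul,
    PowerSeries.coeff_succ_X_mul] at this
  simpa [hK] using this

/-- Polynomials with `g_{k+1} (t + 1) - g_{k+1} (t) = c t g_k (t)` have derivatives at zero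
given by Bernoulli numbers, as in the logarithm of Stirling's series. -/
lemma derivative_eval_zero_of_step {g : ℕ → ℂ[X]} {c : ℂ} (h0 : g 0 = 1)
    (h : ∀ k t, (g (k + 1)).eval (t + 1) - (g (k + 1)).eval t = c * t * (g k).eval t) (n : ℕ) :
    (derivative (g (n + 1))).eval 0 = ∑ r ∈ Finset.range (n + 1),
      (-1) ^ r * c ^ (r + 1) * (bernoulli (r + 1) : ℂ) / (r + 1) * (g (n - r)).eval 0 := by
  have key : ∀ n, g n = ∑ r ∈ Finset.range (n + 1), bernSol c r * C ((g (n - r)).eval 0) := by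
    intro n
    induction n with
    | zero => simp [bernSol, h0]
    | succ n ih =>
      rw [← sub_eq_zero]
      set p := g (n + 1) - ∑ r ∈ Finset.range (n + 1 + 1),
        bernSol c r * C ((g (n + 1 - r)).eval 0) with hp
      have hper : ∀ x, p.eval (x + 1) = p.eval x := by
        intro x
        have h1 := h n x
        have h2 := congrArg (eval x) ih
        simp only [eval_finsetSum, eval_mul, eval_C] at h2
        simp only [hp, eval_sub, eval_finsetSum, eval_mul, eval_C]
        rw [Finset.sum_range_succ', Finset.sum_range_succ' (fun r => eval x (bernSol c r) * _)]
        have h3 : ∀ r ∈ Finset.range (n + 1), eval (x + 1) (bernSol c (r + 1)) *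
            eval 0 (g (n + 1 - (r + 1))) =
            eval x (bernSol c (r + 1)) * eval 0 (g (n + 1 - (r + 1))) +
            c * x * (eval x (bernSol c r) * eval 0 (g (n - r))) := by
          intro r _
          rw [bernSol_eval_add_one, Nat.add_sub_add_right]; ring
        rw [Finset.sum_congr rfl h3, Finset.sum_add_distrib, ← Finset.mul_sum, ← h2]
        simp only [bernSol, eval_one]
        linear_combination h1
      refine Polynomial.funext fun x => ?_
      rw [eval_eq_of_periodic one_ne_zero hper x 0, hp]
      simp only [eval_sub, eval_finsetSum, eval_mul, eval_C, bernSol_eval_zero, eval_zero]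
      simp
  rw [key (n + 1), Finset.sum_range_succ']
  simp only [derivative_add, derivative_sum, derivative_mul, derivative_C, mul_zero, add_zero,
    eval_finsetSum, eval_mul, eval_C, bernSol_derivative_eval_zero, bernSol_zero,
    derivative_one, zero_mul, Nat.add_sub_add_right]

end Difference

/-! ### The flow in `ℓ` -/

noncomputable section Flow

open MvPolynomial

variable {m : ℕ} {ζ lam : ℂ}

lemma linePt_zero : linePt m 0 = 0 := by ext; simp [linePt]

/-- Summing the first-order relations over all directions. -/
lemma sum_fval_single (hm : m ≠ 0) (hζ : IsPrimitiveRoot ζ m) (hlam : lam ≠ 0) (k : ℕ)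
    (ell κ : ℂ) :
    (ell ^ m - lam ^ m) * ∑ i, (fval m ζ lam (k + 1) ell (linePt m κ + Pi.single i 1) -
        fval m ζ lam (k + 1) ell (linePt m κ)) =
      m * ell ^ (m - 1) * (κ / m * fval m ζ lam k ell (linePt m κ) +
        ell * (fval m ζ lam (k + 1) ell (linePt m (κ + 1)) -
          fval m ζ lam (k + 1) ell (linePt m κ))) := by
  rw [Finset.mul_sum, ← prod_eval_sub_eqParam hm hζ, ← sum_prod_erase_eqParam hm hζ lam,
    Finset.sum_mul]
  refine Finset.sum_congr rfl fun i _ => ?_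
  have h := fval_ibp hm hζ hlam k ell (linePt m κ) i
  rw [linePt_add, show linePt m κ i = κ / m from rfl] at h
  rw [h, ← Finset.mul_prod_erase _ _ (Finset.mem_univ i)]
  ring

/-- The flow in `ℓ`, up to the trace term. -/
lemma derivative_linePoly_aux (hm : m ≠ 0) (hζ : IsPrimitiveRoot ζ m) (hlam : lam ≠ 0) (k : ℕ)
    (ell κ : ℂ) :
    (ell ^ m - lam ^ m) * ((Polynomial.derivative (linePoly m ζ lam k κ)).eval ell -
        (traceTerm (invHess m ζ lam)).eval ell * fval m ζ lam k ell (linePt m κ)) =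
      -(m * lam ^ m * (fval m ζ lam (k + 1) ell (linePt m (κ + 1)) -
          fval m ζ lam (k + 1) ell (linePt m κ)) +
        κ * ell ^ (m - 1) * fval m ζ lam k ell (linePt m κ)) := by
  rw [derivative_linePoly, eval_aeval_elim, eval_ellDeriv_formalCoeff hm hζ hlam, linePt_add]
  have h := sum_fval_single hm hζ hlam k ell κ
  rw [Finset.sum_sub_distrib, Finset.sum_const, Finset.card_univ, Fintype.card_fin,
    nsmul_eq_mul] at h
  have hm' : (m : ℂ) ≠ 0 := by exact_mod_cast hm
  have h2 : (m : ℂ) * ell ^ (m - 1) * (κ / m * fval m ζ lam k ell (linePt m κ)) =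
      κ * ell ^ (m - 1) * fval m ζ lam k ell (linePt m κ) := by field_simp
  have h3 : ell ^ m = ell ^ (m - 1) * ell := by rw [← pow_succ, Nat.sub_add_cancel (by omega)]
  rw [mul_add, h2] at h
  rw [h3] at h ⊢
  linear_combination (-1 : ℂ) * h

lemma orderCoeff_one (r : ℕ) (κ : ℂ) : orderCoeff r 1 κ = r * κ + r * (r - 1) / 2 := by
  induction r with
  | zero => simp [orderCoeff]
  | succ r ih =>
    rw [orderCoeff_succ, ih, orderCoeff_zero_right]
    push_cast
    ring

lemma jval_one_one (hm : m ≠ 0) (hζ : IsPrimitiveRoot ζ m) (hlam : lam ≠ 0) (ell : ℂ) :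
    jval m ζ lam ell 1 1 = jval m ζ lam ell 1 0 := by
  obtain ⟨p, hp⟩ := exists_poly_jval (m := m) (ζ := ζ) (lam := lam) ell 1
  have h := eval_eq_of_periodic (s := m) (p := p + Polynomial.C (ell ^ m / lam ^ m / 2) *
    (Polynomial.X ^ 2 - Polynomial.X)) (by exact_mod_cast hm) (fun κ => by
      have := jval_recurrence hm hζ hlam ell 1 κ
      rw [hp, hp, Finset.sum_range_one, orderCoeff_one, Nat.sub_self, jval_zero] at this
      simp only [Polynomial.eval_add, Polynomial.eval_mul, Polynomial.eval_sub,
        Polynomial.eval_C, Polynomial.eval_pow, Polynomial.eval_X]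
      linear_combination this) 1 0
  simpa [hp] using h

lemma infinite_pow_ne (hm : m ≠ 0) (c : ℂ) : {ell : ℂ | ell ≠ 0 ∧ ell ^ m ≠ c}.Infinite := by
  have h : ({ell : ℂ | ell = 0} ∪ {ell : ℂ | ell ^ m = c}).Finite := by
    refine Set.Finite.union (by simp) ?_
    have hne : (Polynomial.X ^ m - Polynomial.C c : Polynomial ℂ) ≠ 0 :=
      Polynomial.X_pow_sub_C_ne_zero (Nat.pos_of_ne_zero hm) c
    refine (Polynomial.X ^ m - Polynomial.C c : Polynomial ℂ).roots.toFinset.finite_toSet.subset ?_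
    intro x hx
    simp only [Finset.mem_coe, Multiset.mem_toFinset, Polynomial.mem_roots hne,
      Polynomial.IsRoot.def, Polynomial.eval_sub, Polynomial.eval_pow, Polynomial.eval_X,
      Polynomial.eval_C]
    exact sub_eq_zero.2 hx
  refine h.infinite_compl.mono fun x hx => ?_
  exact ⟨fun h0 => hx (Or.inl h0), fun h1 => hx (Or.inr h1)⟩

/-- The determinant of the Hessian is constant in `ℓ`, so that the trace term vanishes. -/
lemma traceTerm_invHess (hm : m ≠ 0) (hζ : IsPrimitiveRoot ζ m) (hlam : lam ≠ 0) :
    traceTerm (invHess m ζ lam) = 0 := by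
  refine Polynomial.eq_of_infinite_eval_eq _ _ ((infinite_pow_ne hm (lam ^ m)).mono ?_)
  rintro ell ⟨h0, h1⟩
  rw [Set.mem_ofPred_eq, Polynomial.eval_zero]
  have h := derivative_linePoly_aux hm hζ hlam 0 ell 0
  have h2 : linePoly m ζ lam 0 0 = 1 := by simp [linePoly, formalCoeff_zero]
  have h3 := jval_one_one hm hζ hlam ell
  have h4 : fval m ζ lam 1 ell (linePt m 1) = fval m ζ lam 1 ell (linePt m 0) := by
    have hm' : (m : ℂ) ≠ 0 := by exact_mod_cast hm
    simp only [jval] at h3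
    exact mul_left_cancel₀ (pow_ne_zero _ (mul_ne_zero hm' h0)) h3
  simp only [h2, fval_zero, zero_add, h4] at h
  simp only [Polynomial.derivative_one, Polynomial.eval_zero, mul_one, sub_self, mul_zero,
    zero_mul, add_zero, neg_zero, zero_sub, mul_eq_zero, neg_eq_zero] at h
  exact h.resolve_left (sub_ne_zero.2 h1)

/-- The flow in `ℓ`. -/
lemma derivative_linePoly_eval (hm : m ≠ 0) (hζ : IsPrimitiveRoot ζ m) (hlam : lam ≠ 0) (k : ℕ)
    (ell κ : ℂ) :
    (ell ^ m - lam ^ m) * (Polynomial.derivative (linePoly m ζ lam k κ)).eval ell =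
      -(m * lam ^ m * (fval m ζ lam (k + 1) ell (linePt m (κ + 1)) -
          fval m ζ lam (k + 1) ell (linePt m κ)) +
        κ * ell ^ (m - 1) * fval m ζ lam k ell (linePt m κ)) := by
  have h := derivative_linePoly_aux hm hζ hlam k ell κ
  rwa [traceTerm_invHess hm hζ hlam, Polynomial.eval_zero, zero_mul, sub_zero] at h

end Flow

/-! ### The values at `ℓ = λ_α` -/

noncomputable section Root

open MvPolynomial

variable {m : ℕ} {ζ lam : ℂ}

/-- The restriction of a polynomial to the line through `(ℓ, 0)` in the direction `v`. -/
def restrictLine (ell : ℂ) (v : Fin m → ℂ) : Pol m →ₐ[ℂ] Polynomial ℂ :=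
  aeval fun o : Option (Fin m) => o.elim (Polynomial.C ell) fun i => Polynomial.C (v i) * Polynomial.X

lemma eval_restrictLine (ell : ℂ) (v : Fin m → ℂ) (p : Pol m) (t : ℂ) :
    (restrictLine ell v p).eval t = eval (fun o : Option (Fin m) => o.elim ell (t • v)) p := by
  induction p using MvPolynomial.induction_on with
  | C c => simp [restrictLine]
  | add p q hp hq => simp [hp, hq]
  | mul_X p o hp =>
    rw [map_mul, Polynomial.eval_mul, hp, map_mul]
    cases o <;> simp [restrictLine, mul_comm t]

lemma derivative_restrictLine (ell : ℂ) (v : Fin m → ℂ) (p : Pol m) :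
    Polynomial.derivative (restrictLine ell v p) =
      restrictLine ell v (dirDeriv (fun o : Option (Fin m) => o.elim 0 v) p) := by
  induction p using MvPolynomial.induction_on with
  | C c => simp [restrictLine]
  | add p q hp hq => simp [hp, hq]
  | mul_X p o hp =>
    rw [map_mul, Polynomial.derivative_mul, hp, Derivation.leibniz, map_add, smul_eq_mul,
      smul_eq_mul, map_mul, map_mul, dirDeriv_X, mul_comm, add_comm]
    cases o <;> simp [restrictLine]

/-- The Euler relation at `a = 0`. -/
lemma fval_euler (hm : m ≠ 0) (hζ : IsPrimitiveRoot ζ m) (hlam : lam ≠ 0) (k : ℕ) (ell : ℂ) :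
    ((m : ℂ) / 2 + k) * fval m ζ lam k ell 0 =
      ∑ i, (ell - eqParam m ζ lam i) * (fval m ζ lam (k + 1) ell (Pi.single i 1) -
        fval m ζ lam (k + 1) ell 0 - (Polynomial.derivative (restrictLine ell (Pi.single i 1)
          (formalCoeff (eqParam m ζ lam) (invHess m ζ lam) (k + 1)))).eval 0) -
      m * ell * (fval m ζ lam (k + 1) ell (linePt m 1) - fval m ζ lam (k + 1) ell 0 -
        (Polynomial.derivative (restrictLine ell (linePt m 1)
          (formalCoeff (eqParam m ζ lam) (invHess m ζ lam) (k + 1)))).eval 0) := by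
  have h := congrArg (eval (fun o : Option (Fin m) => o.elim ell (0 : Fin m → ℂ)))
    (actionOp_formalCoeff hm (isInvHessian_invHess hm hζ hlam) k)
  have h1 : ∀ i : Fin m, (fun o : Option (Fin m) => o.elim 0 (Pi.single i 1)) = basisVec i := by
    intro i; ext o; cases o <;> simp [basisVec, Pi.single_apply]
  have h2 : (fun o : Option (Fin m) => o.elim 0 (linePt m 1)) = meanVec m := by
    ext o; cases o <;> simp [linePt]
  rw [actionOp_apply, smul_eval] at h
  simp only [derivative_restrictLine, eval_restrictLine, h1, h2, zero_smul]
  rw [show fval m ζ lam k ell 0 = eval (fun o : Option (Fin m) => o.elim ell (0 : Fin m → ℂ))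
    (formalCoeff (eqParam m ζ lam) (invHess m ζ lam) k) from rfl, ← h]
  simp only [map_sub, map_mul, map_sum, psi_two, eval_shift, eval_polyEll, elim_add_basisVec,
    elim_add_meanVec, xPol, Polynomial.eval_C,
    Polynomial.eval_X, zero_add, map_natCast]
  rfl

/-- The recursion for the coefficients of
`exp (∑ B_{r+1} / (r (r + 1)) * s_r * w ^ r)`, which is the asymptotic expansion of a product of
Gamma functions. -/
def IsGammaSeq (s v : ℕ → ℂ) : Prop :=
  v 0 = 1 ∧ ∀ k : ℕ, ((k : ℂ) + 1) * v (k + 1) =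
    ∑ r ∈ Finset.range (k + 1), (bernoulli (r + 2) : ℂ) / (r + 2) * s (r + 1) * v (k - r)

lemma IsGammaSeq.ext {s v v' : ℕ → ℂ} (h : IsGammaSeq s v) (h' : IsGammaSeq s v') : v = v' := by
  ext n
  induction n using Nat.strong_induction_on with
  | _ n ih =>
    cases n with
    | zero => rw [h.1, h'.1]
    | succ n =>
      refine mul_left_cancel₀ (a := (n : ℂ) + 1) (by exact_mod_cast Nat.succ_ne_zero n) ?_
      rw [h.2, h'.2]
      refine Finset.sum_congr rfl fun r _ => ?_
      rw [ih (n - r) (by omega)]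

/-- At `ℓ = λ_α` integration by parts in the direction `s_α` gives a difference equation in the
direction of the mean, and the other directions decouple from each other. -/
lemma isGammaSeq_fval (hm : m ≠ 0) (hζ : IsPrimitiveRoot ζ m) (hlam : lam ≠ 0) (α : Fin m) :
    IsGammaSeq (fun n => (∑ i ∈ Finset.univ.erase α,
        ((eqParam m ζ lam α - eqParam m ζ lam i) ^ n)⁻¹) + ((-(m * eqParam m ζ lam α)) ^ n)⁻¹)
      (fun n => fval m ζ lam n (eqParam m ζ lam α) 0) := by
  set ell := eqParam m ζ lam α with hell
  have hζ0 : ζ ≠ 0 := hζ.ne_zero hm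
  have hell0 : ell ≠ 0 := mul_ne_zero (pow_ne_zero _ hζ0) hlam
  have hm' : (m : ℂ) ≠ 0 := by exact_mod_cast hm
  have hx : ∀ i, i ≠ α → ell - eqParam m ζ lam i ≠ 0 := by
    intro i hi h
    rw [hell, eqParam, eqParam, ← sub_mul, mul_eq_zero, sub_eq_zero] at h
    have := hζ.pow_inj α.2 i.2 (h.resolve_right hlam)
    exact hi (Fin.ext this.symm)
  have hpow : ell ^ m - lam ^ m = 0 := by
    rw [← prod_eval_sub_eqParam hm hζ]
    exact Finset.prod_eq_zero (Finset.mem_univ α) (by rw [hell, sub_self])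
  set F : ℕ → Pol m := formalCoeff (eqParam m ζ lam) (invHess m ζ lam) with hF
  -- since `x_α = 0`, the relation in the direction `s_α` at `a = 0` is an invariance under the shift
  -- by the mean
  have hone : ∀ k, fval m ζ lam (k + 1) ell (linePt m 1) = fval m ζ lam (k + 1) ell 0 := by
    intro k
    have h := fval_ibp hm hζ hlam k ell 0 α
    rw [← hell, sub_self, zero_mul, zero_sub, Pi.zero_apply, zero_mul, ← linePt_zero, linePt_add,
      zero_add, eq_comm, neg_eq_zero, mul_eq_zero] at h
    rw [← linePt_zero]
    exact sub_eq_zero.1 (h.resolve_left hell0)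
  have hbase : ∀ k i, (ell - eqParam m ζ lam i) * (fval m ζ lam (k + 1) ell (Pi.single i 1) -
      fval m ζ lam (k + 1) ell 0) = 0 := by
    intro k i
    have h := fval_ibp hm hζ hlam k ell 0 i
    rw [Pi.zero_apply, zero_mul, zero_add, zero_add] at h
    have h2 : (fun _ => 1 / (m : ℂ)) = linePt m 1 := rfl
    rw [h2, hone, sub_self, mul_zero, sub_zero] at h
    exact h.symm
  -- in a direction `i ≠ α` the shift by the mean can be eliminated, which leaves a difference equation
  -- of step one with `c = x_i⁻¹`
  have hdec : ∀ i, i ≠ α → ∀ n, (ell - eqParam m ζ lam i) *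
      (Polynomial.derivative (restrictLine ell (Pi.single i 1) (F (n + 1)))).eval 0 =
      ∑ r ∈ Finset.range (n + 1), (-1) ^ r * ((ell - eqParam m ζ lam i) ^ r)⁻¹ *
        (bernoulli (r + 1) : ℂ) / (r + 1) * fval m ζ lam (n - r) ell 0 := by
    intro i hi n
    rw [derivative_eval_zero_of_step (g := fun k => restrictLine ell (Pi.single i 1) (F k))
      (c := (ell - eqParam m ζ lam i)⁻¹) (by simp [hF, formalCoeff_zero]) ?_ n, Finset.mul_sum]
    · refine Finset.sum_congr rfl fun r _ => ?_
      rw [eval_restrictLine, zero_smul]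
      change _ * (_ * fval m ζ lam (n - r) ell 0) = _
      have := hx i hi
      rw [pow_succ, inv_pow]
      field_simp
    · intro k t
      simp only [eval_restrictLine]
      have h1 := fval_ibp hm hζ hlam k ell (t • Pi.single i 1) i
      have h2 := fval_ibp hm hζ hlam k ell (t • Pi.single i 1) α
      rw [← hell, sub_self, zero_mul, zero_sub] at h2
      have h3 : (t • Pi.single i 1 : Fin m → ℂ) + Pi.single i 1 = (t + 1) • Pi.single i 1 := by
        rw [add_smul, one_smul]
      rw [h3] at h1
      simp only [Pi.smul_apply, Pi.single_eq_same, Pi.single_eq_of_ne hi.symm, smul_eq_mul,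
        mul_one, mul_zero, zero_mul] at h1 h2
      change fval m ζ lam (k + 1) ell _ - fval m ζ lam (k + 1) ell _ =
        _ * fval m ζ lam k ell _
      have := hx i hi
      field_simp
      linear_combination h2 - h1
  -- in the direction of the mean the difference equation has `c = (- m ℓ)⁻¹`
  have hmean : ∀ n, (m : ℂ) * ell *
      (Polynomial.derivative (restrictLine ell (linePt m 1) (F (n + 1)))).eval 0 =
      -∑ r ∈ Finset.range (n + 1), (-1) ^ r * ((-(m * ell)) ^ r)⁻¹ *
        (bernoulli (r + 1) : ℂ) / (r + 1) * fval m ζ lam (n - r) ell 0 := by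
    intro n
    rw [derivative_eval_zero_of_step (g := fun k => restrictLine ell (linePt m 1) (F k))
      (c := (-(m * ell))⁻¹) (by simp [hF, formalCoeff_zero]) ?_ n, Finset.mul_sum,
      ← Finset.sum_neg_distrib]
    · refine Finset.sum_congr rfl fun r _ => ?_
      rw [eval_restrictLine, zero_smul]
      change _ * (_ * fval m ζ lam (n - r) ell 0) = _
      rw [pow_succ, inv_pow]
      field_simp
    · intro k t
      simp only [eval_restrictLine]
      have h2 := fval_ibp hm hζ hlam k ell (linePt m t) α
      have h4 : ∀ t, t • linePt m 1 = linePt m t := by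
        intro t; ext; simp [linePt, div_eq_mul_inv]
      rw [← hell, sub_self, zero_mul, zero_sub, linePt_add, show linePt m t α = t / m from rfl] at h2
      rw [h4, h4]
      change fval m ζ lam (k + 1) ell _ - fval m ζ lam (k + 1) ell _ =
        _ * fval m ζ lam k ell _
      field_simp
      field_simp at h2
      linear_combination h2
  refine ⟨fval_zero _ _, fun k => ?_⟩
  have h := fval_euler hm hζ hlam (k + 1) ell
  rw [hone, sub_self, zero_sub] at h
  have hsub : ∀ i, (ell - eqParam m ζ lam i) * (fval m ζ lam (k + 1 + 1) ell (Pi.single i 1) -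
      fval m ζ lam (k + 1 + 1) ell 0 - (Polynomial.derivative (restrictLine ell (Pi.single i 1)
        (F (k + 1 + 1)))).eval 0) = -((ell - eqParam m ζ lam i) *
      (Polynomial.derivative (restrictLine ell (Pi.single i 1) (F (k + 1 + 1)))).eval 0) := by
    intro i
    linear_combination hbase (k + 1) i
  rw [← hF, Finset.sum_congr rfl fun i _ => hsub i] at h
  rw [mul_neg, hmean, Finset.sum_neg_distrib, ← Finset.add_sum_erase _ _ (Finset.mem_univ α),
    ← hell, sub_self, zero_mul, zero_add,
    Finset.sum_congr rfl fun i hi => hdec i (Finset.ne_of_mem_erase hi) (k + 1),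
    Finset.sum_comm, Finset.sum_range_succ', Finset.sum_range_succ' (fun r => (-1) ^ r *
      ((-(m * ell)) ^ r)⁻¹ * (bernoulli (r + 1) : ℂ) / (r + 1) * fval m ζ lam (k + 1 - r) ell 0)] at h
  -- the terms with `r = 0`, in which `B_1 = - 1 / 2`, cancel the term `m / 2` of the Euler relation
  have hcard : ((Finset.univ.erase α).card : ℂ) = m - 1 := by
    rw [Finset.card_erase_of_mem (Finset.mem_univ α), Finset.card_univ, Fintype.card_fin,
      Nat.cast_sub (by omega), Nat.cast_one]
  simp only [pow_zero, inv_one, one_mul, Nat.cast_zero, zero_add, bernoulli_one, Finset.sum_const,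
    nsmul_eq_mul, hcard, Nat.sub_zero] at h
  have hr : ∀ r ∈ Finset.range (k + 1), (bernoulli (r + 2) : ℂ) / (r + 2) *
      ((∑ i ∈ Finset.univ.erase α, ((ell - eqParam m ζ lam i) ^ (r + 1))⁻¹) +
        ((-(m * ell)) ^ (r + 1))⁻¹) * fval m ζ lam (k - r) ell 0 =
      -(∑ i ∈ Finset.univ.erase α, (-1) ^ (r + 1) * ((ell - eqParam m ζ lam i) ^ (r + 1))⁻¹ *
          (bernoulli (r + 1 + 1) : ℂ) / ((r + 1 : ℕ) + 1) * fval m ζ lam (k + 1 - (r + 1)) ell 0) -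
        (-1) ^ (r + 1) * ((-(m * ell)) ^ (r + 1))⁻¹ *
        (bernoulli (r + 1 + 1) : ℂ) / ((r + 1 : ℕ) + 1) * fval m ζ lam (k + 1 - (r + 1)) ell 0 := by
    intro r _
    rw [Nat.add_sub_add_right]
    push_cast
    rw [← Finset.sum_mul, ← Finset.sum_div, ← Finset.sum_mul, ← Finset.mul_sum,
      show (r : ℂ) + 1 + 1 = r + 2 by ring, show r + 1 + 1 = r + 2 from rfl]
    rcases Nat.even_or_odd r with he | ho
    · rw [Even.neg_one_pow he |> fun h => show (-1 : ℂ) ^ (r + 1) = -1 by rw [pow_succ, h]; ring]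
      ring
    · rw [bernoulli_eq_zero_of_odd (by rw [Nat.odd_add]; simp [ho]) (by omega)]
      simp
  rw [Finset.sum_congr rfl hr, Finset.sum_sub_distrib, Finset.sum_neg_distrib]
  push_cast at h ⊢
  linear_combination h

end Root

/-! ### Power sums of the reciprocals of `1 - ζ ^ β` -/

noncomputable section PowerSums

open Polynomial

/-- Newton's identities in the form `f' = f * ∑ (-1) ^ n p_{n+1} X ^ n` for
`f = ∏ (1 + c_i X)`. -/
lemma newton_prod {ι : Type*} [DecidableEq ι] (s : Finset ι) (c : ι → ℂ) (n : ℕ) :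
    ((n : ℂ) + 1) * (∏ i ∈ s, (1 + C (c i) * X)).coeff (n + 1) =
      ∑ r ∈ Finset.range (n + 1), (-1) ^ r * (∑ i ∈ s, c i ^ (r + 1)) *
        (∏ i ∈ s, (1 + C (c i) * X)).coeff (n - r) := by
  set f := ∏ i ∈ s, (1 + C (c i) * X) with hf
  set g : ι → PowerSeries ℂ := fun i => PowerSeries.mk fun n => (-1) ^ n * c i ^ (n + 1) with hg
  have hg1 : ∀ i, g i * ((1 + C (c i) * X : ℂ[X]) : PowerSeries ℂ) = PowerSeries.C (c i) := by
    intro i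
    ext n
    rw [coe_add, coe_mul, coe_C, coe_X, coe_one, mul_add, mul_one, mul_left_comm, map_add,
      PowerSeries.coeff_C_mul, PowerSeries.coeff_C]
    cases n with
    | zero => simp [hg]
    | succ n => rw [PowerSeries.coeff_succ_mul_X]; simp [hg]; ring
  have h : ((derivative f : ℂ[X]) : PowerSeries ℂ) = (∑ i ∈ s, g i) * (f : PowerSeries ℂ) := by
    rw [hf, derivative_prod_finset, Finset.sum_mul, ← coeToPowerSeries.ringHom_apply, map_sum]
    refine Finset.sum_congr rfl fun i hi => ?_
    rw [coeToPowerSeries.ringHom_apply, ← Finset.mul_prod_erase _ _ hi]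
    simp only [derivative_add, derivative_one, derivative_mul, derivative_C, derivative_X, zero_mul,
      mul_one, zero_add]
    rw [coe_mul, coe_mul, ← mul_assoc, hg1, coe_C, mul_comm]
  have h2 := congrArg (PowerSeries.coeff n) h
  rw [coeff_coe, coeff_derivative, PowerSeries.coeff_mul,
    Finset.Nat.sum_antidiagonal_eq_sum_range_succ_mk] at h2
  rw [mul_comm, h2]
  refine Finset.sum_congr rfl fun r _ => ?_
  rw [map_sum, coeff_coe, Finset.mul_sum]
  congr 1
  exact Finset.sum_congr rfl fun i _ => by simp [hg]

variable {m : ℕ} {ζ lam : ℂ}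

lemma eqParam_pow (hζ : IsPrimitiveRoot ζ m) (α : Fin m) : eqParam m ζ lam α ^ m = lam ^ m := by
  rw [eqParam, mul_pow, ← pow_mul, mul_comm, mul_comm (α : ℕ), pow_mul, hζ.pow_eq_one, one_pow,
    mul_one]

lemma eqParam_ne_zero (hm : m ≠ 0) (hζ : IsPrimitiveRoot ζ m) (hlam : lam ≠ 0) (α : Fin m) :
    eqParam m ζ lam α ≠ 0 := mul_ne_zero (pow_ne_zero _ (hζ.ne_zero hm)) hlam

lemma eqParam_injective (hζ : IsPrimitiveRoot ζ m) (hlam : lam ≠ 0) :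
    Function.Injective (eqParam m ζ lam) := fun i j h =>
  Fin.ext (hζ.pow_inj i.2 j.2 (mul_right_cancel₀ hlam h))

/-- The product of the factors `1 + λ_α X / (λ_α - λ_i)` is `((1 + X) ^ m - 1) / (m X)`. -/
lemma coeff_prod_one_add (hm : m ≠ 0) (hζ : IsPrimitiveRoot ζ m) (hlam : lam ≠ 0) (α : Fin m)
    (n : ℕ) :
    (m : ℂ) * (∏ i ∈ Finset.univ.erase α, (1 + C (eqParam m ζ lam α /
      (eqParam m ζ lam α - eqParam m ζ lam i)) * X)).coeff n = (m.choose (n + 1) : ℂ) := by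
  set ell := eqParam m ζ lam α with hell
  have hell0 : ell ≠ 0 := eqParam_ne_zero hm hζ hlam α
  have hx : ∀ i ∈ Finset.univ.erase α, ell - eqParam m ζ lam i ≠ 0 := fun i hi h =>
    Finset.ne_of_mem_erase hi (eqParam_injective hζ hlam (sub_eq_zero.1 h)).symm
  have h0 : ∏ i ∈ Finset.univ.erase α, (ell - eqParam m ζ lam i) = m * ell ^ (m - 1) := by
    rw [← sum_prod_erase_eqParam hm hζ lam, Finset.sum_eq_single_of_mem α (Finset.mem_univ α)]
    intro i _ hi
    exact Finset.prod_eq_zero (Finset.mem_erase.2 ⟨hi.symm, Finset.mem_univ α⟩)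
      (by rw [hell, sub_self])
  have key : X * (C (m : ℂ) * ∏ i ∈ Finset.univ.erase α, (1 + C (ell /
      (ell - eqParam m ζ lam i)) * X)) = (1 + X) ^ m - 1 := by
    refine Polynomial.funext fun w => ?_
    simp only [eval_mul, eval_X, eval_C, eval_prod, eval_add, eval_one, eval_sub, eval_pow]
    have h1 := prod_eval_sub_eqParam hm hζ lam (ell + ell * w)
    rw [← Finset.mul_prod_erase _ _ (Finset.mem_univ α), ← hell, add_sub_cancel_left,
      ← eqParam_pow (lam := lam) hζ α, ← hell] at h1
    have h2 : ∏ i ∈ Finset.univ.erase α, (ell + ell * w - eqParam m ζ lam i) =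
        (∏ i ∈ Finset.univ.erase α, (ell - eqParam m ζ lam i)) *
          ∏ i ∈ Finset.univ.erase α, (1 + ell / (ell - eqParam m ζ lam i) * w) := by
      rw [← Finset.prod_mul_distrib]
      refine Finset.prod_congr rfl fun i hi => ?_
      have := hx i hi
      field_simp
      ring
    rw [h2, h0] at h1
    have h3 : ell ^ m = ell ^ (m - 1) * ell := by rw [← pow_succ, Nat.sub_add_cancel (by omega)]
    refine mul_left_cancel₀ (pow_ne_zero m hell0) ?_
    rw [show ell + ell * w = ell * (1 + w) by ring, mul_pow] at h1
    rw [mul_sub, mul_one, ← h1, h3]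
    ring
  have h4 := congrArg (fun p => p.coeff (n + 1)) key
  simp only [coeff_X_mul, coeff_C_mul] at h4
  rw [h4, coeff_sub, coeff_one_add_X_pow, coeff_one, if_neg (Nat.succ_ne_zero n), sub_zero]

/-- The power sums of the `m / (1 - ζ ^ β)` are polynomials in `m`. -/
lemma exists_powerSum (n : ℕ) : ∃ p : ℚ[X], ∀ (m : ℕ) (ζ lam : ℂ), m ≠ 0 → IsPrimitiveRoot ζ m →
    lam ≠ 0 → ∀ α : Fin m, aeval (m : ℂ) p =
      ∑ i ∈ Finset.univ.erase α,
        (eqParam m ζ lam α / (eqParam m ζ lam α - eqParam m ζ lam i)) ^ (n + 1) := by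
  -- the binomial coefficient divided by `m` is a polynomial in `m`
  have hch : ∀ n, ∃ p : ℚ[X], ∀ m : ℕ, aeval (m : ℂ) p * m = (m.choose (n + 1) : ℂ) := by
    intro n
    refine ⟨C (1 / ((n + 1).factorial : ℚ)) * (descPochhammer ℚ n).comp (X - 1), fun m => ?_⟩
    have h1 := Nat.cast_choose_eq_descPochhammer_div ℂ m (n + 1)
    have h2 : (descPochhammer ℚ n).map (algebraMap ℚ ℂ) = descPochhammer ℂ n :=
      descPochhammer_map _ _
    rw [h1, descPochhammer_succ_left, eval_mul, eval_X, eval_comp, eval_sub, eval_X, eval_one,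
      ← h2, Polynomial.eval_map_algebraMap, map_mul, aeval_comp, aeval_C, map_sub, aeval_X,
      map_one, map_div₀, map_one, map_natCast]
    ring
  choose ch hch using hch
  induction n using Nat.strong_induction_on with
  | _ n ih =>
    choose! P hP using ih
    refine ⟨C ((-1) ^ n) * (C ((n : ℚ) + 1) * ch (n + 1) -
      ∑ r ∈ Finset.range n, C ((-1) ^ r) * P r * ch (n - r)), ?_⟩
    intro m ζ lam hm hζ hlam α
    have hm' : (m : ℂ) ≠ 0 := by exact_mod_cast hm
    have h := newton_prod (Finset.univ.erase α) (fun i => eqParam m ζ lam α /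
      (eqParam m ζ lam α - eqParam m ζ lam i)) n
    have hc : ∀ k, (∏ i ∈ Finset.univ.erase α, (1 + C (eqParam m ζ lam α /
        (eqParam m ζ lam α - eqParam m ζ lam i)) * X)).coeff k = aeval (m : ℂ) (ch k) := by
      intro k
      refine mul_left_cancel₀ hm' ?_
      rw [coeff_prod_one_add hm hζ hlam, ← hch, mul_comm]
    have hc0 : aeval (m : ℂ) (ch 0) = 1 := by
      refine mul_right_cancel₀ hm' ?_
      rw [hch]; simp
    simp only [hc] at h
    rw [Finset.sum_range_succ, Nat.sub_self, hc0, mul_one] at h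
    have h3 : ∀ r ∈ Finset.range n, (-1 : ℂ) ^ r * (∑ i ∈ Finset.univ.erase α, (eqParam m ζ lam α /
        (eqParam m ζ lam α - eqParam m ζ lam i)) ^ (r + 1)) * aeval (m : ℂ) (ch (n - r)) =
        aeval (m : ℂ) (C ((-1) ^ r) * P r * ch (n - r)) := by
      intro r hr
      rw [← hP r (Finset.mem_range.1 hr) m ζ lam hm hζ hlam α]
      simp
    rw [Finset.sum_congr rfl h3] at h
    have hs : ((-1 : ℂ) ^ n) * (-1) ^ n = 1 := by rw [← mul_pow]; simp
    have h4 : aeval (m : ℂ) (C ((-1) ^ n) * (C ((n : ℚ) + 1) * ch (n + 1) -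
        ∑ r ∈ Finset.range n, C ((-1) ^ r) * P r * ch (n - r))) = (-1) ^ n *
        (((n : ℂ) + 1) * aeval (m : ℂ) (ch (n + 1)) -
        ∑ r ∈ Finset.range n, aeval (m : ℂ) (C ((-1) ^ r) * P r * ch (n - r))) := by
      rw [map_mul, map_sub, map_sum, map_mul]
      simp
    rw [h4, h, add_sub_cancel_left, ← mul_assoc, hs, one_mul]

/-- The values at `ℓ = λ_α` are polynomials in `m`. -/
lemma exists_rootValue (n : ℕ) : ∃ p : ℚ[X], ∀ (m : ℕ) (ζ lam : ℂ), m ≠ 0 →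
    IsPrimitiveRoot ζ m → lam ≠ 0 → ∀ α : Fin m,
      jval m ζ lam (eqParam m ζ lam α) n 0 = aeval (m : ℂ) p := by
  choose S hS using exists_powerSum
  induction n using Nat.strong_induction_on with
  | _ n ih =>
    cases n with
    | zero => exact ⟨1, fun m ζ lam _ _ _ α => by simp [jval_zero]⟩
    | succ n =>
      choose! v hv using ih
      refine ⟨C (1 / ((n : ℚ) + 1)) * ∑ r ∈ Finset.range (n + 1), C (_root_.bernoulli (r + 2) / (r + 2)) *
        (X ^ (r + 1) * S r + C ((-1) ^ (r + 1))) * v (n - r), ?_⟩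
      intro m ζ lam hm hζ hlam α
      have hm' : (m : ℂ) ≠ 0 := by exact_mod_cast hm
      have hell := eqParam_ne_zero hm hζ hlam α
      have h := (isGammaSeq_fval hm hζ hlam α).2 n
      have hn : ((n : ℂ) + 1) ≠ 0 := by exact_mod_cast Nat.succ_ne_zero n
      rw [map_mul, map_sum, aeval_C, jval, linePt_zero]
      refine mul_left_cancel₀ hn ?_
      have h5 : (algebraMap ℚ ℂ) (1 / ((n : ℚ) + 1)) = 1 / ((n : ℂ) + 1) := by simp
      rw [h5, ← mul_assoc _ (1 / ((n : ℂ) + 1)), mul_one_div_cancel hn, one_mul, mul_left_comm, h,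
        Finset.mul_sum]
      refine Finset.sum_congr rfl fun r hr => ?_
      have hr' : n - r < n + 1 := by omega
      rw [map_mul, ← hv (n - r) hr' m ζ lam hm hζ hlam α, jval, linePt_zero]
      simp only [map_mul, map_add, map_pow, aeval_X, aeval_C, hS r m ζ lam hm hζ hlam α]
      have h6 : (algebraMap ℚ ℂ) (_root_.bernoulli (r + 2) / (r + 2)) =
          (_root_.bernoulli (r + 2) : ℂ) / (r + 2) := by simp
      have h7 : (algebraMap ℚ ℂ) (-1) = -1 := by simp
      have h8 : ((m : ℂ) * eqParam m ζ lam α) ^ (n + 1) =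
          (m * eqParam m ζ lam α) ^ (r + 1) * (m * eqParam m ζ lam α) ^ (n - r) := by
        rw [← pow_add]; congr 1; have := Finset.mem_range.1 hr; omega
      have h9 : ((m : ℂ) * eqParam m ζ lam α) ^ (r + 1) * ((∑ i ∈ Finset.univ.erase α,
          ((eqParam m ζ lam α - eqParam m ζ lam i) ^ (r + 1))⁻¹) +
            ((-(m * eqParam m ζ lam α)) ^ (r + 1))⁻¹) =
          m ^ (r + 1) * (∑ i ∈ Finset.univ.erase α, (eqParam m ζ lam α /
            (eqParam m ζ lam α - eqParam m ζ lam i)) ^ (r + 1)) + (-1) ^ (r + 1) := by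
        rw [mul_add]
        congr 1
        · rw [mul_pow, mul_assoc, Finset.mul_sum]
          simp only [div_eq_mul_inv, mul_pow, inv_pow]
        · rw [neg_pow (_ * _), mul_inv, ← inv_pow, inv_neg_one, mul_left_comm,
            mul_inv_cancel₀ (pow_ne_zero _ (mul_ne_zero hm' hell)), mul_one]
      rw [h6, h7, h8, ← h9]
      ring

end PowerSums

/-! ### Polynomial dependence on `m` and `κ` -/

noncomputable section Universal

/-- Functions of `(m, κ)` which are polynomials with rational coefficients. -/
def univPoly : Subalgebra ℚ (ℕ × ℂ → ℂ) :=
  Algebra.adjoin ℚ {fun p => (p.1 : ℂ), fun p => p.2}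

lemma fst_mem_univPoly : (fun p : ℕ × ℂ => (p.1 : ℂ)) ∈ univPoly :=
  Algebra.subset_adjoin (by simp)

lemma snd_mem_univPoly : (fun p : ℕ × ℂ => p.2) ∈ univPoly :=
  Algebra.subset_adjoin (by simp)

lemma ratCast_mem_univPoly (c : ℚ) : (fun _ : ℕ × ℂ => (c : ℂ)) ∈ univPoly := by
  have := univPoly.algebraMap_mem c
  exact this

lemma natCast_mem_univPoly (c : ℕ) : (fun _ : ℕ × ℂ => (c : ℂ)) ∈ univPoly := by
  have := ratCast_mem_univPoly c
  simpa using this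

/-- Induction on monomials. -/
lemma univPoly_induction {p : (ℕ × ℂ → ℂ) → Prop}
    (hmon : ∀ a b : ℕ, p fun x => (x.1 : ℂ) ^ a * x.2 ^ b) (hzero : p 0)
    (hadd : ∀ f g, p f → p g → p (f + g)) (hsmul : ∀ (c : ℚ) f, p f → p (c • f))
    {f : ℕ × ℂ → ℂ} (hf : f ∈ univPoly) : p f := by
  rw [← Subalgebra.mem_toSubmodule, univPoly, Algebra.adjoin_eq_span] at hf
  induction hf using Submodule.span_induction with
  | mem x hx =>
    obtain ⟨a, b, rfl⟩ := (Submonoid.mem_closure_pair _ _ _).1 hx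
    exact hmon a b
  | zero => exact hzero
  | add x y _ _ hx hy => exact hadd x y hx hy
  | smul c x _ hx => exact hsmul c x hx

lemma comp_mem_univPoly {f g : ℕ × ℂ → ℂ} (hf : f ∈ univPoly) (hg : g ∈ univPoly) :
    (fun x => f (x.1, g x)) ∈ univPoly := by
  refine univPoly_induction (p := fun f => (fun x => f (x.1, g x)) ∈ univPoly) (fun a b => ?_)
    univPoly.zero_mem (fun f₁ f₂ h₁ h₂ => ?_) (fun c f₁ h₁ => ?_) hf
  rotate_left
  · have := univPoly.add_mem h₁ h₂
    exact this
  · have := univPoly.smul_mem h₁ c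
    exact this
  exact univPoly.mul_mem (univPoly.pow_mem fst_mem_univPoly a) (univPoly.pow_mem hg b)

lemma exists_polynomial_of_mem_univPoly {f : ℕ × ℂ → ℂ} (hf : f ∈ univPoly) (m : ℕ) :
    ∃ p : Polynomial ℂ, ∀ κ, f (m, κ) = p.eval κ := by
  refine univPoly_induction (p := fun f => ∃ p : Polynomial ℂ, ∀ κ, f (m, κ) = p.eval κ)
    (fun a b => ⟨Polynomial.C ((m : ℂ) ^ a) * Polynomial.X ^ b, fun κ => by simp⟩)
    ⟨0, fun κ => by simp⟩ ?_ ?_ hf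
  · rintro f g ⟨p, hp⟩ ⟨q, hq⟩
    exact ⟨p + q, fun κ => by simp [hp, hq]⟩
  · rintro c f ⟨p, hp⟩
    exact ⟨Polynomial.C (c : ℂ) * p, fun κ => by simp [hp, Rat.smul_def]⟩

lemma exists_ratPolynomial_of_mem_univPoly {f : ℕ × ℂ → ℂ} (hf : f ∈ univPoly) (c : ℕ) :
    ∃ p : Polynomial ℚ, ∀ m : ℕ, f (m, c) = Polynomial.aeval (m : ℂ) p := by
  refine univPoly_induction
    (p := fun f => ∃ p : Polynomial ℚ, ∀ m : ℕ, f (m, c) = Polynomial.aeval (m : ℂ) p)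
    (fun a b => ⟨Polynomial.X ^ a * Polynomial.C ((c : ℚ) ^ b), fun m => by simp⟩)
    ⟨0, fun m => by simp⟩ ?_ ?_ hf
  · rintro f g ⟨p, hp⟩ ⟨q, hq⟩
    exact ⟨p + q, fun m => by simp [hp, hq]⟩
  · rintro c f ⟨p, hp⟩
    exact ⟨c • p, fun m => by simp [hp]⟩

lemma aeval_mem_univPoly (p : Polynomial ℚ) :
    (fun x : ℕ × ℂ => Polynomial.aeval (x.1 : ℂ) p) ∈ univPoly := by
  induction p using Polynomial.induction_on' with
  | add p q hp hq =>
    have := univPoly.add_mem hp hq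
    simp only [map_add]
    exact this
  | monomial n a =>
    have := univPoly.mul_mem (ratCast_mem_univPoly a) (univPoly.pow_mem fst_mem_univPoly n)
    simp only [Polynomial.aeval_monomial]
    exact this

/-- Sums over `r < m` are polynomials in `m` without constant term. -/
lemma exists_sum_range_of_mem_univPoly {f : ℕ × ℂ → ℂ} (hf : f ∈ univPoly) :
    ∃ g ∈ univPoly, ∀ (m : ℕ) (κ : ℂ), ∑ r ∈ Finset.range m, f (r, κ) = m * g (m, κ) := by
  refine univPoly_induction (p := fun f => ∃ g ∈ univPoly, ∀ (m : ℕ) (κ : ℂ),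
    ∑ r ∈ Finset.range m, f (r, κ) = m * g (m, κ)) (fun a b => ?_)
    ⟨0, univPoly.zero_mem, fun m κ => by simp⟩ ?_ ?_ hf
  · refine ⟨fun x => (∑ i ∈ Finset.range (a + 1),
      ((bernoulli i * (a + 1).choose i / (a + 1) : ℚ) : ℂ) * (x.1 : ℂ) ^ (a - i)) * x.2 ^ b,
      univPoly.mul_mem ?_ (univPoly.pow_mem snd_mem_univPoly b), fun m κ => ?_⟩
    · have : (∑ i ∈ Finset.range (a + 1), (fun x : ℕ × ℂ =>
          ((bernoulli i * (a + 1).choose i / (a + 1) : ℚ) : ℂ) * (x.1 : ℂ) ^ (a - i))) ∈ univPoly :=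
        univPoly.sum_mem fun i _ => univPoly.mul_mem (ratCast_mem_univPoly _)
          (univPoly.pow_mem fst_mem_univPoly _)
      convert this using 1
      ext x
      simp
    · simp only
      rw [← Finset.sum_mul, ← mul_assoc]
      congr 1
      have h := congrArg (Rat.cast : ℚ → ℂ) (sum_range_pow m a)
      push_cast at h
      rw [h, Finset.mul_sum]
      refine Finset.sum_congr rfl fun i hi => ?_
      rw [show a + 1 - i = (a - i) + 1 by have := Finset.mem_range.1 hi; omega, pow_succ]
      push_cast
      ring
  · rintro f g ⟨p, hp, hp'⟩ ⟨q, hq, hq'⟩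
    exact ⟨p + q, univPoly.add_mem hp hq, fun m κ => by
      simp [Finset.sum_add_distrib, hp', hq', mul_add]⟩
  · rintro c f ⟨p, hp, hp'⟩
    exact ⟨c • p, univPoly.smul_mem hp c, fun m κ => by
      simp [← Finset.smul_sum, hp']⟩

lemma orderCoeff_eq_sum (m s : ℕ) (κ : ℂ) : orderCoeff m (s + 1) κ =
    ∑ r ∈ Finset.range m, (κ + r - s) * orderCoeff r s κ := by
  induction m with
  | zero => simp [orderCoeff]
  | succ m ih => rw [orderCoeff_succ, ih, Finset.sum_range_succ]

/-- The normal ordering coefficients are divisible by `m`. -/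
lemma exists_orderCoeff (s : ℕ) :
    ∃ g ∈ univPoly, ∀ (m : ℕ) (κ : ℂ), orderCoeff m (s + 1) κ = m * g (m, κ) := by
  have h : ∀ s, ∃ g ∈ univPoly, ∀ (m : ℕ) (κ : ℂ), orderCoeff m s κ = g (m, κ) := by
    intro s
    induction s with
    | zero => exact ⟨1, univPoly.one_mem, fun m κ => by rw [orderCoeff_zero_right]; rfl⟩
    | succ s ih =>
      obtain ⟨g, hg, hg'⟩ := ih
      have hmem : (fun x : ℕ × ℂ => (x.2 + (x.1 : ℂ) - s) * g x) ∈ univPoly :=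
        univPoly.mul_mem (univPoly.sub_mem (univPoly.add_mem snd_mem_univPoly fst_mem_univPoly)
          (natCast_mem_univPoly s)) hg
      obtain ⟨f, hf, hf'⟩ := exists_sum_range_of_mem_univPoly hmem
      refine ⟨fun x => (x.1 : ℂ) * f x, univPoly.mul_mem fst_mem_univPoly hf, fun m κ => ?_⟩
      change _ = (m : ℂ) * f (m, κ)
      rw [orderCoeff_eq_sum, ← hf']
      exact Finset.sum_congr rfl fun r _ => by rw [hg']
  obtain ⟨g, hg, hg'⟩ := h s
  have hmem : (fun x : ℕ × ℂ => (x.2 + (x.1 : ℂ) - s) * g x) ∈ univPoly :=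
    univPoly.mul_mem (univPoly.sub_mem (univPoly.add_mem snd_mem_univPoly fst_mem_univPoly)
      (natCast_mem_univPoly s)) hg
  obtain ⟨f, hf, hf'⟩ := exists_sum_range_of_mem_univPoly hmem
  refine ⟨f, hf, fun m κ => ?_⟩
  rw [orderCoeff_eq_sum, ← hf']
  exact Finset.sum_congr rfl fun r _ => by rw [hg']

/-- Polynomial solutions of difference equations of step `m` whose right hand side is divisible
by `m`. -/
lemma exists_step_sum {f : ℕ × ℂ → ℂ} (hf : f ∈ univPoly) :
    ∃ g ∈ univPoly, (∀ m, g (m, 0) = 0) ∧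
      ∀ (m : ℕ) (κ : ℂ), g (m, κ + m) - g (m, κ) = m * f (m, κ) := by
  -- powers of `κ`, by induction from the binomial expansion of `(κ + m) ^ (b + 1)`; the factor `m` on the
  -- right hand side avoids a division by `m`
  have hpow : ∀ b : ℕ, ∃ g ∈ univPoly,
      ∀ (m : ℕ) (κ : ℂ), g (m, κ + m) - g (m, κ) = m * κ ^ b := by
    intro b
    induction b using Nat.strong_induction_on with
    | _ b ih =>
      choose! G hG hG' using ih
      refine ⟨((1 / ((b : ℚ) + 1)) : ℚ) • ((fun x : ℕ × ℂ => x.2 ^ (b + 1)) -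
        ∑ j ∈ (Finset.range b).attach, fun x => (((b + 1).choose j : ℕ) : ℂ) *
          (x.1 : ℂ) ^ (b - j) * G j x), ?_, fun m κ => ?_⟩
      · refine univPoly.smul_mem (univPoly.sub_mem (univPoly.pow_mem snd_mem_univPoly _)
          (univPoly.sum_mem fun j _ => ?_)) _
        exact univPoly.mul_mem (univPoly.mul_mem (natCast_mem_univPoly _)
          (univPoly.pow_mem fst_mem_univPoly _)) (hG j (Finset.mem_range.1 j.2))
      · have hb : ((b : ℂ) + 1) ≠ 0 := by exact_mod_cast Nat.succ_ne_zero b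
        have h1 := add_pow κ (m : ℂ) (b + 1)
        rw [Finset.sum_range_succ, Finset.sum_range_succ] at h1
        have h2 : ∑ j ∈ Finset.range b, κ ^ j * (m : ℂ) ^ (b + 1 - j) * ((b + 1).choose j : ℂ) =
            ∑ j ∈ Finset.range b, ((b + 1).choose j : ℂ) * (m : ℂ) ^ (b - j) *
              (G j (m, κ + m) - G j (m, κ)) := by
          refine Finset.sum_congr rfl fun j hj => ?_
          rw [hG' j (Finset.mem_range.1 hj),
            show b + 1 - j = (b - j) + 1 by have := Finset.mem_range.1 hj; omega, pow_succ]
          ring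
        rw [h2, ← Finset.sum_attach] at h1
        simp only [mul_sub, Finset.sum_sub_distrib] at h1
        simp only [Pi.smul_apply, Pi.sub_apply, Finset.sum_apply, Rat.smul_def]
        rw [Nat.add_sub_cancel_left, Nat.sub_self, Nat.choose_succ_self_right, Nat.choose_self,
          pow_one, pow_zero] at h1
        push_cast at h1 ⊢
        field_simp
        linear_combination h1
  have hall : ∃ g ∈ univPoly, ∀ (m : ℕ) (κ : ℂ), g (m, κ + m) - g (m, κ) = m * f (m, κ) := by
    refine univPoly_induction (p := fun f => ∃ g ∈ univPoly,
      ∀ (m : ℕ) (κ : ℂ), g (m, κ + m) - g (m, κ) = m * f (m, κ)) (fun a b => ?_)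
      ⟨0, univPoly.zero_mem, fun m κ => by simp⟩ ?_ ?_ hf
    · obtain ⟨g, hg, hg'⟩ := hpow b
      refine ⟨fun x => (x.1 : ℂ) ^ a * g x, univPoly.mul_mem (univPoly.pow_mem fst_mem_univPoly a) hg,
        fun m κ => ?_⟩
      simp only
      linear_combination (m : ℂ) ^ a * hg' m κ
    · rintro f g ⟨p, hp, hp'⟩ ⟨q, hq, hq'⟩
      refine ⟨p + q, univPoly.add_mem hp hq, fun m κ => ?_⟩
      simp only [Pi.add_apply]
      linear_combination hp' m κ + hq' m κ
    · rintro c f ⟨p, hp, hp'⟩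
      refine ⟨c • p, univPoly.smul_mem hp c, fun m κ => ?_⟩
      simp only [Pi.smul_apply, Rat.smul_def]
      linear_combination (c : ℂ) * hp' m κ
  obtain ⟨g, hg, hg'⟩ := hall
  refine ⟨fun x => g x - g (x.1, 0), univPoly.sub_mem hg
    (comp_mem_univPoly hg univPoly.zero_mem), fun m => by simp, fun m κ => ?_⟩
  simpa using hg' m κ

/-- The `κ`-dependence forced by the recurrence of order `m`. -/
lemma exists_increment (N : ℕ) {J : ℕ → ℕ → ℕ × ℂ → ℂ} (hJ : ∀ k i, J k i ∈ univPoly) :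
    ∃ E : ℕ → ℕ × ℂ → ℂ, (∀ i, E i ∈ univPoly) ∧ (∀ i m, E i (m, 0) = 0) ∧
      ∀ (m : ℕ) (κ Y : ℂ), ∑ i ∈ Finset.range N, E i (m, κ + m) * Y ^ (i + 1) -
        ∑ i ∈ Finset.range N, E i (m, κ) * Y ^ (i + 1) =
        -Y * ∑ s ∈ Finset.range N, orderCoeff m (s + 1) κ *
          ∑ i ∈ Finset.range N, J (N - (s + 1)) i (m, κ + m - (s + 1)) * Y ^ i := by
  choose q hq hq' using exists_orderCoeff
  have hmem : ∀ i, (-∑ s ∈ Finset.range N, fun x : ℕ × ℂ => q s x *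
      J (N - (s + 1)) i (x.1, x.2 + x.1 - (s + 1))) ∈ univPoly := by
    intro i
    refine univPoly.neg_mem (univPoly.sum_mem fun s _ => univPoly.mul_mem (hq s)
      (comp_mem_univPoly (g := fun x => x.2 + x.1 - (s + 1)) (hJ _ i) ?_))
    exact univPoly.sub_mem (univPoly.add_mem snd_mem_univPoly fst_mem_univPoly)
      (univPoly.add_mem (natCast_mem_univPoly s) univPoly.one_mem)
  choose E hE hE0 hE1 using fun i => exists_step_sum (hmem i)
  refine ⟨E, hE, hE0, fun m κ Y => ?_⟩
  rw [← Finset.sum_sub_distrib]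
  simp only [← sub_mul, hE1, Finset.mul_sum]
  rw [Finset.sum_comm]
  refine Finset.sum_congr rfl fun i _ => ?_
  simp only [Pi.neg_apply, Finset.sum_apply, mul_neg, neg_mul, Finset.sum_neg_distrib,
    Finset.mul_sum, Finset.sum_mul, hq']
  congr 1
  refine Finset.sum_congr rfl fun s _ => ?_
  ring

end Universal

/-! ### The flow in `ℓ` and the universal expansion -/

noncomputable section Expansion

open Polynomial

variable {m : ℕ} {ζ lam : ℂ}

lemma X_mul_derivative_X_pow' (n : ℕ) :
    (X : ℂ[X]) * derivative (X ^ n) = C (n : ℂ) * X ^ n := by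
  cases n with
  | zero => simp
  | succ n => rw [derivative_X_pow, Nat.add_sub_cancel, pow_succ]; ring

lemma eq_monomial_of_X_mul_derivative {p : ℂ[X]} {N : ℕ} (h : X * derivative p = C (N : ℂ) * p) :
    p = C (p.coeff N) * X ^ N := by
  ext k
  rw [coeff_C_mul_X_pow]
  have h2 := congrArg (fun p => coeff p k) h
  simp only [coeff_C_mul] at h2
  have h3 : (X * derivative p).coeff k = k * p.coeff k := by
    cases k with
    | zero => simp
    | succ k => rw [coeff_X_mul, coeff_derivative]; push_cast; ring
  rw [h3] at h2
  split_ifs with hk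
  · rw [hk]
  · have : ((k : ℂ) - N) * p.coeff k = 0 := by linear_combination h2
    refine (mul_eq_zero.1 this).resolve_left (sub_ne_zero.2 ?_)
    exact_mod_cast hk

/-- The coefficients `j_N (0)`, as polynomials in `ℓ`. -/
def basePoly (m : ℕ) (ζ lam : ℂ) (N : ℕ) : ℂ[X] :=
  C ((m : ℂ) ^ N) * X ^ N * linePoly m ζ lam N 0

lemma eval_basePoly (N : ℕ) (ell : ℂ) :
    (basePoly m ζ lam N).eval ell = jval m ζ lam ell N 0 := by
  simp [basePoly, jval, eval_linePoly, mul_pow]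

lemma flow_basePoly (hm : m ≠ 0) (hζ : IsPrimitiveRoot ζ m) (hlam : lam ≠ 0) (N : ℕ) (ell : ℂ) :
    (ell ^ m / lam ^ m - 1) *
      (X * derivative (basePoly m ζ lam N) - C (N : ℂ) * basePoly m ζ lam N).eval ell =
      -(jval m ζ lam ell (N + 1) 1 - jval m ζ lam ell (N + 1) 0) := by
  have h1 : X * derivative (basePoly m ζ lam N) - C (N : ℂ) * basePoly m ζ lam N =
      C ((m : ℂ) ^ N) * X ^ (N + 1) * derivative (linePoly m ζ lam N 0) := by
    rw [basePoly, derivative_mul, derivative_C_mul]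
    linear_combination C ((m : ℂ) ^ N) * linePoly m ζ lam N 0 * X_mul_derivative_X_pow' N
  have h2 := derivative_linePoly_eval hm hζ hlam N ell 0
  rw [zero_mul, zero_mul, add_zero, zero_add] at h2
  rw [h1]
  simp only [eval_mul, eval_C, eval_pow, eval_X, jval]
  have hl : lam ^ m ≠ 0 := pow_ne_zero _ hlam
  have h3 : (ell ^ m / lam ^ m - 1) * eval ell (derivative (linePoly m ζ lam N 0)) =
      -(m * (fval m ζ lam (N + 1) ell (linePt m 1) - fval m ζ lam (N + 1) ell (linePt m 0))) := by
    field_simp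
    linear_combination h2
  linear_combination (m : ℂ) ^ N * ell ^ (N + 1) * h3

lemma sum_partial_sums (e : ℕ → ℂ) (Y : ℂ) (N : ℕ) :
    (Y - 1) * ∑ i ∈ Finset.range N, (∑ j ∈ Finset.range (i + 1), e j) * Y ^ (i + 1) =
      (∑ j ∈ Finset.range N, e j) * Y ^ (N + 1) - ∑ j ∈ Finset.range N, e j * Y ^ (j + 1) := by
  induction N with
  | zero => simp
  | succ N ih =>
    rw [Finset.sum_range_succ, mul_add, ih]
    simp only [Finset.sum_range_succ]
    ring

/-- The flow in `ℓ` determines `j_N (0)` up to a multiple of `ℓ ^ N`. -/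
lemma exists_jval_eq (hm : m ≠ 0) (hζ : IsPrimitiveRoot ζ m) (hlam : lam ≠ 0) {N : ℕ} {e G : ℕ → ℂ}
    (he : ∀ ell, jval m ζ lam ell (N + 1) 1 - jval m ζ lam ell (N + 1) 0 =
      ∑ i ∈ Finset.range (N + 1), e i * (ell ^ m / lam ^ m) ^ (i + 1))
    (hG : ∀ i < N, ((m : ℂ) * (i + 1) - N) * G i = ∑ j ∈ Finset.range (i + 1), e j) :
    ∃ γ : ℂ, ∀ ell, jval m ζ lam ell N 0 =
      γ * ell ^ N + ∑ i ∈ Finset.range N, G i * (ell ^ m / lam ^ m) ^ (i + 1) := by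
  have hl : lam ^ m ≠ 0 := pow_ne_zero _ hlam
  -- the left hand side of the flow vanishes at `ℓ = λ`
  have he0 : ∑ i ∈ Finset.range (N + 1), e i = 0 := by
    have h := flow_basePoly hm hζ hlam N lam
    rw [he, div_self hl, sub_self, zero_mul] at h
    simpa using h.symm
  -- a particular solution of the flow
  set q : ℂ[X] := ∑ i ∈ Finset.range N, C (G i / (lam ^ m) ^ (i + 1)) * X ^ (m * (i + 1)) with hq
  have hqe : ∀ ell, q.eval ell = ∑ i ∈ Finset.range N, G i * (ell ^ m / lam ^ m) ^ (i + 1) := by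
    intro ell
    rw [hq, eval_finsetSum]
    refine Finset.sum_congr rfl fun i _ => ?_
    simp only [eval_mul, eval_C, eval_pow, eval_X, div_pow, ← pow_mul]
    ring
  have hqd : X * derivative q - C (N : ℂ) * q = ∑ i ∈ Finset.range N,
      C ((∑ j ∈ Finset.range (i + 1), e j) / (lam ^ m) ^ (i + 1)) * X ^ (m * (i + 1)) := by
    rw [hq, derivative_sum, Finset.mul_sum, Finset.mul_sum, ← Finset.sum_sub_distrib]
    refine Finset.sum_congr rfl fun i hi => ?_
    rw [← hG i (Finset.mem_range.1 hi), derivative_C_mul, mul_left_comm, X_mul_derivative_X_pow',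
      ← mul_assoc, ← mul_assoc, ← sub_mul, ← C_mul, ← C_mul, ← C_sub]
    congr 2
    push_cast
    ring
  have hflow : X * derivative (basePoly m ζ lam N) - C (N : ℂ) * basePoly m ζ lam N =
      X * derivative q - C (N : ℂ) * q := by
    refine eq_of_infinite_eval_eq _ _ ((infinite_pow_ne hm (lam ^ m)).mono ?_)
    rintro ell ⟨_, h1⟩
    rw [Set.mem_ofPred_eq]
    have hY : ell ^ m / lam ^ m - 1 ≠ 0 := by
      rw [sub_ne_zero, Ne, div_eq_one_iff_eq hl]; exact h1
    refine mul_left_cancel₀ hY ?_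
    rw [flow_basePoly hm hζ hlam, he, hqd, eval_finsetSum]
    have h2 := sum_partial_sums e (ell ^ m / lam ^ m) N
    rw [Finset.sum_range_succ] at he0 ⊢
    have h3 : ∑ i ∈ Finset.range N, eval ell
        (C ((∑ j ∈ Finset.range (i + 1), e j) / (lam ^ m) ^ (i + 1)) * X ^ (m * (i + 1))) =
        ∑ i ∈ Finset.range N, (∑ j ∈ Finset.range (i + 1), e j) * (ell ^ m / lam ^ m) ^ (i + 1) := by
      refine Finset.sum_congr rfl fun i _ => ?_
      simp only [eval_mul, eval_C, eval_pow, eval_X, div_pow, ← pow_mul]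
      ring
    rw [h3, h2]
    linear_combination (-(ell ^ m / lam ^ m) ^ (N + 1)) * he0
  have hd : X * derivative (basePoly m ζ lam N - q) = C (N : ℂ) * (basePoly m ζ lam N - q) := by
    rw [derivative_sub]
    linear_combination hflow
  refine ⟨(basePoly m ζ lam N - q).coeff N, fun ell => ?_⟩
  have h := congrArg (eval ell) (eq_monomial_of_X_mul_derivative hd)
  rw [eval_sub, eval_basePoly, hqe, eval_mul, eval_C, eval_pow, eval_X] at h
  linear_combination h

/-- A sum of fractions with the distinct poles `m = N / (i + 1)`, which takes polynomial values,
has no poles. -/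
lemma dvd_of_sum_div {N : ℕ} (hN : N ≠ 0) {V : ℕ → ℚ[X]} {v : ℚ[X]}
    (h : ∀ m : ℕ, N < m → ∑ i ∈ Finset.range N, (V i).eval (m : ℚ) / (m * (i + 1) - N) =
      v.eval (m : ℚ)) (i : ℕ) (hi : i < N) :
    (C ((i : ℚ) + 1) * X - C (N : ℚ)) ∣ V i := by
  have hNQ : (N : ℚ) ≠ 0 := by exact_mod_cast hN
  have hiQ : ((i : ℚ) + 1) ≠ 0 := by exact_mod_cast Nat.succ_ne_zero i
  set w : ℕ → ℚ[X] := fun i => C ((i : ℚ) + 1) * X - C (N : ℚ) with hw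
  -- the hypothesis after clearing denominators
  have key : ∑ i ∈ Finset.range N, V i * ∏ j ∈ (Finset.range N).erase i, w j =
      v * ∏ j ∈ Finset.range N, w j := by
    refine eq_of_infinite_eval_eq _ _ (Set.Infinite.mono (s := (Nat.cast : ℕ → ℚ) '' Set.Ioi N) ?_
      ((Set.Ioi_infinite N).image Nat.cast_injective.injOn))
    rintro _ ⟨m, hm, rfl⟩
    rw [Set.mem_ofPred_eq]
    have hwne : ∀ j, (w j).eval (m : ℚ) ≠ 0 := by
      intro j
      simp only [hw, eval_sub, eval_mul, eval_C, eval_X]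
      have : (N : ℚ) < m := by exact_mod_cast hm
      have h0 : (0 : ℚ) ≤ j := Nat.cast_nonneg j
      have h1 : (0 : ℚ) ≤ m := Nat.cast_nonneg m
      nlinarith [mul_nonneg h0 h1]
    rw [eval_finsetSum, eval_mul, ← h m hm, eval_prod, Finset.sum_mul]
    refine Finset.sum_congr rfl fun i hi => ?_
    rw [eval_mul, eval_prod, ← Finset.mul_prod_erase _ _ hi]
    have h2 : (w i).eval (m : ℚ) = m * (i + 1) - N := by simp [hw, mul_comm]
    have h3 := hwne i
    rw [h2] at h3 ⊢
    field_simp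
  -- at the root of the `i`-th denominator only the `i`-th summand survives
  have hroot : (w i).eval ((N : ℚ) / (i + 1)) = 0 := by
    simp [hw]; field_simp; simp
  have h1 := congrArg (eval ((N : ℚ) / (i + 1))) key
  rw [eval_mul, eval_prod, Finset.prod_eq_zero (Finset.mem_range.2 hi) hroot, mul_zero,
    eval_finsetSum, Finset.sum_eq_single_of_mem i (Finset.mem_range.2 hi)] at h1
  · rw [eval_mul, eval_prod, mul_eq_zero, Finset.prod_eq_zero_iff] at h1
    have h2 : (V i).eval ((N : ℚ) / (i + 1)) = 0 := by
      refine h1.resolve_right ?_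
      rintro ⟨j, hj, hj0⟩
      simp only [hw, eval_sub, eval_mul, eval_C, eval_X] at hj0
      have : (N : ℚ) * (j - i) = 0 := by field_simp at hj0; linear_combination hj0
      rcases mul_eq_zero.1 this with h | h
      · exact hNQ h
      · exact Finset.ne_of_mem_erase hj (by exact_mod_cast sub_eq_zero.1 h)
    have h3 : (C ((i : ℚ) + 1) * X - C (N : ℚ)) =
        C ((i : ℚ) + 1) * (X - C ((N : ℚ) / (i + 1))) := by
      rw [mul_sub, ← C_mul, mul_div_cancel₀ _ hiQ]
    rw [h3]
    exact (isUnit_C.2 (isUnit_iff_ne_zero.2 hiQ)).mul_left_dvd.2 (dvd_iff_isRoot.2 h2)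
  · intro j hj hne
    rw [eval_mul, eval_prod, Finset.prod_eq_zero (Finset.mem_erase.2
      ⟨hne.symm, Finset.mem_range.2 hi⟩) hroot, mul_zero]

/-- The formal coefficients on the line are polynomials in `m`, `κ` and `(ℓ / λ) ^ m`. -/
theorem exists_jval_expansion (n : ℕ) : ∃ J : ℕ → ℕ × ℂ → ℂ, (∀ i, J i ∈ univPoly) ∧
    (∀ i, n < i → J i = 0) ∧ ∀ (m : ℕ) (ζ lam : ℂ), m ≠ 0 → IsPrimitiveRoot ζ m → lam ≠ 0 →
      ∀ ell κ, jval m ζ lam ell n κ =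
        ∑ i ∈ Finset.range (n + 1), J i (m, κ) * (ell ^ m / lam ^ m) ^ i := by
  induction n using Nat.strong_induction_on with
  | _ n ih =>
  rcases Nat.eq_zero_or_pos n with rfl | hn
  · refine ⟨fun i => if i = 0 then 1 else 0, fun i => ?_, fun i hi => ?_, ?_⟩
    · beta_reduce
      split_ifs
      · exact univPoly.one_mem
      · exact univPoly.zero_mem
    · exact if_neg hi.ne'
    · intros; simp [jval_zero]
  obtain ⟨N, rfl⟩ : ∃ N, n = N + 1 := ⟨n - 1, by omega⟩
  clear hn
  choose! J0 hJ0 hJ0z hJ0e using ih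
  set J : ℕ → ℕ → ℕ × ℂ → ℂ := fun k => if k < N + 1 then J0 k else 0 with hJ
  have hJm : ∀ k i, J k i ∈ univPoly := by
    intro k i
    simp only [hJ]
    split_ifs with h
    · exact hJ0 k h i
    · exact univPoly.zero_mem
  have hJe : ∀ k, k < N + 1 → ∀ M, k < M → ∀ (m : ℕ) (ζ lam : ℂ), m ≠ 0 → IsPrimitiveRoot ζ m →
      lam ≠ 0 → ∀ ell κ, jval m ζ lam ell k κ =
        ∑ i ∈ Finset.range M, J k i (m, κ) * (ell ^ m / lam ^ m) ^ i := by
    intro k hk M hM m ζ lam hm hζ hlam ell κ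
    rw [hJ0e k hk m ζ lam hm hζ hlam, hJ]
    simp only [hk, if_true]
    refine Finset.sum_subset (Finset.range_subset_range.2 hM) fun i _ hi => ?_
    rw [hJ0z k hk i (by simpa using hi), Pi.zero_apply, zero_mul]
  -- a polynomial in `κ` is determined by its increments of step `m` and its value at `κ = 0`
  obtain ⟨E, hEm, hE0, hE⟩ := exists_increment (N + 1) hJm
  have hbase : ∀ (m : ℕ) (ζ lam : ℂ), m ≠ 0 → IsPrimitiveRoot ζ m → lam ≠ 0 → ∀ ell κ,
      jval m ζ lam ell (N + 1) κ = jval m ζ lam ell (N + 1) 0 +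
        ∑ i ∈ Finset.range (N + 1), E i (m, κ) * (ell ^ m / lam ^ m) ^ (i + 1) := by
    intro m ζ lam hm hζ hlam ell κ
    obtain ⟨p, hp⟩ := exists_poly_jval (m := m) (ζ := ζ) (lam := lam) ell (N + 1)
    choose r hr using fun i => exists_polynomial_of_mem_univPoly (hEm i) m
    have h := eval_eq_of_periodic (s := m) (p := p - ∑ i ∈ Finset.range (N + 1),
      r i * C ((ell ^ m / lam ^ m) ^ (i + 1))) (by exact_mod_cast hm) (fun κ => by
        have h1 := jval_recurrence hm hζ hlam ell (N + 1) κ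
        have h2 := hE m κ (ell ^ m / lam ^ m)
        have h3 : ∀ s ∈ Finset.range (N + 1), orderCoeff m (s + 1) κ *
            jval m ζ lam ell (N + 1 - (s + 1)) (κ + m - (s + 1)) = orderCoeff m (s + 1) κ *
            ∑ i ∈ Finset.range (N + 1), J (N + 1 - (s + 1)) i (m, κ + m - (s + 1)) *
              (ell ^ m / lam ^ m) ^ i := by
          intro s _
          rw [hJe (N + 1 - (s + 1)) (by omega) (N + 1) (by omega) m ζ lam hm hζ hlam]
        rw [Finset.sum_congr rfl h3, ← h2, hp, hp] at h1
        simp only [eval_sub, eval_finsetSum, eval_mul, eval_C, ← hr]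
        linear_combination h1) κ 0
    simp only [eval_sub, eval_finsetSum, eval_mul, eval_C, ← hr, ← hp, hE0, zero_mul,
      Finset.sum_const_zero, sub_zero] at h
    linear_combination h
  -- the flow for `j_{N+1} (0)` needs the increment of `j_{N+2}` from `κ = 0` to `κ = 1`; the unknown
  -- `j_{N+1} (0)` contributes a multiple of `κ ^ 2 - κ` to `j_{N+2}`, which has the same value at both
  set J' : ℕ → ℕ → ℕ × ℂ → ℂ := fun k => if k < N + 1 then J0 k else
    fun i => if i = 0 then 0 else E (i - 1) with hJ'
  have hJm' : ∀ k i, J' k i ∈ univPoly := by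
    intro k i
    simp only [hJ']
    by_cases h : k < N + 1
    · rw [if_pos h]; exact hJ0 k h i
    · rw [if_neg h]
      split_ifs
      · exact univPoly.zero_mem
      · exact hEm _
  obtain ⟨E', hEm', hE0', hE'⟩ := exists_increment (N + 2) hJm'
  have hincr : ∀ (m : ℕ) (ζ lam : ℂ), m ≠ 0 → IsPrimitiveRoot ζ m → lam ≠ 0 → ∀ ell,
      jval m ζ lam ell (N + 1 + 1) 1 - jval m ζ lam ell (N + 1 + 1) 0 =
        ∑ i ∈ Finset.range (N + 1 + 1), E' i (m, 1) * (ell ^ m / lam ^ m) ^ (i + 1) := by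
    intro m ζ lam hm hζ hlam ell
    obtain ⟨p, hp⟩ := exists_poly_jval (m := m) (ζ := ζ) (lam := lam) ell (N + 2)
    choose r hr using fun i => exists_polynomial_of_mem_univPoly (hEm' i) m
    set c := jval m ζ lam ell (N + 1) 0 with hc
    have h := eval_eq_of_periodic (s := m) (p := p + C (ell ^ m / lam ^ m * c / 2) * (X ^ 2 - X) -
      ∑ i ∈ Finset.range (N + 2), r i * C ((ell ^ m / lam ^ m) ^ (i + 1)))
      (by exact_mod_cast hm) (fun κ => by
        have h1 := jval_recurrence hm hζ hlam ell (N + 2) κ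
        have h2 := hE' m κ (ell ^ m / lam ^ m)
        have h3 : ∀ s ∈ Finset.range (N + 2), orderCoeff m (s + 1) κ *
            jval m ζ lam ell (N + 2 - (s + 1)) (κ + m - (s + 1)) = (orderCoeff m (s + 1) κ *
            ∑ i ∈ Finset.range (N + 2), J' (N + 2 - (s + 1)) i (m, κ + m - (s + 1)) *
              (ell ^ m / lam ^ m) ^ i) + if s = 0 then orderCoeff m 1 κ * c else 0 := by
          intro s hs
          rcases Nat.eq_zero_or_pos s with rfl | hs0
          · rw [if_pos rfl, show N + 2 - (0 + 1) = N + 1 by omega, hbase m ζ lam hm hζ hlam, ← hc,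
              Finset.sum_range_succ' _ (N + 1)]
            simp only [hJ', lt_irrefl, if_false, if_true,
              Nat.succ_ne_zero, Nat.add_sub_cancel, Pi.zero_apply]
            ring
          · rw [if_neg hs0.ne', add_zero, hJe (N + 2 - (s + 1)) (by omega) (N + 2) (by omega)
              m ζ lam hm hζ hlam]
            simp only [hJ, hJ', show N + 2 - (s + 1) < N + 1 by omega, if_true]
        rw [Finset.sum_congr rfl h3, Finset.sum_add_distrib, mul_add, ← h2,
          Finset.sum_ite_eq' (Finset.range (N + 2)) 0, if_pos (by simp), orderCoeff_one, hp, hp] at h1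
        simp only [eval_sub, eval_add, eval_finsetSum, eval_mul, eval_C, ← hr, eval_pow, eval_X]
        linear_combination h1) 1 0
    simp only [eval_sub, eval_add, eval_pow, eval_X, eval_finsetSum, eval_mul, eval_C, ← hr, ← hp,
      hE0', zero_mul, Finset.sum_const_zero, sub_zero] at h
    linear_combination h
  choose e he using fun i => exists_ratPolynomial_of_mem_univPoly (hEm' i) 1
  simp only [Nat.cast_one] at he
  obtain ⟨v, hv⟩ := exists_rootValue (N + 1)
  set V : ℕ → ℚ[X] := fun i => ∑ j ∈ Finset.range (i + 1), e j with hV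
  -- for `m > N + 1` the homogeneous solution `γ * ℓ ^ (N + 1)` is excluded by the equal values at
  -- `ℓ = 1` and `ℓ = ζ`
  have hsum : ∀ m : ℕ, N + 1 < m → ∑ i ∈ Finset.range (N + 1),
      (V i).eval (m : ℚ) / (m * (i + 1) - (N + 1 : ℕ)) = v.eval (m : ℚ) := by
    intro m hm
    have hm0 : m ≠ 0 := by omega
    have hζ := Complex.isPrimitiveRoot_exp m hm0
    set ζ := Complex.exp (2 * Real.pi * Complex.I / m) with hζd
    obtain ⟨γ, hγ⟩ := exists_jval_eq hm0 hζ one_ne_zero (N := N + 1)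
      (e := fun i => E' i (m, 1)) (G := fun i => aeval (m : ℂ) (V i) / (m * (i + 1) - (N + 1 : ℕ)))
      (hincr m ζ 1 hm0 hζ one_ne_zero) (fun i _ => by
        simp only [hV, map_sum, he]
        refine mul_div_cancel₀ _ (sub_ne_zero.2 ?_)
        norm_cast
        nlinarith)
    have h0 := hv m ζ 1 hm0 hζ one_ne_zero ⟨0, by omega⟩
    have h1 := hv m ζ 1 hm0 hζ one_ne_zero ⟨1, by omega⟩
    have hp0 := eqParam_pow (lam := (1 : ℂ)) hζ ⟨0, by omega⟩
    have hp1 := eqParam_pow (lam := (1 : ℂ)) hζ ⟨1, by omega⟩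
    rw [hγ, hp0] at h0
    rw [hγ, hp1] at h1
    simp only [eqParam, pow_zero, one_pow, mul_one, pow_one, div_one] at h0 h1
    have hne : ζ ^ (N + 1) ≠ 1 := hζ.pow_ne_one_of_pos_of_lt (by omega) hm
    have hγ0 : γ = 0 := by
      have : γ * (ζ ^ (N + 1) - 1) = 0 := by linear_combination h1 - h0
      exact (mul_eq_zero.1 this).resolve_right (sub_ne_zero.2 hne)
    rw [hγ0, zero_add] at h0
    have hcast : ∀ p : ℚ[X], aeval (m : ℂ) p = ((p.eval (m : ℚ) : ℚ) : ℂ) := by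
      intro p
      have := aeval_algebraMap_apply_eq_algebraMap_eval (A := ℂ) (m : ℚ) p
      simpa using this
    simp only [hcast] at h0
    exact_mod_cast h0
  choose! g hg using dvd_of_sum_div (Nat.succ_ne_zero N) hsum
  have hgv : ∑ i ∈ Finset.range (N + 1), g i = v := by
    refine eq_of_infinite_eval_eq _ _ (Set.Infinite.mono
      (s := (Nat.cast : ℕ → ℚ) '' Set.Ioi (N + 1)) ?_
      ((Set.Ioi_infinite _).image Nat.cast_injective.injOn))
    rintro _ ⟨m, hm, rfl⟩
    rw [Set.mem_ofPred_eq, ← hsum m hm, eval_finsetSum]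
    refine Finset.sum_congr rfl fun i hi => ?_
    have hne : (m : ℚ) * (i + 1) - (N + 1 : ℕ) ≠ 0 := by
      rw [sub_ne_zero]
      have : N + 1 < m := hm
      norm_cast
      nlinarith
    rw [hg i (Finset.mem_range.1 hi), eq_div_iff hne]
    simp
    ring
  refine ⟨fun i => if i = 0 then 0 else if i ≤ N + 1 then
    E (i - 1) + fun x => aeval (x.1 : ℂ) (g (i - 1)) else 0, fun i => ?_, fun i hi => ?_, ?_⟩
  · simp only
    split_ifs
    · exact univPoly.zero_mem
    · exact univPoly.add_mem (hEm _) (aeval_mem_univPoly _)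
    · exact univPoly.zero_mem
  · simp only
    rw [if_neg (by omega), if_neg (by omega)]
  · intro m ζ lam hm hζ hlam ell κ
    have hl : lam ^ m ≠ 0 := pow_ne_zero _ hlam
    obtain ⟨γ, hγ⟩ := exists_jval_eq hm hζ hlam (N := N + 1)
      (e := fun i => E' i (m, 1)) (G := fun i => aeval (m : ℂ) (g i))
      (hincr m ζ lam hm hζ hlam) (fun i hi => by
        have h1 := congrArg (aeval (m : ℂ)) (hg i hi)
        simp only [hV, map_sum, ← he] at h1
        rw [h1]
        simp only [map_mul, map_sub, map_add, map_natCast, map_one, aeval_X]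
        ring)
    -- now `∑ g_i` is the value at `ℓ = λ`, which excludes the homogeneous solution for every `m`
    have h0 := hv m ζ lam hm hζ hlam ⟨0, by omega⟩
    have hp0 := eqParam_pow (lam := lam) hζ ⟨0, by omega⟩
    rw [hγ, hp0, div_self hl, ← hgv, map_sum] at h0
    have hγ0 : γ = 0 := by
      have : γ * (eqParam m ζ lam ⟨0, by omega⟩) ^ (N + 1) = 0 := by simpa using h0
      exact (mul_eq_zero.1 this).resolve_right
        (pow_ne_zero _ (eqParam_ne_zero hm hζ hlam _))
    rw [hbase m ζ lam hm hζ hlam ell κ, hγ, hγ0, zero_mul, zero_add, Finset.sum_range_succ' _ (N + 1)]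
    simp only [Nat.succ_ne_zero, if_false, if_true, Pi.zero_apply, zero_mul, add_zero,
      Nat.add_sub_cancel]
    rw [← Finset.sum_add_distrib]
    refine Finset.sum_congr rfl fun i hi => ?_
    rw [if_pos (by have := Finset.mem_range.1 hi; omega), Pi.add_apply]
    ring

end Expansion

/-! ### The degree of the universal polynomials -/

noncomputable section Degree

lemma padicNorm_two_inv_lt (n : ℕ) (hn : n ≠ 0) : padicNorm 2 ((1 : ℚ) / n) < 2 ^ n := by
  have h0 : ((n : ℕ) : ℚ) ≠ 0 := by exact_mod_cast hn
  have h1 : ¬ (((2 : ℕ) ^ n : ℕ) : ℤ) ∣ (n : ℤ) := by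
    intro h
    have h2 := Nat.le_of_dvd (Nat.pos_of_ne_zero hn) (by exact_mod_cast h)
    exact absurd h2 (not_le.2 Nat.lt_two_pow_self)
  rw [padicNorm.dvd_iff_norm_le, not_le] at h1
  rw [padicNorm.div, padicNorm.one]
  have h3 : 0 < padicNorm 2 (n : ℚ) :=
    lt_of_le_of_ne (padicNorm.nonneg _) (Ne.symm (padicNorm.nonzero h0))
  rw [div_lt_iff₀ h3]
  have h4 : ((2 : ℕ) : ℚ) ^ (-(n : ℤ)) < padicNorm 2 (n : ℚ) := by exact_mod_cast h1
  rw [zpow_neg, zpow_natCast, Nat.cast_ofNat, inv_lt_iff_one_lt_mul₀ (by positivity)] at h4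
  rwa [mul_comm] at h4

/-- Bernoulli numbers are integral at two up to a factor of two. -/
lemma padicNorm_two_bernoulli_le (k : ℕ) : padicNorm 2 (bernoulli (2 * k)) ≤ 2 := by
  obtain ⟨z, hz⟩ := Bernoulli.vonStaudt_clausen k
  have h : bernoulli (2 * k) = z - ∑ p ∈ Finset.range (2 * k + 2) with
      Nat.Prime p ∧ p - 1 ∣ 2 * k, 1 / (p : ℚ) := by
    rw [hz]; ring
  rw [h]
  refine padicNorm.sub.trans (max_le ((padicNorm.of_int z).trans one_le_two) ?_)
  refine padicNorm.sum_le' (fun p hp => ?_) zero_le_two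
  obtain ⟨hp1, _⟩ := (Finset.mem_filter.1 hp).2
  rw [padicNorm.div, padicNorm.one]
  by_cases h2 : p = 2
  · subst h2
    rw [padicNorm.padicNorm_p_of_prime]
    norm_num
  · have : Fact p.Prime := ⟨hp1⟩
    rw [padicNorm.padicNorm_of_prime_of_ne (Ne.symm h2)]
    norm_num

/-- The coefficients of `exp (- ∑ B_{r+1} / (r (r + 1)) * w ^ r)`, the reciprocal of Stirling's
series. -/
def stirling : ℕ → ℚ
  | 0 => 1
  | n + 1 => 1 / ((n : ℚ) + 1) * ∑ r : Fin (n + 1),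
      bernoulli (r + 2) / (r + 2) * (-1) ^ ((r : ℕ) + 1) * stirling (n - r)

lemma stirling_succ (n : ℕ) : ((n : ℚ) + 1) * stirling (n + 1) = ∑ r ∈ Finset.range (n + 1),
    bernoulli (r + 2) / (r + 2) * (-1) ^ (r + 1) * stirling (n - r) := by
  rw [stirling, ← mul_assoc, mul_one_div_cancel (by exact_mod_cast Nat.succ_ne_zero n), one_mul,
    Finset.sum_range]

/-- In the recursion for `n! * 12 ^ n * stirling n`, the term with `r = 0` is minus the preceding
number, since `12 * B_2 / 2 = 1`, and the other terms are divisible by two. -/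
lemma padicNorm_stirling (n : ℕ) :
    padicNorm 2 ((n.factorial : ℚ) * 12 ^ n * stirling n) = 1 := by
  induction n using Nat.strong_induction_on with
  | _ n ih =>
    cases n with
    | zero => simp [stirling]
    | succ k =>
      have hrec : ((k + 1).factorial : ℚ) * 12 ^ (k + 1) * stirling (k + 1) =
          ∑ r ∈ Finset.range (k + 1), 12 ^ (r + 1) * (k.descFactorial r : ℚ) *
            (bernoulli (r + 2) / (r + 2)) * (-1) ^ (r + 1) *
            (((k - r).factorial : ℚ) * 12 ^ (k - r) * stirling (k - r)) := by
        rw [Nat.factorial_succ]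
        push_cast
        have h1 := stirling_succ k
        have h2 : ((k : ℚ) + 1) * (k.factorial : ℚ) * 12 ^ (k + 1) * stirling (k + 1) =
            (k.factorial : ℚ) * 12 ^ (k + 1) * (((k : ℚ) + 1) * stirling (k + 1)) := by ring
        rw [h2, h1, Finset.mul_sum]
        refine Finset.sum_congr rfl fun r hr => ?_
        have hr' : r ≤ k := Nat.lt_succ_iff.1 (Finset.mem_range.1 hr)
        have h3 : (k.factorial : ℚ) = ((k - r).factorial : ℚ) * k.descFactorial r := by
          exact_mod_cast (Nat.factorial_mul_descFactorial hr').symm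
        have h4 : (12 : ℚ) ^ (k + 1) = 12 ^ (r + 1) * 12 ^ (k - r) := by
          rw [← pow_add]; congr 1; omega
        rw [h3, h4]
        ring
      rw [hrec, Finset.sum_range_succ']
      have hlast : padicNorm 2 (12 ^ (0 + 1) * (k.descFactorial 0 : ℚ) *
            (bernoulli (0 + 2) / ((0 : ℕ) + 2)) * (-1) ^ (0 + 1) *
            (((k - 0).factorial : ℚ) * 12 ^ (k - 0) * stirling (k - 0))) = 1 := by
        rw [Nat.sub_zero, zero_add, bernoulli_two, Nat.descFactorial_zero]
        have : (12 : ℚ) ^ 1 * (1 : ℕ) * (6⁻¹ / ((0 : ℕ) + 2)) * (-1) ^ 1 *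
            ((k.factorial : ℚ) * 12 ^ k * stirling k) =
            -((k.factorial : ℚ) * 12 ^ k * stirling k) := by norm_num
        rw [this, padicNorm.neg, ih k (Nat.lt_succ_self k)]
      have hrest : padicNorm 2 (∑ r ∈ Finset.range k, 12 ^ (r + 1 + 1) *
          (k.descFactorial (r + 1) : ℚ) *
          (bernoulli (r + 1 + 2) / ((r + 1 : ℕ) + 2)) * (-1) ^ (r + 1 + 1) *
          (((k - (r + 1)).factorial : ℚ) * 12 ^ (k - (r + 1)) * stirling (k - (r + 1)))) < 1 := by
        refine padicNorm.sum_lt' (fun r hr => ?_) one_pos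
        rcases Nat.even_or_odd r with he | ho
        · rw [bernoulli_eq_zero_of_odd (by
            rw [show r + 1 + 2 = r + 2 + 1 by ring]
            exact (he.add (by decide : Even 2)).add_one) (by omega)]
          simp
        · obtain ⟨s, rfl⟩ := ho
          have h12 : padicNorm 2 (12 : ℚ) = 1 / 4 := by
            rw [show (12 : ℚ) = ((2 : ℕ) : ℚ) * ((2 : ℕ) : ℚ) * ((3 : ℕ) : ℚ) by norm_num,
              padicNorm.mul, padicNorm.mul, padicNorm.padicNorm_p_of_prime,
              (padicNorm.nat_eq_one_iff 3).2 (by decide)]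
            norm_num
          have hpow : ∀ (x : ℚ) (n : ℕ), padicNorm 2 (x ^ n) = padicNorm 2 x ^ n := by
            intro x n
            induction n with
            | zero => simp
            | succ n ih => rw [pow_succ, padicNorm.mul, ih, pow_succ]
          have hB := padicNorm_two_bernoulli_le (s + 2)
          have hI := padicNorm_two_inv_lt (2 * s + 1 + 1 + 2) (by omega)
          have hD := padicNorm.of_nat (p := 2) (k.descFactorial (2 * s + 1 + 1))
          rw [padicNorm.mul, padicNorm.mul, padicNorm.mul, padicNorm.mul,
            ih (k - (2 * s + 1 + 1)) (by omega), mul_one, hpow, hpow, h12, padicNorm.neg,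
            padicNorm.one, one_pow, mul_one, div_eq_mul_one_div (bernoulli _), padicNorm.mul,
            show 2 * s + 1 + 1 + 2 = 2 * (s + 2) by ring]
          rw [show 2 * s + 1 + 1 + 2 = 2 * (s + 2) by ring] at hI
          have e1 : ((2 * s + 1 + 1 : ℕ) : ℚ) + 2 = ((2 * (s + 2) : ℕ) : ℚ) := by push_cast; ring
          rw [e1]
          have n1 := padicNorm.nonneg (p := 2) (k.descFactorial (2 * s + 1 + 1) : ℚ)
          have n2 := padicNorm.nonneg (p := 2) (bernoulli (2 * (s + 2)))
          have n3 := padicNorm.nonneg (p := 2) (1 / ((2 * (s + 2) : ℕ) : ℚ))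
          calc (1 / 4 : ℚ) ^ (2 * s + 1 + 1 + 1) *
                padicNorm 2 (k.descFactorial (2 * s + 1 + 1) : ℚ) *
                (padicNorm 2 (bernoulli (2 * (s + 2))) * padicNorm 2 (1 / ((2 * (s + 2) : ℕ) : ℚ)))
              ≤ (1 / 4 : ℚ) ^ (2 * s + 1 + 1 + 1) * 1 * (2 * 2 ^ (2 * (s + 2))) := by
                gcongr
            _ = 1 / 2 * (1 / 4) ^ s := by
                rw [pow_mul 2 2, show 2 * s + 1 + 1 + 1 = s + s + 3 by ring, pow_add, pow_add,
                  pow_add]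
                have : (1 / 4 : ℚ) ^ s * 4 ^ s = 1 := by rw [← mul_pow]; norm_num
                norm_num
                linear_combination (1 / 2 * (1 / 4 : ℚ) ^ s) * this
            _ < 1 := by
                have : (1 / 4 : ℚ) ^ s ≤ 1 := pow_le_one₀ (by norm_num) (by norm_num)
                linarith
      rw [padicNorm.add_eq_max_of_ne (by rw [hlast]; exact hrest.ne), hlast, max_eq_right hrest.le]

lemma stirling_ne_zero (n : ℕ) : stirling n ≠ 0 := by
  intro h
  have := padicNorm_stirling n
  rw [h, mul_zero, padicNorm.zero] at this
  exact zero_ne_one this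

variable {m : ℕ} {ζ lam : ℂ}

lemma jval_one_eq_jval_zero (hm : m ≠ 0) (hζ : IsPrimitiveRoot ζ m) (hlam : lam ≠ 0) (n : ℕ)
    {ell : ℂ} (hell : ell ^ m = lam ^ m) : jval m ζ lam ell n 1 = jval m ζ lam ell n 0 := by
  cases n with
  | zero => rw [jval_zero, jval_zero]
  | succ n =>
    have h := derivative_linePoly_eval hm hζ hlam n ell 0
    rw [hell, sub_self, zero_mul, zero_mul, zero_mul, add_zero, zero_add, eq_comm, neg_eq_zero,
      mul_eq_zero, mul_eq_zero] at h
    have hm' : (m : ℂ) ≠ 0 := by exact_mod_cast hm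
    have h2 := h.resolve_left (not_or.2 ⟨hm', pow_ne_zero _ hlam⟩)
    rw [jval, jval, sub_eq_zero.1 h2]

lemma jval_one_stirling (n : ℕ) : jval 1 1 1 1 n 1 = stirling n := by
  have hζ : IsPrimitiveRoot (1 : ℂ) 1 := IsPrimitiveRoot.one
  rw [jval_one_eq_jval_zero one_ne_zero hζ one_ne_zero n rfl]
  have h := isGammaSeq_fval one_ne_zero hζ (one_ne_zero (α := ℂ)) (0 : Fin 1)
  have h2 : IsGammaSeq (fun n => (-1) ^ n) (fun n => (stirling n : ℂ)) := by
    refine ⟨by simp [stirling], fun k => ?_⟩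
    have := congrArg (Rat.cast : ℚ → ℂ) (stirling_succ k)
    push_cast at this
    exact this
  have h3 : (fun n => (∑ i ∈ Finset.univ.erase (0 : Fin 1), ((eqParam 1 1 (1 : ℂ) 0 -
      eqParam 1 1 1 i) ^ n)⁻¹) + ((-(((1 : ℕ) : ℂ) * eqParam 1 1 1 0)) ^ n)⁻¹) =
      fun n => (-1 : ℂ) ^ n := by
    ext n
    simp [eqParam, ← inv_pow]
  rw [h3] at h
  have h4 := congrFun (h.ext h2) n
  simp only [eqParam, Fin.val_zero, pow_zero, one_mul] at h4
  rw [jval, linePt_zero, h4]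
  simp

/-- The universal polynomials. The divisibility by `X ^ k` comes from the factor `ℓ ^ k` in the
definition of `jval`, and the degree is attained at `m = 1`. -/
theorem exists_universal_polynomials : ∃ P : ℕ → Polynomial (Polynomial ℚ),
    (∀ k, (P k).natDegree = k) ∧
    (∀ m : ℕ, m ≠ 0 → ∀ k,
      Polynomial.X ^ k ∣ Polynomial.expand ℚ m (specialize m (P k))) ∧
    ∀ (m : ℕ) (ζ lam : ℂ), m ≠ 0 → IsPrimitiveRoot ζ m → lam ≠ 0 → ∀ (ell : ℂ) (k : ℕ),
      jval m ζ lam ell k 1 = Polynomial.aeval (ell ^ m / lam ^ m) (specialize m (P k)) := by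
  choose J hJ hJ0 hJe using exists_jval_expansion
  choose p hp using fun k i => exists_ratPolynomial_of_mem_univPoly (hJ k i) 1
  set P : ℕ → Polynomial (Polynomial ℚ) := fun k =>
    ∑ i ∈ Finset.range (k + 1), Polynomial.C (p k i) * Polynomial.X ^ i with hP
  have hval : ∀ (m : ℕ) (ζ lam : ℂ), m ≠ 0 → IsPrimitiveRoot ζ m → lam ≠ 0 → ∀ (ell : ℂ) (k : ℕ),
      jval m ζ lam ell k 1 = Polynomial.aeval (ell ^ m / lam ^ m) (specialize m (P k)) := by
    intro m ζ lam hm hζ hlam ell k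
    rw [hJe k m ζ lam hm hζ hlam, hP, specialize]
    simp only [Polynomial.map_sum, map_sum]
    refine Finset.sum_congr rfl fun i _ => ?_
    have h1 := hp k i m
    rw [Nat.cast_one] at h1
    have h2 : Polynomial.aeval (m : ℂ) (p k i) = (((p k i).eval (m : ℚ) : ℚ) : ℂ) := by
      have := Polynomial.aeval_algebraMap_apply_eq_algebraMap_eval (A := ℂ) (m : ℚ) (p k i)
      simpa using this
    rw [h1, h2]
    simp
  have hdvd : ∀ m : ℕ, m ≠ 0 → ∀ k,
      Polynomial.X ^ k ∣ Polynomial.expand ℚ m (specialize m (P k)) := by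
    intro m hm k
    have hζ := Complex.isPrimitiveRoot_exp m hm
    set ζ := Complex.exp (2 * Real.pi * Complex.I / m)
    have h1 : Polynomial.X ^ k * (Polynomial.C ((m : ℂ) ^ k) * linePoly m ζ 1 k 1) =
        (Polynomial.expand ℚ m (specialize m (P k))).map (algebraMap ℚ ℂ) := by
      refine Polynomial.funext fun ell => ?_
      have h := hval m ζ 1 hm hζ one_ne_zero ell k
      rw [one_pow, div_one] at h
      rw [Polynomial.eval_map_algebraMap, Polynomial.expand_aeval, ← h, jval, mul_pow,
        ← eval_linePoly]
      simp only [Polynomial.eval_mul, Polynomial.eval_pow, Polynomial.eval_X, Polynomial.eval_C]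
      ring
    rw [Polynomial.X_pow_dvd_iff]
    intro d hd
    have h2 := Polynomial.X_pow_dvd_iff.1 (Dvd.intro _ h1) d hd
    rw [Polynomial.coeff_map] at h2
    exact (map_eq_zero _).1 h2
  refine ⟨P, fun k => ?_, hdvd, hval⟩
  have hcoeff : ∀ i, (P k).coeff i = if i < k + 1 then p k i else 0 := by
    intro i
    simp only [hP, Polynomial.finsetSum_coeff, Polynomial.coeff_C_mul_X_pow]
    simp
  refine le_antisymm (Polynomial.natDegree_le_iff_coeff_eq_zero.2 fun i hi => ?_)
    (Polynomial.le_natDegree_of_ne_zero fun h0 => ?_)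
  · rw [hcoeff, if_neg (by omega)]
  · have h1 := hval 1 1 1 one_ne_zero IsPrimitiveRoot.one one_ne_zero 1 k
    rw [jval_one_stirling, one_pow, div_one] at h1
    have h2 := hdvd 1 one_ne_zero k
    rw [Polynomial.expand_one, Polynomial.X_pow_dvd_iff] at h2
    have h3 : specialize 1 (P k) = 0 := by
      ext i
      rw [Polynomial.coeff_zero]
      rcases lt_trichotomy i k with h | h | h
      · exact h2 i h
      · rw [h, specialize, Polynomial.coeff_map, h0, map_zero]
      · rw [specialize, Polynomial.coeff_map, hcoeff, if_neg (by omega), map_zero]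
    rw [h3, map_zero] at h1
    exact stirling_ne_zero k (by exact_mod_cast h1)

end Degree

/-! ### Determinants and derivations -/

section Jacobi

variable {R A : Type*} [CommRing R] [CommRing A] [Algebra R A] (D : Derivation R A A)

lemma derivation_prod {ι : Type*} [DecidableEq ι] (s : Finset ι) (f : ι → A) :
    D (∏ i ∈ s, f i) = ∑ i ∈ s, (∏ j ∈ s.erase i, f j) * D (f i) := by
  induction s using Finset.induction_on with
  | empty => simp
  | insert a s ha ih =>
    rw [Finset.prod_insert ha, D.leibniz, ih, Finset.sum_insert ha, Finset.erase_insert ha,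
      smul_eq_mul, smul_eq_mul, Finset.mul_sum, add_comm]
    congr 1
    refine Finset.sum_congr rfl fun i hi => ?_
    have hai : a ≠ i := fun h => ha (h ▸ hi)
    rw [Finset.erase_insert_of_ne hai, Finset.prod_insert (fun h => ha (Finset.mem_of_mem_erase h)),
      mul_assoc]

/-- Jacobi's formula for the derivative of a determinant. -/
lemma derivation_det {n : Type*} [Fintype n] [DecidableEq n] (M : Matrix n n A) :
    D M.det = ∑ i, ∑ l, M.adjugate i l * D (M l i) := by
  have h : ∀ i, ∑ l, M.adjugate i l * D (M l i) = (M.updateCol i fun l => D (M l i)).det := by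
    intro i
    rw [← Matrix.cramer_apply, Matrix.cramer_eq_adjugate_mulVec]
    rfl
  simp only [h, Matrix.det_apply']
  rw [map_sum, Finset.sum_comm]
  refine Finset.sum_congr rfl fun σ _ => ?_
  rw [D.leibniz, D.map_intCast, smul_zero, add_zero, smul_eq_mul, derivation_prod, Finset.mul_sum]
  refine Finset.sum_congr rfl fun i _ => ?_
  congr 1
  rw [← Finset.mul_prod_erase _ _ (Finset.mem_univ i), Matrix.updateCol_self, mul_comm]
  congr 1
  refine Finset.prod_congr rfl fun j hj => ?_
  rw [Matrix.updateCol_ne (Finset.ne_of_mem_erase hj)]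

/-- The columns of the adjugate of a Jacobian matrix are divergence free, up to a factor of the
Jacobian. -/
lemma det_mul_divergence_adjugate {n : Type*} [Fintype n] [DecidableEq n]
    (D : n → Derivation R A A) (hD : ∀ i j a, D i (D j a) = D j (D i a)) (ψ : n → A) (i : n) :
    (Matrix.of fun l j => D j (ψ l)).det *
      ∑ j, D j ((Matrix.of fun l j => D j (ψ l)).adjugate j i) = 0 := by
  set M : Matrix n n A := Matrix.of fun l j => D j (ψ l) with hM
  have hMa : ∀ l j, M l j = D j (ψ l) := fun l j => rfl
  set Z : n → A := fun i => ∑ j, D j (M.adjugate j i) with hZ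
  -- the derivative of `adjugate M * M = det M`, with Jacobi's formula for the derivative of `det M`
  have h1 : Matrix.vecMul Z M = 0 := by
    ext l
    have h2 : ∀ j, D j (∑ i, M.adjugate j i * M i l) = if j = l then D j M.det else 0 := by
      intro j
      have := congrFun (congrFun (Matrix.adjugate_mul M) j) l
      rw [Matrix.mul_apply, Matrix.smul_apply, Matrix.one_apply, smul_eq_mul] at this
      rw [this]
      split_ifs <;> simp
    have h3 : ∑ j, D j (∑ i, M.adjugate j i * M i l) = D l M.det := by
      rw [Finset.sum_congr rfl fun j _ => h2 j]
      simp
    rw [derivation_det] at h3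
    simp only [map_sum, Derivation.leibniz, smul_eq_mul, Finset.sum_add_distrib] at h3
    have h4 : ∑ j, ∑ i, M.adjugate j i * D j (M i l) = ∑ j, ∑ i, M.adjugate j i * D l (M i j) := by
      refine Finset.sum_congr rfl fun j _ => Finset.sum_congr rfl fun i _ => ?_
      rw [hMa, hMa, hD]
    rw [h4, add_eq_left] at h3
    simp only [Matrix.vecMul, dotProduct, hZ, Finset.sum_mul, Pi.zero_apply]
    rw [Finset.sum_comm, ← h3]
    exact Finset.sum_congr rfl fun j _ => Finset.sum_congr rfl fun i _ => mul_comm _ _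
  have h5 := congrFun (congrArg (fun v => Matrix.vecMul v M.adjugate) h1) i
  simp only [Matrix.vecMul_vecMul, Matrix.mul_adjugate, Matrix.zero_vecMul, Pi.zero_apply,
    Matrix.vecMul_smul, Matrix.vecMul_one, Pi.smul_apply, smul_eq_mul] at h5
  exact h5

end Jacobi

/-! ### The functional of iterated Laplacians at the origin -/

noncomputable section Smooth

variable (m : ℕ)

/-- Smooth complex-valued functions on Euclidean space. -/
def smoothAlg : Subalgebra ℂ (EuclideanSpace ℝ (Fin m) → ℂ) where
  carrier := {f | ContDiff ℝ ((⊤ : ℕ∞) : WithTop ℕ∞) f}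
  mul_mem' := by
    simp only [Set.mem_ofPred_eq]
    exact fun hf hg => hf.mul hg
  add_mem' := by
    simp only [Set.mem_ofPred_eq]
    exact fun hf hg => hf.add hg
  algebraMap_mem' := by
    simp only [Set.mem_ofPred_eq]
    exact fun c => contDiff_const (c := c)

variable {m}

lemma mem_smoothAlg {f : EuclideanSpace ℝ (Fin m) → ℂ} :
    f ∈ smoothAlg m ↔ ContDiff ℝ ((⊤ : ℕ∞) : WithTop ℕ∞) f := by
  rw [← SetLike.mem_coe]
  exact Set.mem_ofPred_eq ▸ Iff.rfl

lemma smoothAlg_contDiff (f : smoothAlg m) : ContDiff ℝ ((⊤ : ℕ∞) : WithTop ℕ∞) f.1 :=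
  mem_smoothAlg.1 f.2

lemma smoothAlg_differentiable (f : smoothAlg m) : Differentiable ℝ f.1 :=
  (smoothAlg_contDiff f).differentiable (by simp)

lemma contDiff_fderiv_apply {f : EuclideanSpace ℝ (Fin m) → ℂ}
    (hf : ContDiff ℝ ((⊤ : ℕ∞) : WithTop ℕ∞) f) (v : EuclideanSpace ℝ (Fin m)) :
    ContDiff ℝ ((⊤ : ℕ∞) : WithTop ℕ∞) fun x => fderiv ℝ f x v :=
  (hf.fderiv_right (m := ((⊤ : ℕ∞) : WithTop ℕ∞)) (by simp)).clm_apply contDiff_const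

/-- The partial derivative as a derivation of the algebra of smooth functions. -/
def pd (j : Fin m) : Derivation ℂ (smoothAlg m) (smoothAlg m) :=
  Derivation.mk'
    { toFun := fun f => ⟨fun x => fderiv ℝ f.1 x (EuclideanSpace.single j 1),
        mem_smoothAlg.2 (contDiff_fderiv_apply (smoothAlg_contDiff f) _)⟩
      map_add' := fun f g => by
        ext x
        change fderiv ℝ (f.1 + g.1) x _ = _
        rw [fderiv_add (smoothAlg_differentiable f x) (smoothAlg_differentiable g x)]
        rfl
      map_smul' := fun c f => by
        ext x
        change fderiv ℝ (c • f.1) x _ = _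
        rw [fderiv_const_smul (smoothAlg_differentiable f x)]
        rfl }
    (fun f g => by
      ext x
      change fderiv ℝ (f.1 * g.1) x _ = f.1 x * _ + g.1 x * _
      rw [fderiv_mul (smoothAlg_differentiable f x) (smoothAlg_differentiable g x)]
      rfl)

lemma pd_apply (j : Fin m) (f : smoothAlg m) (x : EuclideanSpace ℝ (Fin m)) :
    (pd j f).1 x = fderiv ℝ f.1 x (EuclideanSpace.single j 1) := rfl

lemma pd_comm (i j : Fin m) (f : smoothAlg m) : pd i (pd j f) = pd j (pd i f) := by
  ext x
  have h1 : ContDiff ℝ ((⊤ : ℕ∞) : WithTop ℕ∞) (fderiv ℝ f.1) :=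
    (smoothAlg_contDiff f).fderiv_right (by simp)
  have h : ∀ i j : Fin m, (pd i (pd j f)).1 x =
      fderiv ℝ (fderiv ℝ f.1) x (EuclideanSpace.single i 1) (EuclideanSpace.single j 1) := by
    intro i j
    rw [pd_apply]
    change fderiv ℝ (fun y => fderiv ℝ f.1 y (EuclideanSpace.single j 1)) x _ = _
    rw [fderiv_clm_apply (h1.differentiable (by simp) x) (differentiableAt_const _)]
    simp
  rw [h, h]
  exact ((smoothAlg_contDiff f).contDiffAt.isSymmSndFDerivAt (by
    rw [minSmoothness_of_isRCLikeNormedField]; 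
    exact WithTop.coe_le_coe.2 (le_top : (2 : ℕ∞) ≤ ⊤))).eq _ _

/-- The exponential of a smooth function. -/
def smoothExp (f : smoothAlg m) : smoothAlg m := ⟨fun x => Complex.exp (f.1 x), mem_smoothAlg.2 (smoothAlg_contDiff f).cexp⟩

lemma smoothExp_apply (f : smoothAlg m) (x : EuclideanSpace ℝ (Fin m)) :
    (smoothExp f).1 x = Complex.exp (f.1 x) := rfl

lemma smoothExp_add (f g : smoothAlg m) : smoothExp (f + g) = smoothExp f * smoothExp g := by
  ext x
  exact Complex.exp_add _ _

lemma smoothExp_zero : smoothExp (0 : smoothAlg m) = 1 := by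
  ext x
  exact Complex.exp_zero

lemma pd_smoothExp (j : Fin m) (f : smoothAlg m) :
    pd j (smoothExp f) = smoothExp f * pd j f := by
  ext x
  have h := ((smoothAlg_differentiable f x).hasFDerivAt.cexp).fderiv
  rw [pd_apply]
  change fderiv ℝ (fun y => Complex.exp (f.1 y)) x _ = _
  rw [h]
  rfl

/-- The coordinate functions. -/
def coordFn (j : Fin m) : smoothAlg m :=
  ⟨fun x => (x j : ℂ), mem_smoothAlg.2
    (Complex.ofRealCLM.contDiff.comp (EuclideanSpace.proj (𝕜 := ℝ) j).contDiff)⟩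

lemma coordFn_apply (j : Fin m) (x : EuclideanSpace ℝ (Fin m)) : (coordFn j).1 x = x j := rfl

lemma pd_coordFn (i j : Fin m) : pd i (coordFn j) = if i = j then 1 else 0 := by
  ext x
  rw [pd_apply]
  have h : (coordFn j).1 = (Complex.ofRealCLM.comp
      (EuclideanSpace.proj (𝕜 := ℝ) j : EuclideanSpace ℝ (Fin m) →L[ℝ] ℝ) :
      EuclideanSpace ℝ (Fin m) →L[ℝ] ℂ) := rfl
  rw [h, ContinuousLinearMap.fderiv]
  by_cases hij : i = j
  · subst hij; simp
  · simp [hij, Ne.symm hij]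

/-- Evaluation at the origin. -/
def evalZero : smoothAlg m →ₐ[ℂ] ℂ :=
  (Pi.evalAlgHom ℂ (fun _ : EuclideanSpace ℝ (Fin m) => ℂ) 0).comp (smoothAlg m).val

lemma evalZero_apply (f : smoothAlg m) : evalZero f = f.1 0 := rfl

/-- The Laplacian. -/
def laplace : Module.End ℂ (smoothAlg m) := ∑ j, (pd j).toLinearMap * (pd j).toLinearMap

lemma laplace_apply (f : smoothAlg m) : laplace f = ∑ j, pd j (pd j f) := by
  simp [laplace, LinearMap.sum_apply]

lemma pd_laplace_pow (j : Fin m) (k : ℕ) (f : smoothAlg m) :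
    pd j ((laplace ^ k) f) = (laplace ^ k) (pd j f) := by
  induction k generalizing f with
  | zero => rfl
  | succ k ih =>
    rw [pow_succ, Module.End.mul_apply, Module.End.mul_apply, ih]
    congr 1
    rw [laplace_apply, laplace_apply, map_sum]
    refine Finset.sum_congr rfl fun i _ => ?_
    rw [pd_comm, pd_comm j i f]

lemma laplace_coordFn_mul (j : Fin m) (f : smoothAlg m) :
    laplace (coordFn j * f) = coordFn j * laplace f + 2 * pd j f := by
  have h0 : ∀ i, pd i (coordFn j * f) = coordFn j * pd i f + if i = j then f else 0 := by
    intro i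
    rw [Derivation.leibniz, pd_coordFn]
    split_ifs <;> simp
  have h1 : ∀ i, pd i (pd i (coordFn j * f)) =
      coordFn j * pd i (pd i f) + if i = j then 2 * pd j f else 0 := by
    intro i
    rw [h0, map_add, Derivation.leibniz, pd_coordFn]
    split_ifs with h
    · subst h; simp; ring
    · simp
  simp only [laplace_apply, h1, Finset.sum_add_distrib, Finset.mul_sum]
  simp

lemma laplace_pow_coordFn_mul (j : Fin m) (k : ℕ) (f : smoothAlg m) :
    (laplace ^ (k + 1)) (coordFn j * f) =
      coordFn j * (laplace ^ (k + 1)) f + (2 * ((k : ℂ) + 1)) • (laplace ^ k) (pd j f) := by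
  induction k with
  | zero => rw [zero_add, pow_one, laplace_coordFn_mul]; simp [two_mul, two_smul]
  | succ k ih =>
    rw [pow_succ' laplace (k + 1), Module.End.mul_apply, ih, map_add, laplace_coordFn_mul,
      map_smul, pd_laplace_pow, ← Module.End.mul_apply laplace (laplace ^ k),
      ← pow_succ' laplace k, ← Module.End.mul_apply laplace (laplace ^ (k + 1)), add_assoc]
    congr 1
    push_cast
    rw [two_mul]
    module

/-- The coefficients in the expansion of Gaussian integrals,
`∫ exp (- ‖x‖ ^ 2 / ħ) g = (π ħ) ^ (m / 2) * ∑ gaussCoeff k g * ħ ^ k`. -/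
def gaussCoeff (k : ℕ) : smoothAlg m →ₗ[ℂ] ℂ :=
  (1 / (4 ^ k * (k.factorial : ℂ))) • evalZero.toLinearMap.comp (laplace ^ k)

lemma gaussCoeff_apply (k : ℕ) (f : smoothAlg m) :
    gaussCoeff k f = 1 / (4 ^ k * (k.factorial : ℂ)) * evalZero ((laplace ^ k) f) := rfl

lemma gaussCoeff_zero (f : smoothAlg m) : gaussCoeff 0 f = evalZero f := by
  simp [gaussCoeff_apply]

lemma gaussCoeff_laplace (k : ℕ) (f : smoothAlg m) :
    gaussCoeff k (laplace f) = 4 * ((k : ℂ) + 1) * gaussCoeff (k + 1) f := by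
  rw [gaussCoeff_apply, gaussCoeff_apply, pow_succ laplace, Module.End.mul_apply,
    Nat.factorial_succ]
  have h1 : ((k : ℂ) + 1) ≠ 0 := by exact_mod_cast Nat.succ_ne_zero k
  have h2 : (k.factorial : ℂ) ≠ 0 := by exact_mod_cast Nat.factorial_ne_zero k
  push_cast
  field_simp
  ring

/-- Integration by parts. -/
lemma gaussCoeff_coordFn_mul (k : ℕ) (j : Fin m) (f : smoothAlg m) :
    gaussCoeff (k + 1) (coordFn j * f) = 1 / 2 * gaussCoeff k (pd j f) := by
  rw [gaussCoeff_apply, gaussCoeff_apply, laplace_pow_coordFn_mul, map_add, map_mul, map_smul,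
    evalZero_apply (coordFn j), coordFn_apply, Nat.factorial_succ]
  have h1 : ((k : ℂ) + 1) ≠ 0 := by exact_mod_cast Nat.succ_ne_zero k
  have h2 : (k.factorial : ℂ) ≠ 0 := by exact_mod_cast Nat.factorial_ne_zero k
  push_cast
  simp only [PiLp.zero_apply, Complex.ofReal_zero, zero_mul, zero_add, smul_eq_mul]
  field_simp
  ring

/-- Multiplication by the squared norm. -/
lemma gaussCoeff_normSq_mul (k : ℕ) (f : smoothAlg m) :
    gaussCoeff (k + 1) ((∑ j, coordFn j * coordFn j) * f) = ((m : ℂ) / 2 + k) * gaussCoeff k f := by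
  have h1 : ∀ j, gaussCoeff k (coordFn j * pd j f) = 
      if k = 0 then 0 else 1 / 2 * gaussCoeff (k - 1) (pd j (pd j f)) := by
    intro j
    cases k with
    | zero => simp [gaussCoeff_zero, evalZero_apply (coordFn j), coordFn_apply]
    | succ k => rw [gaussCoeff_coordFn_mul]; simp
  have h2 : ∑ j, gaussCoeff k (coordFn j * pd j f) = 2 * k * gaussCoeff k f := by
    simp only [h1]
    cases k with
    | zero => simp
    | succ k =>
      simp only [Nat.succ_ne_zero, if_false, Nat.add_sub_cancel]
      rw [← Finset.mul_sum, ← map_sum, ← laplace_apply, gaussCoeff_laplace]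
      push_cast
      ring
  rw [Finset.sum_mul, map_sum]
  have h3 : ∀ j, gaussCoeff (k + 1) (coordFn j * coordFn j * f) =
      1 / 2 * gaussCoeff k f + 1 / 2 * gaussCoeff k (coordFn j * pd j f) := by
    intro j
    rw [mul_assoc, gaussCoeff_coordFn_mul, Derivation.leibniz, pd_coordFn, if_pos rfl]
    simp only [smul_eq_mul, mul_one, map_add]
    ring
  simp only [h3, Finset.sum_add_distrib, ← Finset.mul_sum, h2, Finset.sum_const, Finset.card_univ,
    Fintype.card_fin, nsmul_eq_mul]
  ring

/-- The coefficients depend only on the germ at the origin. -/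
lemma gaussCoeff_congr {f g : smoothAlg m} (h : f.1 =ᶠ[𝓝 0] g.1) (k : ℕ) :
    gaussCoeff k f = gaussCoeff k g := by
  have hpd : ∀ (j : Fin m) (f g : smoothAlg m), f.1 =ᶠ[𝓝 0] g.1 →
      (pd j f).1 =ᶠ[𝓝 0] (pd j g).1 := by
    intro j f g h
    filter_upwards [h.fderiv (𝕜 := ℝ)] with x hx
    rw [pd_apply, pd_apply, hx]
  have hl : ∀ (f g : smoothAlg m), f.1 =ᶠ[𝓝 0] g.1 → (laplace f).1 =ᶠ[𝓝 0] (laplace g).1 := by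
    intro f g h
    have h2 : ∀ᶠ x in 𝓝 (0 : EuclideanSpace ℝ (Fin m)), ∀ j : Fin m,
        (pd j (pd j f)).1 x = (pd j (pd j g)).1 x :=
      eventually_all.2 fun j => hpd j _ _ (hpd j _ _ h)
    filter_upwards [h2] with x hx
    have h3 : ∀ f : smoothAlg m, (laplace f).1 x = ∑ j, (pd j (pd j f)).1 x := by
      intro f
      rw [laplace_apply]
      simp
    rw [h3, h3]
    exact Finset.sum_congr rfl fun j _ => hx j
  have hp : ∀ k, ((laplace ^ k) f).1 =ᶠ[𝓝 0] ((laplace ^ k) g).1 := by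
    intro k
    induction k with
    | zero => exact h
    | succ k ih => rw [pow_succ', Module.End.mul_apply, Module.End.mul_apply]; exact hl _ _ ih
  rw [gaussCoeff_apply, gaussCoeff_apply, evalZero_apply, evalZero_apply, (hp k).eq_of_nhds]

end Smooth

/-! ### Uniqueness of the formal functional -/

noncomputable section Uniqueness

open MvPolynomial

variable {m : ℕ}

lemma dirDeriv_eq_sum (v : Fin m → ℂ) (p : MvPolynomial (Fin m) ℂ) :
    dirDeriv v p = ∑ i, v i • pderiv i p := by
  induction p using MvPolynomial.induction_on with
  | C c => simp
  | add p q hp hq => simp [hp, hq, Finset.sum_add_distrib]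
  | mul_X p i hp =>
    rw [Derivation.leibniz, hp, dirDeriv_X]
    simp only [Derivation.leibniz, smul_add, Finset.sum_add_distrib, smul_eq_mul, pderiv_X,
      Pi.single_apply, smul_eq_C_mul, Finset.mul_sum]
    congr 1
    · rw [Finset.sum_eq_single i]
      · simp [mul_comm]
      · intro j _ hj; simp [hj.symm]
      · simp
    · exact Finset.sum_congr rfl fun j _ => by ring

lemma mem_lowDeg_succ_of_pderiv {p : MvPolynomial (Fin m) ℂ} {n : ℕ}
    (h : ∀ l, pderiv l p ∈ lowDeg (fun _ : Fin m => 1) n) :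
    p ∈ lowDeg (fun _ : Fin m => 1) (n + 1) := by
  intro s hs
  by_cases h0 : s = 0
  · simp [h0]
  · obtain ⟨l, hl⟩ : ∃ l, s l ≠ 0 := by
      by_contra hcon
      push Not at hcon
      exact h0 (Finsupp.ext hcon)
    have hst : s - Finsupp.single l 1 + Finsupp.single l 1 = s := by
      refine tsub_add_cancel_of_le ?_
      rw [Finsupp.single_le_iff]
      omega
    have h1 := h l (s - Finsupp.single l 1) (by
      rw [coeff_pderiv, hst]
      refine mul_ne_zero hs ?_
      exact Nat.cast_add_one_ne_zero _)
    rw [← hst, map_add, Finsupp.weight_single]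
    simpa using h1

/-- The Hessian `diag (x_i) - ℓ / m`. -/
def numHess (x : Fin m → ℂ) (ell : ℂ) : Matrix (Fin m) (Fin m) ℂ :=
  Matrix.of fun i j => (if i = j then x i else 0) - ell / m

/-- Polynomials annihilated by the difference operators in the integration by parts relations are
constant, since the leading terms of the operators are given by the Hessian. -/
lemma eq_C_of_psi_one {x : Fin m → ℂ} {ell : ℂ} {G : Matrix (Fin m) (Fin m) ℂ}
    (hG : G * numHess x ell = 1) {p : MvPolynomial (Fin m) ℂ}
    (h : ∀ i, x i • psi (Pi.single i 1) 1 p - ell • psi (linePt m 1) 1 p = 0) :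
    ∃ c, p = C c := by
  set w : Fin m → ℕ := fun _ => 1 with hw
  have hw1 : ∀ i, w i ≤ 1 := fun _ => le_rfl
  have hw0 : ∀ (v : Fin m → ℂ) i, w i = 0 → v i = 0 := fun _ _ h => absurd h one_ne_zero
  have hpsi : ∀ v : Fin m → ℂ, psi v 1 p = dirDeriv v p + psi v 2 p := by
    intro v
    rw [psi_one, psi_two]; ring
  -- each step lowers the degree by one: the linear parts of the operators combine, through the Hessian
  -- and its inverse, to the partial derivatives, and the remainders lower the degree by two
  have step : ∀ n, p ∈ lowDeg w (n + 2) → p ∈ lowDeg w (n + 1) := by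
    intro n hp
    refine mem_lowDeg_succ_of_pderiv fun l => ?_
    have h1 : ∀ i, ∑ j, numHess x ell i j • pderiv j p ∈ lowDeg w n := by
      intro i
      have h2 : ∑ j, numHess x ell i j • pderiv j p =
          -(x i • psi (Pi.single i 1) 2 p - ell • psi (linePt m 1) 2 p) := by
        have h3 := h i
        rw [hpsi, hpsi, dirDeriv_eq_sum, dirDeriv_eq_sum] at h3
        have h4 : ∑ j, numHess x ell i j • pderiv j p =
            x i • ∑ j, (Pi.single i 1 : Fin m → ℂ) j • pderiv j p -
              ell • ∑ j, linePt m 1 j • pderiv j p := by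
          simp only [numHess, Matrix.of_apply, sub_smul, Finset.sum_sub_distrib, Finset.smul_sum,
            smul_smul, linePt, mul_one_div, Pi.single_apply, mul_ite, mul_one, mul_zero]
          simp only [eq_comm (a := i)]
        rw [h4, ← sub_eq_zero, ← h3]
        simp only [smul_add]
        ring
      rw [h2]
      refine Submodule.neg_mem _ (Submodule.sub_mem _ (Submodule.smul_mem _ _ ?_)
        (Submodule.smul_mem _ _ ?_))
      · exact psi_mem_lowDeg hw1 (hw0 _) (by norm_num) hp
      · exact psi_mem_lowDeg hw1 (hw0 _) (by norm_num) hp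
    have h5 : pderiv l p = ∑ i, G l i • ∑ j, numHess x ell i j • pderiv j p := by
      simp only [Finset.smul_sum, smul_smul]
      rw [Finset.sum_comm]
      simp only [← Finset.sum_smul]
      have h6 : ∀ j, ∑ i, G l i * numHess x ell i j = if l = j then 1 else 0 := by
        intro j
        rw [← Matrix.mul_apply, hG, Matrix.one_apply]
      simp [h6]
    rw [h5]
    exact Submodule.sum_mem _ fun i _ => Submodule.smul_mem _ _ (h1 i)
  have hall : ∀ n, p ∈ lowDeg w (n + 1) → p ∈ lowDeg w 1 := by
    intro n
    induction n with
    | zero => exact id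
    | succ n ih => exact fun hp => ih (step n hp)
  have hbig : p ∈ lowDeg w (p.totalDegree + 1) := by
    intro s hs
    have := le_totalDegree (mem_support_iff.2 hs)
    rw [Nat.lt_succ_iff]
    refine le_trans (le_of_eq ?_) this
    rw [hw, ← Finsupp.degree_eq_weight_one, Finsupp.degree]
    rfl
  have h1 := hall _ hbig
  refine ⟨coeff 0 p, ?_⟩
  ext s
  rw [coeff_C]
  split_ifs with hs
  · rw [hs]
  · by_contra hne
    have := h1 s hne
    have h2 : Finsupp.weight w s = 0 := by omega
    rw [hw, ← Finsupp.degree_eq_weight_one] at h2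
    exact hs ((Finsupp.degree_eq_zero_iff s).1 h2).symm

/-- The relations which characterise the formal Gaussian functional at a fixed `ℓ`: integration by
parts, and the Euler relation at `a = 0`. -/
structure IsFormalSeq (x : Fin m → ℂ) (ell : ℂ) (D : ℕ → MvPolynomial (Fin m) ℂ) : Prop where
  ibp : ∀ i k, X i * D k = x i • psi (Pi.single i 1) 1 (D (k + 1)) -
    ell • psi (linePt m 1) 1 (D (k + 1))
  euler : ∀ k, ∑ i, x i * eval 0 (psi (Pi.single i 1) 2 (D (k + 1))) -
    m * ell * eval 0 (psi (linePt m 1) 2 (D (k + 1))) = ((m : ℂ) / 2 + k) * eval 0 (D k)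

lemma IsFormalSeq.sub_smul {x : Fin m → ℂ} {ell : ℂ} {D F : ℕ → MvPolynomial (Fin m) ℂ}
    (hD : IsFormalSeq x ell D) (hF : IsFormalSeq x ell F) (c : ℂ) :
    IsFormalSeq x ell fun k => D k - c • F k := by
  refine ⟨fun i k => ?_, fun k => ?_⟩
  · have h1 := hD.ibp i k
    have h2 := hF.ibp i k
    rw [mul_sub, mul_smul_comm, h1, h2]
    simp only [map_sub, map_smul]
    simp only [smul_eq_C_mul]
    ring
  · have h1 := hD.euler k
    have h2 := hF.euler k
    simp only [map_sub, map_smul, smul_eval, mul_sub, Finset.sum_sub_distrib]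
    rw [← h1, mul_left_comm ((m : ℂ) / 2 + k) c, ← h2, mul_sub c, Finset.mul_sum]
    have h3 : ∀ i, x i * (c * eval 0 (psi (Pi.single i 1) 2 (F (k + 1)))) =
        c * (x i * eval 0 (psi (Pi.single i 1) 2 (F (k + 1)))) := fun i => by ring
    simp only [h3]
    ring

/-- Solutions with vanishing initial term vanish: the next term is a constant `c`, the term after it
is `c • F 1` up to a constant, and comparison of the Euler relations gives `(k + 1) * c = 0`. -/
lemma IsFormalSeq.eq_zero {x : Fin m → ℂ} {ell : ℂ} {D F : ℕ → MvPolynomial (Fin m) ℂ}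
    {G : Matrix (Fin m) (Fin m) ℂ} (hG : G * numHess x ell = 1)
    (hD : IsFormalSeq x ell D) (hF : IsFormalSeq x ell F) (hF0 : F 0 = 1) (hD0 : D 0 = 0) (k : ℕ) :
    D k = 0 := by
  induction k with
  | zero => exact hD0
  | succ k ih =>
    obtain ⟨c, hc⟩ := eq_C_of_psi_one hG (p := D (k + 1)) fun i => by
      rw [← hD.ibp, ih, mul_zero]
    obtain ⟨c', hc'⟩ := eq_C_of_psi_one hG (p := D (k + 2) - c • F 1) fun i => by
      have h1 := hD.ibp i (k + 1)
      have h2 := hF.ibp i 0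
      rw [hc] at h1
      rw [hF0, mul_one, zero_add] at h2
      simp only [map_sub, map_smul] at h1 h2 ⊢
      simp only [smul_eq_C_mul] at h1 h2 ⊢
      linear_combination C c * h2 - h1
    have hD2 : D (k + 1 + 1) = C c' + c • F 1 := by
      rw [← hc']; ring
    have h3 := hD.euler (k + 1)
    have h4 := hF.euler 0
    rw [hD2, hc] at h3
    rw [hF0, zero_add] at h4
    have h5 : ∀ v : Fin m → ℂ, eval 0 (psi v 2 (C c' + c • F 1)) = c * eval 0 (psi v 2 (F 1)) := by
      intro v
      rw [map_add, map_smul, map_add, smul_eval, psi_two]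
      simp
    simp only [h5, mul_left_comm (x _) c, ← Finset.mul_sum, map_one, eval_C] at h3 h4
    push_cast at h3 h4
    have h6 : ((k : ℂ) + 1) * c = 0 := by linear_combination c * h4 - h3
    have h7 : c = 0 := (mul_eq_zero.1 h6).resolve_left (by exact_mod_cast Nat.succ_ne_zero k)
    rw [hc, h7, C_0]

variable {ζ lam : ℂ}

/-- The formal coefficients at a fixed value of `ℓ`. -/
def fixedCoeff (m : ℕ) (ζ lam ell : ℂ) (k : ℕ) : MvPolynomial (Fin m) ℂ :=
  aeval (fun o : Option (Fin m) => o.elim (C ell) X)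
    (formalCoeff (eqParam m ζ lam) (invHess m ζ lam) k)

lemma eval_fixedCoeff (ell : ℂ) (k : ℕ) (a : Fin m → ℂ) :
    eval a (fixedCoeff m ζ lam ell k) = fval m ζ lam k ell a := by
  rw [fixedCoeff, fval]
  generalize formalCoeff (eqParam m ζ lam) (invHess m ζ lam) k = p
  induction p using MvPolynomial.induction_on with
  | C c => simp
  | add p q hp hq => simp only [map_add, hp, hq]
  | mul_X p o hp => rw [map_mul, map_mul, hp, map_mul]; cases o <;> simp

lemma eval_zero_dirDeriv_fixedCoeff (ell : ℂ) (k : ℕ) (v : Fin m → ℂ) :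
    eval 0 (dirDeriv v (fixedCoeff m ζ lam ell k)) =
      (Polynomial.derivative (restrictLine ell v
        (formalCoeff (eqParam m ζ lam) (invHess m ζ lam) k))).eval 0 := by
  rw [derivative_restrictLine, eval_restrictLine, zero_smul, fixedCoeff]
  generalize formalCoeff (eqParam m ζ lam) (invHess m ζ lam) k = p
  induction p using MvPolynomial.induction_on with
  | C c => simp
  | add p q hp hq => simp only [map_add, hp, hq]
  | mul_X p o hp =>
    have h : ∀ p : Pol m, eval 0 (aeval (fun o : Option (Fin m) => o.elim (C ell) X) p :
        MvPolynomial (Fin m) ℂ) = eval (fun o : Option (Fin m) => o.elim ell 0) p := by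
      intro p
      induction p using MvPolynomial.induction_on with
      | C c => simp
      | add p q hp hq => simp only [map_add, hp, hq]
      | mul_X p o hp => rw [map_mul, map_mul, hp, map_mul]; cases o <;> simp
    rw [map_mul, Derivation.leibniz, Derivation.leibniz]
    simp only [map_add, smul_eq_mul, map_mul, hp, h]
    cases o <;> simp

lemma isFormalSeq_fixedCoeff (hm : m ≠ 0) (hζ : IsPrimitiveRoot ζ m) (hlam : lam ≠ 0) (ell : ℂ) :
    IsFormalSeq (fun i => ell - eqParam m ζ lam i) ell (fixedCoeff m ζ lam ell) := by
  refine ⟨fun i k => ?_, fun k => ?_⟩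
  · refine MvPolynomial.funext fun a => ?_
    simp only [map_mul, map_sub, smul_eval, psi_one, eval_shift, eval_X, eval_fixedCoeff]
    exact fval_ibp hm hζ hlam k ell a i
  · have h := fval_euler hm hζ hlam k ell
    rw [eval_fixedCoeff, h]
    simp only [psi_two, map_sub, eval_shift, zero_add, eval_fixedCoeff,
      eval_zero_dirDeriv_fixedCoeff]

lemma exists_inv_numHess (hm : m ≠ 0) (hζ : IsPrimitiveRoot ζ m) (hlam : lam ≠ 0) {ell : ℂ}
    (hx : ∀ i, ell - eqParam m ζ lam i ≠ 0) :
    ∃ G, G * numHess (fun i => ell - eqParam m ζ lam i) ell = 1 := by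
  refine ⟨(numHess (fun i => ell - eqParam m ζ lam i) ell)⁻¹, Matrix.nonsing_inv_mul _ ?_⟩
  rw [numHess, det_hessian hm hζ ell hx, isUnit_iff_ne_zero]
  exact neg_ne_zero.2 (pow_ne_zero _ hlam)

end Uniqueness

/-! ### Oscillatory integrals over Morse charts -/

noncomputable section Thimble

open MvPolynomial

variable {m : ℕ} (ψ : Fin m → smoothAlg m)

/-- The operation on functionals, with values in polynomials in `a`, which is dual to
differentiation of products with `exp (a · ψ)`. -/
def nabla (j : Fin m) (Λ : smoothAlg m →ₗ[ℂ] MvPolynomial (Fin m) ℂ) :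
    smoothAlg m →ₗ[ℂ] MvPolynomial (Fin m) ℂ :=
  Λ.comp (pd j).toLinearMap +
    ∑ l, (LinearMap.mulLeft ℂ (X l)).comp (Λ.comp (LinearMap.mulRight ℂ (pd j (ψ l))))

lemma nabla_apply (j : Fin m) (Λ : smoothAlg m →ₗ[ℂ] MvPolynomial (Fin m) ℂ) (f : smoothAlg m) :
    nabla ψ j Λ f = Λ (pd j f) + ∑ l, X l * Λ (f * pd j (ψ l)) := by
  simp [nabla, LinearMap.sum_apply]

/-- The functional `f ↦ Δ ^ k (f * exp (a · ψ)) (0)` as a polynomial in `a`. -/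
def momentPoly : ℕ → smoothAlg m →ₗ[ℂ] MvPolynomial (Fin m) ℂ
  | 0 => (Algebra.linearMap ℂ (MvPolynomial (Fin m) ℂ)).comp evalZero.toLinearMap
  | k + 1 => ∑ j, nabla ψ j (nabla ψ j (momentPoly k))

/-- The exponential `exp (a · ψ)`. -/
def expLin (a : Fin m → ℂ) : smoothAlg m := smoothExp (∑ l, a l • ψ l)

variable {ψ}

lemma pd_smul (j : Fin m) (c : ℂ) (f : smoothAlg m) : pd j (c • f) = c • pd j f :=
  (pd j).map_smul c f

lemma pd_mul_expLin (j : Fin m) (a : Fin m → ℂ) (f : smoothAlg m) :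
    pd j (f * expLin ψ a) = pd j f * expLin ψ a + ∑ l, a l • (f * pd j (ψ l) * expLin ψ a) := by
  rw [Derivation.leibniz, expLin, pd_smoothExp, map_sum]
  simp only [pd_smul, smul_eq_mul, Finset.mul_sum, mul_smul_comm]
  rw [add_comm, mul_comm]
  congr 1
  refine Finset.sum_congr rfl fun l _ => ?_
  congr 1
  ring

lemma eval_nabla {Λ : smoothAlg m →ₗ[ℂ] MvPolynomial (Fin m) ℂ} {μ : smoothAlg m →ₗ[ℂ] ℂ}
    {a : Fin m → ℂ} (h : ∀ f, eval a (Λ f) = μ (f * expLin ψ a)) (j : Fin m) (f : smoothAlg m) :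
    eval a (nabla ψ j Λ f) = μ (pd j (f * expLin ψ a)) := by
  rw [nabla_apply, pd_mul_expLin]
  simp [h]

lemma evalZero_expLin (hψ : ∀ l, evalZero (ψ l) = 0) (a : Fin m → ℂ) :
    evalZero (expLin ψ a) = 1 := by
  have h : evalZero (∑ l, a l • ψ l) = 0 := by simp [hψ]
  rw [evalZero_apply] at h ⊢
  rw [expLin, smoothExp_apply, h, Complex.exp_zero]

lemma eval_momentPoly (hψ : ∀ l, evalZero (ψ l) = 0) (k : ℕ) (a : Fin m → ℂ) (f : smoothAlg m) :
    eval a (momentPoly ψ k f) = evalZero ((laplace ^ k) (f * expLin ψ a)) := by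
  induction k generalizing f with
  | zero =>
    rw [pow_zero, Module.End.one_apply, map_mul, evalZero_expLin hψ, mul_one, momentPoly]
    simp [algebraMap_eq]
  | succ k ih =>
    have h1 : ∀ j, eval a (nabla ψ j (nabla ψ j (momentPoly ψ k)) f) =
        (evalZero.toLinearMap ∘ₗ (laplace ^ k)) (pd j (pd j (f * expLin ψ a))) := by
      intro j
      rw [eval_nabla (μ := (evalZero.toLinearMap ∘ₗ (laplace ^ k)) ∘ₗ (pd j).toLinearMap)]
      · rfl
      · intro f
        rw [eval_nabla (μ := evalZero.toLinearMap ∘ₗ (laplace ^ k))]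
        · rfl
        · exact ih
    rw [momentPoly, LinearMap.sum_apply, map_sum]
    simp only [h1]
    rw [← map_sum, ← laplace_apply, pow_succ, Module.End.mul_apply]
    rfl

lemma pderiv_momentPoly (hψ : ∀ l, evalZero (ψ l) = 0) (k : ℕ) (i : Fin m) (f : smoothAlg m) :
    pderiv i (momentPoly ψ k f) = momentPoly ψ k (f * ψ i) := by
  have step : ∀ (Λ : smoothAlg m →ₗ[ℂ] MvPolynomial (Fin m) ℂ) (j : Fin m),
      (∀ f, pderiv i (Λ f) = Λ (f * ψ i)) →
      ∀ f, pderiv i (nabla ψ j Λ f) = nabla ψ j Λ (f * ψ i) := by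
    intro Λ j h f
    rw [nabla_apply, nabla_apply, map_add, h, map_sum, Derivation.leibniz, map_add]
    simp only [Derivation.leibniz, h, pderiv_X, smul_eq_mul, Finset.sum_add_distrib]
    have h1 : ∑ l, Λ (f * pd j (ψ l)) * (Pi.single i 1 : Fin m → MvPolynomial (Fin m) ℂ) l =
        Λ (f * pd j (ψ i)) := by
      simp [Pi.single_apply]
    have h2 : ∀ l, f * ψ i * pd j (ψ l) = f * pd j (ψ l) * ψ i := fun l => by ring
    simp only [h2, h1, mul_comm (ψ i)]
    ring
  induction k generalizing f with
  | zero =>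
    rw [momentPoly]
    simp [algebraMap_eq, hψ]
  | succ k ih =>
    rw [momentPoly, LinearMap.sum_apply, LinearMap.sum_apply, map_sum]
    exact Finset.sum_congr rfl fun j _ => step _ j (step _ j ih) f

/-- The data of a smooth change of coordinates which makes the action the squared norm. -/
structure IsMorseChart (x : Fin m → ℂ) (ell : ℂ) (ψ : Fin m → smoothAlg m) : Prop where
  zero : ∀ l, evalZero (ψ l) = 0
  action : ∑ l, x l • (smoothExp (ψ l) - 1 - ψ l) -
    ((m : ℂ) * ell) • (smoothExp ((1 / (m : ℂ)) • ∑ l, ψ l) - 1 - (1 / (m : ℂ)) • ∑ l, ψ l) =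
      ∑ j, coordFn j * coordFn j

/-- The Jacobian matrix of a change of coordinates. -/
def jacMat (ψ : Fin m → smoothAlg m) : Matrix (Fin m) (Fin m) (smoothAlg m) :=
  Matrix.of fun l j => pd j (ψ l)

/-- The partial derivatives of the action, in the new coordinates. -/
def gradFn (x : Fin m → ℂ) (ell : ℂ) (ψ : Fin m → smoothAlg m) (l : Fin m) : smoothAlg m :=
  x l • (smoothExp (ψ l) - 1) - ell • (smoothExp ((1 / (m : ℂ)) • ∑ l, ψ l) - 1)

variable {x : Fin m → ℂ} {ell : ℂ}

lemma IsMorseChart.two_mul_coordFn (hm : m ≠ 0) (h : IsMorseChart x ell ψ) (j : Fin m) :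
    2 * coordFn j = ∑ l, gradFn x ell ψ l * jacMat ψ l j := by
  have h1 := congrArg (pd j) h.action
  have h2 : pd j (∑ j, coordFn j * coordFn j) = 2 * coordFn j := by
    rw [map_sum]
    simp only [Derivation.leibniz, pd_coordFn, smul_eq_mul, mul_ite, mul_one, mul_zero,
      Finset.sum_add_distrib, Finset.sum_ite_eq, Finset.mem_univ, if_true]
    ring
  have hm' : (m : ℂ) ≠ 0 := by exact_mod_cast hm
  rw [h2] at h1
  rw [← h1]
  simp only [map_sub, map_sum, pd_smul, pd_smoothExp, Derivation.map_one_eq_zero, sub_zero]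
  simp only [gradFn, jacMat, Matrix.of_apply, sub_mul, Finset.sum_sub_distrib, smul_mul_assoc, one_mul,
    ← Finset.smul_sum, ← Finset.mul_sum, mul_smul_comm]
  simp only [smul_sub, smul_smul, Finset.sum_sub_distrib]
  rw [mul_one_div, mul_div_cancel_left₀ _ hm']

/-- The Jacobian at the origin: a second order expansion of the action compares its Hessian with
that of the squared norm. -/
lemma IsMorseChart.det_sq (hm : m ≠ 0) (h : IsMorseChart x ell ψ) :
    evalZero (jacMat ψ).det ^ 2 * (numHess x ell).det = 2 ^ m := by
  set M0 : Matrix (Fin m) (Fin m) ℂ := evalZero.toRingHom.mapMatrix (jacMat ψ) with hM0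
  have hdet : evalZero (jacMat ψ).det = M0.det := by
    rw [hM0, ← RingHom.map_det]; rfl
  have hM0a : ∀ l j, evalZero (pd j (ψ l)) = M0 l j := fun l j => rfl
  have hexp : ∀ f : smoothAlg m, evalZero f = 0 → evalZero (smoothExp f) = 1 := by
    intro f hf
    rw [evalZero_apply] at hf ⊢
    rw [smoothExp_apply, hf, Complex.exp_zero]
  have hmean : evalZero ((1 / (m : ℂ)) • ∑ l, ψ l) = 0 := by simp [h.zero]
  have hg0 : ∀ l, evalZero (gradFn x ell ψ l) = 0 := by
    intro l
    rw [gradFn]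
    simp only [map_sub, map_smul, hexp _ (h.zero l), hexp _ hmean, map_one, sub_self, smul_zero]
  have hg1 : ∀ i l, evalZero (pd i (gradFn x ell ψ l)) = ∑ p, numHess x ell l p * M0 p i := by
    intro i l
    rw [gradFn]
    simp only [map_sub, pd_smul, pd_smoothExp, Derivation.map_one_eq_zero, map_mul, map_smul,
      hexp _ (h.zero l), hexp _ hmean, map_sum, hM0a, smul_eq_mul, sub_zero, one_mul, numHess,
      Matrix.of_apply, sub_mul, Finset.sum_sub_distrib, ite_mul, zero_mul, Finset.sum_ite_eq,
      Finset.mem_univ, if_true, ← Finset.mul_sum]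
    ring
  have hmat : M0.transpose * ((numHess x ell) * M0) = (2 : ℂ) • (1 : Matrix (Fin m) (Fin m) ℂ) := by
    ext j i
    have h1 := congrArg (fun f => evalZero (pd i f)) (h.two_mul_coordFn hm j)
    simp only [map_sum, Derivation.leibniz, smul_eq_mul, map_add, map_mul, hg0, zero_mul, hg1,
      zero_add, pd_coordFn] at h1
    rw [Matrix.mul_apply, Matrix.smul_apply, Matrix.one_apply]
    simp only [Matrix.mul_apply, Matrix.transpose_apply, smul_eq_mul]
    have h3 : pd i (2 : smoothAlg m) = 0 := by
      have := (pd i).map_natCast 2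
      exact_mod_cast this
    simp only [h3, map_zero, mul_zero, add_zero, map_ofNat] at h1
    have h4 : ∀ l, evalZero (jacMat ψ l j) = M0 l j := fun l => rfl
    simp only [h4] at h1
    rw [← h1]
    by_cases hij : i = j
    · subst hij; simp
    · simp [hij, Ne.symm hij]
  have h5 := congrArg Matrix.det hmat
  rw [Matrix.det_mul, Matrix.det_mul, Matrix.det_transpose, Matrix.det_smul, Matrix.det_one,
    Fintype.card_fin, mul_one] at h5
  rw [hdet, ← h5]
  ring

/-- The functionals of a Morse chart satisfy the integration by parts relations. The vector field
`adjugate * exp (a · ψ)` plays the part of `∂ / ∂s_i` in the coordinates of the chart. -/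
lemma IsMorseChart.gaussCoeff_ibp (hm : m ≠ 0) (h : IsMorseChart x ell ψ) (k : ℕ) (i : Fin m)
    (a : Fin m → ℂ) : a i * gaussCoeff k ((jacMat ψ).det * expLin ψ a) =
      gaussCoeff (k + 1) (gradFn x ell ψ i * ((jacMat ψ).det * expLin ψ a)) := by
  have hZ1 := det_mul_divergence_adjugate (pd (m := m)) pd_comm ψ i
  change (jacMat ψ).det * ∑ j, pd j ((jacMat ψ).adjugate j i) = 0 at hZ1
  set M := jacMat ψ with hM
  generalize hZ : ∑ j, pd j (M.adjugate j i) = Z at hZ1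
  -- the Jacobian need not be invertible away from the origin, but the functionals depend on germs only
  have hZ0 : Z.1 =ᶠ[𝓝 0] (0 : smoothAlg m).1 := by
    have h1 : M.det * Z = 0 := hZ1
    have h2 : M.det.1 0 ≠ 0 := by
      intro h0
      have h3 := h.det_sq hm
      rw [evalZero_apply, ← hM, h0] at h3
      exact pow_ne_zero m (two_ne_zero (α := ℂ)) (by simpa using h3.symm)
    have hc : ContinuousAt M.det.1 0 := (smoothAlg_contDiff _).continuous.continuousAt
    filter_upwards [hc.eventually_ne h2] with y hy
    have h4 : M.det.1 y * Z.1 y = 0 := congrFun (congrArg Subtype.val h1) y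
    exact (mul_eq_zero.1 h4).resolve_left hy
  have hdiv : ∑ j, pd j (M.adjugate j i * expLin ψ a) =
      Z * expLin ψ a + a i • (M.det * expLin ψ a) := by
    simp only [pd_mul_expLin, Finset.sum_add_distrib]
    rw [← Finset.sum_mul, hZ]
    congr 1
    rw [Finset.sum_comm]
    simp only [← Finset.smul_sum, ← Finset.sum_mul]
    have h1 : ∀ l, ∑ j, M.adjugate j i * pd j (ψ l) = if l = i then M.det else 0 := by
      intro l
      have h2 := congrFun (congrFun (Matrix.mul_adjugate M) l) i
      rw [Matrix.mul_apply, Matrix.smul_apply, Matrix.one_apply, smul_eq_mul, mul_ite, mul_one,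
        mul_zero] at h2
      rw [← h2]
      exact Finset.sum_congr rfl fun j _ => mul_comm _ _
    simp only [h1]
    simp
  have hvec : ∑ j, coordFn j * (2 * (M.adjugate j i * expLin ψ a)) =
      gradFn x ell ψ i * (M.det * expLin ψ a) := by
    have h1 : ∀ j, coordFn j * (2 * (M.adjugate j i * expLin ψ a)) =
        ∑ l, gradFn x ell ψ l * (M l j * M.adjugate j i) * expLin ψ a := by
      intro j
      have h2 := h.two_mul_coordFn hm j
      rw [← mul_assoc, mul_comm (coordFn j), h2, ← mul_assoc, Finset.sum_mul, Finset.sum_mul]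
      exact Finset.sum_congr rfl fun l _ => by rw [hM]; ring
    simp only [h1]
    rw [Finset.sum_comm]
    simp only [← Finset.sum_mul, ← Finset.mul_sum]
    have h3 : ∀ l, ∑ j, M l j * M.adjugate j i = if l = i then M.det else 0 := by
      intro l
      rw [← Matrix.mul_apply, Matrix.mul_adjugate, Matrix.smul_apply, Matrix.one_apply, smul_eq_mul,
        mul_ite, mul_one, mul_zero]
    simp only [h3]
    simp [mul_assoc]
  have h1 := congrArg (gaussCoeff k) hdiv
  have h2 : gaussCoeff k (Z * expLin ψ a) = 0 := by
    rw [gaussCoeff_congr (g := 0) _ k, map_zero]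
    filter_upwards [hZ0] with y hy
    change Z.1 y * (expLin ψ a).1 y = 0
    rw [hy]
    exact zero_mul _
  rw [map_add, h2, zero_add, map_smul, smul_eq_mul, map_sum] at h1
  rw [← h1, ← hvec, map_sum]
  refine Finset.sum_congr rfl fun j _ => ?_
  rw [gaussCoeff_coordFn_mul, two_mul, map_add, map_add]
  ring

/-- The functionals of a Morse chart as polynomials in `a`. -/
def chartPoly (ψ : Fin m → smoothAlg m) (k : ℕ) : MvPolynomial (Fin m) ℂ :=
  C (1 / (4 ^ k * (k.factorial : ℂ))) * momentPoly ψ k (jacMat ψ).det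

lemma eval_chartPoly (hψ : ∀ l, evalZero (ψ l) = 0) (k : ℕ) (a : Fin m → ℂ) :
    eval a (chartPoly ψ k) = gaussCoeff k ((jacMat ψ).det * expLin ψ a) := by
  rw [chartPoly, map_mul, eval_C, eval_momentPoly hψ, gaussCoeff_apply]

lemma expLin_add (a b : Fin m → ℂ) : expLin ψ (a + b) = expLin ψ a * expLin ψ b := by
  rw [expLin, expLin, expLin, ← smoothExp_add, ← Finset.sum_add_distrib]
  simp only [Pi.add_apply, add_smul]

lemma expLin_single (i : Fin m) : expLin ψ (Pi.single i 1) = smoothExp (ψ i) := by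
  rw [expLin]
  congr 1
  rw [Finset.sum_eq_single i]
  · simp
  · intro j _ hj; simp [hj]
  · simp

lemma expLin_linePt : expLin ψ (linePt m 1) = smoothExp ((1 / (m : ℂ)) • ∑ l, ψ l) := by
  rw [expLin, Finset.smul_sum]
  rfl

lemma expLin_zero : expLin ψ 0 = 1 := by
  rw [expLin]
  simp [smoothExp_zero]

lemma eval_dirDeriv_chartPoly (hψ : ∀ l, evalZero (ψ l) = 0) (k : ℕ) (v : Fin m → ℂ) :
    eval 0 (dirDeriv v (chartPoly ψ k)) = gaussCoeff k ((jacMat ψ).det * ∑ l, v l • ψ l) := by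
  have h : ∀ i, eval 0 (pderiv i (chartPoly ψ k)) = gaussCoeff k ((jacMat ψ).det * ψ i) := by
    intro i
    rw [chartPoly, Derivation.leibniz, pderiv_C, smul_zero, add_zero, smul_eq_mul,
      pderiv_momentPoly hψ, map_mul, eval_C, eval_momentPoly hψ, gaussCoeff_apply, expLin_zero,
      mul_one]
  rw [dirDeriv_eq_sum, map_sum, Finset.mul_sum, map_sum]
  refine Finset.sum_congr rfl fun i _ => ?_
  rw [smul_eval, h, mul_smul_comm, map_smul, smul_eq_mul]

lemma IsMorseChart.isFormalSeq (hm : m ≠ 0) (h : IsMorseChart x ell ψ) :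
    IsFormalSeq x ell (chartPoly ψ) := by
  refine ⟨fun i k => ?_, fun k => ?_⟩
  · refine MvPolynomial.funext fun a => ?_
    simp only [map_mul, map_sub, smul_eval, psi_one, eval_shift, eval_X, eval_chartPoly h.zero]
    rw [h.gaussCoeff_ibp hm, gradFn, ← expLin_single, ← expLin_linePt, expLin_add, expLin_add,
      ← smul_eq_mul (x i), ← smul_eq_mul ell, ← map_sub, ← map_sub, ← map_smul, ← map_smul,
      ← map_sub]
    congr 1
    simp only [sub_mul, smul_mul_assoc, one_mul]
    congr 3
    · ring
    · ring
  · have h1 : ∀ v : Fin m → ℂ, eval 0 (psi v 2 (chartPoly ψ (k + 1))) = gaussCoeff (k + 1)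
        ((jacMat ψ).det * (expLin ψ v - 1 - ∑ l, v l • ψ l)) := by
      intro v
      rw [psi_two, map_sub, map_sub, eval_shift, eval_dirDeriv_chartPoly h.zero, zero_add,
        eval_chartPoly h.zero, eval_chartPoly h.zero, expLin_zero, mul_sub, mul_sub, map_sub,
        map_sub]
    rw [eval_chartPoly h.zero, expLin_zero, mul_one, ← gaussCoeff_normSq_mul, ← h.action]
    simp only [h1]
    simp only [← smul_eq_mul (x _), ← smul_eq_mul ((m : ℂ) * ell), ← map_smul, ← map_sum, ← map_sub]
    congr 1
    rw [sub_mul, Finset.sum_mul]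
    have h2 : ∀ i, ∑ l, (Pi.single i 1 : Fin m → ℂ) l • ψ l = ψ i := by
      intro i
      rw [Finset.sum_eq_single i]
      · simp
      · intro j _ hj; simp [hj]
      · simp
    have h3 : ∑ l, linePt m 1 l • ψ l = (1 / (m : ℂ)) • ∑ l, ψ l := by
      rw [Finset.smul_sum]; rfl
    simp only [h2, h3, expLin_single, expLin_linePt, smul_mul_assoc, mul_comm (jacMat ψ).det]

variable {ζ lam : ℂ}

/-- The expansion of an oscillatory integral over a Morse chart is the formal one. -/
theorem IsMorseChart.gaussCoeff_eq (hm : m ≠ 0) (hζ : IsPrimitiveRoot ζ m) (hlam : lam ≠ 0)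
    (hx : ∀ i, ell - eqParam m ζ lam i ≠ 0)
    (h : IsMorseChart (fun i => ell - eqParam m ζ lam i) ell ψ) (k : ℕ) (a : Fin m → ℂ) :
    gaussCoeff k ((jacMat ψ).det * expLin ψ a) =
      evalZero (jacMat ψ).det * fval m ζ lam k ell a := by
  obtain ⟨G, hG⟩ := exists_inv_numHess hm hζ hlam hx
  have hF := isFormalSeq_fixedCoeff hm hζ hlam ell
  have hF0 : fixedCoeff m ζ lam ell 0 = 1 := by simp [fixedCoeff, formalCoeff_zero]
  have hD := (h.isFormalSeq hm).sub_smul hF (evalZero (jacMat ψ).det)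
  have h0 := hD.eq_zero hG hF hF0 (by
    refine MvPolynomial.funext fun a => ?_
    rw [map_sub, smul_eval, eval_chartPoly h.zero, gaussCoeff_zero, map_mul,
      evalZero_expLin h.zero, hF0]
    simp) k
  have h1 := congrArg (eval a) h0
  rw [map_sub, smul_eval, eval_chartPoly h.zero, eval_fixedCoeff, map_zero] at h1
  exact sub_eq_zero.1 h1

end Thimble

/-! ### Laplace's method -/

noncomputable section LaplaceMethod

variable {m : ℕ}

/-- The Gaussian `exp (- ‖x‖ ^ 2)`. -/
def gaussFn : smoothAlg m := smoothExp (-∑ j, coordFn j * coordFn j)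

lemma sum_coordFn_sq (x : EuclideanSpace ℝ (Fin m)) :
    (∑ j, coordFn j * coordFn j : smoothAlg m).1 x = ((‖x‖ ^ 2 : ℝ) : ℂ) := by
  have h : (∑ j, coordFn j * coordFn j : smoothAlg m).1 x = ∑ j, ((x j : ℂ) * (x j : ℂ)) := by
    simp [coordFn_apply]
  rw [h, EuclideanSpace.norm_sq_eq]
  push_cast
  refine Finset.sum_congr rfl fun j _ => ?_
  rw [Real.norm_eq_abs, ← Complex.ofReal_pow, sq_abs]
  push_cast
  ring

lemma gaussFn_apply (x : EuclideanSpace ℝ (Fin m)) :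
    gaussFn.1 x = ((Real.exp (-‖x‖ ^ 2) : ℝ) : ℂ) := by
  have h : (-∑ j, coordFn j * coordFn j : smoothAlg m).1 x = -((‖x‖ ^ 2 : ℝ) : ℂ) := by
    rw [← sum_coordFn_sq]; rfl
  rw [gaussFn, smoothExp_apply, h]
  push_cast
  rfl

lemma pd_gaussFn (j : Fin m) : pd j gaussFn = (-2 : ℂ) • (coordFn j * gaussFn) := by
  have h2 : pd j (∑ i, coordFn i * coordFn i) = (2 : ℂ) • coordFn j := by
    rw [map_sum]
    simp only [Derivation.leibniz, pd_coordFn, smul_eq_mul, mul_ite, mul_one, mul_zero,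
      Finset.sum_add_distrib, Finset.sum_ite_eq, Finset.mem_univ, if_true]
    rw [two_smul]
  rw [gaussFn, pd_smoothExp, map_neg, h2, ← gaussFn]
  ext x
  change gaussFn.1 x * -(2 * (coordFn j).1 x) = -2 * ((coordFn j).1 x * gaussFn.1 x)
  ring

/-- The dilation of a function by `r`. -/
def dilate (r : ℝ) (f : smoothAlg m) : smoothAlg m :=
  ⟨fun x => f.1 (r • x), mem_smoothAlg.2 ((smoothAlg_contDiff f).comp (contDiff_const_smul r))⟩

lemma pd_dilate (r : ℝ) (f : smoothAlg m) (j : Fin m) :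
    pd j (dilate r f) = (r : ℂ) • dilate r (pd j f) := by
  ext x
  rw [pd_apply]
  change fderiv ℝ (fun y => f.1 (r • y)) x _ = (r : ℂ) * fderiv ℝ f.1 (r • x) _
  rw [fderiv_comp_smul]
  simp

lemma hasDerivAt_dilate (f : smoothAlg m) (x : EuclideanSpace ℝ (Fin m)) (r : ℝ) :
    HasDerivAt (fun r : ℝ => (dilate r f).1 x)
      (∑ j, (coordFn j * dilate r (pd j f)).1 x) r := by
  have h1 : HasDerivAt (fun r : ℝ => r • x) x r := by
    simpa using (hasDerivAt_id r).smul_const x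
  have h2 := (smoothAlg_differentiable f (r • x)).hasFDerivAt.comp_hasDerivAt r h1
  refine h2.congr_deriv ?_
  have hx : x = ∑ j, x j • EuclideanSpace.single j (1 : ℝ) := by
    ext i
    simp [Finset.sum_apply, Pi.single_apply]
  have h3 : fderiv ℝ f.1 (r • x) x =
      ∑ j, fderiv ℝ f.1 (r • x) (x j • EuclideanSpace.single j (1 : ℝ)) := by
    rw [← map_sum, ← hx]
  rw [h3]
  refine Finset.sum_congr rfl fun j _ => ?_
  rw [map_smul, Complex.real_smul]
  rfl

lemma integrable_exp_neg_mul_norm_sq {b : ℝ} (hb : 0 < b) :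
    Integrable fun x : EuclideanSpace ℝ (Fin m) => Real.exp (-b * ‖x‖ ^ 2) := by
  have h := GaussianFourier.integrable_cexp_neg_mul_sq_norm_add (V := EuclideanSpace ℝ (Fin m))
    (b := (b : ℂ)) (by simpa using hb) 0 0
  refine h.norm.congr (Eventually.of_forall fun x => ?_)
  simp only [zero_mul, add_zero, Complex.norm_exp]
  congr 1
  rw [← Complex.ofReal_neg, ← Complex.ofReal_pow, ← Complex.ofReal_mul, Complex.ofReal_re]

lemma smoothAlg_aestronglyMeasurable (f : smoothAlg m) : AEStronglyMeasurable f.1 :=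
  (smoothAlg_contDiff f).continuous.aestronglyMeasurable

lemma norm_gaussFn_le (x : EuclideanSpace ℝ (Fin m)) :
    ‖gaussFn.1 x‖ ≤ Real.exp (-(1 / 2) * ‖x‖ ^ 2) := by
  rw [gaussFn_apply, Complex.norm_real, Real.norm_eq_abs, Real.abs_exp]
  exact Real.exp_le_exp.2 (by nlinarith [sq_nonneg ‖x‖])

lemma norm_coordFn_mul_gaussFn_le (j : Fin m) (x : EuclideanSpace ℝ (Fin m)) :
    ‖(coordFn j * gaussFn).1 x‖ ≤ Real.exp (-(1 / 2) * ‖x‖ ^ 2) := by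
  change ‖(coordFn j).1 x * gaussFn.1 x‖ ≤ _
  rw [norm_mul, coordFn_apply, gaussFn_apply, Complex.norm_real, Complex.norm_real,
    Real.norm_eq_abs (Real.exp _), Real.abs_exp]
  have h1 : ‖x j‖ ≤ ‖x‖ := PiLp.norm_apply_le x j
  have h2 : ‖x‖ ≤ Real.exp (1 / 2 * ‖x‖ ^ 2) := by
    refine le_trans ?_ (Real.add_one_le_exp _)
    nlinarith [sq_nonneg (‖x‖ - 1)]
  calc ‖x j‖ * Real.exp (-‖x‖ ^ 2) ≤ Real.exp (1 / 2 * ‖x‖ ^ 2) * Real.exp (-‖x‖ ^ 2) := by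
        gcongr
        exact h1.trans h2
    _ = _ := by rw [← Real.exp_add]; congr 1; ring

lemma integrable_mul_of_bound {g f : smoothAlg m} {C : ℝ}
    (hg : ∀ x, ‖g.1 x‖ ≤ Real.exp (-(1 / 2) * ‖x‖ ^ 2)) (hf : ∀ x, ‖f.1 x‖ ≤ C) :
    Integrable (g * f).1 := by
  refine Integrable.mono' ((integrable_exp_neg_mul_norm_sq (m := m) (b := 1 / 2)
    (by norm_num)).mul_const C) (smoothAlg_aestronglyMeasurable _)
    (Eventually.of_forall fun x => ?_)
  change ‖g.1 x * f.1 x‖ ≤ _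
  rw [norm_mul]
  exact mul_le_mul (hg x) (hf x) (norm_nonneg _) (Real.exp_nonneg _)

lemma pd_hasCompactSupport {f : smoothAlg m} (hf : HasCompactSupport f.1) (j : Fin m) :
    HasCompactSupport (pd j f).1 :=
  hf.fderiv_apply (𝕜 := ℝ) _

lemma laplace_hasCompactSupport {f : smoothAlg m} (hf : HasCompactSupport f.1) :
    HasCompactSupport (laplace f).1 := by
  have h : (laplace f).1 = ∑ j, (pd j (pd j f)).1 := by
    rw [laplace_apply]; simp
  rw [h]
  refine Finset.sum_induction _ HasCompactSupport (fun _ _ => HasCompactSupport.add)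
    HasCompactSupport.zero fun j _ => ?_
  exact pd_hasCompactSupport (pd_hasCompactSupport hf j) j

lemma exists_bound_dilate {f : smoothAlg m} (hf : HasCompactSupport f.1) :
    ∃ C, ∀ r x, ‖(dilate r f).1 x‖ ≤ C := by
  obtain ⟨C, hC⟩ := hf.exists_bound_of_continuous (smoothAlg_contDiff f).continuous
  exact ⟨C, fun r x => hC _⟩

/-- The Gaussian average of `f` at scale `r`. -/
def gaussMean (f : smoothAlg m) (r : ℝ) : ℂ := ∫ x, (gaussFn * dilate r f).1 x

lemma integral_mul_pd {f g : smoothAlg m} (j : Fin m) (h1 : Integrable (pd j f * g).1)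
    (h2 : Integrable (f * pd j g).1) (h3 : Integrable (f * g).1) :
    ∫ x, (f * pd j g).1 x = -∫ x, (pd j f * g).1 x :=
  integral_mul_fderiv_eq_neg_fderiv_mul_of_integrable h1 h2 h3
    (fun x _ => smoothAlg_differentiable f x) (fun x _ => smoothAlg_differentiable g x)

/-- The heat equation, in the variable `r ^ 2 / 4`: differentiation under the integral sign gives a
factor `x_j`, which is removed by integration by parts against the Gaussian. -/
lemma hasDerivAt_gaussMean {f : smoothAlg m} (hf : HasCompactSupport f.1) (r : ℝ) :
    HasDerivAt (gaussMean f) ((r / 2 : ℂ) * gaussMean (laplace f) r) r := by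
  obtain ⟨C, hC⟩ := exists_bound_dilate hf
  choose C1 hC1 using fun j => exists_bound_dilate (pd_hasCompactSupport hf j)
  choose C2 hC2 using fun j => exists_bound_dilate
    (pd_hasCompactSupport (pd_hasCompactSupport hf j) j)
  have hint : ∀ j, Integrable (coordFn j * gaussFn * dilate r (pd j f)).1 := fun j =>
    integrable_mul_of_bound (norm_coordFn_mul_gaussFn_le j) (hC1 j r)
  have hder := (hasDerivAt_integral_of_dominated_loc_of_deriv_le (s := Set.univ) (x₀ := r)
    (μ := (volume : Measure (EuclideanSpace ℝ (Fin m)))) (F := fun r x => (gaussFn * dilate r f).1 x)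
    (F' := fun r x => ∑ j, (coordFn j * gaussFn * dilate r (pd j f)).1 x)
    (bound := fun x => Real.exp (-(1 / 2) * ‖x‖ ^ 2) * ∑ j, C1 j) univ_mem
    (Eventually.of_forall fun r => smoothAlg_aestronglyMeasurable _)
    (integrable_mul_of_bound norm_gaussFn_le (hC r))
    (integrable_finsetSum _ fun j _ => hint j).aestronglyMeasurable
    (Eventually.of_forall fun x r _ => by
      rw [Finset.mul_sum]
      refine (norm_sum_le _ _).trans (Finset.sum_le_sum fun j _ => ?_)
      change ‖(coordFn j * gaussFn).1 x * (dilate r (pd j f)).1 x‖ ≤ _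
      rw [norm_mul]
      exact mul_le_mul (norm_coordFn_mul_gaussFn_le j x) (hC1 j r x) (norm_nonneg _)
        (Real.exp_nonneg _))
    ((integrable_exp_neg_mul_norm_sq (by norm_num)).mul_const _)
    (Eventually.of_forall fun x r _ => by
      have h := (hasDerivAt_dilate f x r).const_mul (gaussFn.1 x)
      refine h.congr_deriv ?_
      rw [Finset.mul_sum]
      refine Finset.sum_congr rfl fun j _ => ?_
      change gaussFn.1 x * ((coordFn j).1 x * (dilate r (pd j f)).1 x) =
        (coordFn j).1 x * gaussFn.1 x * (dilate r (pd j f)).1 x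
      ring)).2
  refine hder.congr_deriv ?_
  rw [integral_finsetSum _ fun j _ => hint j]
  have hl : gaussMean (laplace f) r = ∑ j, ∫ x, (gaussFn * dilate r (pd j (pd j f))).1 x := by
    rw [gaussMean, ← integral_finsetSum]
    · refine integral_congr_ae (Eventually.of_forall fun x => ?_)
      change gaussFn.1 x * (laplace f).1 (r • x) = ∑ j, gaussFn.1 x * (pd j (pd j f)).1 (r • x)
      rw [← Finset.mul_sum, laplace_apply]
      simp
    · exact fun j _ => integrable_mul_of_bound norm_gaussFn_le (hC2 j r)
  rw [hl, Finset.mul_sum]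
  refine Finset.sum_congr rfl fun j _ => Eq.symm ?_
  have e1 : gaussFn * pd j (dilate r (pd j f)) =
      (r : ℂ) • (gaussFn * dilate r (pd j (pd j f))) := by
    rw [pd_dilate, mul_smul_comm]
  have e2 : pd j gaussFn * dilate r (pd j f) =
      (-2 : ℂ) • (coordFn j * gaussFn * dilate r (pd j f)) := by
    rw [pd_gaussFn, smul_mul_assoc]
  have h := integral_mul_pd (f := gaussFn) (g := dilate r (pd j f)) j
    (by rw [e2]; exact (hint j).smul (-2 : ℂ))
    (by rw [e1]; exact (integrable_mul_of_bound norm_gaussFn_le (hC2 j r)).smul (r : ℂ))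
    (integrable_mul_of_bound norm_gaussFn_le (hC1 j r))
  rw [e1, e2] at h
  change ∫ x, (r : ℂ) • (gaussFn * dilate r (pd j (pd j f))).1 x =
    -∫ x, (-2 : ℂ) • (coordFn j * gaussFn * dilate r (pd j f)).1 x at h
  rw [integral_smul, integral_smul, smul_eq_mul, smul_eq_mul] at h
  linear_combination h / 2

lemma gaussMean_zero (f : smoothAlg m) :
    gaussMean f 0 = ((Real.pi ^ ((m : ℝ) / 2) : ℝ) : ℂ) * evalZero f := by
  have h1 : ∀ x, (gaussFn * dilate 0 f).1 x = ((Real.exp (-1 * ‖x‖ ^ 2) : ℝ) : ℂ) * evalZero f := by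
    intro x
    change gaussFn.1 x * f.1 ((0 : ℝ) • x) = _
    rw [zero_smul, gaussFn_apply, neg_one_mul]
    rfl
  rw [gaussMean]
  simp only [h1]
  rw [integral_mul_const, integral_complex_ofReal, GaussianFourier.integral_rexp_neg_mul_sq_norm one_pos]
  simp

/-- The expansion of Gaussian averages at small scales, by induction on the order: the derivative of
the remainder for `f` is `r / 2` times the remainder for the Laplacian of `f`. -/
lemma exists_bound_gaussMean_sub (N : ℕ) {f : smoothAlg m} (hf : HasCompactSupport f.1) :
    ∃ C, ∀ r : ℝ, 0 ≤ r → ‖gaussMean f r - ((Real.pi ^ ((m : ℝ) / 2) : ℝ) : ℂ) *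
      ∑ k ∈ Finset.range N, gaussCoeff k f * (r : ℂ) ^ (2 * k)‖ ≤ C * r ^ (2 * N) := by
  induction N generalizing f with
  | zero =>
    obtain ⟨C, hC⟩ := exists_bound_dilate hf
    refine ⟨∫ x : EuclideanSpace ℝ (Fin m), Real.exp (-(1 / 2) * ‖x‖ ^ 2) * C, fun r _ => ?_⟩
    simp only [Finset.range_zero, Finset.sum_empty, mul_zero, sub_zero, pow_zero, mul_one]
    refine norm_integral_le_of_norm_le
      ((integrable_exp_neg_mul_norm_sq (by norm_num)).mul_const _) (Eventually.of_forall fun x => ?_)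
    change ‖gaussFn.1 x * (dilate r f).1 x‖ ≤ _
    rw [norm_mul]
    exact mul_le_mul (norm_gaussFn_le x) (hC r x) (norm_nonneg _) (Real.exp_nonneg _)
  | succ N ih =>
    obtain ⟨C, hC⟩ := ih (laplace_hasCompactSupport hf)
    refine ⟨C / 2, fun r hr => ?_⟩
    set c : ℂ := ((Real.pi ^ ((m : ℝ) / 2) : ℝ) : ℂ) with hc
    set E : ℝ → ℂ := fun r => gaussMean f r -
      c * ∑ k ∈ Finset.range (N + 1), gaussCoeff k f * (r : ℂ) ^ (2 * k) with hE
    set E' : ℝ → ℂ := fun r => (r / 2 : ℂ) * (gaussMean (laplace f) r -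
      c * ∑ k ∈ Finset.range N, gaussCoeff k (laplace f) * (r : ℂ) ^ (2 * k)) with hE'
    have hd : ∀ s : ℝ, HasDerivAt E (E' s) s := by
      intro s
      have h1 : ∀ k : ℕ, HasDerivAt (fun r : ℝ => gaussCoeff k f * (r : ℂ) ^ (2 * k))
          (gaussCoeff k f * ((2 * k : ℕ) * (s : ℂ) ^ (2 * k - 1))) s := by
        intro k
        have h3 := (hasDerivAt_pow (2 * k) (s : ℂ)).comp_ofReal
        exact h3.const_mul _
      have h2 := (hasDerivAt_gaussMean hf s).sub
        ((HasDerivAt.fun_sum fun k (_ : k ∈ Finset.range (N + 1)) => h1 k).const_mul c)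
      refine h2.congr_deriv ?_
      rw [hE']
      beta_reduce
      rw [mul_sub, Finset.sum_range_succ']
      congr 1
      rw [mul_left_comm (s / 2 : ℂ)]
      refine congrArg (c * ·) ?_
      rw [Finset.mul_sum]
      simp only [Nat.cast_zero, zero_mul, mul_zero, add_zero]
      refine Finset.sum_congr rfl fun k _ => ?_
      rw [gaussCoeff_laplace, show 2 * (k + 1) - 1 = 2 * k + 1 by omega, pow_succ]
      push_cast
      ring
    have hE0 : E 0 = 0 := by
      rw [hE]
      beta_reduce
      rw [gaussMean_zero, Finset.sum_range_succ']
      simp [gaussCoeff_zero, hc]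
    have hbound : ∀ s ∈ Set.Icc (0 : ℝ) r, ‖E' s‖ ≤ C / 2 * r ^ (2 * N + 1) := by
      intro s hs
      rw [hE']
      beta_reduce
      have hC0 := hC s hs.1
      rw [norm_mul, norm_div, Complex.norm_real, Real.norm_of_nonneg hs.1]
      have hCnn : 0 ≤ C := by
        have := hC 1 zero_le_one
        rw [one_pow, mul_one] at this
        exact (norm_nonneg _).trans this
      have h2 : ‖(2 : ℂ)‖ = 2 := by norm_num
      rw [h2]
      calc s / 2 * _ ≤ s / 2 * (C * s ^ (2 * N)) := by
            refine mul_le_mul_of_nonneg_left hC0 (by linarith [hs.1])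
        _ = C / 2 * s ^ (2 * N + 1) := by ring
        _ ≤ _ := by
            refine mul_le_mul_of_nonneg_left (pow_le_pow_left₀ hs.1 hs.2 _) (by linarith)
    have h := (convex_Icc (0 : ℝ) r).norm_image_sub_le_of_norm_hasDerivWithin_le
      (fun s _ => (hd s).hasDerivWithinAt) hbound (Set.left_mem_Icc.2 hr) (Set.right_mem_Icc.2 hr)
    rw [hE0, sub_zero, sub_zero, Real.norm_of_nonneg hr] at h
    refine h.trans (le_of_eq ?_)
    ring

/-- A smooth cutoff function. -/
def bump : ContDiffBump (0 : EuclideanSpace ℝ (Fin m)) := ⟨1, 2, one_pos, one_lt_two⟩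

/-- The cutoff function as a complex valued smooth function. -/
def cutoff : smoothAlg m :=
  ⟨fun x => ((bump x : ℝ) : ℂ), mem_smoothAlg.2 (Complex.ofRealCLM.contDiff.comp bump.contDiff)⟩

lemma cutoff_apply (x : EuclideanSpace ℝ (Fin m)) : (cutoff (m := m)).1 x = ((bump x : ℝ) : ℂ) :=
  rfl

lemma cutoff_eq_one {x : EuclideanSpace ℝ (Fin m)} (hx : ‖x‖ ≤ 1) : (cutoff (m := m)).1 x = 1 := by
  rw [cutoff_apply, bump.one_of_mem_closedBall (by simpa [bump] using hx), Complex.ofReal_one]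

lemma norm_one_sub_cutoff_le (x : EuclideanSpace ℝ (Fin m)) : ‖1 - (cutoff (m := m)).1 x‖ ≤ 1 := by
  rw [cutoff_apply, ← Complex.ofReal_one, ← Complex.ofReal_sub, Complex.norm_real, Real.norm_eq_abs,
    abs_le]
  constructor <;> linarith [bump.nonneg (x := x), bump.le_one (x := x)]

lemma hasCompactSupport_cutoff_mul (G : smoothAlg m) : HasCompactSupport (cutoff * G).1 := by
  have h : HasCompactSupport (cutoff (m := m)).1 :=
    (bump (m := m)).hasCompactSupport.comp_left (g := fun x : ℝ => (x : ℂ)) Complex.ofReal_zero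
  exact h.mul_right

lemma gaussCoeff_cutoff_mul (k : ℕ) (G : smoothAlg m) :
    gaussCoeff k (cutoff * G) = gaussCoeff k G := by
  refine gaussCoeff_congr ?_ k
  filter_upwards [Metric.closedBall_mem_nhds (0 : EuclideanSpace ℝ (Fin m)) one_pos] with x hx
  change cutoff.1 x * G.1 x = G.1 x
  rw [cutoff_eq_one (by simpa using hx), one_mul]

lemma integral_exp_mul_eq_gaussMean (f : smoothAlg m) {r : ℝ} (hr : 0 < r) :
    ∫ x, ((Real.exp (-‖x‖ ^ 2 / r ^ 2) : ℝ) : ℂ) * f.1 x = (r : ℂ) ^ m * gaussMean f r := by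
  have h := Measure.integral_comp_smul (volume : Measure (EuclideanSpace ℝ (Fin m)))
    (fun x => ((Real.exp (-‖x‖ ^ 2 / r ^ 2) : ℝ) : ℂ) * f.1 x) r
  have h1 : gaussMean f r =
      ∫ x, ((Real.exp (-‖r • x‖ ^ 2 / r ^ 2) : ℝ) : ℂ) * f.1 (r • x) := by
    refine integral_congr_ae (Eventually.of_forall fun x => ?_)
    change gaussFn.1 x * f.1 (r • x) = _
    beta_reduce
    have h2 : -‖r • x‖ ^ 2 / r ^ 2 = -‖x‖ ^ 2 := by
      rw [norm_smul, Real.norm_of_nonneg hr.le]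
      field_simp
    rw [gaussFn_apply, h2]
  have hr' : (r : ℂ) ≠ 0 := Complex.ofReal_ne_zero.2 hr.ne'
  rw [h1, h, finrank_euclideanSpace, Fintype.card_fin, abs_of_pos (by positivity),
    Complex.real_smul]
  push_cast
  field_simp

/-- **Laplace's method**: the expansion of Gaussian integrals of smooth functions. -/
theorem laplace_expansion {G : smoothAlg m} {t : ℝ} (ht : 0 < t)
    (hint : Integrable fun x => ((Real.exp (-‖x‖ ^ 2 / t) : ℝ) : ℂ) * G.1 x) (N : ℕ) :
    (fun h : ℝ => (∫ x, ((Real.exp (-‖x‖ ^ 2 / h) : ℝ) : ℂ) * G.1 x) /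
        (((Real.pi * h) ^ ((m : ℝ) / 2) : ℝ) : ℂ) -
      ∑ k ∈ Finset.range N, gaussCoeff k G * (h : ℂ) ^ k) =O[𝓝[>] (0 : ℝ)] fun h : ℝ => h ^ N := by
  obtain ⟨C, hC⟩ := exists_bound_gaussMean_sub N (hasCompactSupport_cutoff_mul G)
  set A : ℝ := ∫ x, ‖((Real.exp (-‖x‖ ^ 2 / t) : ℝ) : ℂ) * G.1 x‖ with hA
  have hA0 : 0 ≤ A := integral_nonneg fun x => norm_nonneg _
  set p : ℝ := Real.pi ^ ((m : ℝ) / 2) with hp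
  have hp0 : 0 < p := Real.rpow_pos_of_pos Real.pi_pos _
  refine IsBigO.of_bound (C / p + Real.exp (1 / t) * A * ((N + m).factorial : ℝ) / p) ?_
  filter_upwards [Ioo_mem_nhdsGT (lt_min one_pos ht)] with h hh
  have h0 : 0 < h := hh.1
  have h1 : h ≤ 1 := (hh.2.trans_le (min_le_left _ _)).le
  have hht : h ≤ t := (hh.2.trans_le (min_le_right _ _)).le
  set r : ℝ := Real.sqrt h with hr
  have hr0 : 0 < r := Real.sqrt_pos.2 h0
  have hr2 : r ^ 2 = h := Real.sq_sqrt h0.le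
  have hexp : ∀ x : EuclideanSpace ℝ (Fin m),
      Real.exp (-‖x‖ ^ 2 / h) ≤ Real.exp (-‖x‖ ^ 2 / t) := by
    intro x
    refine Real.exp_le_exp.2 ?_
    rw [neg_div, neg_div, neg_le_neg_iff]
    exact div_le_div_of_nonneg_left (sq_nonneg _) h0 hht
  have hinth : Integrable fun x => ((Real.exp (-‖x‖ ^ 2 / h) : ℝ) : ℂ) * G.1 x := by
    refine Integrable.mono hint ?_ (Eventually.of_forall fun x => ?_)
    · refine Continuous.aestronglyMeasurable ?_
      have := (smoothAlg_contDiff G).continuous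
      fun_prop
    · rw [norm_mul, norm_mul, Complex.norm_real, Complex.norm_real, Real.norm_eq_abs,
        Real.norm_eq_abs, Real.abs_exp, Real.abs_exp]
      exact mul_le_mul_of_nonneg_right (hexp x) (norm_nonneg _)
  have hint1 : Integrable fun x => (1 - (cutoff (m := m)).1 x) *
      (((Real.exp (-‖x‖ ^ 2 / h) : ℝ) : ℂ) * G.1 x) := by
    refine hinth.bdd_mul (c := 1) ?_ (Eventually.of_forall norm_one_sub_cutoff_le)
    exact (continuous_const.sub (smoothAlg_contDiff cutoff).continuous).aestronglyMeasurable
  have hint2 : Integrable fun x =>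
      ((Real.exp (-‖x‖ ^ 2 / h) : ℝ) : ℂ) * (cutoff * G).1 x := by
    refine (hinth.sub hint1).congr (Eventually.of_forall fun x => ?_)
    change _ - _ = _ * (cutoff.1 x * G.1 x)
    ring
  have hsplit : ∫ x, ((Real.exp (-‖x‖ ^ 2 / h) : ℝ) : ℂ) * G.1 x =
      (r : ℂ) ^ m * gaussMean (cutoff * G) r + ∫ x, (1 - (cutoff (m := m)).1 x) *
        (((Real.exp (-‖x‖ ^ 2 / h) : ℝ) : ℂ) * G.1 x) := by
    rw [← integral_exp_mul_eq_gaussMean _ hr0, hr2, ← integral_add hint2 hint1]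
    refine integral_congr_ae (Eventually.of_forall fun x => ?_)
    change _ = _ * (cutoff.1 x * G.1 x) + _
    ring
  -- the cutoff leaves the region `‖x‖ ≥ 1`, where the Gaussian with parameter `h` is at most
  -- `exp (1 / t - 1 / h)` times the one with parameter `t`
  have htail : ‖∫ x, (1 - (cutoff (m := m)).1 x) *
      (((Real.exp (-‖x‖ ^ 2 / h) : ℝ) : ℂ) * G.1 x)‖ ≤ Real.exp (1 / t) * Real.exp (-(1 / h)) * A := by
    rw [hA, ← integral_const_mul]
    refine norm_integral_le_of_norm_le (hint.norm.const_mul _) (Eventually.of_forall fun x => ?_)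
    rw [norm_mul]
    by_cases hx : ‖x‖ ≤ 1
    · rw [cutoff_eq_one hx, sub_self, norm_zero, zero_mul]
      positivity
    · have hx2 : 1 ≤ ‖x‖ ^ 2 := by nlinarith
      rw [norm_mul, norm_mul, Complex.norm_real, Complex.norm_real, Real.norm_eq_abs,
        Real.norm_eq_abs, Real.abs_exp, Real.abs_exp, ← mul_assoc (Real.exp _ * _), ← Real.exp_add, ← Real.exp_add]
      refine (mul_le_of_le_one_left (by positivity) (norm_one_sub_cutoff_le x)).trans ?_
      refine mul_le_mul_of_nonneg_right (Real.exp_le_exp.2 ?_) (norm_nonneg _)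
      have h3 : 1 / t ≤ 1 / h := one_div_le_one_div_of_le h0 hht
      have h4 : -‖x‖ ^ 2 / h = -(‖x‖ ^ 2 * (1 / h)) := by ring
      have h5 : -‖x‖ ^ 2 / t = -(‖x‖ ^ 2 * (1 / t)) := by ring
      rw [h4, h5]
      nlinarith
  have hdecay : Real.exp (-(1 / h)) ≤ (N + m).factorial * h ^ (N + m) := by
    have h3 := Real.pow_div_factorial_le_exp (1 / h) (by positivity) (N + m)
    rw [Real.exp_neg, inv_le_comm₀ (Real.exp_pos _) (by positivity)]
    refine le_trans (le_of_eq ?_) h3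
    rw [one_div, inv_pow, mul_inv, div_eq_mul_inv, mul_comm]
  have hprm : (Real.pi * h) ^ ((m : ℝ) / 2) = p * r ^ m := by
    rw [Real.mul_rpow Real.pi_pos.le h0.le, ← hr2, ← Real.rpow_natCast r 2, ← Real.rpow_mul hr0.le,
      ← Real.rpow_natCast r m]
    congr 2
    push_cast
    ring
  have hpC : (p : ℂ) ≠ 0 := Complex.ofReal_ne_zero.2 hp0.ne'
  have hrC : (r : ℂ) ≠ 0 := Complex.ofReal_ne_zero.2 hr0.ne'
  rw [hsplit, hprm]
  set T := ∫ x, (1 - (cutoff (m := m)).1 x) * (((Real.exp (-‖x‖ ^ 2 / h) : ℝ) : ℂ) * G.1 x)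
  have heq : ((r : ℂ) ^ m * gaussMean (cutoff * G) r + T) / ((p * r ^ m : ℝ) : ℂ) -
      ∑ k ∈ Finset.range N, gaussCoeff k G * (h : ℂ) ^ k =
      (gaussMean (cutoff * G) r -
        p * ∑ k ∈ Finset.range N, gaussCoeff k (cutoff * G) * (r : ℂ) ^ (2 * k)) / p +
      T / (p * r ^ m) := by
    have h3 : ∀ k, gaussCoeff k (cutoff * G) * (r : ℂ) ^ (2 * k) = gaussCoeff k G * (h : ℂ) ^ k := by
      intro k
      rw [gaussCoeff_cutoff_mul, pow_mul, ← hr2]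
      push_cast
      rfl
    simp only [h3]
    push_cast
    field_simp
    ring
  rw [heq, Real.norm_of_nonneg (by positivity), add_mul]
  refine (norm_add_le _ _).trans (add_le_add ?_ ?_)
  · rw [norm_div, Complex.norm_real, Real.norm_of_nonneg hp0.le, div_mul_eq_mul_div]
    refine div_le_div_of_nonneg_right ((hC r hr0.le).trans (le_of_eq ?_)) hp0.le
    rw [pow_mul, hr2]
  · rw [norm_div, norm_mul, norm_pow, Complex.norm_real, Complex.norm_real,
      Real.norm_of_nonneg hp0.le, Real.norm_of_nonneg hr0.le, div_le_iff₀ (by positivity)]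
    refine htail.trans ?_
    have hrm : h ^ m ≤ r ^ m := by
      refine pow_le_pow_left₀ h0.le ?_ m
      rw [← hr2]
      have : r ≤ 1 := by rw [hr]; exact Real.sqrt_le_one.2 h1
      nlinarith
    calc Real.exp (1 / t) * Real.exp (-(1 / h)) * A
        ≤ Real.exp (1 / t) * ((N + m).factorial * (h ^ N * r ^ m)) * A := by
          gcongr
          refine hdecay.trans ?_
          rw [pow_add]
          gcongr
      _ = _ := by field_simp

end LaplaceMethod

/-! ### Domination of exponential families -/

noncomputable section Domination

variable {E : Type*} [NormedAddCommGroup E] [MeasurableSpace E] [BorelSpace E]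
  {μ : Measure E} {y v : E → ℂ}

/-- Integrability of `exp (‖x‖ ^ 2 / z + η y) v` for small `η` gives an integrable bound with
`exp (c ‖y‖)`: the values `η = ± d, ± i d` control the positive and negative parts of the real and
imaginary parts of `y`. -/
lemma exists_integrable_exp_norm (hy : Continuous y) (hv : Continuous v) {z : ℝ}
    (h : ∀ᶠ η in 𝓝 (0 : ℂ),
      Integrable (fun x => Complex.exp (((‖x‖ ^ 2 / z : ℝ) : ℂ) + η * y x) * v x) μ) :
    ∃ c > 0, Integrable (fun x => Real.exp (‖x‖ ^ 2 / z + c * ‖y x‖) * ‖v x‖) μ := by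
  obtain ⟨ε, hε, hball⟩ := Metric.eventually_nhds_iff_ball.1 h
  set d : ℝ := ε / 2 with hd
  have hd0 : 0 < d := by positivity
  have hmem : ∀ w : ℂ, ‖w‖ = 1 → (d : ℂ) * w ∈ Metric.ball (0 : ℂ) ε := by
    intro w hw
    rw [mem_ball_zero_iff, norm_mul, hw, Complex.norm_real, Real.norm_of_nonneg hd0.le]
    linarith
  have hn : ∀ (w : ℂ) (x : E), ‖Complex.exp (((‖x‖ ^ 2 / z : ℝ) : ℂ) + (d : ℂ) * w * y x) * v x‖ =
      Real.exp (‖x‖ ^ 2 / z + d * (w * y x).re) * ‖v x‖ := by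
    intro w x
    rw [norm_mul, Complex.norm_exp, mul_assoc, Complex.add_re, Complex.ofReal_re,
      Complex.re_ofReal_mul]
  have h1 := (hball _ (hmem 1 (by simp))).norm
  have h2 := (hball _ (hmem (-1) (by simp))).norm
  have h3 := (hball _ (hmem Complex.I (by simp))).norm
  have h4 := (hball _ (hmem (-Complex.I) (by simp))).norm
  simp only [hn] at h1 h2 h3 h4
  refine ⟨d / 2, by positivity, Integrable.mono' (((h1.add h2).add h3).add h4) ?_ ?_⟩
  · exact Continuous.aestronglyMeasurable (by fun_prop)
  · refine Eventually.of_forall fun x => ?_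
    rw [Real.norm_of_nonneg (by positivity)]
    change _ ≤ Real.exp _ * ‖v x‖ + Real.exp _ * ‖v x‖ + Real.exp _ * ‖v x‖ + Real.exp _ * ‖v x‖
    rw [← add_mul, ← add_mul, ← add_mul]
    refine mul_le_mul_of_nonneg_right ?_ (norm_nonneg _)
    have hre : (1 * y x).re = (y x).re := by simp
    have hre2 : (-1 * y x).re = -(y x).re := by simp
    have him : (Complex.I * y x).re = -(y x).im := by simp
    have him2 : (-Complex.I * y x).re = (y x).im := by simp
    rw [hre, hre2, him, him2]
    have hle := Complex.norm_le_abs_re_add_abs_im (y x)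
    have key : ∀ s : ℝ, ‖y x‖ ≤ 2 * s →
        Real.exp (‖x‖ ^ 2 / z + d / 2 * ‖y x‖) ≤ Real.exp (‖x‖ ^ 2 / z + d * s) := by
      intro s hs
      exact Real.exp_le_exp.2 (by nlinarith)
    have p1 := Real.exp_pos (‖x‖ ^ 2 / z + d * (y x).re)
    have p2 := Real.exp_pos (‖x‖ ^ 2 / z + d * -(y x).re)
    have p3 := Real.exp_pos (‖x‖ ^ 2 / z + d * -(y x).im)
    have p4 := Real.exp_pos (‖x‖ ^ 2 / z + d * (y x).im)
    rcases le_total |(y x).re| |(y x).im| with hc | hc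
    · rcases abs_choice (y x).im with hs | hs
      · linarith [key (y x).im (by linarith)]
      · linarith [key (-(y x).im) (by linarith)]
    · rcases abs_choice (y x).re with hs | hs
      · linarith [key (y x).re (by linarith)]
      · linarith [key (-(y x).re) (by linarith)]

lemma norm_le_exp_norm {c : ℝ} (hc : 0 < c) (w : ℂ) : ‖w‖ ≤ 2 / c * Real.exp (c / 2 * ‖w‖) := by
  have h := Real.add_one_le_exp (c / 2 * ‖w‖)
  rw [div_mul_eq_mul_div, le_div_iff₀ hc]
  linarith

/-- Differentiation under the integral sign for the family `exp (η y)`, at all `z` closer to zero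
than the `z₀` at which the dominating function is integrable. -/
lemma integrable_exp_mul_mul (hy : Continuous y) (hv : Continuous v) {z₀ z c : ℝ} (hz : z₀ ≤ z)
    (hz0 : z < 0) (hc : 0 < c)
    (h : Integrable (fun x => Real.exp (‖x‖ ^ 2 / z₀ + c * ‖y x‖) * ‖v x‖) μ) :
    Integrable (fun x => Complex.exp ((‖x‖ ^ 2 / z : ℝ) : ℂ) * v x) μ ∧
    Integrable (fun x => Complex.exp ((‖x‖ ^ 2 / z : ℝ) : ℂ) * (y x * v x)) μ ∧
    HasDerivAt (fun η : ℂ => ∫ x, Complex.exp (((‖x‖ ^ 2 / z : ℝ) : ℂ) + η * y x) * v x ∂μ)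
      (∫ x, Complex.exp ((‖x‖ ^ 2 / z : ℝ) : ℂ) * (y x * v x) ∂μ) 0 := by
  have hzz : ∀ x : E, ‖x‖ ^ 2 / z ≤ ‖x‖ ^ 2 / z₀ := by
    intro x
    have h1 : z₀ < 0 := lt_of_le_of_lt hz hz0
    rw [div_eq_mul_inv, div_eq_mul_inv]
    exact mul_le_mul_of_nonneg_left ((inv_le_inv_of_neg hz0 h1).2 hz) (sq_nonneg _)
  have hF0 : Integrable (fun x => Complex.exp (((‖x‖ ^ 2 / z : ℝ) : ℂ) + 0 * y x) * v x) μ := by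
    refine Integrable.mono' h (Continuous.aestronglyMeasurable (by fun_prop))
      (Eventually.of_forall fun x => ?_)
    rw [norm_mul, Complex.norm_exp, zero_mul, add_zero, Complex.ofReal_re]
    refine mul_le_mul_of_nonneg_right (Real.exp_le_exp.2 ?_) (norm_nonneg _)
    have := mul_nonneg hc.le (norm_nonneg (y x))
    linarith [hzz x]
  have hder := hasDerivAt_integral_of_dominated_loc_of_deriv_le (μ := μ) (x₀ := (0 : ℂ))
    (s := Metric.ball (0 : ℂ) (c / 2))
    (F := fun (η : ℂ) x => Complex.exp (((‖x‖ ^ 2 / z : ℝ) : ℂ) + η * y x) * v x)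
    (F' := fun (η : ℂ) x => Complex.exp (((‖x‖ ^ 2 / z : ℝ) : ℂ) + η * y x) * (y x * v x))
    (bound := fun x => 2 / c * (Real.exp (‖x‖ ^ 2 / z₀ + c * ‖y x‖) * ‖v x‖))
    (Metric.ball_mem_nhds _ (by positivity))
    (Eventually.of_forall fun η => Continuous.aestronglyMeasurable (by fun_prop)) hF0
    (Continuous.aestronglyMeasurable (by fun_prop))
    (Eventually.of_forall fun x η hη => by
      rw [mem_ball_zero_iff] at hη
      rw [norm_mul, Complex.norm_exp, norm_mul, Complex.add_re, Complex.ofReal_re]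
      have h1 : (η * y x).re ≤ c / 2 * ‖y x‖ := by
        refine (Complex.re_le_norm _).trans ?_
        rw [norm_mul]
        exact mul_le_mul_of_nonneg_right hη.le (norm_nonneg _)
      calc Real.exp (‖x‖ ^ 2 / z + (η * y x).re) * (‖y x‖ * ‖v x‖)
          ≤ Real.exp (‖x‖ ^ 2 / z₀ + c / 2 * ‖y x‖) *
              (2 / c * Real.exp (c / 2 * ‖y x‖) * ‖v x‖) := by
            refine mul_le_mul (Real.exp_le_exp.2 (add_le_add (hzz x) h1))
              (mul_le_mul_of_nonneg_right (norm_le_exp_norm hc _) (norm_nonneg _)) (by positivity)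
              (by positivity)
        _ = 2 / c * ((Real.exp (‖x‖ ^ 2 / z₀ + c / 2 * ‖y x‖) *
              Real.exp (c / 2 * ‖y x‖)) * ‖v x‖) := by ring
        _ = _ := by
            rw [← Real.exp_add, show ‖x‖ ^ 2 / z₀ + c / 2 * ‖y x‖ + c / 2 * ‖y x‖ =
              ‖x‖ ^ 2 / z₀ + c * ‖y x‖ by ring])
    (h.const_mul _)
    (Eventually.of_forall fun x η _ => by
      have h1 : HasDerivAt (fun η : ℂ => ((‖x‖ ^ 2 / z : ℝ) : ℂ) + η * y x) (y x) η := by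
        simpa using ((hasDerivAt_id η).mul_const (y x)).const_add ((‖x‖ ^ 2 / z : ℝ) : ℂ)
      refine (h1.cexp.mul_const (v x)).congr_deriv ?_
      ring)
  simp only [zero_mul, add_zero] at hder hF0
  exact ⟨hF0, hder.1, hder.2⟩

end Domination

/-! ### Lefschetz thimbles -/

noncomputable section Thimbles

variable {m : ℕ} {ζ lam τ ell : ℂ} {φ : EuclideanSpace ℝ (Fin m) → (Fin m → ℂ)}

lemma IsThimble.ell_ne_zero (h : IsThimble m ζ lam τ ell φ) : ell ≠ 0 := by
  rintro rfl
  have h1 := h.branch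
  rw [mul_zero] at h1
  exact Complex.exp_ne_zero _ h1

/-- The critical points: `x_i = y / m - λ_i`. -/
lemma IsThimble.exp_eq (hm : m ≠ 0) (h : IsThimble m ζ lam τ ell φ) (i : Fin m) :
    Complex.exp (φ 0 i) = ell - eqParam m ζ lam i := by
  have hm' : (m : ℂ) ≠ 0 := by exact_mod_cast hm
  have hdiff : DifferentiableAt ℂ (potential m ζ lam τ) (φ 0) := by
    unfold potential yFun
    fun_prop
  have h1 : HasDerivAt (fun s : ℂ => φ 0 + s • (Pi.single i 1 : Fin m → ℂ)) (Pi.single i 1) 0 := by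
    simpa using ((hasDerivAt_id (0 : ℂ)).smul_const (Pi.single i 1 : Fin m → ℂ)).const_add (φ 0)
  have hdiff' : HasFDerivAt (potential m ζ lam τ) (0 : (Fin m → ℂ) →L[ℂ] ℂ)
      (φ 0 + (0 : ℂ) • (Pi.single i 1 : Fin m → ℂ)) := by
    rw [zero_smul, add_zero, ← h.critical]
    exact hdiff.hasFDerivAt
  have h2 := hdiff'.comp_hasDerivAt (0 : ℂ) h1
  have h3 : HasDerivAt (fun s : ℂ => potential m ζ lam τ (φ 0 + s • (Pi.single i 1 : Fin m → ℂ)))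
      (Complex.exp (φ 0 i) + eqParam m ζ lam i - yFun m τ (φ 0) * (1 / m)) 0 := by
    have hc : ∀ j, HasDerivAt (fun s : ℂ => φ 0 j + s * (Pi.single i 1 : Fin m → ℂ) j)
        ((Pi.single i 1 : Fin m → ℂ) j) 0 := by
      intro j
      simpa using ((hasDerivAt_id (0 : ℂ)).mul_const ((Pi.single i 1 : Fin m → ℂ) j)).const_add
        (φ 0 j)
    have hs := (HasDerivAt.fun_sum fun j (_ : j ∈ (Finset.univ : Finset (Fin m))) =>
      (hc j).cexp.add ((hc j).const_mul (eqParam m ζ lam j))).sub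
      (((HasDerivAt.fun_sum fun j (_ : j ∈ (Finset.univ : Finset (Fin m))) =>
        hc j).sub_const τ).div_const (m : ℂ)).cexp
    refine hs.congr_deriv ?_
    simp only [zero_mul, add_zero, Finset.sum_add_distrib]
    rw [Finset.sum_pi_single', yFun]
    congr 1
    · congr 1
      · rw [Finset.sum_eq_single i]
        · simp
        · intro j _ hj; simp [hj]
        · simp
      · rw [Finset.sum_eq_single i]
        · simp
        · intro j _ hj; simp [hj]
        · simp
    · simp
  have h4 := h2.unique h3
  rw [h.branch] at h4
  have h5 : (m : ℂ) * ell * (1 / m) = ell := by field_simp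
  rw [h5] at h4
  simp only [zero_apply] at h4
  linear_combination -h4

lemma IsThimble.sub_ne_zero (hm : m ≠ 0) (h : IsThimble m ζ lam τ ell φ) (i : Fin m) :
    ell - eqParam m ζ lam i ≠ 0 := by
  rw [← h.exp_eq hm]
  exact Complex.exp_ne_zero _

/-- The displacement from the critical point, as a tuple of smooth functions. -/
def IsThimble.chart (h : IsThimble m ζ lam τ ell φ) (l : Fin m) : smoothAlg m :=
  ⟨fun x => φ x l - φ 0 l,
    mem_smoothAlg.2 ((contDiff_pi.1 h.smooth l).sub contDiff_const)⟩

lemma IsThimble.chart_apply (h : IsThimble m ζ lam τ ell φ) (l : Fin m)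
    (x : EuclideanSpace ℝ (Fin m)) : (h.chart l).1 x = φ x l - φ 0 l := rfl

lemma IsThimble.mean_chart_apply (h : IsThimble m ζ lam τ ell φ) (x : EuclideanSpace ℝ (Fin m)) :
    ((1 / (m : ℂ)) • ∑ l, h.chart l).1 x = (∑ l, φ x l - ∑ l, φ 0 l) / m := by
  change (1 / (m : ℂ)) * (∑ l, h.chart l).1 x = _
  have h1 : (∑ l, h.chart l).1 x = ∑ l, (φ x l - φ 0 l) := by
    simp [IsThimble.chart_apply]
  rw [h1, Finset.sum_sub_distrib]
  ring

lemma IsThimble.yFun_eq (h : IsThimble m ζ lam τ ell φ) (x : EuclideanSpace ℝ (Fin m)) :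
    yFun m τ (φ x) = m * ell * (smoothExp ((1 / (m : ℂ)) • ∑ l, h.chart l)).1 x := by
  rw [← h.branch, smoothExp_apply, h.mean_chart_apply, yFun, yFun, ← Complex.exp_add]
  congr 1
  ring

/-- The potential minus its critical value is the action in the displacement from the critical
point, the linear terms cancelling by the critical point equations. -/
lemma IsThimble.isMorseChart (hm : m ≠ 0) (h : IsThimble m ζ lam τ ell φ) :
    IsMorseChart (fun i => ell - eqParam m ζ lam i) ell h.chart := by
  have hm' : (m : ℂ) ≠ 0 := by exact_mod_cast hm
  refine ⟨fun l => by rw [evalZero_apply, h.chart_apply, sub_self], ?_⟩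
  ext x
  rw [sum_coordFn_sq]
  have h1 := h.ray x
  have hL : (∑ l, (ell - eqParam m ζ lam l) • (smoothExp (h.chart l) - 1 - h.chart l) -
      ((m : ℂ) * ell) • (smoothExp ((1 / (m : ℂ)) • ∑ l, h.chart l) - 1 -
        (1 / (m : ℂ)) • ∑ l, h.chart l) : smoothAlg m).1 x =
      ∑ l, (ell - eqParam m ζ lam l) * (Complex.exp (φ x l - φ 0 l) - 1 - (φ x l - φ 0 l)) -
      (m : ℂ) * ell * ((smoothExp ((1 / (m : ℂ)) • ∑ l, h.chart l)).1 x - 1 -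
        (∑ l, φ x l - ∑ l, φ 0 l) / m) := by
    rw [← h.mean_chart_apply]
    have h2 : (∑ l, (ell - eqParam m ζ lam l) • (smoothExp (h.chart l) - 1 - h.chart l) :
        smoothAlg m).1 x = ∑ l, (ell - eqParam m ζ lam l) *
          (Complex.exp (φ x l - φ 0 l) - 1 - (φ x l - φ 0 l)) := by
      simp [smoothExp_apply, h.chart_apply]
    rw [← h2]
    rfl
  rw [hL]
  have h3 : ∀ l, Complex.exp (φ x l) = (ell - eqParam m ζ lam l) * Complex.exp (φ x l - φ 0 l) := by
    intro l
    rw [← h.exp_eq hm, ← Complex.exp_add]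
    congr 1
    ring
  have h4 : ((‖x‖ ^ 2 : ℝ) : ℂ) = potential m ζ lam τ (φ x) - potential m ζ lam τ (φ 0) := by
    rw [h1]; ring
  rw [h4, potential, potential, h.yFun_eq, h.branch]
  simp only [h3, h.exp_eq hm]
  rw [show (m : ℂ) * ell * ((smoothExp ((1 / (m : ℂ)) • ∑ l, h.chart l)).1 x - 1 -
        (∑ l, φ x l - ∑ l, φ 0 l) / m) = m * ell * (smoothExp ((1 / (m : ℂ)) • ∑ l, h.chart l)).1 x
        - m * ell - ell * ∑ l, φ x l + ell * ∑ l, φ 0 l by field_simp; ring]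
  have h5 : ∑ l, (ell - eqParam m ζ lam l) * (Complex.exp (φ x l - φ 0 l) - 1 - (φ x l - φ 0 l)) =
      ∑ l, ((ell - eqParam m ζ lam l) * Complex.exp (φ x l - φ 0 l) + eqParam m ζ lam l * φ x l) -
      ∑ l, (ell - eqParam m ζ lam l + eqParam m ζ lam l * φ 0 l) -
      ell * ∑ l, φ x l + ell * ∑ l, φ 0 l := by
    rw [Finset.mul_sum, Finset.mul_sum, ← Finset.sum_sub_distrib, ← Finset.sum_sub_distrib,
      ← Finset.sum_add_distrib]
    exact Finset.sum_congr rfl fun l _ => by ring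
  rw [h5]
  ring

lemma IsThimble.volForm_eq (h : IsThimble m ζ lam τ ell φ) (x : EuclideanSpace ℝ (Fin m)) :
    volForm m φ x = (jacMat h.chart).det.1 x := by
  have h1 : (jacMat h.chart).det.1 x =
      (((Pi.evalRingHom (fun _ : EuclideanSpace ℝ (Fin m) => ℂ) x).comp
        (smoothAlg m).val.toRingHom).mapMatrix (jacMat h.chart)).det := by
    rw [← RingHom.map_det]
    rfl
  rw [h1, volForm]
  congr 1
  ext l j
  change fderiv ℝ φ x (EuclideanSpace.single j 1) l =
    fderiv ℝ (fun x => φ x l - φ 0 l) x (EuclideanSpace.single j 1)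
  rw [fderiv_sub_const, fderiv_apply (h.smooth.differentiable (by simp) x)]
  rfl

/-- The dependence of the integrand on the parameter: only the term `y` of the potential depends on
`τ'`, by the factor `exp (- (τ' - τ) / m)`. -/
lemma IsThimble.integrand_eq (h : IsThimble m ζ lam τ ell φ) (τ' : ℂ) (z : ℝ)
    (x : EuclideanSpace ℝ (Fin m)) :
    integrand m ζ lam τ' φ z x = Complex.exp (potential m ζ lam τ (φ 0) / z) *
      (Complex.exp (((‖x‖ ^ 2 / z : ℝ) : ℂ) + (1 - Complex.exp (-(τ' - τ) / m)) / z *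
        yFun m τ (φ x)) * volForm m φ x) := by
  have h1 : yFun m τ' (φ x) = yFun m τ (φ x) * Complex.exp (-(τ' - τ) / m) := by
    rw [yFun, yFun, ← Complex.exp_add]
    congr 1
    ring
  have h2 : potential m ζ lam τ' (φ x) =
      potential m ζ lam τ (φ x) + (1 - Complex.exp (-(τ' - τ) / m)) * yFun m τ (φ x) := by
    rw [potential, potential, h1]
    ring
  rw [integrand, h2, h.ray, ← mul_assoc, ← Complex.exp_add]
  congr 2
  push_cast
  ring

lemma IsThimble.continuous_yFun (h : IsThimble m ζ lam τ ell φ) :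
    Continuous fun x => yFun m τ (φ x) := by
  have := h.smooth.continuous
  unfold yFun
  fun_prop

lemma IsThimble.continuous_volForm (h : IsThimble m ζ lam τ ell φ) :
    Continuous (volForm m φ) := by
  have h1 : volForm m φ = (jacMat h.chart).det.1 := funext h.volForm_eq
  rw [h1]
  exact (smoothAlg_contDiff _).continuous

/-- Convergence at `z₀` for all parameters near `τ` amounts to the integrability of
`exp (‖x‖ ^ 2 / z₀ + η y)` for all small `η`. -/
lemma IsThimble.exists_domination (hm : m ≠ 0) (h : IsThimble m ζ lam τ ell φ) :
    ∃ z₀ < (0 : ℝ), ∃ c > 0, Integrable fun x => Real.exp (‖x‖ ^ 2 / z₀ + c * ‖yFun m τ (φ x)‖) *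
      ‖volForm m φ x‖ := by
  obtain ⟨z₀, hz₀, hint⟩ := h.convergent
  have hm' : (m : ℂ) ≠ 0 := by exact_mod_cast hm
  have hz' : (z₀ : ℂ) ≠ 0 := Complex.ofReal_ne_zero.2 hz₀.ne
  refine ⟨z₀, hz₀, exists_integrable_exp_norm h.continuous_yFun h.continuous_volForm ?_⟩
  -- the parameter `τ - m log (1 - z₀ η)` produces the factor `exp (η y)` at `z₀`
  have hcont : ContinuousAt (fun η : ℂ => τ - m * Complex.log (1 - z₀ * η)) 0 := by
    have h1 : ContinuousAt (fun η : ℂ => Complex.log (1 - z₀ * η)) 0 :=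
      ContinuousAt.clog (by fun_prop) (by simp)
    exact continuousAt_const.sub (continuousAt_const.mul h1)
  have htend : Tendsto (fun η : ℂ => τ - m * Complex.log (1 - z₀ * η)) (𝓝 0) (𝓝 τ) := by
    have := hcont.tendsto
    simpa using this
  have hne : ∀ᶠ η : ℂ in 𝓝 (0 : ℂ), 1 - (z₀ : ℂ) * η ≠ 0 := by
    have h1 : ContinuousAt (fun η : ℂ => 1 - (z₀ : ℂ) * η) (0 : ℂ) := by fun_prop
    exact h1.eventually_ne (by simp : (1 : ℂ) - (z₀ : ℂ) * 0 ≠ 0)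
  filter_upwards [htend.eventually hint, hne] with η hη h0
  have h2 := hη.const_mul (Complex.exp (potential m ζ lam τ (φ 0) / z₀))⁻¹
  refine h2.congr (Eventually.of_forall fun x => ?_)
  beta_reduce
  rw [h.integrand_eq, ← mul_assoc, inv_mul_cancel₀ (Complex.exp_ne_zero _), one_mul]
  have h3 : -(τ - m * Complex.log (1 - z₀ * η) - τ) / m = Complex.log (1 - z₀ * η) := by
    field_simp
    ring
  rw [h3, Complex.exp_log h0]
  congr 4
  field_simp
  ring

/-- Integrability at small `z`, and the derivative with respect to the parameter. -/
lemma IsThimble.hasDerivAt_oscIntegral (h : IsThimble m ζ lam τ ell φ) {z₀ z c : ℝ}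
    (hz : z₀ ≤ z) (hz0 : z < 0) (hc : 0 < c)
    (hint : Integrable fun x => Real.exp (‖x‖ ^ 2 / z₀ + c * ‖yFun m τ (φ x)‖) * ‖volForm m φ x‖) :
    Integrable (integrand m ζ lam τ φ z) ∧
    HasDerivAt (fun τ' => oscIntegral m ζ lam φ τ' z)
      (Complex.exp (potential m ζ lam τ (φ 0) / z) *
        ((∫ x, Complex.exp ((‖x‖ ^ 2 / z : ℝ) : ℂ) * (yFun m τ (φ x) * volForm m φ x)) *
          (1 / (m * z)))) τ := by
  obtain ⟨h1, h2, h3⟩ := integrable_exp_mul_mul h.continuous_yFun h.continuous_volForm hz hz0 hc hint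
  refine ⟨?_, ?_⟩
  · refine (h1.const_mul (Complex.exp (potential m ζ lam τ (φ 0) / z))).congr
      (Eventually.of_forall fun x => ?_)
    rw [h.integrand_eq]
    simp
  · have h4 : HasDerivAt (fun τ' : ℂ => (1 - Complex.exp (-(τ' - τ) / m)) / z) (1 / (m * z)) τ := by
      have h5 : HasDerivAt (fun τ' : ℂ => -(τ' - τ) / m) (-1 / m) τ :=
        (((hasDerivAt_id τ).sub_const τ).neg).div_const (m : ℂ)
      refine ((h5.cexp.const_sub 1).div_const (z : ℂ)).congr_deriv ?_
      rw [sub_self, neg_zero, zero_div, Complex.exp_zero]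
      ring
    have h0 : (1 - Complex.exp (-(τ - τ) / m)) / (z : ℂ) = 0 := by simp
    rw [← h0] at h3
    have h6 := (h3.comp τ h4).const_mul (Complex.exp (potential m ζ lam τ (φ 0) / z))
    refine h6.congr_of_eventuallyEq (Eventually.of_forall fun τ' => ?_)
    change oscIntegral m ζ lam φ τ' z = _
    rw [oscIntegral]
    simp only [h.integrand_eq, integral_const_mul]
    rfl

/-- The expansion of the oscillatory integral over a thimble. The derivative `q d/dq` multiplies the
integrand by `y / (m z)`, and `y` is `m ℓ` times the exponential of the mean displacement, so that
the coefficients are the formal ones at `a = (1 / m, …, 1 / m)`. The square root in the prefactor is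
the Jacobian of the chart at the origin divided by `2 ^ (m / 2)`. -/
theorem IsThimble.expansion (hm : m ≠ 0) (hζ : IsPrimitiveRoot ζ m) (hlam : lam ≠ 0)
    (h : IsThimble m ζ lam τ ell φ) :
    ∃ c : ℂ, c ^ 2 * (-lam ^ m) = 1 ∧
      (∀ᶠ z in 𝓝[<] (0 : ℝ), Integrable (integrand m ζ lam τ φ z) ∧
        DifferentiableAt ℂ (fun τ' => oscIntegral m ζ lam φ τ' z) τ) ∧
      HasExpansion (fun z => z * deriv (fun τ' => oscIntegral m ζ lam φ τ' z) τ)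
        (fun z => c * Complex.exp (potential m ζ lam τ (φ 0) / z) *
          (((-2 * Real.pi * z) ^ ((m : ℝ) / 2) : ℝ) : ℂ) * ell)
        fun k => fval m ζ lam k ell (linePt m 1) := by
  have hm' : (m : ℂ) ≠ 0 := by exact_mod_cast hm
  have hell := h.ell_ne_zero
  have hchart := h.isMorseChart hm
  obtain ⟨z₀, hz₀, d, hd, hint⟩ := h.exists_domination hm
  set v0 : ℂ := evalZero (jacMat h.chart).det with hv0
  set p : ℂ := (((2 : ℝ) ^ ((m : ℝ) / 2) : ℝ) : ℂ) with hp
  have hp2 : p ^ 2 = 2 ^ m := by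
    rw [hp, ← Complex.ofReal_pow, ← Real.rpow_natCast, ← Real.rpow_mul (by norm_num)]
    rw [show (m : ℝ) / 2 * ((2 : ℕ) : ℝ) = (m : ℝ) by push_cast; ring, Real.rpow_natCast]
    push_cast
    rfl
  have hp0 : p ≠ 0 := by
    intro h0
    rw [h0] at hp2
    exact pow_ne_zero m (two_ne_zero (α := ℂ)) (by rw [← hp2]; ring)
  have hsq : v0 ^ 2 * (-lam ^ m) = 2 ^ m := by
    have h1 := hchart.det_sq hm
    rwa [numHess, det_hessian hm hζ ell (h.sub_ne_zero hm)] at h1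
  have hv : v0 ≠ 0 := by
    intro h0
    rw [h0] at hsq
    exact pow_ne_zero m (two_ne_zero (α := ℂ)) (by rw [← hsq]; ring)
  set G : smoothAlg m := (jacMat h.chart).det * expLin h.chart (linePt m 1) with hG
  have hGx : ∀ x, yFun m τ (φ x) * volForm m φ x = m * ell * G.1 x := by
    intro x
    rw [h.yFun_eq, h.volForm_eq, hG, expLin_linePt]
    change _ = m * ell * (_ * _)
    ring
  have hz : ∀ᶠ z in 𝓝[<] (0 : ℝ), z ∈ Set.Ioo z₀ 0 := Ioo_mem_nhdsLT hz₀
  refine ⟨v0 / p, ?_, ?_, ?_⟩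
  · rw [div_pow, hp2, div_mul_eq_mul_div, hsq, div_self (pow_ne_zero _ two_ne_zero)]
  · filter_upwards [hz] with z hz
    obtain ⟨h1, h2⟩ := h.hasDerivAt_oscIntegral hz.1.le hz.2 hd hint
    exact ⟨h1, h2.differentiableAt⟩
  · intro N
    have hintG : Integrable fun x => ((Real.exp (-‖x‖ ^ 2 / (-z₀)) : ℝ) : ℂ) * G.1 x := by
      have h1 := (integrable_exp_mul_mul h.continuous_yFun h.continuous_volForm le_rfl hz₀ hd
        hint).2.1.const_mul ((m : ℂ) * ell)⁻¹
      refine h1.congr (Eventually.of_forall fun x => ?_)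
      beta_reduce
      rw [hGx, neg_div_neg_eq]
      push_cast
      field_simp
    have hlap := laplace_expansion (neg_pos.2 hz₀) hintG (N + 1)
    have htend : Tendsto (fun z : ℝ => -z) (𝓝[<] 0) (𝓝[>] 0) := by
      have := tendsto_neg_nhdsLT (a := (0 : ℝ))
      rwa [neg_zero] at this
    have h2 := (hlap.comp_tendsto htend).const_mul_left v0⁻¹
    refine (h2.trans ?_).congr' ?_ (EventuallyEq.rfl)
    · refine IsBigO.of_bound 1 (Eventually.of_forall fun z => ?_)
      simp
    · filter_upwards [hz] with z hz
      have hzC : (z : ℂ) ≠ 0 := Complex.ofReal_ne_zero.2 hz.2.ne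
      rw [(h.hasDerivAt_oscIntegral hz.1.le hz.2 hd hint).2.deriv]
      simp only [hGx, Function.comp_apply]
      have h3 : ∀ x : EuclideanSpace ℝ (Fin m), Complex.exp ((‖x‖ ^ 2 / z : ℝ) : ℂ) *
          (m * ell * G.1 x) = m * ell * (((Real.exp (-‖x‖ ^ 2 / -z) : ℝ) : ℂ) * G.1 x) := by
        intro x
        rw [neg_div_neg_eq, Complex.ofReal_exp]
        ring
      simp only [h3, integral_const_mul]
      set K := ∫ x, ((Real.exp (-‖x‖ ^ 2 / -z) : ℝ) : ℂ) * G.1 x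
      have h4 : (-2 * Real.pi * z) ^ ((m : ℝ) / 2) =
          2 ^ ((m : ℝ) / 2) * (Real.pi * -z) ^ ((m : ℝ) / 2) := by
        rw [← Real.mul_rpow (by norm_num) (mul_nonneg Real.pi_pos.le (by linarith [hz.2]))]
        congr 1
        ring
      have h5 : (((Real.pi * -z) ^ ((m : ℝ) / 2) : ℝ) : ℂ) ≠ 0 :=
        Complex.ofReal_ne_zero.2
          (Real.rpow_pos_of_pos (mul_pos Real.pi_pos (by linarith [hz.2])) _).ne'
      rw [h4, Complex.ofReal_mul, ← hp]
      set Q : ℂ := (((Real.pi * -z) ^ ((m : ℝ) / 2) : ℝ) : ℂ)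
      have h6 : ∀ k, gaussCoeff k G = v0 * fval m ζ lam k ell (linePt m 1) := fun k =>
        hchart.gaussCoeff_eq hm hζ hlam (h.sub_ne_zero hm) k _
      have h7 : ∑ k ∈ Finset.range (N + 1), gaussCoeff k G * ((-z : ℝ) : ℂ) ^ k =
          v0 * ∑ k ∈ Finset.range (N + 1), fval m ζ lam k ell (linePt m 1) * (-(z : ℂ)) ^ k := by
        rw [Finset.mul_sum]
        refine Finset.sum_congr rfl fun k _ => ?_
        rw [h6]
        push_cast
        ring
      rw [h7]
      have h8 := Complex.exp_ne_zero (potential m ζ lam τ (φ 0) / z)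
      set e := Complex.exp (potential m ζ lam τ (φ 0) / z)
      rw [mul_sub, ← mul_assoc v0⁻¹ v0, inv_mul_cancel₀ hv, one_mul]
      congr 1
      field_simp

end Thimbles

/-! ### The hypergeometric series of the quintic -/

noncomputable section QuantumSeries

open PowerSeries

lemma coeff_qD (d : ℕ) (f : PowerSeries ℂ) : coeff d (qD f) = d * coeff d f := by
  rw [qD, coeff_mk]

lemma qD_eq (f : PowerSeries ℂ) : qD f = X * derivative ℂ f := by
  ext d
  rw [coeff_qD]
  cases d with
  | zero => simp
  | succ d => rw [coeff_succ_X_mul, coeff_derivative]; push_cast; ring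

lemma qD_add (f g : PowerSeries ℂ) : qD (f + g) = qD f + qD g := by
  rw [qD_eq, qD_eq, qD_eq, map_add, mul_add]

lemma qD_sub (f g : PowerSeries ℂ) : qD (f - g) = qD f - qD g := by
  rw [qD_eq, qD_eq, qD_eq, map_sub, mul_sub]

lemma qD_mul (f g : PowerSeries ℂ) : qD (f * g) = f * qD g + qD f * g := by
  rw [qD_eq, qD_eq, qD_eq, Derivation.leibniz, smul_eq_mul, smul_eq_mul]
  ring

lemma qD_C (c : ℂ) : qD (C c) = 0 := by
  rw [qD_eq, derivative_C, mul_zero]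

lemma qD_one : qD 1 = 0 := by
  rw [← map_one (C (R := ℂ)), qD_C]

lemma qD_zero : qD 0 = 0 := by
  have h := qD_C 0
  rwa [map_zero] at h

lemma qD_X : qD X = X := by
  rw [qD_eq, derivative_X, mul_one]

lemma qD_pow (f : PowerSeries ℂ) (n : ℕ) : qD (f ^ n) = n * f ^ (n - 1) * qD f := by
  rw [qD_eq, qD_eq, Derivation.leibniz_pow, smul_eq_mul, nsmul_eq_mul]
  ring

lemma constantCoeff_qD (f : PowerSeries ℂ) : constantCoeff (qD f) = 0 := by
  rw [qD_eq, map_mul, constantCoeff_X, zero_mul]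

lemma eq_C_of_qD_eq_zero {f : PowerSeries ℂ} (h : qD f = 0) : f = C (constantCoeff f) := by
  ext d
  cases d with
  | zero => simp
  | succ d =>
    have h1 := congrArg (coeff (d + 1)) h
    rw [coeff_qD, map_zero] at h1
    have h2 : ((d + 1 : ℕ) : ℂ) ≠ 0 := by exact_mod_cast Nat.succ_ne_zero d
    rw [coeff_C, if_neg (Nat.succ_ne_zero d), (mul_eq_zero.1 h1).resolve_left h2]

lemma constantCoeff_Lser : constantCoeff Lser = 1 := by
  rw [← coeff_zero_eq_constantCoeff_apply, Lser, coeff_mk]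
  simp

lemma qD_Lser : (1 - 5 ^ 5 * X) * qD Lser = 5 ^ 4 * X * Lser := by
  have h : qD Lser = C (5 ^ 5 : ℂ) * (X * (qD Lser + C (1 / 5 : ℂ) * Lser)) := by
    ext d
    rw [coeff_qD]
    cases d with
    | zero => simp
    | succ d =>
      rw [coeff_C_mul, coeff_succ_X_mul, map_add, coeff_C_mul, coeff_qD, Lser, coeff_mk, coeff_mk,
        Finset.prod_range_succ, Nat.factorial_succ]
      have h1 : ((d : ℂ) + 1) ≠ 0 := by exact_mod_cast Nat.succ_ne_zero d
      have h2 : (d.factorial : ℂ) ≠ 0 := by exact_mod_cast Nat.factorial_ne_zero d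
      push_cast
      field_simp
      ring
  have h5 : C (5 ^ 5 : ℂ) = (5 : PowerSeries ℂ) ^ 5 := by rw [map_pow, map_ofNat]
  have h6 : (5 : PowerSeries ℂ) ^ 5 * C (1 / 5 : ℂ) = 5 ^ 4 := by
    rw [← h5, ← map_mul]
    have : ((5 : ℂ) ^ 5 * (1 / 5)) = 5 ^ 4 := by norm_num
    rw [this, map_pow, map_ofNat]
  rw [h5] at h
  linear_combination h + X * Lser * h6

lemma Lser_pow_five : Lser ^ 5 * (1 - 5 ^ 5 * X) = 1 := by
  have hX : qD (1 - 5 ^ 5 * X : PowerSeries ℂ) = -(5 ^ 5 * X) := by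
    have h5 : (5 : PowerSeries ℂ) ^ 5 = C (5 ^ 5 : ℂ) := by rw [map_pow, map_ofNat]
    rw [qD_sub, qD_one, h5, qD_mul, qD_C, qD_X]
    ring
  have h : qD (Lser ^ 5 * (1 - 5 ^ 5 * X)) = 0 := by
    rw [qD_mul, qD_pow, hX]
    have := qD_Lser
    push_cast
    norm_num
    linear_combination 5 * Lser ^ 4 * this
  rw [eq_C_of_qD_eq_zero h]
  simp [constantCoeff_Lser]

/-- The coefficient of `q ^ d` in the hypergeometric series, as a series in `H` (at `z = 1`). -/
def hyperCoeff (d : ℕ) : PowerSeries ℂ :=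
  (∏ k ∈ Finset.Icc 1 (5 * d), (5 * X + C (k : ℂ))) * (∏ k ∈ Finset.Icc 1 d, (X + C (k : ℂ)) ^ 5)⁻¹

lemma coeff_Iser (j d : ℕ) : coeff d (Iser j) = coeff j (hyperCoeff d) := by
  rw [Iser, coeff_mk, hyperCoeff]

lemma hyperCoeff_zero : hyperCoeff 0 = 1 := by
  simp [hyperCoeff]

lemma constantCoeff_Iser_zero : constantCoeff (Iser 0) = 1 := by
  rw [← coeff_zero_eq_constantCoeff_apply, coeff_Iser, hyperCoeff_zero]
  simp

/-- The hypergeometric recurrence; one of the five factors `H + d + 1` cancels. -/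
lemma hyperCoeff_succ (d : ℕ) :
    (X + C ((d : ℂ) + 1)) ^ 4 * hyperCoeff (d + 1) =
      5 * ((5 * X + C (5 * d + 1 : ℂ)) * (5 * X + C (5 * d + 2 : ℂ)) * (5 * X + C (5 * d + 3 : ℂ)) *
        (5 * X + C (5 * d + 4 : ℂ))) * hyperCoeff d := by
  set A : PowerSeries ℂ := ∏ k ∈ Finset.Icc 1 (5 * d), (5 * X + C (k : ℂ)) with hA
  set B : PowerSeries ℂ := ∏ k ∈ Finset.Icc 1 d, (X + C (k : ℂ)) ^ 5 with hB
  have hB0 : constantCoeff B ≠ 0 := by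
    rw [hB, map_prod]
    refine Finset.prod_ne_zero_iff.2 fun k hk => ?_
    have : (k : ℂ) ≠ 0 := by
      have := (Finset.mem_Icc.1 hk).1
      exact_mod_cast (by omega : k ≠ 0)
    simpa using this
  have hd : (d : ℂ) + 1 ≠ 0 := by exact_mod_cast Nat.succ_ne_zero d
  set Q : PowerSeries ℂ := X + C ((d : ℂ) + 1) with hQ
  have hQ0 : constantCoeff Q ≠ 0 := by simpa [hQ] using hd
  have h1 : ∏ k ∈ Finset.Icc 1 (d + 1), (X + C (k : ℂ)) ^ 5 = B * Q ^ 5 := by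
    rw [Finset.prod_Icc_succ_top (by omega), hQ]
    push_cast
    rfl
  have h2 : ∏ k ∈ Finset.Icc 1 (5 * (d + 1)), (5 * X + C (k : ℂ)) =
      A * ((5 * X + C (5 * d + 1 : ℂ)) * (5 * X + C (5 * d + 2 : ℂ)) * (5 * X + C (5 * d + 3 : ℂ)) *
        (5 * X + C (5 * d + 4 : ℂ))) * (5 * Q) := by
    rw [show 5 * (d + 1) = 5 * d + 1 + 1 + 1 + 1 + 1 by ring]
    repeat rw [Finset.prod_Icc_succ_top (by omega)]
    have h5 : (5 : PowerSeries ℂ) * C ((d : ℂ) + 1) = C (5 * d + 5 : ℂ) := by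
      rw [← map_ofNat (C (R := ℂ)), ← map_mul]
      congr 1
      ring
    have c1 : ((5 * d + 1 : ℕ) : ℂ) = 5 * d + 1 := by push_cast; ring
    have c2 : ((5 * d + 1 + 1 : ℕ) : ℂ) = 5 * d + 2 := by push_cast; ring
    have c3 : ((5 * d + 1 + 1 + 1 : ℕ) : ℂ) = 5 * d + 3 := by push_cast; ring
    have c4 : ((5 * d + 1 + 1 + 1 + 1 : ℕ) : ℂ) = 5 * d + 4 := by push_cast; ring
    have c5 : ((5 * d + 1 + 1 + 1 + 1 + 1 : ℕ) : ℂ) = 5 * d + 5 := by push_cast; ring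
    rw [hQ, mul_add 5 X, h5, c1, c2, c3, c4, c5, ← hA]
    ring
  have h3 : (B * Q ^ 5) * (B * Q ^ 5)⁻¹ = 1 :=
    PowerSeries.mul_inv_cancel _ (by simp [hB0, hQ0])
  have h4 : B * B⁻¹ = 1 := PowerSeries.mul_inv_cancel _ hB0
  rw [hyperCoeff, h1, h2, hyperCoeff, ← hA, ← hB]
  set T := (5 * X + C (5 * d + 1 : ℂ)) * (5 * X + C (5 * d + 2 : ℂ)) * (5 * X + C (5 * d + 3 : ℂ)) *
        (5 * X + C (5 * d + 4 : ℂ))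
  have hQne : Q ≠ 0 := fun h0 => hQ0 (by rw [h0, map_zero])
  have hBne : B ≠ 0 := fun h0 => hB0 (by rw [h0, map_zero])
  refine mul_left_cancel₀ (mul_ne_zero hQne hBne) ?_
  linear_combination (A * T * 5 * Q) * h3 - 5 * T * A * Q * h4

/-- The Picard--Fuchs operator `D ^ 4 - 5 q ∏ (5 D + j)`. -/
def picardFuchs (f : PowerSeries ℂ) : PowerSeries ℂ :=
  qD (qD (qD (qD f))) - 5 * X * (625 * qD (qD (qD (qD f))) + 1250 * qD (qD (qD f)) +
    875 * qD (qD f) + 250 * qD f + 24 * f)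

/-- The formal derivative of the Picard--Fuchs operator with respect to `D`. -/
def picardFuchsDeriv (f : PowerSeries ℂ) : PowerSeries ℂ :=
  4 * qD (qD (qD f)) - 5 * X * (2500 * qD (qD (qD f)) + 3750 * qD (qD f) + 1750 * qD f + 250 * f)

lemma coeff_ofNat_mul (n d : ℕ) [n.AtLeastTwo] (f : PowerSeries ℂ) :
    coeff d ((ofNat(n) : PowerSeries ℂ) * f) = (ofNat(n) : ℂ) * coeff d f := by
  rw [← map_ofNat (C (R := ℂ)), coeff_C_mul]

lemma coeff_one_ofNat (n : ℕ) [n.AtLeastTwo] : coeff 1 (ofNat(n) : PowerSeries ℂ) = 0 := by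
  rw [← map_ofNat (C (R := ℂ)), coeff_C]
  simp

lemma picardFuchs_Iser_zero : picardFuchs (Iser 0) = 0 := by
  ext d
  rw [picardFuchs, map_sub, mul_assoc, coeff_ofNat_mul]
  cases d with
  | zero => simp [coeff_qD]
  | succ d =>
    have h := congrArg constantCoeff (hyperCoeff_succ d)
    simp only [map_mul, map_pow, map_add, constantCoeff_X, constantCoeff_C, zero_add, map_ofNat,
      mul_zero] at h
    rw [coeff_succ_X_mul]
    simp only [map_add, coeff_ofNat_mul, coeff_qD, coeff_Iser, map_zero,
      coeff_zero_eq_constantCoeff_apply]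
    push_cast
    linear_combination h

lemma picardFuchs_Iser_one : picardFuchs (Iser 1) + picardFuchsDeriv (Iser 0) = 0 := by
  ext d
  rw [picardFuchs, picardFuchsDeriv, map_add, map_sub, map_sub, mul_assoc, mul_assoc,
    coeff_ofNat_mul, coeff_ofNat_mul, coeff_ofNat_mul]
  cases d with
  | zero => simp [coeff_qD]
  | succ d =>
    have h0 := congrArg constantCoeff (hyperCoeff_succ d)
    have h := congrArg (coeff 1) (hyperCoeff_succ d)
    have e4 : (X + C ((d : ℂ) + 1)) ^ 4 = (X + C ((d : ℂ) + 1)) * (X + C ((d : ℂ) + 1)) *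
      (X + C ((d : ℂ) + 1)) * (X + C ((d : ℂ) + 1)) := by ring
    have eC : ∀ c : ℂ, coeff 1 (C c) = 0 := fun c => by simp
    have e5 : coeff 1 (5 * X : PowerSeries ℂ) = 5 := by
      rw [coeff_ofNat_mul, coeff_one_X, mul_one]
    rw [e4] at h
    simp only [coeff_one_mul, map_mul, map_add, constantCoeff_X, constantCoeff_C, zero_add,
      map_ofNat, mul_zero, zero_mul, coeff_one_X, eC, e5, coeff_one_ofNat, add_zero] at h
    rw [coeff_succ_X_mul, coeff_succ_X_mul]
    simp only [map_add, coeff_ofNat_mul, coeff_qD, coeff_Iser, map_zero,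
      coeff_zero_eq_constantCoeff_apply]
    push_cast
    linear_combination h

end QuantumSeries

/-! ### Factorization of the Picard--Fuchs operator -/

noncomputable section Factorization

open PowerSeries

/-- The coefficients of the differential operator `u₀ θ u₁ θ u₂ θ u₁ θ u₀`, for a derivation `δ`:
the coefficient of `θ ^ j` is the `j`-th entry. -/
def factorCoeff {R : Type*} [CommRing R] (δ : R → R) (u₀ u₁ u₂ : R) : Fin 5 → R :=
  let c₃ := u₂ * (u₁ * u₀)
  let c₂ := u₂ * (u₁ * δ u₀ + δ (u₁ * u₀)) + δ (u₂ * (u₁ * u₀))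
  let c₁ := u₂ * δ (u₁ * δ u₀) + δ (u₂ * (u₁ * δ u₀ + δ (u₁ * u₀)))
  let c₀ := δ (u₂ * δ (u₁ * δ u₀))
  ![u₀ * δ (u₁ * c₀), u₀ * (u₁ * c₀ + δ (u₁ * c₁)), u₀ * (u₁ * c₁ + δ (u₁ * c₂)),
    u₀ * (u₁ * c₂ + δ (u₁ * c₃)), u₀ * (u₁ * c₃)]

section

variable {R M : Type*} [CommRing R] [AddCommGroup M] [Module R M] {δ : R → R} {θ : M → M} {z : R}

/-- Expansion of the factorized operator. It is used for `qD` acting on logarithmic solutions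
(`z = 1`) and for `theta` acting on formal series (`z = X`). -/
lemma factor_expand (hz : δ z = 0) (hθa : ∀ a b, θ (a + b) = θ a + θ b)
    (hδm : ∀ a b, δ (a * b) = a * δ b + δ a * b)
    (hθm : ∀ (c : R) (b : M), θ (c • b) = c • θ b + (z * δ c) • b) (u₀ u₁ u₂ : R) (b : M) :
    u₀ • θ (u₁ • θ (u₂ • θ (u₁ • θ (u₀ • b)))) =
      factorCoeff δ u₀ u₁ u₂ 4 • θ (θ (θ (θ b))) +
      (z * factorCoeff δ u₀ u₁ u₂ 3) • θ (θ (θ b)) +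
      (z ^ 2 * factorCoeff δ u₀ u₁ u₂ 2) • θ (θ b) +
      (z ^ 3 * factorCoeff δ u₀ u₁ u₂ 1) • θ b + (z ^ 4 * factorCoeff δ u₀ u₁ u₂ 0) • b := by
  have hzm : ∀ a, δ (z * a) = z * δ a := by
    intro a
    rw [hδm, hz, zero_mul, add_zero]
  have s1 : u₁ • θ (u₀ • b) = (u₁ * u₀) • θ b + (z * (u₁ * δ u₀)) • b := by
    rw [hθm]; module
  have s2 : u₂ • θ (u₁ • θ (u₀ • b)) = (u₂ * (u₁ * u₀)) • θ (θ b) +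
      (z * (u₂ * (u₁ * δ u₀ + δ (u₁ * u₀)))) • θ b + (z * (z * (u₂ * δ (u₁ * δ u₀)))) • b := by
    rw [s1, hθa, hθm, hθm, hzm]; module
  set b₂ := u₂ * (u₁ * u₀)
  set b₁ := u₂ * (u₁ * δ u₀ + δ (u₁ * u₀))
  set b₀ := u₂ * δ (u₁ * δ u₀)
  have s3 : u₁ • θ (u₂ • θ (u₁ • θ (u₀ • b))) = (u₁ * b₂) • θ (θ (θ b)) +
      (z * (u₁ * (b₁ + δ b₂))) • θ (θ b) + (z * (z * (u₁ * (b₀ + δ b₁)))) • θ b +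
      (z * (z * (z * (u₁ * δ b₀)))) • b := by
    rw [s2, hθa, hθa, hθm, hθm, hθm, hzm, hzm, hzm]; module
  have e4 : factorCoeff δ u₀ u₁ u₂ 4 = u₀ * (u₁ * b₂) := rfl
  have e3 : factorCoeff δ u₀ u₁ u₂ 3 = u₀ * (u₁ * (b₁ + δ b₂) + δ (u₁ * b₂)) := rfl
  have e2 : factorCoeff δ u₀ u₁ u₂ 2 = u₀ * (u₁ * (b₀ + δ b₁) + δ (u₁ * (b₁ + δ b₂))) := rfl
  have e1 : factorCoeff δ u₀ u₁ u₂ 1 = u₀ * (u₁ * δ b₀ + δ (u₁ * (b₀ + δ b₁))) := rfl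
  have e0 : factorCoeff δ u₀ u₁ u₂ 0 = u₀ * δ (u₁ * δ b₀) := rfl
  rw [s3, hθa, hθa, hθa, hθm, hθm, hθm, hθm, hzm, hzm, hzm, hzm, hzm, hzm, e4, e3, e2, e1, e0]
  module

/-- The factorized operator is formally self-adjoint, which determines its odd coefficients. -/
lemma factorCoeff_three (hδa : ∀ a b, δ (a + b) = δ a + δ b)
    (hδm : ∀ a b, δ (a * b) = a * δ b + δ a * b) (u₀ u₁ u₂ : R) :
    factorCoeff δ u₀ u₁ u₂ 3 = 2 * δ (factorCoeff δ u₀ u₁ u₂ 4) := by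
  simp only [factorCoeff, Matrix.cons_val, hδa, hδm]
  ring

lemma factorCoeff_one (hδa : ∀ a b, δ (a + b) = δ a + δ b)
    (hδm : ∀ a b, δ (a * b) = a * δ b + δ a * b) (u₀ u₁ u₂ : R) :
    factorCoeff δ u₀ u₁ u₂ 1 = δ (factorCoeff δ u₀ u₁ u₂ 2) -
      δ (δ (δ (factorCoeff δ u₀ u₁ u₂ 4))) := by
  simp only [factorCoeff, Matrix.cons_val, hδa, hδm]
  ring

end

/-- The operator `q d/dq`, on pairs `(f₀, f₁)` representing `f₀ + f₁ * log q`. -/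
def logD (f : PowerSeries ℂ × PowerSeries ℂ) : PowerSeries ℂ × PowerSeries ℂ :=
  (qD f.1 + f.2, qD f.2)

lemma logD_add (a b : PowerSeries ℂ × PowerSeries ℂ) : logD (a + b) = logD a + logD b := by
  simp only [logD, Prod.fst_add, Prod.snd_add, qD_add, Prod.mk_add_mk]
  ring_nf

lemma logD_smul (c : PowerSeries ℂ) (b : PowerSeries ℂ × PowerSeries ℂ) :
    logD (c • b) = c • logD b + (1 * qD c) • b := by
  ext1
  · simp only [logD, Prod.smul_fst, Prod.smul_snd, Prod.fst_add, smul_eq_mul, qD_mul]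
    ring
  · simp only [logD, Prod.smul_fst, Prod.smul_snd, Prod.snd_add, smul_eq_mul, qD_mul]
    ring

lemma constantCoeff_I11 : constantCoeff I11 = 1 := by
  rw [I11, map_add, constantCoeff_qD, map_one, add_zero]

lemma Iser_zero_mul_inv : Iser 0 * (Iser 0)⁻¹ = 1 :=
  PowerSeries.mul_inv_cancel _ (by rw [constantCoeff_Iser_zero]; exact one_ne_zero)

lemma I11_mul_inv : I11 * I11⁻¹ = 1 :=
  PowerSeries.mul_inv_cancel _ (by rw [constantCoeff_I11]; exact one_ne_zero)

lemma constantCoeff_I22 : constantCoeff I22 = 1 := by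
  rw [I22, map_mul, map_pow, constantCoeff_Lser, constantCoeff_inv, map_mul, map_pow, map_pow,
    constantCoeff_I11, constantCoeff_Iser_zero]
  norm_num

lemma I22_mul_inv : I22 * I22⁻¹ = 1 :=
  PowerSeries.mul_inv_cancel _ (by rw [constantCoeff_I22]; exact one_ne_zero)

lemma I22_mul : I22 * (Iser 0 ^ 2 * I11 ^ 2) = Lser ^ 5 := by
  rw [I22, mul_assoc, PowerSeries.inv_mul_cancel, mul_one]
  rw [map_mul, map_pow, map_pow, constantCoeff_I11, constantCoeff_Iser_zero]
  norm_num

/-- The coefficients of the factorization of the Picard--Fuchs operator. -/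
def pfCoeff : Fin 5 → PowerSeries ℂ := factorCoeff qD (Iser 0)⁻¹ I11⁻¹ I22⁻¹

lemma pfCoeff_four : pfCoeff 4 = 1 - 5 ^ 5 * X := by
  have h : pfCoeff 4 = (Iser 0)⁻¹ * (I11⁻¹ * (I22⁻¹ * (I11⁻¹ * (Iser 0)⁻¹))) := rfl
  have hL := Lser_pow_five
  rw [← I22_mul] at hL
  rw [h]
  have e : (Iser 0)⁻¹ * (I11⁻¹ * (I22⁻¹ * (I11⁻¹ * (Iser 0)⁻¹))) * (I22 * (Iser 0 ^ 2 * I11 ^ 2)) =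
      (Iser 0 * (Iser 0)⁻¹) ^ 2 * (I11 * I11⁻¹) ^ 2 * (I22 * I22⁻¹) := by ring
  rw [Iser_zero_mul_inv, I11_mul_inv, I22_mul_inv] at e
  linear_combination (1 - 5 ^ 5 * X) * e -
    ((Iser 0)⁻¹ * (I11⁻¹ * (I22⁻¹ * (I11⁻¹ * (Iser 0)⁻¹)))) * hL

lemma qD_ofNat_mul (n : ℕ) [n.AtLeastTwo] (f : PowerSeries ℂ) :
    qD ((ofNat(n) : PowerSeries ℂ) * f) = (ofNat(n) : PowerSeries ℂ) * qD f := by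
  rw [← map_ofNat (C (R := ℂ)), qD_mul, qD_C, zero_mul, add_zero]

lemma qD_pfCoeff_four : qD (pfCoeff 4) = -(3125 * X) := by
  rw [pfCoeff_four, qD_sub, qD_one, show (5 : PowerSeries ℂ) ^ 5 = 3125 by norm_num, qD_ofNat_mul,
    qD_X, zero_sub]

lemma qD_neg (f : PowerSeries ℂ) : qD (-f) = -qD f := by
  rw [← zero_sub, qD_sub, qD_zero, zero_sub]

lemma pfCoeff_three : pfCoeff 3 = -(6250 * X) := by
  have h := factorCoeff_three qD_add qD_mul (Iser 0)⁻¹ I11⁻¹ I22⁻¹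
  change pfCoeff 3 = 2 * qD (pfCoeff 4) at h
  rw [h, qD_pfCoeff_four]
  ring

lemma pfCoeff_one_eq : pfCoeff 1 = qD (pfCoeff 2) + 3125 * X := by
  have h := factorCoeff_one qD_add qD_mul (Iser 0)⁻¹ I11⁻¹ I22⁻¹
  change pfCoeff 1 = qD (pfCoeff 2) - qD (qD (qD (pfCoeff 4))) at h
  rw [h, qD_pfCoeff_four, qD_neg, qD_neg, qD_ofNat_mul, qD_ofNat_mul, qD_X, qD_X]
  ring

lemma constantCoeff_pfCoeff_two : constantCoeff (pfCoeff 2) = 0 := by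
  simp only [pfCoeff, factorCoeff, Matrix.cons_val, map_mul, map_add, constantCoeff_qD, mul_zero,
    add_zero]

/-- The factorized operator annihilates `I₀` and `I₁ + I₀ * log q`. -/
lemma pfCoeff_logD :
    pfCoeff 4 • logD (logD (logD (logD (Iser 1, Iser 0)))) +
      pfCoeff 3 • logD (logD (logD (Iser 1, Iser 0))) + pfCoeff 2 • logD (logD (Iser 1, Iser 0)) +
      pfCoeff 1 • logD (Iser 1, Iser 0) + pfCoeff 0 • (Iser 1, Iser 0) = 0 := by
  have h := factor_expand (δ := qD) (z := (1 : PowerSeries ℂ)) qD_one logD_add qD_mul logD_smul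
    (Iser 0)⁻¹ I11⁻¹ I22⁻¹ (Iser 1, Iser 0)
  simp only [one_pow, one_mul] at h
  have h1 : (Iser 0)⁻¹ • (Iser 1, Iser 0) = (Iser 1 * (Iser 0)⁻¹, 1) := by
    rw [Prod.smul_mk, smul_eq_mul, smul_eq_mul, mul_comm _ (Iser 0), Iser_zero_mul_inv, mul_comm]
  have h2 : logD (Iser 1 * (Iser 0)⁻¹, 1) = (I11, 0) := by
    rw [logD, qD_one, I11, add_comm]
  have h3 : I11⁻¹ • (I11, (0 : PowerSeries ℂ)) = (1, 0) := by
    rw [Prod.smul_mk, smul_eq_mul, smul_zero, mul_comm, I11_mul_inv]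
  have h4 : logD (1, 0) = 0 := by
    rw [logD, qD_one, qD_zero, add_zero]; rfl
  have h5 : logD 0 = 0 := by
    change (qD 0 + 0, qD 0) = _
    rw [qD_zero, add_zero]; rfl
  rw [h1, h2, h3, h4, smul_zero, h5, smul_zero, h5, smul_zero] at h
  exact h.symm

/-- The Picard--Fuchs operator factorizes: both operators are self-adjoint of order four with the
same leading coefficient, and have two solutions in common. -/
lemma pfCoeff_lower :
    pfCoeff 2 = -(4375 * X) ∧ pfCoeff 1 = -(1250 * X) ∧ pfCoeff 0 = -(120 * X) := by
  have h := pfCoeff_logD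
  have hf := congrArg Prod.fst h
  have hs := congrArg Prod.snd h
  simp only [logD, Prod.fst_add, Prod.snd_add, Prod.smul_fst, Prod.smul_snd, smul_eq_mul,
    Prod.fst_zero, Prod.snd_zero, qD_add] at hf hs
  have p0 := picardFuchs_Iser_zero
  have p1 := picardFuchs_Iser_one
  rw [picardFuchs] at p0 p1
  rw [picardFuchsDeriv] at p1
  rw [pfCoeff_four, pfCoeff_three, pfCoeff_one_eq] at hf hs
  -- the differences of the two undetermined coefficients from those of the Picard--Fuchs operator
  set c₂ := pfCoeff 2 + 4375 * X with hc₂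
  set c₀ := pfCoeff 0 + 120 * X with hc₀
  have hD : qD c₂ = qD (pfCoeff 2) + 4375 * X := by
    rw [hc₂, qD_add, qD_ofNat_mul, qD_X]
  have q0 : c₂ * qD (qD (Iser 0)) + qD c₂ * qD (Iser 0) + c₀ * Iser 0 = 0 := by
    rw [hD, hc₂, hc₀]
    linear_combination hs - p0
  have q1 : c₂ * (qD (qD (Iser 1)) + 2 * qD (Iser 0)) + qD c₂ * (qD (Iser 1) + Iser 0) +
      c₀ * Iser 1 = 0 := by
    rw [hD, hc₂, hc₀]
    linear_combination hf - p1
  -- With `W` the Wronskian of the two common solutions, `q d/dq` annihilates `c₂ * W`, which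
  -- vanishes at `q = 0`.
  set W := Iser 0 * qD (Iser 1) - Iser 1 * qD (Iser 0) + Iser 0 ^ 2 with hW
  have hDW : qD (c₂ * W) = 0 := by
    rw [hW, qD_mul, qD_add, qD_sub, qD_mul, qD_mul, pow_two, qD_mul]
    linear_combination Iser 0 * q1 - Iser 1 * q0
  have hW0 : constantCoeff W = 1 := by
    rw [hW, map_add, map_sub, map_mul, map_mul, constantCoeff_qD, constantCoeff_qD, map_pow,
      constantCoeff_Iser_zero]
    ring
  have hc20 : constantCoeff c₂ = 0 := by
    rw [hc₂, map_add, constantCoeff_pfCoeff_two, map_mul, constantCoeff_X]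
    ring
  have h1 := eq_C_of_qD_eq_zero hDW
  rw [map_mul, hc20, zero_mul, map_zero] at h1
  have hc2 : c₂ = 0 := (mul_eq_zero.1 h1).resolve_right fun h0 => by
    rw [h0, map_zero] at hW0
    exact zero_ne_one hW0
  rw [hc2, qD_zero, zero_mul, zero_mul, zero_add, zero_add] at q0
  have hc0 : c₀ = 0 := (mul_eq_zero.1 q0).resolve_right fun h0 => by
    have h2 := constantCoeff_Iser_zero
    rw [h0, map_zero] at h2
    exact zero_ne_one h2
  have e2 : pfCoeff 2 = -(4375 * X) := by
    rw [hc₂] at hc2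
    linear_combination hc2
  refine ⟨e2, ?_, ?_⟩
  · rw [pfCoeff_one_eq, e2, qD_neg, qD_ofNat_mul, qD_X]
    ring
  · rw [hc₀] at hc0
    linear_combination hc0

end Factorization

/-! ### The formal solution for the quintic -/

noncomputable section QuinticSolution

open PowerSeries

lemma coeff_qDz (k : ℕ) (f : PowerSeries (PowerSeries ℂ)) : coeff k (qDz f) = qD (coeff k f) := by
  rw [qDz, coeff_mk]

lemma qDz_add (f g : PowerSeries (PowerSeries ℂ)) : qDz (f + g) = qDz f + qDz g := by
  ext1 k
  rw [map_add, coeff_qDz, coeff_qDz, coeff_qDz, map_add, qD_add]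

lemma qD_sum {ι : Type*} (s : Finset ι) (f : ι → PowerSeries ℂ) :
    qD (∑ i ∈ s, f i) = ∑ i ∈ s, qD (f i) := by
  simp only [qD_eq, map_sum, Finset.mul_sum]

lemma qDz_mul (f g : PowerSeries (PowerSeries ℂ)) : qDz (f * g) = f * qDz g + qDz f * g := by
  ext1 k
  rw [map_add, coeff_qDz, coeff_mul, coeff_mul, coeff_mul, qD_sum, ← Finset.sum_add_distrib]
  refine Finset.sum_congr rfl fun p _ => ?_
  rw [qD_mul, coeff_qDz, coeff_qDz]

lemma qDz_C (a : PowerSeries ℂ) : qDz (C a) = C (qD a) := by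
  ext1 k
  rw [coeff_qDz, coeff_C, coeff_C]
  split_ifs
  · rfl
  · exact qD_zero

lemma qDz_X : qDz X = 0 := by
  ext1 k
  rw [coeff_qDz, coeff_X, map_zero]
  split_ifs
  · exact qD_one
  · exact qD_zero

/-- The operator `z q d/dq + ℓ`. -/
def theta (l : PowerSeries ℂ) (b : PowerSeries (PowerSeries ℂ)) : PowerSeries (PowerSeries ℂ) :=
  X * qDz b + C l * b

lemma theta_add (l : PowerSeries ℂ) (a b : PowerSeries (PowerSeries ℂ)) :
    theta l (a + b) = theta l a + theta l b := by
  rw [theta, theta, theta, qDz_add]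
  ring

lemma theta_mul (l : PowerSeries ℂ) (c b : PowerSeries (PowerSeries ℂ)) :
    theta l (c * b) = c * theta l b + (X * qDz c) * b := by
  rw [theta, theta, qDz_mul]
  ring

lemma theta_C_C_mul (l : PowerSeries ℂ) (c : ℂ) (b : PowerSeries (PowerSeries ℂ)) :
    theta l (C (C c) * b) = C (C c) * theta l b := by
  rw [theta_mul, qDz_C, qD_C, map_zero, mul_zero, zero_mul, add_zero]

lemma theta_X_mul (l : PowerSeries ℂ) (b : PowerSeries (PowerSeries ℂ)) :
    theta l (X * b) = X * theta l b := by
  rw [theta_mul, qDz_X, mul_zero, zero_mul, add_zero]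

variable {ζ lam h : ℂ}

/-- The series `ℓ = h L`. -/
def ellSer (h : ℂ) : PowerSeries ℂ := C h * Lser

lemma qD_ellSer (hh : h ^ 5 = lam ^ 5) : C (5 * lam ^ 5) * qD (ellSer h) =
    ellSer h * (ellSer h ^ 5 - C (lam ^ 5)) := by
  have h1 := qD_Lser
  have h2 := Lser_pow_five
  have h3 : qD Lser = 5 ^ 4 * X * Lser * Lser ^ 5 := by
    linear_combination Lser ^ 5 * h1 - qD Lser * h2
  have h4 : 5 * qD Lser = Lser * (Lser ^ 5 - 1) := by
    linear_combination 5 * h3 - Lser * h2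
  rw [ellSer, qD_mul, qD_C, zero_mul, add_zero, mul_pow, ← map_pow, hh, map_mul, map_ofNat]
  linear_combination C (lam ^ 5) * C h * h4

/-- The coefficients of the formal solution, as power series in `q`. -/
def lineSer (ζ lam h : ℂ) (k : ℕ) (κ : ℂ) : PowerSeries ℂ :=
  Polynomial.aeval (ellSer h) (linePoly 5 ζ lam k κ)

lemma qD_aeval (a : PowerSeries ℂ) (p : Polynomial ℂ) :
    qD (Polynomial.aeval a p) = Polynomial.aeval a (Polynomial.derivative p) * qD a := by
  rw [qD_eq, qD_eq, Derivation.map_aeval, smul_eq_mul]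
  ring

lemma qD_lineSer (hζ : IsPrimitiveRoot ζ 5) (hlam : lam ≠ 0) (hh : h ^ 5 = lam ^ 5) (k : ℕ) (κ : ℂ) :
    C (5 * lam ^ 5) * qD (lineSer ζ lam h k κ) =
      -ellSer h * (C (5 * lam ^ 5) * (lineSer ζ lam h (k + 1) (κ + 1) - lineSer ζ lam h (k + 1) κ) +
        C κ * ellSer h ^ 4 * lineSer ζ lam h k κ) := by
  have hp : (Polynomial.X ^ 5 - Polynomial.C (lam ^ 5)) *
      Polynomial.derivative (linePoly 5 ζ lam k κ) =
      -(Polynomial.C (5 * lam ^ 5) * (linePoly 5 ζ lam (k + 1) (κ + 1) - linePoly 5 ζ lam (k + 1) κ) +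
        Polynomial.C κ * Polynomial.X ^ 4 * linePoly 5 ζ lam k κ) := by
    refine Polynomial.funext fun e => ?_
    have h1 := derivative_linePoly_eval (m := 5) (by norm_num) hζ hlam k e κ
    simp only [Polynomial.eval_mul, Polynomial.eval_sub, Polynomial.eval_neg, Polynomial.eval_add,
      Polynomial.eval_pow, Polynomial.eval_X, Polynomial.eval_C, eval_linePoly]
    rw [h1]
    push_cast
    ring
  have h2 := congrArg (Polynomial.aeval (ellSer h)) hp
  simp only [map_mul, map_sub, map_neg, map_add, map_pow, Polynomial.aeval_X, Polynomial.aeval_C,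
    PowerSeries.algebraMap_apply, Algebra.algebraMap_self, RingHom.id_apply] at h2
  have h3 := qD_ellSer hh
  rw [lineSer, qD_aeval]
  simp only [map_mul, map_pow] at h2 h3 ⊢
  change _ = -ellSer h * (C 5 * C lam ^ 5 * (Polynomial.aeval (ellSer h) _ -
    Polynomial.aeval (ellSer h) _) + C κ * ellSer h ^ 4 * Polynomial.aeval (ellSer h) _)
  linear_combination Polynomial.aeval (ellSer h) (Polynomial.derivative (linePoly 5 ζ lam k κ)) * h3 +
    ellSer h * h2

lemma lineSer_zero (κ : ℂ) : lineSer ζ lam h 0 κ = 1 := by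
  have h1 : linePoly 5 ζ lam 0 κ = 1 := by
    refine Polynomial.funext fun e => ?_
    rw [eval_linePoly, fval_zero, Polynomial.eval_one]
  rw [lineSer, h1, map_one]

/-- The formal series `Y_n = ∑ ℓ ^ n f_k (n) (- z) ^ k`, where `f_k (n)` is the `k`-th expansion
coefficient at the point of the line with parameter `n`, and `ℓ = h L`. -/
def solSer (ζ lam h : ℂ) (n : ℕ) : PowerSeries (PowerSeries ℂ) :=
  mk fun k => (-1) ^ k * ellSer h ^ n * lineSer ζ lam h k n

lemma coeff_solSer (n k : ℕ) :
    coeff k (solSer ζ lam h n) = (-1) ^ k * ellSer h ^ n * lineSer ζ lam h k n := by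
  rw [solSer, coeff_mk]

lemma qD_ellSer_pow (hh : h ^ 5 = lam ^ 5) (n : ℕ) : C (5 * lam ^ 5) * qD (ellSer h ^ n) =
    (n : PowerSeries ℂ) * ellSer h ^ n * (ellSer h ^ 5 - C (lam ^ 5)) := by
  cases n with
  | zero => rw [pow_zero, qD_one]; simp
  | succ n =>
    rw [qD_pow, Nat.add_sub_cancel]
    linear_combination ((n + 1 : ℕ) : PowerSeries ℂ) * ellSer h ^ n * qD_ellSer hh

/-- The differential-difference equation of the series `Y_n`. -/
lemma theta_solSer (hζ : IsPrimitiveRoot ζ 5) (hlam : lam ≠ 0) (hh : h ^ 5 = lam ^ 5) (n : ℕ) :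
    theta (ellSer h) (solSer ζ lam h n) =
      solSer ζ lam h (n + 1) - C (C ((n : ℂ) / 5)) * (X * solSer ζ lam h n) := by
  ext1 k
  rw [theta, map_add, map_sub, coeff_C_mul, coeff_C_mul]
  cases k with
  | zero =>
    rw [coeff_zero_X_mul, coeff_zero_X_mul, coeff_solSer, coeff_solSer, lineSer_zero, lineSer_zero]
    ring
  | succ k =>
    rw [coeff_succ_X_mul, coeff_succ_X_mul, coeff_qDz, coeff_solSer, coeff_solSer, coeff_solSer]
    have h0 : C (5 * lam ^ 5) ≠ 0 := by
      rw [Ne, map_eq_zero_iff _ C_injective]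
      exact mul_ne_zero (by norm_num) (pow_ne_zero _ hlam)
    refine mul_left_cancel₀ h0 ?_
    have h1 := qD_ellSer_pow hh n
    have h2 := qD_lineSer hζ hlam hh k (n : ℂ)
    have h3 : qD ((-1) ^ k * ellSer h ^ n * lineSer ζ lam h k n) =
        (-1) ^ k * (ellSer h ^ n * qD (lineSer ζ lam h k n) +
          qD (ellSer h ^ n) * lineSer ζ lam h k n) := by
      rw [mul_assoc, qD_mul, qD_mul]
      have : qD ((-1) ^ k) = 0 := by
        rw [qD_pow, ← map_one (C (R := ℂ)), ← map_neg, qD_C, mul_zero]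
      rw [this]
      ring
    rw [h3]
    have h4 : C (5 * lam ^ 5) * C ((n : ℂ) / 5) = C (lam ^ 5) * (n : PowerSeries ℂ) := by
      rw [← map_natCast (C (R := ℂ)), ← map_mul, ← map_mul]
      congr 1
      ring
    have h5 : C (n : ℂ) = (n : PowerSeries ℂ) := map_natCast _ _
    rw [h5] at h2
    push_cast
    linear_combination (-1) ^ k * ellSer h ^ n * h2 + (-1) ^ k * lineSer ζ lam h k n * h1 +
      (-1) ^ k * ellSer h ^ n * lineSer ζ lam h k n * h4

/-- A truncated sum with vanishing upper coefficients. -/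
lemma sum_range_eq_sum_ite {c g : ℕ → ℂ} {r : ℕ} (hc : ∀ s, r ≤ s → c s = 0) (n : ℕ) :
    ∑ s ∈ Finset.range n, c s * g s = ∑ s ∈ Finset.range r, if s + 1 ≤ n then c s * g s else 0 := by
  rw [← Finset.sum_filter]
  symm
  refine Finset.sum_subset (fun s hs => ?_) fun s hs hs' => ?_
  · exact Finset.mem_range.2 (Finset.mem_filter.1 hs).2
  · rw [hc s (by
      by_contra hcon
      exact hs' (Finset.mem_filter.2 ⟨Finset.mem_range.2 (by omega), Finset.mem_range.1 hs⟩)),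
      zero_mul]

lemma orderCoeff_eq_zero (r s : ℕ) (hs : r < s) (κ : ℂ) : orderCoeff r s κ = 0 := by
  induction r generalizing s with
  | zero => obtain ⟨s, rfl⟩ := Nat.exists_eq_succ_of_ne_zero (by omega : s ≠ 0); simp [orderCoeff]
  | succ r ih =>
    obtain ⟨s, rfl⟩ := Nat.exists_eq_succ_of_ne_zero (by omega : s ≠ 0)
    rw [orderCoeff_succ, ih _ (by omega), ih _ (by omega), mul_zero, add_zero]

/-- The shift relation at `m = 5`, starting from `κ = 1`. The numbers `15, 65, 90, 31, 1` are the
Stirling numbers `S(6, j)`, `j = 5, …, 1`. -/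
lemma fval_shift_five (hζ : IsPrimitiveRoot ζ 5) (hlam : lam ≠ 0) {e : ℂ} (he : e ≠ 0) (n : ℕ) :
    lam ^ 5 * e ^ 6 * (fval 5 ζ lam n e (linePt 5 6) - fval 5 ζ lam n e (linePt 5 1)) =
      -e ^ 5 * (15 / 5 * e ^ 5 * (if 1 ≤ n then fval 5 ζ lam (n - 1) e (linePt 5 5) else 0) +
        65 / 25 * e ^ 4 * (if 2 ≤ n then fval 5 ζ lam (n - 2) e (linePt 5 4) else 0) +
        90 / 125 * e ^ 3 * (if 3 ≤ n then fval 5 ζ lam (n - 3) e (linePt 5 3) else 0) +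
        31 / 625 * e ^ 2 * (if 4 ≤ n then fval 5 ζ lam (n - 4) e (linePt 5 2) else 0) +
        1 / 3125 * e * (if 5 ≤ n then fval 5 ζ lam (n - 5) e (linePt 5 1) else 0)) := by
  have h := jval_recurrence (m := 5) (by norm_num) hζ hlam e n 1
  rw [sum_range_eq_sum_ite (c := fun s => orderCoeff 5 (s + 1) 1) (r := 5)
    (fun s hs => orderCoeff_eq_zero 5 (s + 1) (by omega) 1)] at h
  have h5e : (5 : ℂ) * e ≠ 0 := mul_ne_zero (by norm_num) he
  have hj : ∀ s κ, s ≤ n → jval 5 ζ lam e (n - s) κ =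
      (5 * e) ^ n * ((5 * e) ^ s)⁻¹ * fval 5 ζ lam (n - s) e (linePt 5 κ) := by
    intro s κ hs
    rw [jval, ← pow_sub₀ _ h5e hs]
    push_cast
    rfl
  have hite : ∀ (s : ℕ) (c κ : ℂ), (if s ≤ n then c * jval 5 ζ lam e (n - s) κ else 0) =
      (5 * e) ^ n * (c * ((5 * e) ^ s)⁻¹ *
        if s ≤ n then fval 5 ζ lam (n - s) e (linePt 5 κ) else 0) := by
    intro s c κ
    split_ifs with hs
    · rw [hj s κ hs]; ring
    · simp
  simp only [Finset.sum_range_succ, Finset.sum_range_zero, hite, zero_add, Nat.reduceAdd] at h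
  have hj0 : ∀ κ, jval 5 ζ lam e n κ = (5 * e) ^ n * fval 5 ζ lam n e (linePt 5 κ) := by
    intro κ
    rw [jval]
    push_cast
    rfl
  rw [hj0, hj0] at h
  have o1 : orderCoeff 5 1 1 = 15 := by simp [orderCoeff]; norm_num
  have o2 : orderCoeff 5 2 1 = 65 := by simp [orderCoeff]; norm_num
  have o3 : orderCoeff 5 3 1 = 90 := by simp [orderCoeff]; norm_num
  have o4 : orderCoeff 5 4 1 = 31 := by simp [orderCoeff]; norm_num
  have o5 : orderCoeff 5 5 1 = 1 := by simp [orderCoeff]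
  have k6 : (1 : ℂ) + ((5 : ℕ) : ℂ) = 6 := by norm_num
  rw [k6] at h
  have k1 : (6 : ℂ) - (((0 : ℕ) : ℂ) + 1) = 5 := by norm_num
  have k2 : (6 : ℂ) - (((1 : ℕ) : ℂ) + 1) = 4 := by norm_num
  have k3 : (6 : ℂ) - (((2 : ℕ) : ℂ) + 1) = 3 := by norm_num
  have k4 : (6 : ℂ) - (((3 : ℕ) : ℂ) + 1) = 2 := by norm_num
  have k5 : (6 : ℂ) - (((4 : ℕ) : ℂ) + 1) = 1 := by norm_num
  rw [o1, o2, o3, o4, o5, k1, k2, k3, k4, k5] at h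
  have hpow : ((5 : ℂ) * e) ^ n ≠ 0 := pow_ne_zero _ h5e
  have hl5 : lam ^ 5 ≠ 0 := pow_ne_zero _ hlam
  generalize (if 1 ≤ n then fval 5 ζ lam (n - 1) e (linePt 5 5) else 0) = g1 at h ⊢
  generalize (if 2 ≤ n then fval 5 ζ lam (n - 2) e (linePt 5 4) else 0) = g2 at h ⊢
  generalize (if 3 ≤ n then fval 5 ζ lam (n - 3) e (linePt 5 3) else 0) = g3 at h ⊢
  generalize (if 4 ≤ n then fval 5 ζ lam (n - 4) e (linePt 5 2) else 0) = g4 at h ⊢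
  generalize (if 5 ≤ n then fval 5 ζ lam (n - 5) e (linePt 5 1) else 0) = g5 at h ⊢
  have h' : fval 5 ζ lam n e (linePt 5 6) - fval 5 ζ lam n e (linePt 5 1) =
      -(e ^ 5 / lam ^ 5) * (15 * ((5 * e) ^ 1)⁻¹ * g1 + 65 * ((5 * e) ^ 2)⁻¹ * g2 +
        90 * ((5 * e) ^ 3)⁻¹ * g3 + 31 * ((5 * e) ^ 4)⁻¹ * g4 + 1 * ((5 * e) ^ 5)⁻¹ * g5) :=
    mul_left_cancel₀ hpow (by linear_combination h)
  rw [h']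
  field_simp
  ring

lemma lineSer_shift_five (hζ : IsPrimitiveRoot ζ 5) (hlam : lam ≠ 0) (n : ℕ) :
    C (lam ^ 5) * ellSer h ^ 6 * (lineSer ζ lam h n 6 - lineSer ζ lam h n 1) =
      -ellSer h ^ 5 *
        (C (15 / 5) * ellSer h ^ 5 * (if 1 ≤ n then lineSer ζ lam h (n - 1) 5 else 0) +
        C (65 / 25) * ellSer h ^ 4 * (if 2 ≤ n then lineSer ζ lam h (n - 2) 4 else 0) +
        C (90 / 125) * ellSer h ^ 3 * (if 3 ≤ n then lineSer ζ lam h (n - 3) 3 else 0) +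
        C (31 / 625) * ellSer h ^ 2 * (if 4 ≤ n then lineSer ζ lam h (n - 4) 2 else 0) +
        C (1 / 3125) * ellSer h * (if 5 ≤ n then lineSer ζ lam h (n - 5) 1 else 0)) := by
  have hp : Polynomial.C (lam ^ 5) * Polynomial.X ^ 6 *
      (linePoly 5 ζ lam n 6 - linePoly 5 ζ lam n 1) = -Polynomial.X ^ 5 *
        (Polynomial.C (15 / 5) * Polynomial.X ^ 5 * (if 1 ≤ n then linePoly 5 ζ lam (n - 1) 5 else 0) +
        Polynomial.C (65 / 25) * Polynomial.X ^ 4 * (if 2 ≤ n then linePoly 5 ζ lam (n - 2) 4 else 0) +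
        Polynomial.C (90 / 125) * Polynomial.X ^ 3 * (if 3 ≤ n then linePoly 5 ζ lam (n - 3) 3 else 0) +
        Polynomial.C (31 / 625) * Polynomial.X ^ 2 * (if 4 ≤ n then linePoly 5 ζ lam (n - 4) 2 else 0) +
        Polynomial.C (1 / 3125) * Polynomial.X * (if 5 ≤ n then linePoly 5 ζ lam (n - 5) 1 else 0)) := by
    refine Polynomial.eq_of_infinite_eval_eq _ _
      ((infinite_pow_ne (m := 5) (by norm_num) 0).mono fun e he => ?_)
    rw [Set.mem_ofPred_eq] at he ⊢
    have h1 := fval_shift_five hζ hlam he.1 n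
    have hite : ∀ (s : ℕ) (κ : ℂ), Polynomial.eval e (if s ≤ n then linePoly 5 ζ lam (n - s) κ else 0) =
        if s ≤ n then fval 5 ζ lam (n - s) e (linePt 5 κ) else 0 := by
      intro s κ
      split_ifs
      · rw [eval_linePoly]
      · rw [Polynomial.eval_zero]
    simp only [Polynomial.eval_mul, Polynomial.eval_sub, Polynomial.eval_neg, Polynomial.eval_add,
      Polynomial.eval_pow, Polynomial.eval_X, Polynomial.eval_C, hite, eval_linePoly]
    exact h1
  have h2 := congrArg (Polynomial.aeval (ellSer h)) hp
  have hite : ∀ (s : ℕ) (κ : ℂ), Polynomial.aeval (ellSer h)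
      (if s ≤ n then linePoly 5 ζ lam (n - s) κ else 0) =
        if s ≤ n then lineSer ζ lam h (n - s) κ else 0 := by
    intro s κ
    split_ifs
    · rfl
    · rw [map_zero]
  have hC : ∀ c : ℂ, Polynomial.aeval (ellSer h) (Polynomial.C c) = C c := by
    intro c
    rw [Polynomial.aeval_C, PowerSeries.algebraMap_apply]
    rfl
  rw [map_mul, map_mul, map_mul, map_sub, hC] at h2
  simp only [map_add, map_neg, map_mul (Polynomial.aeval (ellSer h)),
    map_pow (Polynomial.aeval (ellSer h)), hite, hC, Polynomial.aeval_X] at h2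
  exact h2

/-- The lower order terms in the fifth power of `theta`, expressed by the shift relation. -/
lemma solSer_shift_five (hζ : IsPrimitiveRoot ζ 5) (hlam : lam ≠ 0) :
    C (ellSer h ^ 5) * (C (C (15 * (-1 / 5))) * (X ^ 1 * solSer ζ lam h 5) +
      C (C (65 * (-1 / 5) ^ 2)) * (X ^ 2 * solSer ζ lam h 4) +
      C (C (90 * (-1 / 5) ^ 3)) * (X ^ 3 * solSer ζ lam h 3) +
      C (C (31 * (-1 / 5) ^ 4)) * (X ^ 4 * solSer ζ lam h 2) +
      C (C ((-1 / 5) ^ 5)) * (X ^ 5 * solSer ζ lam h 1)) =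
    -(C (C (lam ^ 5)) * (solSer ζ lam h 6 - C (ellSer h ^ 5) * solSer ζ lam h 1)) := by
  ext1 n
  have h1 := lineSer_shift_five (h := h) hζ hlam n
  have hite : ∀ (s r : ℕ) (κ : ℂ) (_ : (r : ℂ) = κ),
      coeff n (X ^ s * solSer ζ lam h r) = (-1) ^ s * (-1) ^ n * ellSer h ^ r *
        (if s ≤ n then lineSer ζ lam h (n - s) κ else 0) := by
    rintro s r κ rfl
    rw [coeff_X_pow_mul']
    split_ifs with hs
    · rw [coeff_solSer, ← pow_add]
      congr 2
      rw [neg_one_pow_eq_pow_mod_two, neg_one_pow_eq_pow_mod_two (n := s + n)]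
      congr 1
      omega
    · simp
  have h6 : coeff n (solSer ζ lam h 6) = (-1) ^ n * ellSer h ^ 6 * lineSer ζ lam h n 6 := by
    rw [coeff_solSer]; push_cast; rfl
  have h1' : coeff n (solSer ζ lam h 1) = (-1) ^ n * ellSer h ^ 1 * lineSer ζ lam h n 1 := by
    rw [coeff_solSer]; push_cast; rfl
  rw [map_neg, coeff_C_mul, coeff_C_mul, map_sub, coeff_C_mul, h6, h1']
  simp only [map_add, coeff_C_mul]
  rw [hite 1 5 5 (by norm_num), hite 2 4 4 (by norm_num), hite 3 3 3 (by norm_num),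
    hite 4 2 2 (by norm_num), hite 5 1 1 (by norm_num)]
  have c1 : C (15 * (-1 / 5) : ℂ) = -C (15 / 5 : ℂ) := by rw [← map_neg]; congr 1; norm_num
  have c2 : C (65 * (-1 / 5) ^ 2 : ℂ) = C (65 / 25 : ℂ) := by congr 1; norm_num
  have c3 : C (90 * (-1 / 5) ^ 3 : ℂ) = -C (90 / 125 : ℂ) := by rw [← map_neg]; congr 1; norm_num
  have c4 : C (31 * (-1 / 5) ^ 4 : ℂ) = C (31 / 625 : ℂ) := by congr 1; norm_num
  have c5 : C ((-1 / 5) ^ 5 : ℂ) = -C (1 / 3125 : ℂ) := by rw [← map_neg]; congr 1; norm_num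
  rw [c1, c2, c3, c4, c5]
  linear_combination (-1) ^ n * h1

/-- The fifth order equation: `θ ^ 5 Y_1 = 5 ^ 5 q Y_6 + λ ^ 5 Y_1`. -/
lemma theta_pow_five_solSer (hζ : IsPrimitiveRoot ζ 5) (hlam : lam ≠ 0) (hh : h ^ 5 = lam ^ 5) :
    theta (ellSer h) (theta (ellSer h) (theta (ellSer h) (theta (ellSer h) (theta (ellSer h)
      (solSer ζ lam h 1))))) =
      C (5 ^ 5 * X) * solSer ζ lam h 6 + C (C (lam ^ 5)) * solSer ζ lam h 1 := by
  have hL : ellSer h ^ 5 * (1 - 5 ^ 5 * X) = C (lam ^ 5) := by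
    rw [ellSer, mul_pow, mul_assoc, Lser_pow_five, ← map_pow, hh, mul_one]
  set t : PowerSeries (PowerSeries ℂ) := C (C (-1 / 5)) * X with ht
  have hstep : ∀ n : ℕ, theta (ellSer h) (solSer ζ lam h n) =
      solSer ζ lam h (n + 1) + n * (t * solSer ζ lam h n) := by
    intro n
    have h1 : C (C ((n : ℂ) / 5)) = -((n : PowerSeries (PowerSeries ℂ)) * C (C (-1 / 5))) := by
      rw [← map_natCast (C (R := PowerSeries ℂ)), ← map_natCast (C (R := ℂ)), ← map_mul, ← map_mul,
        ← map_neg, ← map_neg]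
      congr 2
      ring
    rw [theta_solSer hζ hlam hh, h1, ht]
    ring
  have ht1 : ∀ b, theta (ellSer h) (t * b) = t * theta (ellSer h) b := by
    intro b
    rw [ht, mul_assoc, theta_C_C_mul, theta_X_mul, mul_assoc]
  have htn : ∀ (k : ℕ) b, theta (ellSer h) ((k : PowerSeries (PowerSeries ℂ)) * b) =
      (k : PowerSeries (PowerSeries ℂ)) * theta (ellSer h) b := by
    intro k b
    rw [← map_natCast (C (R := PowerSeries ℂ)), ← map_natCast (C (R := ℂ)), theta_C_C_mul]
  have h5 : theta (ellSer h) (theta (ellSer h) (theta (ellSer h) (theta (ellSer h) (theta (ellSer h)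
      (solSer ζ lam h 1))))) = solSer ζ lam h 6 + (15 * (t * solSer ζ lam h 5) +
        65 * (t ^ 2 * solSer ζ lam h 4) + 90 * (t ^ 3 * solSer ζ lam h 3) +
        31 * (t ^ 4 * solSer ζ lam h 2) + t ^ 5 * solSer ζ lam h 1) := by
    simp only [hstep, theta_add, ht1, htn]
    push_cast
    ring
  have h6 := solSer_shift_five (h := h) hζ hlam
  have h7 : (15 * (t * solSer ζ lam h 5) +
        65 * (t ^ 2 * solSer ζ lam h 4) + 90 * (t ^ 3 * solSer ζ lam h 3) +
        31 * (t ^ 4 * solSer ζ lam h 2) + t ^ 5 * solSer ζ lam h 1) =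
      C (C (15 * (-1 / 5))) * (X ^ 1 * solSer ζ lam h 5) +
      C (C (65 * (-1 / 5) ^ 2)) * (X ^ 2 * solSer ζ lam h 4) +
      C (C (90 * (-1 / 5) ^ 3)) * (X ^ 3 * solSer ζ lam h 3) +
      C (C (31 * (-1 / 5) ^ 4)) * (X ^ 4 * solSer ζ lam h 2) +
      C (C ((-1 / 5) ^ 5)) * (X ^ 5 * solSer ζ lam h 1) := by
    simp only [map_mul, map_pow, map_ofNat, ht]
    ring
  rw [← h7] at h6
  rw [h5]
  set S := (15 * (t * solSer ζ lam h 5) +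
        65 * (t ^ 2 * solSer ζ lam h 4) + 90 * (t ^ 3 * solSer ζ lam h 3) +
        31 * (t ^ 4 * solSer ζ lam h 2) + t ^ 5 * solSer ζ lam h 1)
  have h8 := congrArg (C (R := PowerSeries ℂ)) hL
  have h0 : C (C (lam ^ 5)) ≠ (0 : PowerSeries (PowerSeries ℂ)) := by
    rw [Ne, map_eq_zero_iff _ C_injective, map_eq_zero_iff _ C_injective]
    exact pow_ne_zero _ hlam
  refine mul_left_cancel₀ h0 ?_
  rw [map_mul, map_sub, map_one] at h8
  generalize C (ellSer h ^ 5) = E at h6 h8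
  generalize C (5 ^ 5 * X : PowerSeries ℂ) = Q at h8 ⊢
  generalize C (C (lam ^ 5)) = Λ at h6 h8 ⊢
  linear_combination (1 - Q) * h6 - (S - Λ * solSer ζ lam h 1) * h8

/-- `625 Y_5` is the product of the operators `5 θ + j z`, `1 ≤ j ≤ 4`, applied to `Y_1`. -/
lemma solSer_five (hζ : IsPrimitiveRoot ζ 5) (hlam : lam ≠ 0) (hh : h ^ 5 = lam ^ 5) :
    625 * solSer ζ lam h 5 =
      625 * theta (ellSer h) (theta (ellSer h) (theta (ellSer h) (theta (ellSer h)
        (solSer ζ lam h 1)))) +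
      1250 * (X * theta (ellSer h) (theta (ellSer h) (theta (ellSer h) (solSer ζ lam h 1)))) +
      875 * (X ^ 2 * theta (ellSer h) (theta (ellSer h) (solSer ζ lam h 1))) +
      250 * (X ^ 3 * theta (ellSer h) (solSer ζ lam h 1)) + 24 * (X ^ 4 * solSer ζ lam h 1) := by
  set t : PowerSeries (PowerSeries ℂ) := C (C (1 / 5)) * X with ht
  have h5t : 5 * t = X := by
    rw [ht, ← mul_assoc, ← map_ofNat (C (R := PowerSeries ℂ)), ← map_ofNat (C (R := ℂ)), ← map_mul,
      ← map_mul]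
    norm_num
  have hstep : ∀ n : ℕ, solSer ζ lam h (n + 1) =
      theta (ellSer h) (solSer ζ lam h n) + n * (t * solSer ζ lam h n) := by
    intro n
    have h1 : C (C ((n : ℂ) / 5)) = (n : PowerSeries (PowerSeries ℂ)) * C (C (1 / 5)) := by
      rw [← map_natCast (C (R := PowerSeries ℂ)), ← map_natCast (C (R := ℂ)), ← map_mul, ← map_mul]
      congr 2
      ring
    rw [theta_solSer hζ hlam hh, h1, ht]
    ring
  have ht1 : ∀ b, theta (ellSer h) (t * b) = t * theta (ellSer h) b := by
    intro b
    rw [ht, mul_assoc, theta_C_C_mul, theta_X_mul, mul_assoc]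
  have htn : ∀ (k : ℕ) b, theta (ellSer h) ((k : PowerSeries (PowerSeries ℂ)) * b) =
      (k : PowerSeries (PowerSeries ℂ)) * theta (ellSer h) b := by
    intro k b
    rw [← map_natCast (C (R := PowerSeries ℂ)), ← map_natCast (C (R := ℂ)), theta_C_C_mul]
  rw [hstep 4, hstep 3, hstep 2, hstep 1, ← h5t]
  simp only [theta_add, ht1, htn]
  push_cast
  ring

end QuinticSolution

/-! ### The quantum differential equation of the quintic -/

noncomputable section QuinticSystem

open PowerSeries

variable {ζ lam h : ℂ}

lemma hpt_eq_eqParam (α : Fin 5) : hpt ζ lam α = eqParam 5 ζ lam α := rfl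

lemma hpt_pow_five (hζ : IsPrimitiveRoot ζ 5) (α : Fin 5) : hpt ζ lam α ^ 5 = lam ^ 5 :=
  eqParam_pow hζ α

lemma hpt_ne_zero (hζ : IsPrimitiveRoot ζ 5) (hlam : lam ≠ 0) (α : Fin 5) : hpt ζ lam α ≠ 0 :=
  mul_ne_zero (pow_ne_zero _ (hζ.ne_zero (by norm_num))) hlam

/-- The series of the coefficients at `q = 0`. -/
def initSer (ζ lam h : ℂ) : PowerSeries ℂ := mk fun k => (-1) ^ k * fval 5 ζ lam k h (linePt 5 1)

lemma fval_one_eq_fval_zero (hζ : IsPrimitiveRoot ζ 5) (hlam : lam ≠ 0) (hh : h ^ 5 = lam ^ 5)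
    (k : ℕ) : fval 5 ζ lam k h (linePt 5 1) = fval 5 ζ lam k h 0 := by
  have h1 := jval_one_eq_jval_zero (m := 5) (by norm_num) hζ hlam k hh
  rw [jval, jval, linePt_zero] at h1
  have hh0 : h ≠ 0 := by
    rintro rfl
    exact pow_ne_zero 5 hlam (by rw [← hh]; ring)
  exact mul_left_cancel₀ (pow_ne_zero _ (mul_ne_zero (by norm_num) hh0)) h1

lemma constantCoeff_logC (α : Fin 5) : constantCoeff (logC ζ lam α) = 0 := by
  rw [← coeff_zero_eq_constantCoeff_apply, logC, coeff_mk]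
  simp

lemma hasSubst_logC (α : Fin 5) : HasSubst (logC ζ lam α) :=
  HasSubst.of_constantCoeff_zero (constantCoeff_logC α)

lemma derivative_Cser (α : Fin 5) : derivative ℂ (Cser ζ lam α) =
    Cser ζ lam α * derivative ℂ (logC ζ lam α) := by
  rw [Cser, derivative_subst (hasSubst_logC α), derivative_exp]

lemma constantCoeff_Cser (α : Fin 5) : constantCoeff (Cser ζ lam α) = 1 := by
  rw [Cser]
  have h1 := PowerSeries.constantCoeff_subst_eq_zero (a := logC ζ lam α)
    (constantCoeff_logC α) (PowerSeries.exp ℂ - 1) (by simp)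
  rw [PowerSeries.subst_sub (hasSubst_logC α)] at h1
  have h2 : PowerSeries.subst (logC ζ lam α) (1 : PowerSeries ℂ) = (1 : PowerSeries ℂ) := by
    rw [← PowerSeries.coe_substAlgHom (hasSubst_logC α), map_one]
  rw [h2] at h1
  have h3 : constantCoeff (PowerSeries.subst (logC ζ lam α) (PowerSeries.exp ℂ)) -
    constantCoeff (1 : PowerSeries ℂ) = 0 := by
    rw [← map_sub]; exact h1
  rw [map_one] at h3
  linear_combination h3

/-- The series at `q = 0` is inverse to `C_α`: both satisfy first order equations, given by the
recurrence for the coefficients of products of Gamma functions. -/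
lemma initSer_mul_Cser (hζ : IsPrimitiveRoot ζ 5) (hlam : lam ≠ 0) (α : Fin 5) :
    initSer ζ lam (hpt ζ lam α) * Cser ζ lam α = 1 := by
  obtain ⟨hv0, hv⟩ := isGammaSeq_fval (m := 5) (by norm_num) hζ hlam α
  have hf : ∀ k, fval 5 ζ lam k (hpt ζ lam α) (linePt 5 1) = fval 5 ζ lam k (eqParam 5 ζ lam α) 0 :=
    fun k => fval_one_eq_fval_zero hζ hlam (hpt_pow_five hζ α) k
  have hd : derivative ℂ (initSer ζ lam (hpt ζ lam α)) =
      -(derivative ℂ (logC ζ lam α) * initSer ζ lam (hpt ζ lam α)) := by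
    ext k
    rw [coeff_derivative, initSer, coeff_mk, map_neg, coeff_mul,
      Finset.Nat.sum_antidiagonal_eq_sum_range_succ_mk]
    have h1 := hv k
    simp only [hf]
    have h2 : (-1 : ℂ) ^ (k + 1) * fval 5 ζ lam (k + 1) (eqParam 5 ζ lam α) 0 * (k + 1) =
        -((-1) ^ k * ((k + 1) * fval 5 ζ lam (k + 1) (eqParam 5 ζ lam α) 0)) := by ring
    rw [h2, h1, Finset.mul_sum]
    congr 1
    refine Finset.sum_congr rfl fun r hr => ?_
    have hrk : r ≤ k := Nat.lt_succ_iff.1 (Finset.mem_range.1 hr)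
    rw [coeff_mk, coeff_derivative, logC, coeff_mk]
    rcases Nat.even_or_odd r with he | ho
    · rw [if_pos he.add_one]
      have h3 : (-1 : ℂ) ^ k = (-1) ^ (k - r) := by
        obtain ⟨j, rfl⟩ := Nat.exists_eq_add_of_le hrk
        rw [Nat.add_sub_cancel_left, pow_add, he.neg_one_pow, one_mul]
      have h4 : ((r : ℂ) + 1) ≠ 0 := by exact_mod_cast Nat.succ_ne_zero r
      have h5 : ((r : ℂ) + 2) ≠ 0 := by exact_mod_cast Nat.succ_ne_zero (r + 1)
      have h6 : (r : ℂ) + 1 + 1 = r + 2 := by ring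
      have h7 : -5 * hpt ζ lam α = -(((5 : ℕ) : ℂ) * eqParam 5 ζ lam α) := by
        rw [hpt_eq_eqParam]; push_cast; ring
      rw [h3, h7]
      simp only [hpt_eq_eqParam]
      push_cast
      rw [h6]
      field_simp
    · rw [if_neg (by
        rw [Nat.not_odd_iff_even]
        exact ho.add_one), zero_mul, zero_mul]
      have h3 : _root_.bernoulli (r + 2) = 0 :=
        bernoulli_eq_zero_of_odd (by
          obtain ⟨j, rfl⟩ := ho
          exact ⟨j + 1, by ring⟩) (by omega)
      rw [h3]
      simp
  refine derivative.ext ?_ ?_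
  · rw [Derivation.leibniz, hd, derivative_Cser, smul_eq_mul, smul_eq_mul, Derivation.map_one_eq_zero]
    ring
  · rw [map_mul, constantCoeff_Cser, ← coeff_zero_eq_constantCoeff_apply, initSer, coeff_mk,
      map_one, hf, fval_zero]
    norm_num

lemma map_constantCoeff_solSer_one :
    PowerSeries.map constantCoeff (solSer ζ lam h 1) = C h * initSer ζ lam h := by
  have h0 : constantCoeff (ellSer h) = h := by
    rw [ellSer, map_mul, constantCoeff_C, constantCoeff_Lser, mul_one]
  ext k
  rw [coeff_map, coeff_solSer, coeff_C_mul, initSer, coeff_mk, map_mul, map_mul, map_pow, map_pow,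
    h0, lineSer]
  have h1 : constantCoeff (Polynomial.aeval (ellSer h) (linePoly 5 ζ lam k ((1 : ℕ) : ℂ))) =
      (linePoly 5 ζ lam k ((1 : ℕ) : ℂ)).eval h := by
    generalize linePoly 5 ζ lam k ((1 : ℕ) : ℂ) = p
    induction p using Polynomial.induction_on' with
    | add p q hp hq => rw [map_add, map_add, hp, hq, Polynomial.eval_add]
    | monomial n c =>
      rw [Polynomial.aeval_monomial, map_mul, map_pow, h0, Polynomial.eval_monomial,
        PowerSeries.algebraMap_apply, constantCoeff_C]
      rfl
  rw [h1, eval_linePoly, map_neg, map_one, Nat.cast_one]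
  ring

/-- The action of the factorized operator on the formal solution. -/
lemma factor_theta_solSer (hζ : IsPrimitiveRoot ζ 5) (hlam : lam ≠ 0) (hh : h ^ 5 = lam ^ 5) :
    C (Iser 0)⁻¹ * theta (ellSer h) (C I11⁻¹ * theta (ellSer h) (C I22⁻¹ * theta (ellSer h)
      (C I11⁻¹ * theta (ellSer h) (C (Iser 0)⁻¹ * solSer ζ lam h 1)))) =
    theta (ellSer h) (theta (ellSer h) (theta (ellSer h) (theta (ellSer h) (solSer ζ lam h 1)))) -
      C (5 ^ 5 * X) * solSer ζ lam h 5 := by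
  have h1 := factor_expand (R := PowerSeries (PowerSeries ℂ)) (M := PowerSeries (PowerSeries ℂ))
    (δ := qDz) (θ := theta (ellSer h)) (z := X) qDz_X (theta_add _) qDz_mul (theta_mul _)
    (C (Iser 0)⁻¹) (C I11⁻¹) (C I22⁻¹) (solSer ζ lam h 1)
  simp only [smul_eq_mul] at h1
  have h2 : ∀ i, factorCoeff qDz (C (Iser 0)⁻¹) (C I11⁻¹) (C I22⁻¹) i =
      C (factorCoeff qD (Iser 0)⁻¹ I11⁻¹ I22⁻¹ i) := by
    intro i
    fin_cases i <;> simp only [factorCoeff, Fin.zero_eta, Fin.mk_one, Fin.reduceFinMk,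
      Matrix.cons_val, ← map_mul, ← map_add, qDz_C]
  have h3 : ∀ i, factorCoeff qD (Iser 0)⁻¹ I11⁻¹ I22⁻¹ i = pfCoeff i := fun i => rfl
  obtain ⟨p2, p1, p0⟩ := pfCoeff_lower
  rw [h1, h2, h2, h2, h2, h2, h3, h3, h3, h3, h3, p2, p1, p0, pfCoeff_three, pfCoeff_four]
  have h4 := solSer_five hζ hlam hh
  simp only [map_sub, map_neg, map_mul, map_pow, map_one, map_ofNat]
  linear_combination 5 * C X * h4

/-- The quantum differential system closes up on the formal solution: applying its five steps to
`Y_1` gives back `lam ^ 5 Y_1`. -/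
lemma theta_factor_theta_solSer (hζ : IsPrimitiveRoot ζ 5) (hlam : lam ≠ 0)
    (hh : h ^ 5 = lam ^ 5) :
    theta (ellSer h) (C (Iser 0)⁻¹ * theta (ellSer h) (C I11⁻¹ * theta (ellSer h) (C I22⁻¹ *
      theta (ellSer h) (C I11⁻¹ * theta (ellSer h) (C (Iser 0)⁻¹ * solSer ζ lam h 1))))) =
    C (C (lam ^ 5)) * solSer ζ lam h 1 := by
  have hsub : ∀ a b, theta (ellSer h) (a - b) = theta (ellSer h) a - theta (ellSer h) b := by
    intro a b
    have h1 := theta_add (ellSer h) (a - b) b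
    rw [sub_add_cancel] at h1
    rw [h1]
    ring
  have h5 := theta_solSer hζ hlam hh 5
  have hq : qDz (C (5 ^ 5 * X)) = C (5 ^ 5 * X) := by
    rw [qDz_C, show (5 : PowerSeries ℂ) ^ 5 = 3125 by norm_num, qD_ofNat_mul, qD_X]
  have hc : C (C (((5 : ℕ) : ℂ) / 5)) = (1 : PowerSeries (PowerSeries ℂ)) := by
    rw [show (((5 : ℕ) : ℂ) / 5) = 1 by norm_num, map_one, map_one]
  rw [factor_theta_solSer hζ hlam hh, hsub, theta_pow_five_solSer hζ hlam hh, theta_mul, h5, hq, hc]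
  ring

/-- The coefficient of `q ^ d`, as a series in `z`. -/
def slice (d : ℕ) (F : PowerSeries (PowerSeries ℂ)) : PowerSeries ℂ :=
  mk fun k => coeff d (coeff k F)

lemma coeff_slice (d k : ℕ) (F : PowerSeries (PowerSeries ℂ)) :
    coeff k (slice d F) = coeff d (coeff k F) := by
  rw [slice, coeff_mk]

lemma slice_C_mul {d : ℕ} {F : PowerSeries (PowerSeries ℂ)} (hF : ∀ e < d, slice e F = 0)
    (a : PowerSeries ℂ) : slice d (C a * F) = C (constantCoeff a) * slice d F := by
  ext k
  rw [coeff_slice, coeff_C_mul, coeff_C_mul, coeff_slice, coeff_mul, Finset.sum_eq_single (0, d)]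
  · rw [coeff_zero_eq_constantCoeff_apply]
  · intro p hp hne
    rw [Finset.HasAntidiagonal.mem_antidiagonal] at hp
    have h1 : p.2 < d := by
      by_contra hcon
      exact hne (Prod.ext (by omega) (by omega))
    rw [← coeff_slice, hF _ h1, map_zero, mul_zero]
  · intro h0
    exact absurd (Finset.HasAntidiagonal.mem_antidiagonal.2 (zero_add d)) h0

lemma slice_X_mul_qDz (d : ℕ) (F : PowerSeries (PowerSeries ℂ)) :
    slice d (X * qDz F) = C (d : ℂ) * (X * slice d F) := by
  ext k
  rw [coeff_slice, coeff_C_mul]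
  cases k with
  | zero => rw [coeff_zero_X_mul, coeff_zero_X_mul, map_zero, mul_zero]
  | succ k => rw [coeff_succ_X_mul, coeff_succ_X_mul, coeff_qDz, coeff_qD, coeff_slice]

lemma slice_add (d : ℕ) (F G : PowerSeries (PowerSeries ℂ)) :
    slice d (F + G) = slice d F + slice d G := by
  ext k
  simp only [coeff_slice, map_add]

lemma eq_zero_of_slice {F : PowerSeries (PowerSeries ℂ)} (hF : ∀ d, slice d F = 0) : F = 0 := by
  ext k d
  rw [← coeff_slice, hF]
  simp

lemma slice_zero (F : PowerSeries (PowerSeries ℂ)) :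
    slice 0 F = PowerSeries.map constantCoeff F := by
  ext k
  rw [coeff_slice, coeff_map, coeff_zero_eq_constantCoeff_apply]

lemma sum_quantumMul (E : Fin 5 → PowerSeries (PowerSeries ℂ)) (i : Fin 5) :
    ∑ j, C (quantumMul lam i j) * E j =
      C (if i = 4 then C (lam ^ 5) * Idiag i else Idiag i) * E (i + 1) := by
  rw [Finset.sum_eq_single (i + 1)]
  · rw [quantumMul, if_pos rfl]
  · intro j _ hj
    rw [quantumMul, if_neg hj, map_zero, zero_mul]
  · simp

lemma constantCoeff_Idiag (i : Fin 5) : constantCoeff (Idiag i) = 1 := by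
  fin_cases i
  · exact constantCoeff_I11
  · exact constantCoeff_I22
  · exact constantCoeff_I11
  · exact constantCoeff_Iser_zero
  · exact constantCoeff_Iser_zero

/-- Power series solutions of the quantum differential equation are determined by their values at
`q = 0`. -/
lemma eq_zero_of_system (hlam : lam ≠ 0) (hh : h ^ 5 = lam ^ 5)
    {E : Fin 5 → PowerSeries (PowerSeries ℂ)}
    (hE : ∀ i, theta (ellSer h) (E i) = ∑ j, C (quantumMul lam i j) * E j)
    (h0 : ∀ i, PowerSeries.map constantCoeff (E i) = 0) : E = 0 := by
  have key : ∀ d, ∀ i, slice d (E i) = 0 := by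
    intro d
    induction d using Nat.strong_induction_on with
    | _ d ih =>
      rcases Nat.eq_zero_or_pos d with rfl | hd
      · intro i
        rw [slice_zero, h0]
      · have hlow : ∀ i, ∀ e < d, slice e (E i) = 0 := fun i e he => ih e he i
        have hc : constantCoeff (ellSer h) = h := by
          rw [ellSer, map_mul, constantCoeff_C, constantCoeff_Lser, mul_one]
        -- The lowest-order slice satisfies a cyclic system with `T = d z + h`, and
        -- `T ^ 5 ≠ h ^ 5` because `d > 0`.
        have hs : ∀ i, (C (d : ℂ) * X + C h) * slice d (E i) =
            C (if i = 4 then lam ^ 5 else 1) * slice d (E (i + 1)) := by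
          intro i
          have h1 := congrArg (slice d) (hE i)
          rw [sum_quantumMul, slice_C_mul (hlow _), theta, slice_add, slice_X_mul_qDz,
            slice_C_mul (hlow _), hc] at h1
          have h2 : constantCoeff (if i = 4 then C (lam ^ 5) * Idiag i else Idiag i) =
              if i = 4 then lam ^ 5 else 1 := by
            split_ifs
            · rw [map_mul, constantCoeff_C, constantCoeff_Idiag, mul_one]
            · exact constantCoeff_Idiag i
          rw [h2] at h1
          rw [← h1]
          ring
        set T : PowerSeries ℂ := C (d : ℂ) * X + C h with hT
        have hs' : ∀ i, i ≠ 4 → T * slice d (E i) = slice d (E (i + 1)) := by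
          intro i hi
          rw [hs, if_neg hi, map_one, one_mul]
        have s0 : T * slice d (E 0) = slice d (E 1) := hs' 0 (by decide)
        have s1 : T * slice d (E 1) = slice d (E 2) := hs' 1 (by decide)
        have s2 : T * slice d (E 2) = slice d (E 3) := hs' 2 (by decide)
        have s3 : T * slice d (E 3) = slice d (E 4) := hs' 3 (by decide)
        have s4 : T * slice d (E 4) = C lam ^ 5 * slice d (E 0) := by
          have h1 := hs 4
          rwa [if_pos rfl, map_pow] at h1
        have h5 : (T ^ 5 - C (h ^ 5)) * slice d (E 0) = 0 := by
          rw [hh, map_pow, sub_mul]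
          have : T ^ 5 * slice d (E 0) = C lam ^ 5 * slice d (E 0) := by
            rw [← s4]
            have e1 : slice d (E 4) = T ^ 4 * slice d (E 0) := by
              rw [← s3, ← s2, ← s1, ← s0]
              ring
            rw [e1]
            ring
          rw [this, sub_self]
        have hne : T ^ 5 - C (h ^ 5) ≠ 0 := by
          intro hz
          have h1 := congrArg (coeff 1) hz
          have e5 : T ^ 5 = C (h ^ 5) + X * (C (5 * d * h ^ 4 : ℂ) + X * (C (10 * d ^ 2 * h ^ 3 : ℂ) +
            X * (C (10 * d ^ 3 * h ^ 2 : ℂ) + X * (C (5 * d ^ 4 * h : ℂ) + X * C ((d : ℂ) ^ 5))))) := by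
            rw [hT]
            simp only [map_mul, map_pow, map_ofNat]
            ring
          have hh0 : h ≠ 0 := by
            rintro rfl
            exact pow_ne_zero 5 hlam (by rw [← hh]; ring)
          rw [e5, add_sub_cancel_left, coeff_succ_X_mul, map_add, coeff_zero_X_mul, add_zero,
            coeff_zero_C, map_zero] at h1
          have hd0 : (d : ℂ) ≠ 0 := by exact_mod_cast hd.ne'
          exact mul_ne_zero (mul_ne_zero (by norm_num) hd0) (pow_ne_zero 4 hh0) h1
        have z0 : slice d (E 0) = 0 := (mul_eq_zero.1 h5).resolve_left hne
        rw [z0, mul_zero] at s0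
        rw [← s0, mul_zero] at s1
        rw [← s1, mul_zero] at s2
        rw [← s2, mul_zero] at s3
        intro i
        fin_cases i
        · exact z0
        · exact s0.symm
        · exact s1.symm
        · exact s2.symm
        · exact s3.symm
  funext i
  exact eq_zero_of_slice fun d => key d i

end QuinticSystem

/-! ### The `R`-matrix of the quintic -/

noncomputable section QuinticMatrix

open PowerSeries

variable {ζ lam h : ℂ}

lemma C_C_mul_C_C (x y : ℂ) :
    (C (C x) * C (C y) : PowerSeries (PowerSeries ℂ)) = C (C (x * y)) := by
  rw [← map_mul, ← map_mul]

/-- The entries of the formal solution, up to a constant factor. -/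
def baseSol (ζ lam h : ℂ) : Fin 5 → PowerSeries (PowerSeries ℂ) :=
  let r₀ := C (Iser 0)⁻¹ * solSer ζ lam h 1
  let r₁ := C I11⁻¹ * theta (ellSer h) r₀
  let r₂ := C I22⁻¹ * theta (ellSer h) r₁
  let r₃ := C I11⁻¹ * theta (ellSer h) r₂
  ![r₀, r₁, r₂, r₃, C (Iser 0)⁻¹ * theta (ellSer h) r₃]

lemma baseSol_zero : baseSol ζ lam h 0 = C (Iser 0)⁻¹ * solSer ζ lam h 1 := rfl

lemma theta_baseSol (hζ : IsPrimitiveRoot ζ 5) (hlam : lam ≠ 0) (hh : h ^ 5 = lam ^ 5) (i : Fin 5) :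
    theta (ellSer h) (baseSol ζ lam h i) = ∑ j, C (quantumMul lam i j) * baseSol ζ lam h j := by
  have h0 : C (Iser 0) * C (Iser 0)⁻¹ = (1 : PowerSeries (PowerSeries ℂ)) := by
    rw [← map_mul, Iser_zero_mul_inv, map_one]
  have h1 : C I11 * C I11⁻¹ = (1 : PowerSeries (PowerSeries ℂ)) := by
    rw [← map_mul, I11_mul_inv, map_one]
  have h2 : C I22 * C I22⁻¹ = (1 : PowerSeries (PowerSeries ℂ)) := by
    rw [← map_mul, I22_mul_inv, map_one]
  have e4 : baseSol ζ lam h 4 = C (Iser 0)⁻¹ * theta (ellSer h) (C I11⁻¹ * theta (ellSer h)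
      (C I22⁻¹ * theta (ellSer h) (C I11⁻¹ * theta (ellSer h)
        (C (Iser 0)⁻¹ * solSer ζ lam h 1)))) := rfl
  rw [sum_quantumMul]
  fin_cases i
  · change theta (ellSer h) (baseSol ζ lam h 0) = C I11 * (C I11⁻¹ * theta (ellSer h) (baseSol ζ lam h 0))
    rw [← mul_assoc, h1, one_mul]
  · change theta (ellSer h) (baseSol ζ lam h 1) = C I22 * (C I22⁻¹ * theta (ellSer h) (baseSol ζ lam h 1))
    rw [← mul_assoc, h2, one_mul]
  · change theta (ellSer h) (baseSol ζ lam h 2) = C I11 * (C I11⁻¹ * theta (ellSer h) (baseSol ζ lam h 2))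
    rw [← mul_assoc, h1, one_mul]
  · change theta (ellSer h) (baseSol ζ lam h 3) =
      C (Iser 0) * (C (Iser 0)⁻¹ * theta (ellSer h) (baseSol ζ lam h 3))
    rw [← mul_assoc, h0, one_mul]
  · change theta (ellSer h) (baseSol ζ lam h 4) = C (C (lam ^ 5) * Iser 0) * baseSol ζ lam h 0
    rw [e4, theta_factor_theta_solSer hζ hlam hh, baseSol_zero, map_mul]
    linear_combination -C (C (lam ^ 5)) * solSer ζ lam h 1 * h0

lemma map_constantCoeff_theta (b : PowerSeries (PowerSeries ℂ)) :
    PowerSeries.map constantCoeff (theta (ellSer h) b) =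
      C h * PowerSeries.map constantCoeff b := by
  have h0 : constantCoeff (ellSer h) = h := by
    rw [ellSer, map_mul, constantCoeff_C, constantCoeff_Lser, mul_one]
  have h1 : PowerSeries.map constantCoeff (qDz b) = 0 := by
    ext k
    rw [coeff_map, coeff_qDz, constantCoeff_qD, map_zero]
  rw [theta, map_add, map_mul, map_mul, h1, mul_zero, zero_add, map_C, h0]

lemma map_constantCoeff_C_mul {a : PowerSeries ℂ} (ha : constantCoeff a = 1)
    (b : PowerSeries (PowerSeries ℂ)) :
    PowerSeries.map constantCoeff (C a⁻¹ * b) = PowerSeries.map constantCoeff b := by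
  rw [map_mul, map_C, constantCoeff_inv, ha, inv_one, map_one, one_mul]

lemma map_constantCoeff_baseSol (i : Fin 5) :
    PowerSeries.map constantCoeff (baseSol ζ lam h i) = C (h ^ ((i : ℕ) + 1)) * initSer ζ lam h := by
  have e0 : PowerSeries.map constantCoeff (baseSol ζ lam h 0) = C h * initSer ζ lam h := by
    rw [baseSol_zero, map_constantCoeff_C_mul constantCoeff_Iser_zero, map_constantCoeff_solSer_one]
  have e1 : PowerSeries.map constantCoeff (baseSol ζ lam h 1) = C h * (C h * initSer ζ lam h) := by
    change PowerSeries.map constantCoeff (C I11⁻¹ * theta (ellSer h) (baseSol ζ lam h 0)) = _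
    rw [map_constantCoeff_C_mul constantCoeff_I11, map_constantCoeff_theta, e0]
  have e2 : PowerSeries.map constantCoeff (baseSol ζ lam h 2) =
      C h * (C h * (C h * initSer ζ lam h)) := by
    change PowerSeries.map constantCoeff (C I22⁻¹ * theta (ellSer h) (baseSol ζ lam h 1)) = _
    rw [map_constantCoeff_C_mul constantCoeff_I22, map_constantCoeff_theta, e1]
  have e3 : PowerSeries.map constantCoeff (baseSol ζ lam h 3) =
      C h * (C h * (C h * (C h * initSer ζ lam h))) := by
    change PowerSeries.map constantCoeff (C I11⁻¹ * theta (ellSer h) (baseSol ζ lam h 2)) = _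
    rw [map_constantCoeff_C_mul constantCoeff_I11, map_constantCoeff_theta, e2]
  have e4 : PowerSeries.map constantCoeff (baseSol ζ lam h 4) =
      C h * (C h * (C h * (C h * (C h * initSer ζ lam h)))) := by
    change PowerSeries.map constantCoeff (C (Iser 0)⁻¹ * theta (ellSer h) (baseSol ζ lam h 3)) = _
    rw [map_constantCoeff_C_mul constantCoeff_Iser_zero, map_constantCoeff_theta, e3]
  rw [map_pow]
  fin_cases i
  · refine e0.trans ?_; change _ = C h ^ 1 * _; ring
  · refine e1.trans ?_; change _ = C h ^ 2 * _; ring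
  · refine e2.trans ?_; change _ = C h ^ 3 * _; ring
  · refine e3.trans ?_; change _ = C h ^ 4 * _; ring
  · refine e4.trans ?_; change _ = C h ^ 5 * _; ring

lemma sqrtH_sq (ζ lam : ℂ) (α : Fin 5) : sqrtH ζ lam α ^ 2 = hpt ζ lam α := by
  have h1 := Complex.cpow_nat_inv_pow (hpt ζ lam α) (n := 2) (by norm_num)
  rw [sqrtH]
  convert h1 using 3
  norm_num

lemma sqrtH_ne_zero (hζ : IsPrimitiveRoot ζ 5) (hlam : lam ≠ 0) (α : Fin 5) :
    sqrtH ζ lam α ≠ 0 := by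
  intro h0
  have h1 := sqrtH_sq ζ lam α
  rw [h0] at h1
  exact hpt_ne_zero hζ hlam α (by rw [← h1]; ring)

/-- The entries `R_{i,α}`. -/
def solEntry (ζ lam : ℂ) (α i : Fin 5) : PowerSeries (PowerSeries ℂ) :=
  C (C ((sqrtH ζ lam α ^ 3)⁻¹ * (hpt ζ lam α)⁻¹)) * baseSol ζ lam (hpt ζ lam α) i

lemma theta_solEntry (hζ : IsPrimitiveRoot ζ 5) (hlam : lam ≠ 0) (α i : Fin 5) :
    theta (ellSer (hpt ζ lam α)) (solEntry ζ lam α i) =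
      ∑ j, C (quantumMul lam i j) * solEntry ζ lam α j := by
  simp only [solEntry]
  rw [theta_C_C_mul, theta_baseSol hζ hlam (hpt_pow_five hζ α), Finset.mul_sum]
  exact Finset.sum_congr rfl fun j _ => by ring

lemma map_constantCoeff_solEntry (hζ : IsPrimitiveRoot ζ 5) (hlam : lam ≠ 0) (α i : Fin 5) :
    PowerSeries.map constantCoeff (solEntry ζ lam α i) * Cser ζ lam α =
      C ((sqrtH ζ lam α ^ 3)⁻¹ * hpt ζ lam α ^ (i : ℕ)) := by
  rw [solEntry, map_mul, map_C, constantCoeff_C, map_constantCoeff_baseSol, mul_assoc, mul_assoc,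
    initSer_mul_Cser hζ hlam, mul_one, ← map_mul]
  congr 1
  rw [pow_succ]
  linear_combination ((sqrtH ζ lam α ^ 3)⁻¹ * hpt ζ lam α ^ (i : ℕ)) *
    inv_mul_cancel₀ (hpt_ne_zero hζ hlam α)

/-- Orthogonality of the powers of the `h_α`. -/
lemma sum_hpt_zpow (hζ : IsPrimitiveRoot ζ 5) (n : ℤ) :
    ∑ α, hpt ζ lam α ^ n = if (5 : ℤ) ∣ n then 5 * lam ^ n else 0 := by
  have h1 : ∀ α : Fin 5, hpt ζ lam α ^ n = (ζ ^ n) ^ (α : ℕ) * lam ^ n := by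
    intro α
    rw [hpt, mul_zpow, ← zpow_natCast, ← zpow_natCast, ← zpow_mul, ← zpow_mul, mul_comm (n : ℤ)]
  simp only [h1]
  rw [← Finset.sum_mul, Fin.sum_univ_eq_sum_range (fun i => (ζ ^ n) ^ i) 5]
  split_ifs with hn
  · rw [(hζ.zpow_eq_one_iff_dvd n).2 (by exact_mod_cast hn)]
    simp
  · have hp : IsPrimitiveRoot (ζ ^ n) 5 := by
      refine hζ.zpow_of_gcd_eq_one n ?_
      have h5 : Nat.Prime 5 := by norm_num
      have h2 : ¬ 5 ∣ n.natAbs := fun h => hn (by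
        have := Int.natCast_dvd_natCast.2 h
        rwa [Int.dvd_natAbs] at this)
      have := (Nat.Prime.coprime_iff_not_dvd h5).2 h2
      rw [Int.gcd_comm]
      exact this
    rw [hp.geom_sum_eq_zero (by norm_num), zero_mul]

lemma idem_apply (α a : Fin 5) : idem ζ lam α a =
    C (C ((1 / 5) * sqrtH ζ lam α ^ (3 - 2 * ((a : ℕ) : ℤ)))) * C (phiFactor a) := by
  rw [idem, Finset.sum_eq_single a]
  · rw [phiBar, Pi.single_eq_same]
  · intro i _ hi
    rw [phiBar, Pi.single_eq_of_ne hi.symm, mul_zero]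
  · simp

/-- The matrix of the pairing of the idempotents with the flat basis. -/
def idemMat (ζ lam : ℂ) : Matrix (Fin 5) (Fin 5) (PowerSeries (PowerSeries ℂ)) :=
  Matrix.of fun α b => ∑ a, C (C (gram lam a b)) * idem ζ lam α a

lemma pairing_idem (α : Fin 5) (w : Fin 5 → PowerSeries (PowerSeries ℂ)) :
    pairing lam (idem ζ lam α) w = ∑ b, idemMat ζ lam α b * w b := by
  rw [pairing, Finset.sum_comm]
  refine Finset.sum_congr rfl fun b _ => ?_
  rw [idemMat, Matrix.of_apply, Finset.sum_mul]

lemma entry_eq (Rs : Matrix (Fin 5) (Fin 5) (PowerSeries (PowerSeries ℂ))) (i α : Fin 5) :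
    entry ζ lam Rs i α = (idemMat ζ lam * Rs) α i := by
  rw [entry, pairing_idem, Matrix.mul_apply, flat, Matrix.mulVec_single_one]
  rfl

/-- The dual index of the flat basis: `H ^ b` pairs nontrivially only with `H ^ (dualIdx b)`. -/
def dualIdx (b : Fin 5) : Fin 5 := if b = 4 then 4 else 3 - b

lemma sqrtH_zpow (ζ lam : ℂ) (α : Fin 5) (n : ℤ) :
    sqrtH ζ lam α ^ (2 * n) = hpt ζ lam α ^ n := by
  rw [zpow_mul, ← sqrtH_sq]
  norm_cast

lemma idemMat_apply (hζ : IsPrimitiveRoot ζ 5) (hlam : lam ≠ 0) (α b : Fin 5) :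
    idemMat ζ lam α b = C (C ((sqrtH ζ lam α ^ 3)⁻¹ * hpt ζ lam α ^ (b : ℕ))) *
      C (phiFactor (dualIdx b)) := by
  have hs := sqrtH_ne_zero hζ hlam α
  have h5 := hpt_pow_five (lam := lam) hζ α
  have hl : lam ^ 5 = sqrtH ζ lam α ^ 10 := by
    rw [← h5, ← sqrtH_sq]; ring
  have key : ∀ a : Fin 5, (∀ a', a' ≠ a → gram lam a' b = 0) →
      gram lam a b * ((1 / 5) * sqrtH ζ lam α ^ (3 - 2 * ((a : ℕ) : ℤ))) =
        (sqrtH ζ lam α ^ 3)⁻¹ * hpt ζ lam α ^ (b : ℕ) → dualIdx b = a →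
      idemMat ζ lam α b = C (C ((sqrtH ζ lam α ^ 3)⁻¹ * hpt ζ lam α ^ (b : ℕ))) *
      C (phiFactor (dualIdx b)) := by
    intro a h1 h2 h3
    rw [idemMat, Matrix.of_apply, Finset.sum_eq_single a]
    · rw [idem_apply, ← mul_assoc, C_C_mul_C_C, h2, h3]
    · intro a' _ ha'
      rw [h1 a' ha', map_zero, map_zero, zero_mul]
    · simp
  refine key (dualIdx b) (fun a' ha' => ?_) ?_ rfl
  · revert ha'
    fin_cases b <;> fin_cases a' <;> simp [dualIdx, gram]
  · rw [← sqrtH_sq]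
    have e : ∀ n : ℤ, ∀ k : ℕ, n = k → sqrtH ζ lam α ^ n = sqrtH ζ lam α ^ k := by
      rintro n k rfl
      exact zpow_natCast _ _
    have e' : ∀ n : ℤ, ∀ k : ℕ, n = -k → sqrtH ζ lam α ^ n = (sqrtH ζ lam α ^ k)⁻¹ := by
      rintro n k rfl
      rw [zpow_neg, zpow_natCast]
    fin_cases b
    · change gram lam 3 0 * (1 / 5 * sqrtH ζ lam α ^ (3 - 2 * (3 : ℤ))) = _
      rw [e' _ 3 (by norm_num)]
      simp [gram]
    · change gram lam 2 1 * (1 / 5 * sqrtH ζ lam α ^ (3 - 2 * (2 : ℤ))) = _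
      rw [e' _ 1 (by norm_num)]
      simp [gram]
      field_simp
    · change gram lam 1 2 * (1 / 5 * sqrtH ζ lam α ^ (3 - 2 * (1 : ℤ))) = _
      rw [e _ 1 (by norm_num)]
      simp [gram]
      field_simp
    · change gram lam 0 3 * (1 / 5 * sqrtH ζ lam α ^ (3 - 2 * (0 : ℤ))) = _
      rw [e _ 3 (by norm_num)]
      simp [gram]
      field_simp
    · change gram lam 4 4 * (1 / 5 * sqrtH ζ lam α ^ (3 - 2 * (4 : ℤ))) = _
      rw [e' _ 5 (by norm_num)]
      simp [gram, hl]
      field_simp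

lemma constantCoeff_phiFactor (i : Fin 5) : constantCoeff (phiFactor i) = 1 := by
  rw [phiFactor, map_mul, map_mul, constantCoeff_Iser_zero, map_prod, constantCoeff_inv, map_pow,
    constantCoeff_Lser]
  simp [constantCoeff_Idiag]

lemma phiFactor_mul_inv (i : Fin 5) : phiFactor i * (phiFactor i)⁻¹ = 1 :=
  PowerSeries.mul_inv_cancel _ (by rw [constantCoeff_phiFactor]; exact one_ne_zero)

/-- The inverse of the matrix of the idempotents. -/
def idemInv (ζ lam : ℂ) : Matrix (Fin 5) (Fin 5) (PowerSeries (PowerSeries ℂ)) :=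
  Matrix.of fun b α => C (C ((1 / 5) * (sqrtH ζ lam α ^ 3 * (hpt ζ lam α ^ (b : ℕ))⁻¹))) *
    C (phiFactor (dualIdx b))⁻¹

lemma idemInv_mul (hζ : IsPrimitiveRoot ζ 5) (hlam : lam ≠ 0) :
    idemInv ζ lam * idemMat ζ lam = 1 := by
  ext1 b c
  rw [Matrix.mul_apply]
  have h1 : ∀ α, idemInv ζ lam b α * idemMat ζ lam α c =
      C (C ((1 / 5) * hpt ζ lam α ^ ((c : ℕ) - (b : ℕ) : ℤ))) *
        (C (phiFactor (dualIdx b))⁻¹ * C (phiFactor (dualIdx c))) := by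
    intro α
    have h2 : hpt ζ lam α ^ ((c : ℕ) - (b : ℕ) : ℤ) =
        hpt ζ lam α ^ (c : ℕ) * (hpt ζ lam α ^ (b : ℕ))⁻¹ := by
      rw [zpow_sub₀ (hpt_ne_zero hζ hlam α), zpow_natCast, zpow_natCast, div_eq_mul_inv]
    have h3 : (1 / 5) * (sqrtH ζ lam α ^ 3 * (hpt ζ lam α ^ (b : ℕ))⁻¹) *
        ((sqrtH ζ lam α ^ 3)⁻¹ * hpt ζ lam α ^ (c : ℕ)) =
        (1 / 5) * (hpt ζ lam α ^ (c : ℕ) * (hpt ζ lam α ^ (b : ℕ))⁻¹) := by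
      linear_combination ((1 / 5) * (hpt ζ lam α ^ (c : ℕ) * (hpt ζ lam α ^ (b : ℕ))⁻¹)) *
        mul_inv_cancel₀ (pow_ne_zero 3 (sqrtH_ne_zero hζ hlam α))
    rw [idemInv, Matrix.of_apply, idemMat_apply hζ hlam, h2, ← h3, ← C_C_mul_C_C _ ((sqrtH ζ lam α ^ 3)⁻¹ * _)]
    ring
  simp only [h1]
  rw [← Finset.sum_mul, ← map_sum, ← map_sum, ← Finset.mul_sum, sum_hpt_zpow hζ]
  by_cases hbc : b = c
  · subst hbc
    rw [sub_self, if_pos (dvd_zero _), zpow_zero, Matrix.one_apply_eq, mul_one,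
      one_div_mul_cancel (by norm_num), map_one, map_one, one_mul, ← map_mul, mul_comm,
      phiFactor_mul_inv, map_one]
  · have hb := b.isLt
    have hc := c.isLt
    have hne : (b : ℕ) ≠ c := fun h => hbc (Fin.ext h)
    rw [if_neg (by omega), mul_zero, map_zero, map_zero, zero_mul, Matrix.one_apply_ne hbc]

lemma idemMat_mul (hζ : IsPrimitiveRoot ζ 5) (hlam : lam ≠ 0) :
    idemMat ζ lam * idemInv ζ lam = 1 :=
  mul_eq_one_comm.1 (idemInv_mul hζ hlam)

lemma map_constantCoeff_pairing_flat (hζ : IsPrimitiveRoot ζ 5) (hlam : lam ≠ 0) (α i : Fin 5) :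
    PowerSeries.map constantCoeff (pairing lam (idem ζ lam α) (flat i)) =
      C ((sqrtH ζ lam α ^ 3)⁻¹ * hpt ζ lam α ^ (i : ℕ)) := by
  rw [pairing_idem, Finset.sum_eq_single i]
  · rw [flat, Pi.single_eq_same, mul_one, idemMat_apply hζ hlam, map_mul, map_C, map_C,
      constantCoeff_C, constantCoeff_phiFactor, map_one, mul_one]
  · intro b _ hb
    rw [flat, Pi.single_eq_of_ne hb, mul_zero]
  · simp

lemma theta_eq_qde (α : Fin 5) (b : PowerSeries (PowerSeries ℂ)) :
    X * qDz b + C (C (hpt ζ lam α) * Lser) * b = theta (ellSer (hpt ζ lam α)) b := rfl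

lemma IsRMatrix.entry_eq_solEntry (hζ : IsPrimitiveRoot ζ 5) (hlam : lam ≠ 0)
    {Rs : Matrix (Fin 5) (Fin 5) (PowerSeries (PowerSeries ℂ))} (hR : IsRMatrix ζ lam Rs)
    (i α : Fin 5) : entry ζ lam Rs i α = solEntry ζ lam α i := by
  have h1 : (fun i => entry ζ lam Rs i α - solEntry ζ lam α i) = 0 := by
    refine eq_zero_of_system (h := hpt ζ lam α) hlam (hpt_pow_five hζ α) (fun i => ?_) fun i => ?_
    · have h2 := hR.qde i α
      rw [theta_eq_qde] at h2
      have h3 := theta_solEntry hζ hlam α i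
      have h4 := theta_add (ellSer (hpt ζ lam α)) (entry ζ lam Rs i α - solEntry ζ lam α i)
        (solEntry ζ lam α i)
      rw [sub_add_cancel, h2, h3] at h4
      simp only [mul_sub, Finset.sum_sub_distrib]
      rw [h4]
      ring
    · have h2 := hR.initial i α
      rw [map_constantCoeff_pairing_flat hζ hlam, ← map_constantCoeff_solEntry hζ hlam] at h2
      have h3 : Cser ζ lam α ≠ 0 := by
        intro h0
        have h4 := constantCoeff_Cser (ζ := ζ) (lam := lam) α
        rw [h0, map_zero] at h4
        exact zero_ne_one h4
      rw [map_sub, mul_right_cancel₀ h3 h2, sub_self]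
  exact sub_eq_zero.1 (congrFun h1 i)

/-- Existence and uniqueness of the endomorphism `R^*`. -/
theorem existsUnique_isRMatrix (hζ : IsPrimitiveRoot ζ 5) (hlam : lam ≠ 0) :
    ∃! Rs : Matrix (Fin 5) (Fin 5) (PowerSeries (PowerSeries ℂ)), IsRMatrix ζ lam Rs := by
  have hent : ∀ i α, entry ζ lam (idemInv ζ lam * Matrix.of (solEntry ζ lam)) i α =
      solEntry ζ lam α i := by
    intro i α
    rw [entry_eq, ← Matrix.mul_assoc, idemMat_mul hζ hlam, Matrix.one_mul, Matrix.of_apply]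
  refine ⟨idemInv ζ lam * Matrix.of (solEntry ζ lam), ⟨fun i α => ?_, fun i α => ?_⟩,
    fun Rs hR => ?_⟩
  · simp only [hent]
    rw [theta_eq_qde, theta_solEntry hζ hlam]
  · rw [hent, map_constantCoeff_solEntry hζ hlam, map_constantCoeff_pairing_flat hζ hlam]
  · have h1 : idemMat ζ lam * Rs = Matrix.of (solEntry ζ lam) := by
      ext1 α i
      rw [← entry_eq, hR.entry_eq_solEntry hζ hlam, Matrix.of_apply]
    rw [← h1, ← Matrix.mul_assoc, idemInv_mul hζ hlam, Matrix.one_mul]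

/-- The pairings of the idempotents with the first column of `R^*`. -/
lemma IsRMatrix.coeff_pairing (hζ : IsPrimitiveRoot ζ 5) (hlam : lam ≠ 0)
    {Rs : Matrix (Fin 5) (Fin 5) (PowerSeries (PowerSeries ℂ))} (hR : IsRMatrix ζ lam Rs)
    (k : ℕ) (α : Fin 5) :
    coeff k (pairing lam (idem ζ lam α) (Rs.mulVec (phiBar 0))) =
      C ((sqrtH ζ lam α ^ 3)⁻¹) * ((-1) ^ k * lineSer ζ lam (hpt ζ lam α) k 1) := by
  have h1 : Rs.mulVec (phiBar 0) = fun b => C (phiFactor 0) * (Rs.mulVec (flat 0)) b := by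
    funext b
    rw [phiBar, flat, Matrix.mulVec_single, Matrix.mulVec_single_one]
    exact mul_comm _ _
  have h2 : pairing lam (idem ζ lam α) (Rs.mulVec (phiBar 0)) =
      C (phiFactor 0) * entry ζ lam Rs 0 α := by
    rw [h1, entry, pairing, pairing, Finset.mul_sum]
    refine Finset.sum_congr rfl fun a _ => ?_
    rw [Finset.mul_sum]
    exact Finset.sum_congr rfl fun b _ => by ring
  have h3 : phiFactor 0 = Iser 0 * Lser⁻¹ := by
    have h4 : Finset.univ.filter (fun k : Fin 5 => k < 0) = ∅ := by
      ext k; simp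
    rw [phiFactor, h4]
    simp
  have hL : Lser * Lser⁻¹ = 1 :=
    PowerSeries.mul_inv_cancel _ (by rw [constantCoeff_Lser]; exact one_ne_zero)
  have hc : C ((sqrtH ζ lam α ^ 3)⁻¹ * (hpt ζ lam α)⁻¹) * C (hpt ζ lam α) =
      C ((sqrtH ζ lam α ^ 3)⁻¹) := by
    rw [← map_mul, mul_assoc, inv_mul_cancel₀ (hpt_ne_zero hζ hlam α), mul_one]
  rw [h2, hR.entry_eq_solEntry hζ hlam, solEntry, baseSol_zero, coeff_C_mul, coeff_C_mul,
    coeff_C_mul, coeff_solSer, h3, ellSer, pow_one, Nat.cast_one, ← hc]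
  have hI := Iser_zero_mul_inv
  generalize (Iser 0)⁻¹ = I' at hI ⊢
  generalize Lser⁻¹ = L' at hL ⊢
  generalize C ((sqrtH ζ lam α ^ 3)⁻¹ * (hpt ζ lam α)⁻¹) = c
  linear_combination (c * C (hpt ζ lam α) * (-1) ^ k * lineSer ζ lam (hpt ζ lam α) k 1) *
    (Lser * L' * hI + hL)

/-- The coefficients of the formal solution in terms of the universal polynomials. -/
lemma lineSer_eq_aeval (hlam : lam ≠ 0) {p : Polynomial ℚ} {k : ℕ}
    (hp : ∀ e : ℂ, jval 5 ζ lam e k 1 = Polynomial.aeval (e ^ 5 / lam ^ 5) p)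
    (hh : h ^ 5 = lam ^ 5) :
    (C (5 * h) * Lser) ^ k * lineSer ζ lam h k 1 = Polynomial.aeval (Lser ^ 5) p := by
  have hpoly : (Polynomial.C 5 * Polynomial.X) ^ k * linePoly 5 ζ lam k 1 =
      Polynomial.aeval (Polynomial.C ((lam ^ 5)⁻¹) * Polynomial.X ^ 5 : Polynomial ℂ) p := by
    refine Polynomial.funext fun e => ?_
    have h1 := Polynomial.aeval_algHom_apply ((Polynomial.aeval e : Polynomial ℂ →ₐ[ℂ] ℂ).restrictScalars ℚ)
      (Polynomial.C ((lam ^ 5)⁻¹) * Polynomial.X ^ 5 : Polynomial ℂ) p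
    simp only [AlgHom.restrictScalars_apply, Polynomial.coe_aeval_eq_eval] at h1
    rw [← h1, Polynomial.eval_mul, Polynomial.eval_pow, Polynomial.eval_mul, Polynomial.eval_C,
      Polynomial.eval_X, eval_linePoly]
    have h2 := hp e
    rw [jval] at h2
    simp only [Polynomial.eval_mul, Polynomial.eval_pow, Polynomial.eval_C, Polynomial.eval_X]
    rw [mul_comm ((lam ^ 5)⁻¹), ← div_eq_mul_inv, ← h2]
    push_cast
    rfl
  have h3 := congrArg (Polynomial.aeval (ellSer h)) hpoly
  have h4 := Polynomial.aeval_algHom_apply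
    ((Polynomial.aeval (ellSer h) : Polynomial ℂ →ₐ[ℂ] PowerSeries ℂ).restrictScalars ℚ)
    (Polynomial.C ((lam ^ 5)⁻¹) * Polynomial.X ^ 5 : Polynomial ℂ) p
  simp only [AlgHom.restrictScalars_apply] at h4
  have hC : ∀ c : ℂ, Polynomial.aeval (ellSer h) (Polynomial.C c) = C c := by
    intro c
    rw [Polynomial.aeval_C, PowerSeries.algebraMap_apply]
    rfl
  have h5 : Polynomial.aeval (ellSer h) (Polynomial.C ((lam ^ 5)⁻¹) * Polynomial.X ^ 5 :
      Polynomial ℂ) = Lser ^ 5 := by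
    rw [map_mul (Polynomial.aeval (ellSer h)), map_pow (Polynomial.aeval (ellSer h)), hC,
      Polynomial.aeval_X, ellSer, mul_pow, ← map_pow, hh, ← mul_assoc, ← map_mul,
      inv_mul_cancel₀ (pow_ne_zero _ hlam), map_one, one_mul]
  rw [h5] at h4
  have h6 : C (5 * h) * Lser = C 5 * ellSer h := by rw [ellSer, map_mul, mul_assoc]
  rw [h4, ← h3, map_mul (Polynomial.aeval (ellSer h)), map_pow (Polynomial.aeval (ellSer h)),
    map_mul (Polynomial.aeval (ellSer h)), hC, Polynomial.aeval_X, h6]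
  rfl

lemma phiDual_eq (hζ : IsPrimitiveRoot ζ 5) (hlam : lam ≠ 0) (j a : Fin 5) :
    phiDual lam j a =
      ∑ α, C (C ((1 / 5) * (sqrtH ζ lam α ^ 3 * (hpt ζ lam α ^ (j : ℕ))⁻¹))) * idem ζ lam α a := by
  have h1 : ∀ α, C (C ((1 / 5) * (sqrtH ζ lam α ^ 3 * (hpt ζ lam α ^ (j : ℕ))⁻¹))) *
      idem ζ lam α a = C (C ((1 / 25) * hpt ζ lam α ^ (3 - (j : ℕ) - (a : ℕ) : ℤ))) *
        C (phiFactor a) := by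
    intro α
    have hs := sqrtH_ne_zero hζ hlam α
    rw [idem_apply, ← mul_assoc, C_C_mul_C_C]
    congr 3
    have h2 : hpt ζ lam α ^ (j : ℕ) = sqrtH ζ lam α ^ (2 * ((j : ℕ) : ℤ)) := by
      rw [sqrtH_zpow, zpow_natCast]
    have h3 : sqrtH ζ lam α ^ 3 = sqrtH ζ lam α ^ (3 : ℤ) := by norm_cast
    rw [← sqrtH_zpow, h2, h3, ← zpow_neg, ← zpow_add₀ hs,
      show (2 * (3 - (j : ℕ) - (a : ℕ)) : ℤ) = (3 + -(2 * (j : ℕ))) + (3 - 2 * (a : ℕ)) by ring,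
      zpow_add₀ hs (3 + -(2 * ((j : ℕ) : ℤ)))]
    ring
  simp only [h1]
  rw [← Finset.sum_mul, ← map_sum, ← map_sum, ← Finset.mul_sum, sum_hpt_zpow hζ]
  by_cases hj : j = 4
  · subst hj
    rw [phiDual, if_pos rfl]
    by_cases ha : a = 4
    · subst ha
      rw [phiBar, Pi.single_eq_same]
      change _ = C (C (1 / 25 * if (5 : ℤ) ∣ 3 - (4 : ℕ) - (4 : ℕ) then
        5 * lam ^ (3 - (4 : ℕ) - (4 : ℕ) : ℤ) else 0)) * _
      rw [if_pos (by norm_num)]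
      congr 3
      rw [show (3 - (4 : ℕ) - (4 : ℕ) : ℤ) = -((5 : ℕ) : ℤ) by norm_num, zpow_neg, zpow_natCast]
      field_simp
      norm_num
    · rw [phiBar, Pi.single_eq_of_ne ha, mul_zero]
      have hlt := a.isLt
      have hne : (a : ℕ) ≠ 4 := fun h => ha (Fin.ext h)
      have h4 : (((4 : Fin 5) : ℕ) : ℤ) = 4 := rfl
      rw [h4, if_neg (by omega), mul_zero, map_zero, map_zero, zero_mul]
  · rw [phiDual, if_neg hj]
    have hjlt := j.isLt
    have hjne : (j : ℕ) ≠ 4 := fun h => hj (Fin.ext h)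
    have hsub : ((3 - j : Fin 5) : ℕ) = 3 - (j : ℕ) := by
      fin_cases j <;> first | rfl | exact absurd rfl hjne
    have halt := a.isLt
    by_cases ha : a = 3 - j
    · have ha' : (a : ℕ) = 3 - (j : ℕ) := by rw [ha, hsub]
      rw [← ha, phiBar, Pi.single_eq_same]
      have h0 : (3 - (j : ℕ) - (a : ℕ) : ℤ) = 0 := by omega
      rw [h0, if_pos (dvd_zero _), zpow_zero]
      norm_num
    · rw [phiBar, Pi.single_eq_of_ne ha, mul_zero]
      have hne : (a : ℕ) ≠ 3 - (j : ℕ) := fun h => ha (Fin.ext (by rw [hsub, h]))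
      rw [if_neg (by omega), mul_zero, map_zero, map_zero, zero_mul]

lemma pairing_sum_left (c : Fin 5 → PowerSeries (PowerSeries ℂ))
    (v : Fin 5 → Fin 5 → PowerSeries (PowerSeries ℂ)) (w : Fin 5 → PowerSeries (PowerSeries ℂ)) :
    pairing lam (fun a => ∑ α, c α * v α a) w = ∑ α, c α * pairing lam (v α) w := by
  simp only [pairing, Finset.mul_sum, Finset.sum_mul]
  rw [Finset.sum_congr rfl fun a _ => Finset.sum_comm, Finset.sum_comm]
  exact Finset.sum_congr rfl fun α _ => Finset.sum_congr rfl fun a _ =>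
    Finset.sum_congr rfl fun b _ => by ring

/-- The coefficients of the first column. -/
lemma IsRMatrix.coeff_firstColumn (hζ : IsPrimitiveRoot ζ 5) (hlam : lam ≠ 0)
    {Rs : Matrix (Fin 5) (Fin 5) (PowerSeries (PowerSeries ℂ))} (hR : IsRMatrix ζ lam Rs)
    {p : Polynomial ℚ} {k : ℕ}
    (hp : ∀ e : ℂ, jval 5 ζ lam e k 1 = Polynomial.aeval (e ^ 5 / lam ^ 5) p) (j : Fin 5) :
    Lser ^ k * coeff k (firstColumn lam Rs j) =
      C ((-1 / 5) ^ k * if 5 ∣ k + (j : ℕ) then (lam ^ (k + (j : ℕ)))⁻¹ else 0) *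
        Polynomial.aeval (Lser ^ 5) p := by
  have h1 : firstColumn lam Rs j =
      ∑ α, C (C ((1 / 5) * (sqrtH ζ lam α ^ 3 * (hpt ζ lam α ^ (j : ℕ))⁻¹))) *
        pairing lam (idem ζ lam α) (Rs.mulVec (phiBar 0)) := by
    rw [firstColumn]
    generalize Rs.mulVec (phiBar 0) = w
    have e : phiDual lam j = fun a => ∑ α, C (C ((1 / 5) * (sqrtH ζ lam α ^ 3 *
        (hpt ζ lam α ^ (j : ℕ))⁻¹))) * idem ζ lam α a := funext (phiDual_eq hζ hlam j)
    rw [e, pairing_sum_left]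
  have h2 : ∀ α, Lser ^ k * lineSer ζ lam (hpt ζ lam α) k 1 =
      C (((5 * hpt ζ lam α) ^ k)⁻¹) * Polynomial.aeval (Lser ^ 5) p := by
    intro α
    rw [← lineSer_eq_aeval hlam hp (hpt_pow_five hζ α), mul_pow (C (5 * hpt ζ lam α)), ← map_pow,
      ← mul_assoc, ← mul_assoc, ← map_mul, inv_mul_cancel₀ (pow_ne_zero _ (mul_ne_zero (by norm_num) (hpt_ne_zero hζ hlam α))),
      map_one, one_mul]
  have h3 : ∀ α, Lser ^ k * coeff k (C (C ((1 / 5) * (sqrtH ζ lam α ^ 3 *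
      (hpt ζ lam α ^ (j : ℕ))⁻¹))) * pairing lam (idem ζ lam α) (Rs.mulVec (phiBar 0))) =
      C ((1 / 5) * (-1 / 5) ^ k * hpt ζ lam α ^ (-(k + (j : ℕ) : ℕ) : ℤ)) *
        Polynomial.aeval (Lser ^ 5) p := by
    intro α
    have hh := hpt_ne_zero hζ hlam α
    have hs := pow_ne_zero 3 (sqrtH_ne_zero hζ hlam α)
    have hneg : ((-1 : PowerSeries ℂ)) ^ k = C ((-1) ^ k) := by rw [map_pow, map_neg, map_one]
    rw [coeff_C_mul, hR.coeff_pairing hζ hlam, hneg]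
    have e1 : C ((1 / 5) * (-1 / 5) ^ k * hpt ζ lam α ^ (-(k + (j : ℕ) : ℕ) : ℤ)) =
        C ((1 / 5) * (sqrtH ζ lam α ^ 3 * (hpt ζ lam α ^ (j : ℕ))⁻¹)) *
          C ((sqrtH ζ lam α ^ 3)⁻¹) * C ((-1) ^ k) * C (((5 * hpt ζ lam α) ^ k)⁻¹) := by
      rw [← map_mul, ← map_mul, ← map_mul]
      congr 1
      rw [zpow_neg, zpow_natCast, pow_add, div_pow, mul_pow]
      generalize sqrtH ζ lam α ^ 3 = s at hs
      field_simp
    rw [e1]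
    linear_combination (C ((1 / 5) * (sqrtH ζ lam α ^ 3 * (hpt ζ lam α ^ (j : ℕ))⁻¹)) *
          C ((sqrtH ζ lam α ^ 3)⁻¹) * C ((-1) ^ k)) * h2 α
  rw [h1, map_sum, Finset.mul_sum]
  simp only [h3]
  rw [← Finset.sum_mul, ← map_sum, ← Finset.mul_sum, sum_hpt_zpow hζ]
  congr 2
  have hdvd : (5 : ℤ) ∣ -((k + (j : ℕ) : ℕ) : ℤ) ↔ 5 ∣ k + (j : ℕ) := by
    rw [dvd_neg]
    exact_mod_cast Iff.rfl
  simp only [hdvd]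
  split_ifs
  · rw [zpow_neg, zpow_natCast]; ring
  · ring

end QuinticMatrix

/-! ### Polynomiality of the coefficients -/

noncomputable section MainProof

lemma Lser_ne_zero : Lser ≠ 0 := fun h => by
  have := constantCoeff_Lser
  rw [h, map_zero] at this
  exact zero_ne_one this

/-- If `X ^ k` divides `p (X ^ m)`, then `p (x ^ m)` is a multiple of `x ^ k` by a polynomial
in `x`. -/
lemma exists_aeval_pow_eq_pow_mul {A : Type*} [CommRing A] [Algebra ℚ A] {m k : ℕ}
    {p : Polynomial ℚ} (hp : Polynomial.X ^ k ∣ Polynomial.expand ℚ m p) (x : A) :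
    ∃ r : Polynomial ℚ, Polynomial.aeval (x ^ m) p = x ^ k * Polynomial.aeval x r := by
  obtain ⟨r, hr⟩ := hp
  refine ⟨r, ?_⟩
  rw [← Polynomial.expand_aeval, hr, map_mul, map_pow, Polynomial.aeval_X]

/-- The scalar of `IsRMatrix.coeff_firstColumn`, as a rational number once the power of `lam` is
removed. -/
lemma C_pow_mul_C_eq_algebraMap {lam : ℂ} (hlam : lam ≠ 0) (k j : ℕ) :
    (PowerSeries.C (lam ^ (k + j)) * PowerSeries.C ((-1 / 5) ^ k *
      if 5 ∣ k + j then (lam ^ (k + j))⁻¹ else 0) : PowerSeries ℂ) =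
      algebraMap ℚ (PowerSeries ℂ) (if 5 ∣ k + j then (-1 / 5) ^ k else 0) := by
  rw [← map_mul, PowerSeries.algebraMap_apply]
  congr 1
  have h := pow_ne_zero (k + j) hlam
  split_ifs
  · rw [mul_comm, mul_assoc, inv_mul_cancel₀ h, mul_one]
    push_cast
    simp
  · simp

end MainProof

end ZagierZinger

theorem mainTheorem7 :
    ∃ P : ℕ → Polynomial (Polynomial ℚ),
      (∀ k, (P k).natDegree = k) ∧
      (∀ m : ℕ, 1 ≤ m → ∀ k,
        Polynomial.X ^ k ∣ Polynomial.expand ℚ m (ZagierZinger.specialize m (P k))) ∧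
      (∀ (m : ℕ) (ζ lam τ L : ℂ), 1 ≤ m → IsPrimitiveRoot ζ m → lam ≠ 0 →
        L ^ m * (1 - (m : ℂ) ^ m * Complex.exp τ) = 1 →
        ∀ (α : Fin m) (φ : EuclideanSpace ℝ (Fin m) → (Fin m → ℂ)),
          ZagierZinger.IsThimble m ζ lam τ (ζ ^ (α : ℕ) * lam * L) φ →
          ∃ (c : ℂ) (R : ℕ → ℂ),
            c ^ 2 * (-lam ^ m) = 1 ∧ R 0 = 1 ∧
            (∀ᶠ z in 𝓝[<] (0 : ℝ), Integrable (ZagierZinger.integrand m ζ lam τ φ z) ∧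
              DifferentiableAt ℂ (fun τ' => ZagierZinger.oscIntegral m ζ lam φ τ' z) τ) ∧
            ZagierZinger.HasExpansion
              (fun z => z * deriv (fun τ' => ZagierZinger.oscIntegral m ζ lam φ τ' z) τ)
              (fun z => c * Complex.exp (ZagierZinger.potential m ζ lam τ (φ 0) / z) *
                (((-2 * Real.pi * z) ^ ((m : ℝ) / 2) : ℝ) : ℂ) * (ζ ^ (α : ℕ) * lam * L))
              R ∧
            ∀ k, ((m : ℂ) * (ζ ^ (α : ℕ) * lam * L)) ^ k * R k =
              Polynomial.aeval (L ^ m) (ZagierZinger.specialize m (P k))) ∧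
      (∀ ζ lam : ℂ, IsPrimitiveRoot ζ 5 → lam ≠ 0 →
        ∃! Rs : Matrix (Fin 5) (Fin 5) (PowerSeries (PowerSeries ℂ)),
          ZagierZinger.IsRMatrix ζ lam Rs) ∧
      (∀ (ζ lam : ℂ) (Rs : Matrix (Fin 5) (Fin 5) (PowerSeries (PowerSeries ℂ))),
        IsPrimitiveRoot ζ 5 → lam ≠ 0 → ZagierZinger.IsRMatrix ζ lam Rs →
        (∀ (k : ℕ) (α : Fin 5),
          PowerSeries.C (ZagierZinger.sqrtH ζ lam α ^ 3) *
              (PowerSeries.C (5 * ZagierZinger.hpt ζ lam α) * ZagierZinger.Lser) ^ k *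
              PowerSeries.coeff k
                (ZagierZinger.pairing lam (ZagierZinger.idem ζ lam α)
                  (Rs.mulVec (ZagierZinger.phiBar 0))) =
            (-1) ^ k * Polynomial.aeval (ZagierZinger.Lser ^ 5)
              (ZagierZinger.specialize 5 (P k))) ∧
        ∀ (k : ℕ) (j : Fin 5),
          (∃ p : Polynomial ℚ,
            PowerSeries.C (lam ^ (k + (j : ℕ))) *
                PowerSeries.coeff k (ZagierZinger.firstColumn lam Rs j) =
              Polynomial.aeval ZagierZinger.Lser p) ∧
          (∃ p : Polynomial ℚ,
            ZagierZinger.Lser ^ k * (PowerSeries.C (lam ^ (k + (j : ℕ))) *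
                PowerSeries.coeff k (ZagierZinger.firstColumn lam Rs j)) =
              Polynomial.aeval (ZagierZinger.Lser ^ 5) p) ∧
          (¬ 5 ∣ k + (j : ℕ) →
            PowerSeries.coeff k (ZagierZinger.firstColumn lam Rs j) = 0)) := by
  obtain ⟨P, hdeg, hdvd, hP⟩ := ZagierZinger.exists_universal_polynomials
  have hP5 : ∀ ζ lam : ℂ, IsPrimitiveRoot ζ 5 → lam ≠ 0 → ∀ (k : ℕ) (e : ℂ),
      ZagierZinger.jval 5 ζ lam e k 1 =
        Polynomial.aeval (e ^ 5 / lam ^ 5) (ZagierZinger.specialize 5 (P k)) :=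
    fun ζ lam hζ hlam k e => hP 5 ζ lam (by norm_num) hζ hlam e k
  refine ⟨P, hdeg, fun m hm k => hdvd m (by omega) k, ?_, ?_, ?_⟩
  · intro m ζ lam τ L hm hζ hlam hL α φ h
    obtain ⟨c, hc, hint, hexp⟩ := h.expansion (by omega) hζ hlam
    refine ⟨c, _, hc, ?_, hint, hexp, fun k => ?_⟩
    · exact ZagierZinger.fval_zero ..
    · have h1 := hP m ζ lam (by omega) hζ hlam (ζ ^ (α : ℕ) * lam * L) k
      have h2 : (ζ ^ (α : ℕ) * lam * L) ^ m / lam ^ m = L ^ m := by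
        rw [mul_pow, mul_pow, ← pow_mul, mul_comm (α : ℕ), pow_mul, hζ.pow_eq_one, one_pow,
          one_mul, mul_div_cancel_left₀ _ (pow_ne_zero m hlam)]
      rw [h2] at h1
      exact h1
  · intro ζ lam hζ hlam
    exact ZagierZinger.existsUnique_isRMatrix hζ hlam
  · intro ζ lam Rs hζ hlam hR
    refine ⟨fun k α => ?_, fun k j => ?_⟩
    · have hs := pow_ne_zero 3 (ZagierZinger.sqrtH_ne_zero hζ hlam α)
      rw [hR.coeff_pairing hζ hlam, ← ZagierZinger.lineSer_eq_aeval hlam (hP5 ζ lam hζ hlam k)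
        (ZagierZinger.hpt_pow_five hζ α)]
      have h1 : (PowerSeries.C (ZagierZinger.sqrtH ζ lam α ^ 3) *
          PowerSeries.C ((ZagierZinger.sqrtH ζ lam α ^ 3)⁻¹) : PowerSeries ℂ) = 1 := by
        rw [← map_mul, mul_inv_cancel₀ hs, map_one]
      linear_combination ((PowerSeries.C (5 * ZagierZinger.hpt ζ lam α) * ZagierZinger.Lser) ^ k *
        ((-1) ^ k * ZagierZinger.lineSer ζ lam (ZagierZinger.hpt ζ lam α) k 1)) * h1
    · have h1 := hR.coeff_firstColumn hζ hlam (hP5 ζ lam hζ hlam k) j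
      have hL := pow_ne_zero k ZagierZinger.Lser_ne_zero
      have h2 : ZagierZinger.Lser ^ k * (PowerSeries.C (lam ^ (k + (j : ℕ))) *
          PowerSeries.coeff k (ZagierZinger.firstColumn lam Rs j)) =
          algebraMap ℚ (PowerSeries ℂ) (if 5 ∣ k + (j : ℕ) then (-1 / 5) ^ k else 0) *
            Polynomial.aeval (ZagierZinger.Lser ^ 5) (ZagierZinger.specialize 5 (P k)) := by
        rw [← ZagierZinger.C_pow_mul_C_eq_algebraMap hlam, mul_assoc, ← h1]
        ring
      refine ⟨?_, ⟨Polynomial.C (if 5 ∣ k + (j : ℕ) then (-1 / 5) ^ k else 0) *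
        ZagierZinger.specialize 5 (P k), ?_⟩, fun hkj => ?_⟩
      · obtain ⟨r, hr⟩ := ZagierZinger.exists_aeval_pow_eq_pow_mul (hdvd 5 (by norm_num) k)
          ZagierZinger.Lser
        refine ⟨Polynomial.C (if 5 ∣ k + (j : ℕ) then (-1 / 5) ^ k else 0) * r, ?_⟩
        apply mul_left_cancel₀ hL
        rw [h2, hr, map_mul, Polynomial.aeval_C]
        ring
      · rw [h2, map_mul, Polynomial.aeval_C]
      · rw [if_neg hkj, mul_zero, map_zero, zero_mul] at h1
        exact (mul_eq_zero.1 h1).resolve_left hL
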